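/- **The canal.** Let $l>0$ and let $\Gamma\subset\{x'=(x_2,x_3)\in\mathbb R^2: x_3<0\}$ be a bounded Lipschitz domain whose boundary meets the line $\{x_3=0\}$ exactly in the closed segment $\{|x_2|\le l,\ x_3=0\}$ (for instance, $\Gamma$ is bounded by this segment and a smooth simple curve in the lower half-plane that meets the segment at $(\pm l,0)$ with angles in $(0,\pi)$). Put $\Pi=\mathbb R\times\Gamma\ni x=(x_1,x_2,x_3)$ and $\Lambda=\{x: |x_2|<l,\ x_3=0\}$. **The plate.** Let $a_1,a_2,A_1,A_2>0$, $0<h\le H$, $\sigma=\{\eta\in\mathbb R^2: |\eta_i|<a_i/2\}$, $\omega=\{y\in\mathbb R^2:|y_i|<A_i/2\}$, and let the periodicity cell $\Sigma$ satisfy $\sigma\times(-h,0)\subset\Sigma\subset\sigma\times(-H,0)$. For $\varepsilon>0$ such that $A_i=\varepsilon a_iN_i$ $(i=1,2)$ with positive integers $N_1,N_2$, let $\Omega_\varepsilon$ be the interior of the union of the closures of the $N_1\times N_2$ cells $$\Sigma^\nu_\varepsilon=\{x:\ (\varepsilon^{-1}x_1-\nu_1a_1,\ \varepsilon^{-1}x_2-\nu_2a_2,\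 \varepsilon^{-1}x_3)\in\Sigma\},\qquad \nu_i\in\Big\{-\tfrac{N_i-1}{2},-\tfrac{N_i-1}{2}+1,\dots,\tfrac{N_i-1}{2}\Big\},$$ and let $\omega_-(\varepsilon)=\{x\in\partial\Omega_\varepsilon:(x_1,x_2)\in\omega,\ x_3<0\}$ be its lower base. **The body.** For such $\varepsilon$, consider a bounded body $\Theta\subset\Pi$ with $\overline\Theta\cap\Lambda=\emptyset$ such that $\Pi(\varepsilon)=\Pi\setminus\overline{\Theta}$ is connected, has Lipschitz boundary, is symmetric with respect to the plane $\{x_2=0\}$, contains $\Omega_\varepsilon$, and $\omega_-(\varepsilon)\subset\partial\Theta$. **The problem.** Consider $$-\Delta\Phi=0\ \text{in }\Pi(\varepsilon),\qquad \partial_n\Phi=0\ \text{on }\partial\Pi(\varepsilon)\setminus\overline\Lambda,\qquad \partial_{x_3}\Phi=\lambda\Phi\ \text{on }\Lambda,$$ in the variational form: an eigenfunction with eigenvalue $\lambda$ is a function $\Phi\in H^1(\Pi(\varepsilon))\setminus\{0\}$ with $(\nabla\Phi,\nabla\Psi)_{\Pi(\varepsilon)}=\lambda(\Phi,\Psi)_\Lambda$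 for all $\Psi\in H^1(\Pi(\varepsilon))$. The continuous spectrum of the problem is the set of $\lambda$ for which the range of the operator $H^1(\Pi(\varepsilon))\to H^1(\Pi(\varepsilon))^*$, $\Phi\mapsto(\nabla\Phi,\nabla\,\cdot\,)_{\Pi(\varepsilon)}-\lambda(\Phi,\,\cdot\,)_\Lambda$, is not closed. **Theorem.** For every $d>0$ and every $N\in\mathbb N$ there is $\varepsilon(d,N)>0$ (depending also on $\Gamma,\Sigma,a_i,A_i,h,H$, but not on the body) such that for every $\varepsilon\in(0,\varepsilon(d,N))$ with $A_i/(\varepsilon a_i)\in\mathbb N$, $i=1,2$, and every body $\Theta=\Theta(\varepsilon)$ as above, the problem has at least $N$ eigenvalues, counted with multiplicity, in the interval $(0,d)$: there are linearly independent eigenfunctions $\Phi^{(1)},\dots,\Phi^{(N)}$ with eigenvalues $\lambda^{(1)},\dots,\lambda^{(N)}\in(0,d)$. These eigenvalues belong to the continuous spectrum, and the eigenfunctions decay exponentially as $x_1\to\pm\infty$, i.e. for each $k$ there is $\theta>0$ such that $e^{\theta\sqrt{1+x_1^2}}\,\Phi^{(k)}$ and $e^{\theta\sqrt{1+x_1^2}}\,\nabla\Phi^{(k)}$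 belong to $L^2(\Pi(\varepsilon))$ and $e^{\theta\sqrt{1+x_1^2}}\,\Phi^{(k)}|_\Lambda$ belongs to $L^2(\Lambda)$; thus they are trapped modes. -/

import Mathlib

open MeasureTheory Set
open scoped ContDiff InnerProductSpace

namespace WaterWave

/-- The Euclidean plane; it hosts the cross-section (coordinates `(x₂, x₃)`) and the horizontal
variables `y = (x₁, x₂)`. -/
abbrev Plane : Type := EuclideanSpace ℝ (Fin 2)

/-- Euclidean space; `x 0, x 1, x 2` are the coordinates `x₁, x₂, x₃`. -/
abbrev Space : Type := EuclideanSpace ℝ (Fin 3)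

/-- An open set which near each of its boundary points is, for some unit vector `e`, the set of
points lying above the graph (in the direction `e`, over the hyperplane orthogonal to `e`) of a
Lipschitz function. -/
def IsLipschitzDomain {E : Type*} [NormedAddCommGroup E] [InnerProductSpace ℝ E]
    (U : Set E) : Prop :=
  IsOpen U ∧ ∀ p ∈ frontier U, ∃ (e : E) (f : E → ℝ) (K : NNReal) (r : ℝ),
    ‖e‖ = 1 ∧ LipschitzWith K f ∧ 0 < r ∧
      ∀ x ∈ Metric.ball p r, x ∈ U ↔ f (x - ⟪e, x⟫_ℝ • e) < ⟪e, x⟫_ℝ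

/-- `Γ` is a cross-section of a canal whose water line is `γ₀ = {|x₂| < l, x₃ = 0}`: a bounded
Lipschitz domain in the lower half-plane whose boundary consists of the closed segment
`{|x₂| ≤ l, x₃ = 0}` and a remaining part contained in the open lower half-plane. -/
structure IsCrossSection (Γ : Set Plane) (l : ℝ) : Prop where
  connected : IsConnected Γ
  bounded : Bornology.IsBounded Γ
  lipschitz : IsLipschitzDomain Γ
  lower : ∀ p ∈ Γ, p 1 < 0
  waterLine : frontier Γ ∩ {p | p 1 = 0} = {p | |p 0| ≤ l ∧ p 1 = 0}

/-- The canal `Π = ℝ × Γ`. -/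
def canal (Γ : Set Plane) : Set Space := {x | !₂[x 1, x 2] ∈ Γ}

/-- The free surface `Λ = ℝ × γ₀` as a subset of space. -/
def freeSurface (l : ℝ) : Set Space := {x | |x 1| < l ∧ x 2 = 0}

/-- The free surface in the horizontal variables `y = (x₁, x₂)`. -/
def surfaceStrip (l : ℝ) : Set Plane := {y | |y 1| < l}

/-- The point `(y, 0)` of the plane `x₃ = 0`. -/
noncomputable def toSurface (y : Plane) : Space := !₂[y 0, y 1, 0]

/-- The reflection `(x₁, x₂, x₃) ↦ (x₁, -x₂, x₃)`. -/
noncomputable def reflect (x : Space) : Space := !₂[x 0, -x 1, x 2]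

/-- The part of the canal filled with water, `Π \ closure Θ`. -/
def waterDomain (Γ : Set Plane) (Θ : Set Space) : Set Space := canal Γ \ closure Θ

/-- `Θ` is a finite body in the canal, submerged (it does not touch the free surface), such that
the water occupies a domain with Lipschitz boundary. -/
structure IsSubmergedBody (Γ : Set Plane) (l : ℝ) (Θ : Set Space) : Prop where
  subset_canal : Θ ⊆ canal Γ
  bounded : Bornology.IsBounded Θ
  submerged : Disjoint (closure Θ) (freeSurface l)
  connected : IsConnected (waterDomain Γ Θ)
  lipschitz : IsLipschitzDomain (waterDomain Γ Θ)

/-- The box `σ × (-t, 0)` over the rectangle `σ = {|η_i| < a_i / 2}`. -/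
def cellBox (a : Fin 2 → ℝ) (t : ℝ) : Set Space :=
  {ξ | |ξ 0| < a 0 / 2 ∧ |ξ 1| < a 1 / 2 ∧ -t < ξ 2 ∧ ξ 2 < 0}

/-- The periodicity cell `C`, scaled by `ε`, with number `j = (j₁, j₂)`, `0 ≤ j_i < n_i`, in an
array of `n₁ × n₂` cells centred at the origin. If `n_i` is odd, then `j_i - (n_i - 1) / 2` runs
through the integers `ν_i` with `|ν_i| ≤ (n_i - 1) / 2`. -/
noncomputable def scaledCell (ε : ℝ) (a : Fin 2 → ℝ) (n : Fin 2 → ℕ) (C : Set Space)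
    (j : Fin 2 → ℕ) : Set Space :=
  {x | !₂[x 0 / ε - ((j 0 : ℝ) - ((n 0 : ℝ) - 1) / 2) * a 0,
          x 1 / ε - ((j 1 : ℝ) - ((n 1 : ℝ) - 1) / 2) * a 1,
          x 2 / ε] ∈ C}

/-- The thin plate composed of `n₁ × n₂` scaled periodicity cells: the interior of the union of
their closures. -/
noncomputable def plate (ε : ℝ) (a : Fin 2 → ℝ) (n : Fin 2 → ℕ) (C : Set Space) : Set Space :=
  interior (⋃ j ∈ {j : Fin 2 → ℕ | ∀ i, j i < n i}, closure (scaledCell ε a n C j))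

/-- The lower base of a plate `Ω` over the rectangle `ω = {|y_i| < A_i / 2}`: the part of its
boundary which lies strictly under `ω`. -/
def lowerBase (A : Fin 2 → ℝ) (Ω : Set Space) : Set Space :=
  {x | x ∈ frontier Ω ∧ |x 0| < A 0 / 2 ∧ |x 1| < A 1 / 2 ∧ x 2 < 0}

/-- Smooth compactly supported functions on space that vanish near `∂U \ Λ` (but not necessarily
near the free surface `Λ`). -/
structure IsTestFunction (U : Set Space) (l : ℝ) (φ : Space → ℝ) : Prop where
  smooth : ContDiff ℝ ∞ φ
  compact : HasCompactSupport φ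
  vanishes : Disjoint (tsupport φ) (frontier U \ freeSurface l)

/-- Triples (function on `U`, vector field on `U`, function on the free surface), all of them
square integrable, with the Hilbert norm. -/
abbrev Triples (U : Set Space) (l : ℝ) : Type :=
  WithLp 2 (Lp ℝ 2 (volume.restrict U) ×
    WithLp 2 (Lp Space 2 (volume.restrict U) × Lp ℝ 2 (volume.restrict (surfaceStrip l))))

/-- For a test function `φ` and each index `i`,
`∫_U u ∂_i φ + ∫_U G_i φ = δ_{i3} ∫_Λ g φ`,
that is, `G` is the weak gradient of `u` in `U` and `g` is the trace of `u` on `Λ`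
(where the outward normal is the third coordinate vector). -/
def GreenIdentity (U : Set Space) (l : ℝ) (w : Triples U l) (φ : Space → ℝ) (i : Fin 3) : Prop :=
  (∫ x in U, w.fst x * fderiv ℝ φ x (EuclideanSpace.single i 1)) +
      (∫ x in U, w.snd.fst x i * φ x) =
    if i = 2 then ∫ y in surfaceStrip l, w.snd.snd y * φ (toSurface y) else 0

theorem continuous_toSurface : Continuous toSurface := by
  unfold toSurface
  fun_prop

theorem norm_le_norm_toSurface (y : Plane) : ‖y‖ ≤ ‖toSurface y‖ := by
  simp [EuclideanSpace.norm_eq, toSurface, Fin.sum_univ_three, Fin.sum_univ_two]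

theorem IsTestFunction.memLp {U V : Set Space} {l : ℝ} {φ : Space → ℝ}
    (hφ : IsTestFunction U l φ) : MemLp φ 2 (volume.restrict V) :=
  (hφ.smooth.continuous.memLp_of_hasCompactSupport hφ.compact).restrict V

theorem IsTestFunction.memLp_fderiv {U V : Set Space} {l : ℝ} {φ : Space → ℝ}
    (hφ : IsTestFunction U l φ) (v : Space) :
    MemLp (fun x => fderiv ℝ φ x v) 2 (volume.restrict V) := by
  have hc : Continuous fun x => fderiv ℝ φ x v :=
    (hφ.smooth.continuous_fderiv (by simp)).clm_apply continuous_const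
  exact (hc.memLp_of_hasCompactSupport (hφ.compact.fderiv_apply ℝ v)).restrict V

theorem IsTestFunction.memLp_surface {U : Set Space} {V : Set Plane} {l : ℝ} {φ : Space → ℝ}
    (hφ : IsTestFunction U l φ) :
    MemLp (fun y => φ (toSurface y)) 2 (volume.restrict V) := by
  have hc : Continuous fun y => φ (toSurface y) :=
    hφ.smooth.continuous.comp continuous_toSurface
  refine (hc.memLp_of_hasCompactSupport ?_).restrict V
  obtain ⟨R, hR⟩ := hφ.compact.isCompact.isBounded.subset_closedBall 0
  refine HasCompactSupport.intro (isCompact_closedBall (0 : Plane) R) fun y hy => ?_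
  by_contra hne
  have h1 := hR (subset_tsupport φ hne)
  simp only [mem_closedBall_zero_iff] at h1 hy
  exact hy ((norm_le_norm_toSurface y).trans h1)

theorem memLp_coord {U : Set Space} (G : Lp Space 2 (volume.restrict U)) (i : Fin 3) :
    MemLp (fun x => G x i) 2 (volume.restrict U) :=
  (EuclideanSpace.proj (𝕜 := ℝ) i).comp_memLp' (Lp.memLp G)

theorem greenIdentity_add {U : Set Space} {l : ℝ} {φ : Space → ℝ} (hφ : IsTestFunction U l φ)
    {i : Fin 3} {v w : Triples U l} (hv : GreenIdentity U l v φ i)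
    (hw : GreenIdentity U l w φ i) : GreenIdentity U l (v + w) φ i := by
  unfold GreenIdentity at *
  have e1 : (∫ x in U, (v + w).fst x * fderiv ℝ φ x (EuclideanSpace.single i 1)) =
      (∫ x in U, v.fst x * fderiv ℝ φ x (EuclideanSpace.single i 1)) +
        ∫ x in U, w.fst x * fderiv ℝ φ x (EuclideanSpace.single i 1) := by
    refine Eq.trans ?_ (integral_add ((Lp.memLp v.fst).integrable_mul (hφ.memLp_fderiv _))
      ((Lp.memLp w.fst).integrable_mul (hφ.memLp_fderiv _)))
    refine integral_congr_ae ?_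
    filter_upwards [Lp.coeFn_add v.fst w.fst] with x hx
    simp only [WithLp.add_fst, hx, Pi.add_apply, add_mul]
  have e2 : (∫ x in U, (v + w).snd.fst x i * φ x) =
      (∫ x in U, v.snd.fst x i * φ x) + ∫ x in U, w.snd.fst x i * φ x := by
    refine Eq.trans ?_ (integral_add ((memLp_coord v.snd.fst i).integrable_mul hφ.memLp)
      ((memLp_coord w.snd.fst i).integrable_mul hφ.memLp))
    refine integral_congr_ae ?_
    filter_upwards [Lp.coeFn_add v.snd.fst w.snd.fst] with x hx
    simp only [WithLp.add_snd, WithLp.add_fst, hx, Pi.add_apply, PiLp.add_apply,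
      add_mul]
  have e3 : (∫ y in surfaceStrip l, (v + w).snd.snd y * φ (toSurface y)) =
      (∫ y in surfaceStrip l, v.snd.snd y * φ (toSurface y)) +
        ∫ y in surfaceStrip l, w.snd.snd y * φ (toSurface y) := by
    refine Eq.trans ?_ (integral_add ((Lp.memLp v.snd.snd).integrable_mul hφ.memLp_surface)
      ((Lp.memLp w.snd.snd).integrable_mul hφ.memLp_surface))
    refine integral_congr_ae ?_
    filter_upwards [Lp.coeFn_add v.snd.snd w.snd.snd] with x hx
    simp only [WithLp.add_snd, hx, Pi.add_apply, add_mul]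
  rw [e1, e2, e3]
  split_ifs at * <;> linarith

theorem greenIdentity_smul {U : Set Space} {l : ℝ} {φ : Space → ℝ}
    {i : Fin 3} (c : ℝ) {w : Triples U l}
    (hw : GreenIdentity U l w φ i) : GreenIdentity U l (c • w) φ i := by
  unfold GreenIdentity at *
  have e1 : (∫ x in U, (c • w).fst x * fderiv ℝ φ x (EuclideanSpace.single i 1)) =
      c * ∫ x in U, w.fst x * fderiv ℝ φ x (EuclideanSpace.single i 1) := by
    rw [← integral_const_mul]
    refine integral_congr_ae ?_
    filter_upwards [Lp.coeFn_smul c w.fst] with x hx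
    rw [WithLp.smul_fst, hx, Pi.smul_apply, smul_eq_mul, mul_assoc]
  have e2 : (∫ x in U, (c • w).snd.fst x i * φ x) = c * ∫ x in U, w.snd.fst x i * φ x := by
    rw [← integral_const_mul]
    refine integral_congr_ae ?_
    filter_upwards [Lp.coeFn_smul c w.snd.fst] with x hx
    rw [WithLp.smul_snd, WithLp.smul_fst, hx, Pi.smul_apply, PiLp.smul_apply, smul_eq_mul,
      mul_assoc]
  have e3 : (∫ y in surfaceStrip l, (c • w).snd.snd y * φ (toSurface y)) =
      c * ∫ y in surfaceStrip l, w.snd.snd y * φ (toSurface y) := by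
    rw [← integral_const_mul]
    refine integral_congr_ae ?_
    filter_upwards [Lp.coeFn_smul c w.snd.snd] with x hx
    rw [WithLp.smul_snd, WithLp.smul_snd, hx, Pi.smul_apply, smul_eq_mul, mul_assoc]
  rw [e1, e2, e3, ← mul_add, hw]
  split_ifs <;> simp

/-- The space `H¹(U)` of square integrable functions with square integrable weak gradient,
each one stored together with its weak gradient and its trace on the free surface.  (For the
water domains considered here every such function has a unique square integrable trace.) -/
noncomputable def EnergySpace (U : Set Space) (l : ℝ) : Submodule ℝ (Triples U l) where
  carrier := {w | ∀ φ, IsTestFunction U l φ → ∀ i, GreenIdentity U l w φ i}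
  zero_mem' := by
    intro φ _ i
    have h0 : GreenIdentity U l ((0 : ℝ) • (0 : Triples U l)) φ i := by
      unfold GreenIdentity
      have e1 := Lp.coeFn_zero ℝ 2 (volume.restrict U)
      have e2 := Lp.coeFn_zero Space 2 (volume.restrict U)
      have e3 := Lp.coeFn_zero ℝ 2 (volume.restrict (surfaceStrip l))
      have f1 : (∫ x in U, (0 : Lp ℝ 2 (volume.restrict U)) x *
          fderiv ℝ φ x (EuclideanSpace.single i 1)) = 0 :=
        integral_eq_zero_of_ae (by filter_upwards [e1] with x hx; simp only [hx]; simp)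
      have f2 : (∫ x in U, (0 : Lp Space 2 (volume.restrict U)) x i * φ x) = 0 :=
        integral_eq_zero_of_ae (by filter_upwards [e2] with x hx; simp only [hx]; simp)
      have f3 : (∫ y in surfaceStrip l, (0 : Lp ℝ 2 (volume.restrict (surfaceStrip l))) y *
          φ (toSurface y)) = 0 :=
        integral_eq_zero_of_ae (by filter_upwards [e3] with x hx; simp only [hx]; simp)
      rw [smul_zero]
      simp only [WithLp.zero_fst, WithLp.zero_snd, f1, f2, f3]
      simp
    simpa using h0
  add_mem' := fun hv hw φ hφ i => greenIdentity_add hφ (hv φ hφ i) (hw φ hφ i)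
  smul_mem' := fun c _ hw φ hφ i => greenIdentity_smul c (hw φ hφ i)

/-- The function. -/
noncomputable def potential {U : Set Space} {l : ℝ} (Φ : EnergySpace U l) :
    Lp ℝ 2 (volume.restrict U) := (Φ : Triples U l).fst

/-- The weak gradient. -/
noncomputable def grad {U : Set Space} {l : ℝ} (Φ : EnergySpace U l) :
    Lp Space 2 (volume.restrict U) := (Φ : Triples U l).snd.fst

/-- The trace on the free surface. -/
noncomputable def surfaceTrace {U : Set Space} {l : ℝ} (Φ : EnergySpace U l) :
    Lp ℝ 2 (volume.restrict (surfaceStrip l)) := (Φ : Triples U l).snd.snd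

/-- The form `(∇Φ, ∇Ψ)_U - lam (Φ, Ψ)_Λ` of the water-wave problem. -/
noncomputable def waveForm {U : Set Space} {l : ℝ} (lam : ℝ) (Φ Ψ : EnergySpace U l) : ℝ :=
  ⟪grad Φ, grad Ψ⟫_ℝ - lam * ⟪surfaceTrace Φ, surfaceTrace Ψ⟫_ℝ

/-- `Φ ∈ H¹(U)` is an eigenfunction, with eigenvalue `lam`, of the linear water-wave problem
`-ΔΦ = 0` in `U`, `∂_n Φ = 0` on `∂U \ closure Λ`, `∂_z Φ = lam Φ` on `Λ`, understood in the
variational sense. -/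
def IsEigenfunction (U : Set Space) (l lam : ℝ) (Φ : EnergySpace U l) : Prop :=
  Φ ≠ 0 ∧ ∀ Ψ : EnergySpace U l, ⟪grad Φ, grad Ψ⟫_ℝ = lam * ⟪surfaceTrace Φ, surfaceTrace Ψ⟫_ℝ

/-- `lam` belongs to the continuous spectrum of the water-wave problem: the range of the operator
`H¹(U) → H¹(U)*` of the inhomogeneous problem, `(∇Φ, ∇Ψ)_U - lam (Φ, Ψ)_Λ = F(Ψ)` for all `Ψ`,
is not closed.  (The continuous spectrum of a self-adjoint operator `T` is the set of `μ` for which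
the range of `T - μ` is not closed; it may contain eigenvalues.  Here, for `lam > 0`, it is applied
to the bounded self-adjoint operator `T` in `H¹(U)` given by `⟨TΦ, Ψ⟩ = (Φ, Ψ)_Λ`, where
`⟨Φ, Ψ⟩ = (∇Φ, ∇Ψ)_U + (Φ, Ψ)_Λ`, and to `μ = (1 + lam)⁻¹`:
`⟨(T - μ)Φ, Ψ⟩ = -μ ((∇Φ, ∇Ψ)_U - lam (Φ, Ψ)_Λ)`.  On the water domains considered here the
inner product `⟨·, ·⟩` induces the usual topology of `H¹(U)`, hence the same dual.) -/
def InContinuousSpectrum (U : Set Space) (l lam : ℝ) : Prop :=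
  ¬ IsClosed {F : StrongDual ℝ (EnergySpace U l) |
    ∃ Φ : EnergySpace U l, ∀ Ψ : EnergySpace U l, waveForm lam Φ Ψ = F Ψ}

/-- Exponential decay as `x₁ → ±∞`: for some `θ > 0` the function, its gradient and its trace
remain square integrable after multiplication by `exp (θ √(1 + x₁²))`. -/
def DecaysExponentially {U : Set Space} {l : ℝ} (Φ : EnergySpace U l) : Prop :=
  ∃ θ : ℝ, 0 < θ ∧
    MemLp (fun x : Space => Real.exp (θ * √(1 + x 0 ^ 2)) * potential Φ x) 2 (volume.restrict U) ∧
    MemLp (fun x : Space => Real.exp (θ * √(1 + x 0 ^ 2)) • grad Φ x) 2 (volume.restrict U) ∧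
    MemLp (fun y : Plane => Real.exp (θ * √(1 + y 0 ^ 2)) * surfaceTrace Φ y) 2
      (volume.restrict (surfaceStrip l))

end WaterWave

open WaterWave

open scoped Topology
open Filter

namespace WaterWave

/-! ### Norms in `L²` by duality with test functions -/

section Duality

variable {α F : Type*} [MeasurableSpace α] [NormedAddCommGroup F]

/-! The eigenvalues lie in a continuous spectrum that fills the half-line, so they are sought in the
subspace of functions odd in `x₂`, which is available because the water domain is symmetric. An odd
function has mean zero on every slab over a ball centred on the axis `x₂ = 0`. By the Poincaré
inequality, propagated through the connected cross-section, its `L²` norm and the norm of its trace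
on a slab of the canal are bounded by its gradient there, uniformly in the position of the slab
(`IsCrossSection.exists_slab_odd_bound`). Summing over the slabs away from the body gives `‖g‖² ≤ c
‖∇u‖²` for the far part of the trace `g`, where `c` depends on `Γ` and `l` but not on the body
(`exists_far_bound`, `exists_hasFarBound`). The near part of the trace is arbitrarily small relative
to the gradient up to finitely many mean values, which is Rellich's theorem in quantitative form
(`IsLipschitzDomain.smallUpToMeans`). So, on odd functions, the quotient `‖trace‖² / ‖gradient‖²`
exceeds any `κ > c` only through a finite rank perturbation.

Above that threshold the maximum of the quotient is attained, and repeating this on orthogonal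
complements gives `N` eigenvectors whenever an `N`-dimensional trial space has quotients above `μ >
c` (`exists_rayleigh_maximizer`, `exists_eigenvectors`). A value `m > μ` of the quotient is an
eigenvalue `1 / m < 1 / μ` of the water-wave problem. The equation extends from odd to all test
functions by antisymmetrization (`isEigenfunction_of_odd`).

The trial functions are `N` fixed functions `ζ(x₁, x₂)` with disjoint supports in the rectangle, odd
in `x₂`, placed in the layer of water above the body and extended by zero. The layer is at most `εH`
thick, hence the gradient energy is `O(ε)`, while the traces do not depend on `ε`. The extension is
admissible because the lower base of the plate is part of the boundary of the body and `ζ` vanishes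
near the lateral sides (`exists_trial_element`). Small `ε` therefore pushes the quotients above `μ =
max (1 / d) (2 c)`.

Exponential decay is an Agmon type estimate. The equation is tested with `W² w`, where `W` is a
bounded regularization of `exp (θ √(1 + x₁²))`. Since `λ c ≤ 1 / 2` and `θ` is small, the terms on
the right are absorbed uniformly in the regularization (`exists_weighted_bound`), and Fatou's lemma
removes it.

Every `λ > 0` is in the continuous spectrum, even if it is an eigenvalue. Let `T` be the operator of
the form `(∇Φ, ∇Ψ) - λ (Φ, Ψ)_Λ` in the energy space. Each `τ` in `(0, 1)` is an approximate
eigenvalue of `T`: in the straight end of the canal take the product of a long oscillating cutoff in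
`x₁` with a near minimizer of `(1 - τ) ‖∇v‖² - (λ + τ) ‖g‖²` over the cross-section
(`HasCylindricalEnd.exists_approx`). The infimum is nonpositive, as constants show, so the axial
wave number is real. A symmetric operator with closed range is bounded below on the complement of
its kernel, which excludes small nonzero approximate eigenvalues (`not_isClosed_range_of_approx`).
-/

theorem eLpNorm_two_sq (f : α → F) (μ : Measure α) :
    eLpNorm f 2 μ ^ 2 = ∫⁻ x, ‖f x‖ₑ ^ 2 ∂μ := by
  rw [eLpNorm_eq_lintegral_rpow_enorm_toReal (by simp) (by simp)]
  rw [← ENNReal.rpow_natCast, ← ENNReal.rpow_mul]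
  simp

theorem lintegral_enorm_sq_lt_top {f : α → F} {μ : Measure α} (hf : MemLp f 2 μ) :
    ∫⁻ x, ‖f x‖ₑ ^ 2 ∂μ < ⊤ := by
  rw [← eLpNorm_two_sq]
  exact ENNReal.pow_lt_top hf.2

theorem memLp_two_of_lintegral {f : α → F} {μ : Measure α} (hm : AEStronglyMeasurable f μ)
    (hf : ∫⁻ x, ‖f x‖ₑ ^ 2 ∂μ < ⊤) : MemLp f 2 μ := by
  refine ⟨hm, ?_⟩
  rw [← eLpNorm_two_sq] at hf
  by_contra h
  simp only [not_lt, top_le_iff] at h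
  simp [h] at hf

theorem norm_sq_eq_toReal {μ : Measure α} (f : Lp F 2 μ) :
    ‖f‖ ^ 2 = (∫⁻ x, ‖f x‖ₑ ^ 2 ∂μ).toReal := by
  rw [← eLpNorm_two_sq, ENNReal.toReal_pow, Lp.norm_def]

theorem ofReal_norm_sq {μ : Measure α} (f : Lp F 2 μ) :
    ENNReal.ofReal (‖f‖ ^ 2) = ∫⁻ x, ‖f x‖ₑ ^ 2 ∂μ := by
  rw [norm_sq_eq_toReal, ENNReal.ofReal_toReal (lintegral_enorm_sq_lt_top (Lp.memLp f)).ne]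

theorem lintegral_sq_eq_ofReal {f : α → ℝ} {μ : Measure α} (hf : MemLp f 2 μ) :
    ∫⁻ x, ‖f x‖ₑ ^ 2 ∂μ = ENNReal.ofReal (∫ x, f x ^ 2 ∂μ) := by
  rw [ofReal_integral_eq_lintegral_ofReal hf.integrable_sq (ae_of_all _ fun x => sq_nonneg _)]
  refine lintegral_congr fun x => ?_
  rw [← ofReal_norm, ← ENNReal.ofReal_pow (norm_nonneg _)]
  simp

theorem sq_integral_mul_le {f g : α → ℝ} {μ : Measure α} (hf : MemLp f 2 μ) (hg : MemLp g 2 μ) :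
    (∫ x, f x * g x ∂μ) ^ 2 ≤ (∫ x, f x ^ 2 ∂μ) * ∫ x, g x ^ 2 ∂μ := by
  have h := real_inner_mul_inner_self_le (hf.toLp f) (hg.toLp g)
  have e : ∀ {p q : α → ℝ} (hp : MemLp p 2 μ) (hq : MemLp q 2 μ),
      ⟪hp.toLp p, hq.toLp q⟫_ℝ = ∫ x, p x * q x ∂μ := by
    intro p q hp hq
    rw [L2.inner_def]
    refine integral_congr_ae ?_
    filter_upwards [hp.coeFn_toLp, hq.coeFn_toLp] with x h1 h2
    rw [h1, h2]
    simp [mul_comm]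
  rw [e, e, e] at h
  simpa only [sq] using h

end Duality

section DualityOpen

variable {E : Type*} [NormedAddCommGroup E] [InnerProductSpace ℝ E] [FiniteDimensional ℝ E]
  [MeasurableSpace E] [BorelSpace E]

/-- The classes of smooth functions with compact support in `V`, as a subspace of `L²(V)`. -/
noncomputable def testSubmodule (V : Set E) : Submodule ℝ (Lp ℝ 2 (volume.restrict V)) where
  carrier := {x | ∃ ψ : E → ℝ, ContDiff ℝ ∞ ψ ∧ HasCompactSupport ψ ∧ tsupport ψ ⊆ V ∧
    x =ᵐ[volume.restrict V] ψ}
  zero_mem' := ⟨0, contDiff_const, HasCompactSupport.zero, by simp [tsupport],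
    Lp.coeFn_zero _ _ _⟩
  add_mem' := by
    rintro x y ⟨ψ, h1, h2, h3, h4⟩ ⟨χ, k1, k2, k3, k4⟩
    refine ⟨ψ + χ, h1.add k1, h2.add k2, (tsupport_add ψ χ).trans (union_subset h3 k3), ?_⟩
    exact (Lp.coeFn_add x y).trans (h4.add k4)
  smul_mem' := by
    rintro c x ⟨ψ, h1, h2, h3, h4⟩
    refine ⟨c • ψ, h1.const_smul c, h2.smul_left (f := fun _ => c),
      (closure_mono (Function.support_const_smul_subset c ψ)).trans h3, ?_⟩
    exact (Lp.coeFn_smul c x).trans (h4.const_smul c)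

/-- This is the fundamental lemma of the calculus of variations. It is used as a density statement
for smooth functions with compact support in `V`. -/
theorem testSubmodule_orthogonal {V : Set E} (hV : IsOpen V) : (testSubmodule V)ᗮ = ⊥ := by
  rw [Submodule.eq_bot_iff]
  intro f hf
  rw [Lp.eq_zero_iff_ae_eq_zero]
  have hloc : LocallyIntegrableOn f V volume := by
    rw [locallyIntegrableOn_iff hV.isLocallyClosed]
    intro k hk hc
    have hk2 : MemLp f 2 (volume.restrict k) := (Lp.memLp f).mono_measure
      (Measure.restrict_mono hk le_rfl)
    have : IsFiniteMeasure (volume.restrict k) := ⟨by simpa using hc.measure_lt_top⟩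
    exact hk2.integrable (by norm_num)
  have := hV.ae_eq_zero_of_integral_contDiff_smul_eq_zero hloc (μ := volume) ?_
  · exact (ae_restrict_iff' hV.measurableSet).2 this
  · intro g g1 g2 g3
    have hg : MemLp g 2 (volume.restrict V) := (g1.continuous.memLp_of_hasCompactSupport g2).restrict V
    have hmem : hg.toLp g ∈ testSubmodule V := ⟨g, g1, g2, g3, hg.coeFn_toLp⟩
    have h0 := (Submodule.mem_orthogonal _ _).1 hf _ hmem
    rw [L2.inner_def] at h0
    rw [← h0, ← setIntegral_eq_integral_of_forall_compl_eq_zero (s := V)]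
    · refine integral_congr_ae ?_
      filter_upwards [hg.coeFn_toLp] with x hx
      rw [hx]
      simp [mul_comm]
    · intro x hx
      rw [image_eq_zero_of_notMem_tsupport (fun h => hx (g3 h)), zero_smul]

/-- The `L²(V)` norm of a function is determined by its integrals against test functions. -/
theorem lintegral_sq_le_of_duality {V : Set E} (hV : IsOpen V) {f : E → ℝ}
    (hf : MemLp f 2 (volume.restrict V)) {C : ℝ} (hC : 0 ≤ C)
    (h : ∀ ψ : E → ℝ, ContDiff ℝ ∞ ψ → HasCompactSupport ψ → tsupport ψ ⊆ V →
      (∫ x in V, f x * ψ x) ^ 2 ≤ C * ∫ x in V, ψ x ^ 2) :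
    ∫⁻ x in V, ‖f x‖ₑ ^ 2 ≤ ENNReal.ofReal C := by
  have hd : Dense (testSubmodule V : Set (Lp ℝ 2 (volume.restrict V))) := by
    rw [Submodule.dense_iff_topologicalClosure_eq_top]
    rw [Submodule.topologicalClosure_eq_top_iff]
    exact testSubmodule_orthogonal hV
  -- Both sides are continuous in `x`, so density carries the hypothesis from test functions to all
  -- of `L²(V)`.
  have key : ∀ x : Lp ℝ 2 (volume.restrict V), ⟪hf.toLp f, x⟫_ℝ ^ 2 ≤ C * ‖x‖ ^ 2 := by
    intro x
    refine hd.induction (P := fun x => ⟪hf.toLp f, x⟫_ℝ ^ 2 ≤ C * ‖x‖ ^ 2) ?_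
      (isClosed_le (by fun_prop) (by fun_prop)) x
    rintro x ⟨ψ, h1, h2, h3, h4⟩
    have e1 : ⟪hf.toLp f, x⟫_ℝ = ∫ x in V, f x * ψ x := by
      rw [L2.inner_def]
      refine integral_congr_ae ?_
      filter_upwards [hf.coeFn_toLp, h4] with y hy hy2
      rw [hy, hy2]
      simp [mul_comm]
    have e2 : ‖x‖ ^ 2 = ∫ x in V, ψ x ^ 2 := by
      rw [← real_inner_self_eq_norm_sq, L2.inner_def]
      refine integral_congr_ae ?_
      filter_upwards [h4] with y hy2
      rw [hy2]
      simp
    simp only [e1, e2]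
    exact h ψ h1 h2 h3
  -- Tested with `f` itself, the bound reads `‖f‖⁴ ≤ C ‖f‖²`.
  have h1 := key (hf.toLp f)
  rw [real_inner_self_eq_norm_sq] at h1
  have h2 : ‖hf.toLp f‖ ^ 2 ≤ C := by
    by_cases h0 : ‖hf.toLp f‖ ^ 2 = 0
    · rw [h0]; exact hC
    · have : 0 < ‖hf.toLp f‖ ^ 2 := lt_of_le_of_ne (sq_nonneg _) (Ne.symm h0)
      nlinarith
  have h3 := ENNReal.ofReal_le_ofReal h2
  rw [ofReal_norm_sq] at h3
  refine le_trans (le_of_eq ?_) h3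
  refine lintegral_congr_ae ?_
  filter_upwards [hf.coeFn_toLp] with y hy
  rw [hy]

end DualityOpen

/-! ### Functions of finite energy and their translates -/

/-- Square integrable functions `u`, `G` on `U` and `g` on the free surface such that `G` is the
weak gradient and `g` the trace of `u`. -/
structure IsEnergyTriple (U : Set Space) (l : ℝ) (u : Space → ℝ) (G : Space → Space)
    (g : Plane → ℝ) : Prop where
  fn : MemLp u 2 (volume.restrict U)
  gradient : MemLp G 2 (volume.restrict U)
  trace : MemLp g 2 (volume.restrict (surfaceStrip l))
  green : ∀ φ, IsTestFunction U l φ → ∀ i : Fin 3,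
    (∫ x in U, u x * fderiv ℝ φ x (EuclideanSpace.single i 1)) + (∫ x in U, G x i * φ x) =
      if i = 2 then ∫ y in surfaceStrip l, g y * φ (toSurface y) else 0

theorem isEnergyTriple {U : Set Space} {l : ℝ} (w : EnergySpace U l) :
    IsEnergyTriple U l (potential w) (grad w) (surfaceTrace w) :=
  ⟨Lp.memLp _, Lp.memLp _, Lp.memLp _, w.2⟩

namespace IsEnergyTriple

variable {U : Set Space} {l : ℝ} {u : Space → ℝ} {G : Space → Space} {g : Plane → ℝ}

/-- The element of the energy space given by a triple of functions. -/
noncomputable def toEnergySpace (h : IsEnergyTriple U l u G g) : EnergySpace U l :=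
  ⟨WithLp.toLp 2 (h.fn.toLp u, WithLp.toLp 2 (h.gradient.toLp G, h.trace.toLp g)), by
    intro φ hφ i
    unfold GreenIdentity
    have e1 : (∫ x in U, (h.fn.toLp u) x * fderiv ℝ φ x (EuclideanSpace.single i 1)) =
        ∫ x in U, u x * fderiv ℝ φ x (EuclideanSpace.single i 1) := by
      refine integral_congr_ae ?_
      filter_upwards [h.fn.coeFn_toLp] with x hx
      rw [hx]
    have e2 : (∫ x in U, (h.gradient.toLp G) x i * φ x) = ∫ x in U, G x i * φ x := by
      refine integral_congr_ae ?_
      filter_upwards [h.gradient.coeFn_toLp] with x hx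
      rw [hx]
    have e3 : (∫ y in surfaceStrip l, (h.trace.toLp g) y * φ (toSurface y)) =
        ∫ y in surfaceStrip l, g y * φ (toSurface y) := by
      refine integral_congr_ae ?_
      filter_upwards [h.trace.coeFn_toLp] with x hx
      rw [hx]
    simp only [WithLp.toLp_fst, WithLp.toLp_snd, e1, e2, e3]
    exact h.green φ hφ i⟩

theorem potential_toEnergySpace (h : IsEnergyTriple U l u G g) :
    potential h.toEnergySpace =ᵐ[volume.restrict U] u := h.fn.coeFn_toLp

theorem grad_toEnergySpace (h : IsEnergyTriple U l u G g) :
    grad h.toEnergySpace =ᵐ[volume.restrict U] G := h.gradient.coeFn_toLp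

theorem surfaceTrace_toEnergySpace (h : IsEnergyTriple U l u G g) :
    surfaceTrace h.toEnergySpace =ᵐ[volume.restrict (surfaceStrip l)] g := h.trace.coeFn_toLp

theorem gradient_apply (h : IsEnergyTriple U l u G g) (i : Fin 3) :
    MemLp (fun x => G x i) 2 (volume.restrict U) :=
  (EuclideanSpace.proj (𝕜 := ℝ) i).comp_memLp' h.gradient

theorem gradient_inner (h : IsEnergyTriple U l u G g) (v : Space) :
    MemLp (fun x => ⟪G x, v⟫_ℝ) 2 (volume.restrict U) := by
  have := (innerSL ℝ v).comp_memLp' h.gradient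
  refine this.ae_eq (ae_of_all _ fun x => ?_)
  simp [real_inner_comm]

/-- The Green identity in the direction of a vector `v`. -/
theorem green_dir (h : IsEnergyTriple U l u G g) {φ : Space → ℝ} (hφ : IsTestFunction U l φ)
    (v : Space) :
    (∫ x in U, u x * fderiv ℝ φ x v) + (∫ x in U, ⟪G x, v⟫_ℝ * φ x) =
      v 2 * ∫ y in surfaceStrip l, g y * φ (toSurface y) := by
  have hv : v = ∑ i, v i • EuclideanSpace.single i (1 : ℝ) := by
    ext j
    simp [Finset.sum_apply, Pi.single_apply]
  have e1 : (∫ x in U, u x * fderiv ℝ φ x v) =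
      ∑ i, v i * ∫ x in U, u x * fderiv ℝ φ x (EuclideanSpace.single i 1) := by
    simp_rw [← integral_const_mul]
    rw [← integral_finsetSum]
    · refine integral_congr_ae (ae_of_all _ fun x => ?_)
      simp only
      conv_lhs => rw [hv]
      rw [map_sum, Finset.mul_sum]
      refine Finset.sum_congr rfl fun i _ => ?_
      rw [map_smul, smul_eq_mul]; ring
    · intro i _
      exact ((h.fn.integrable_mul (hφ.memLp_fderiv _)).const_mul _)
  have e2 : (∫ x in U, ⟪G x, v⟫_ℝ * φ x) = ∑ i, v i * ∫ x in U, G x i * φ x := by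
    simp_rw [← integral_const_mul]
    rw [← integral_finsetSum]
    · refine integral_congr_ae (ae_of_all _ fun x => ?_)
      simp only [PiLp.inner_apply, Finset.sum_mul]
      refine Finset.sum_congr rfl fun i _ => ?_
      simp; ring
    · intro i _
      exact (((h.gradient_apply i).integrable_mul hφ.memLp).const_mul _)
  rw [e1, e2, ← Finset.sum_add_distrib]
  simp_rw [← mul_add, h.green φ hφ]
  simp

end IsEnergyTriple

theorem enorm_sq_le_add {F : Type*} [NormedAddCommGroup F] (a b : F) :
    ‖a‖ₑ ^ 2 ≤ 2 * ‖b‖ₑ ^ 2 + 2 * ‖b - a‖ₑ ^ 2 := by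
  have h : ‖a‖ ^ 2 ≤ 2 * ‖b‖ ^ 2 + 2 * ‖b - a‖ ^ 2 := by
    have h1 : ‖a‖ ≤ ‖b‖ + ‖b - a‖ := by
      have := norm_sub_le b (b - a)
      simpa using this
    nlinarith [norm_nonneg a, sq_nonneg (‖b‖ - ‖b - a‖)]
  have h2 := ENNReal.ofReal_le_ofReal h
  rw [ENNReal.ofReal_add (by positivity) (by positivity), ENNReal.ofReal_mul (by norm_num),
    ENNReal.ofReal_mul (by norm_num)] at h2
  simpa [ENNReal.ofReal_pow, ofReal_norm] using h2

theorem lintegral_enorm_sq_eq_ofReal {α F : Type*} [MeasurableSpace α] [NormedAddCommGroup F]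
    {f : α → F} {μ : Measure α} (hf : MemLp f 2 μ) :
    ∫⁻ x, ‖f x‖ₑ ^ 2 ∂μ = ENNReal.ofReal (∫ x, ‖f x‖ ^ 2 ∂μ) := by
  rw [← lintegral_sq_eq_ofReal hf.norm]
  simp

theorem IsTestFunction.of_tsupport_subset {U : Set Space} {l : ℝ} (hU : IsOpen U) {φ : Space → ℝ}
    (h1 : ContDiff ℝ ∞ φ) (h2 : HasCompactSupport φ) (h3 : tsupport φ ⊆ U) :
    IsTestFunction U l φ := by
  refine ⟨h1, h2, ?_⟩
  rw [Set.disjoint_left]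
  intro x hx hx2
  have : x ∈ U ∩ frontier U := ⟨h3 hx, hx2.1⟩
  rw [hU.inter_frontier_eq] at this
  exact this

theorem memLp_comp_add {F : Type*} [NormedAddCommGroup F] {U V : Set Space} {u : Space → F}
    (hu : MemLp u 2 (volume.restrict U)) (hU : MeasurableSet U) (v : Space)
    (hV : ∀ x ∈ V, x + v ∈ U) : MemLp (fun x => u (x + v)) 2 (volume.restrict V) := by
  have h1 : MeasurePreserving (fun x : Space => x + v) volume volume :=
    measurePreserving_add_right volume v
  have h2 := hu.comp_measurePreserving (h1.restrict_preimage hU)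
  exact h2.mono_measure (Measure.restrict_mono hV le_rfl)

theorem tsupport_comp_sub {ψ : Space → ℝ} (c : Space) :
    tsupport (fun z => ψ (z - c)) = (fun z => z - c) ⁻¹' tsupport ψ :=
  tsupport_comp_eq_preimage ψ (Homeomorph.subRight c)

namespace IsEnergyTriple

variable {U : Set Space} {l : ℝ} {u : Space → ℝ} {G : Space → Space} {g : Plane → ℝ}

/-- The translation is carried by the smooth function `ψ`, so differentiating under the integral
needs no regularity of `u`. For parameters within `1` of `t` all supports stay in one ball, which
provides the dominating function. -/
theorem hasDerivAt_integral_translate (h : IsEnergyTriple U l u G g) (v : Space) {ψ : Space → ℝ}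
    (h1 : ContDiff ℝ ∞ ψ) (h2 : HasCompactSupport ψ) (t : ℝ) :
    HasDerivAt (fun t : ℝ => ∫ z in U, u z * ψ (z - t • v))
      (∫ z in U, u z * -(fderiv ℝ ψ (z - t • v) v)) t := by
  obtain ⟨R, hR⟩ := h2.isCompact.isBounded.subset_closedBall 0
  have hc : Continuous fun z => fderiv ℝ ψ z v :=
    (h1.continuous_fderiv (by simp)).clm_apply continuous_const
  obtain ⟨K, hK⟩ := (h2.fderiv_apply ℝ v).exists_bound_of_continuous hc
  have hK0 : 0 ≤ K := (norm_nonneg _).trans (hK 0)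
  set B : Set Space := Metric.closedBall 0 (R + (|t| + 1) * ‖v‖)
  have hB : MemLp (B.indicator fun _ => K) 2 (volume.restrict U) := by
    refine MemLp.restrict U ?_
    refine memLp_indicator_const 2 Metric.isClosed_closedBall.measurableSet K (Or.inr ?_)
    exact (isCompact_closedBall _ _).measure_lt_top.ne
  have hφ : ∀ s : ℝ, MemLp (fun z => ψ (z - s • v)) 2 (volume.restrict U) := fun s =>
    ((h1.continuous.comp (continuous_sub_right _)).memLp_of_hasCompactSupport
      (h2.comp_homeomorph (Homeomorph.subRight (s • v)))).restrict U
  refine (hasDerivAt_integral_of_dominated_loc_of_deriv_le (s := Metric.ball t 1)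
    (F := fun t z => u z * ψ (z - t • v)) (F' := fun t z => u z * -(fderiv ℝ ψ (z - t • v) v))
    (bound := fun z => ‖u z‖ * B.indicator (fun _ => K) z)
    (Metric.ball_mem_nhds t one_pos) ?_ ?_ ?_ ?_ ?_ ?_).2
  · exact Eventually.of_forall fun s => (h.fn.integrable_mul (hφ s)).aestronglyMeasurable
  · exact h.fn.integrable_mul (hφ t)
  · exact h.fn.1.mul (hc.comp (continuous_sub_right _)).neg.aestronglyMeasurable
  · refine ae_of_all _ fun z s hs => ?_
    rw [norm_mul, norm_neg]
    refine mul_le_mul_of_nonneg_left ?_ (norm_nonneg _)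
    by_cases hz : z ∈ B
    · rw [indicator_of_mem hz]; exact hK _
    · rw [indicator_of_notMem hz]
      have : fderiv ℝ ψ (z - s • v) v = 0 := by
        by_contra hne
        have hmem : z - s • v ∈ tsupport ψ := by
          refine support_fderiv_subset ℝ (f := ψ) ?_
          intro h0
          apply hne
          rw [h0]; rfl
        have := hR hmem
        apply hz
        simp only [B, mem_closedBall_zero_iff] at this ⊢
        have h3 : ‖z‖ ≤ ‖z - s • v‖ + ‖s • v‖ := by
          simpa using norm_add_le (z - s • v) (s • v)
        rw [norm_smul, Real.norm_eq_abs] at h3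
        have h4 : |s| ≤ |t| + 1 := by
          have := abs_sub_abs_le_abs_sub s t
          rw [Metric.mem_ball, Real.dist_eq] at hs
          linarith
        nlinarith [norm_nonneg v]
      rw [this, norm_zero]
  · exact h.fn.norm.integrable_mul hB
  · refine ae_of_all _ fun z s _ => ?_
    refine HasDerivAt.const_mul _ ?_
    have hd : HasFDerivAt ψ (fderiv ℝ ψ (z - s • v)) (z - s • v) :=
      ((h1.differentiable (by simp)) _).hasFDerivAt
    have hl : HasDerivAt (fun s : ℝ => z - s • v) (-v) s := by
      simpa using ((hasDerivAt_id s).smul_const v).const_sub z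
    have := hd.comp_hasDerivAt s hl
    rw [map_neg] at this
    exact this

/-- The difference of `u` and its translate is controlled by the gradient. -/
theorem translation (h : IsEnergyTriple U l u G g) (hU : IsOpen U)
    (hlow : ∀ x ∈ U, x 2 < 0) {V D : Set Space} (hV : IsOpen V) (hDU : D ⊆ U) (v : Space)
    (hVD : ∀ x ∈ V, ∀ t ∈ Icc (0 : ℝ) 1, x + t • v ∈ D) :
    ∫⁻ x in V, ‖u (x + v) - u x‖ₑ ^ 2 ≤
      ENNReal.ofReal (‖v‖ ^ 2) * ∫⁻ x in D, ‖G x‖ₑ ^ 2 := by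
  have hVU : V ⊆ U := fun x hx => hDU (by simpa using hVD x hx 0 (by simp))
  have hVU1 : ∀ x ∈ V, x + v ∈ U := fun x hx => hDU (by simpa using hVD x hx 1 (by simp))
  have huV : MemLp u 2 (volume.restrict V) := h.fn.mono_measure (Measure.restrict_mono hVU le_rfl)
  have hGD : MemLp G 2 (volume.restrict D) :=
    h.gradient.mono_measure (Measure.restrict_mono hDU le_rfl)
  have huv := memLp_comp_add h.fn hU.measurableSet v hVU1
  rw [lintegral_enorm_sq_eq_ofReal hGD, ← ENNReal.ofReal_mul (sq_nonneg _)]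
  refine lintegral_sq_le_of_duality hV (f := fun x => u (x + v) - u x) (huv.sub huV)
    (by positivity) ?_
  intro ψ h1 h2 h3
  have hψ : ∀ W : Set Space, MemLp ψ 2 (volume.restrict W) := fun W =>
    (h1.continuous.memLp_of_hasCompactSupport h2).restrict W
  have hψs : ∀ (s : ℝ) (W : Set Space), MemLp (fun z => ψ (z - s • v)) 2 (volume.restrict W) :=
    fun s W => ((h1.continuous.comp (continuous_sub_right _)).memLp_of_hasCompactSupport
      (h2.comp_homeomorph (Homeomorph.subRight (s • v)))).restrict W
  -- The increment `f 1 - f 0` pairs `ψ` with the difference of the translate and `u`; it is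
  -- estimated by the mean value inequality for `f`.
  set f : ℝ → ℝ := fun t => ∫ z in U, u z * ψ (z - t • v) with hf
  have hsub : ∀ x, x ∉ V → ψ x = 0 := fun x hx =>
    image_eq_zero_of_notMem_tsupport fun hx2 => hx (h3 hx2)
  have hf0 : f 0 = ∫ x in V, u x * ψ x := by
    simp only [hf, zero_smul, sub_zero]
    rw [setIntegral_eq_integral_of_forall_compl_eq_zero,
      setIntegral_eq_integral_of_forall_compl_eq_zero]
    · intro x hx; rw [hsub x hx, mul_zero]
    · intro x hx; rw [hsub x (fun hx2 => hx (hVU hx2)), mul_zero]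
  have hf1 : f 1 = ∫ x in V, u (x + v) * ψ x := by
    simp only [hf, one_smul]
    rw [setIntegral_eq_integral_of_forall_compl_eq_zero,
      setIntegral_eq_integral_of_forall_compl_eq_zero,
      ← integral_sub_right_eq_self (μ := volume) (fun x => u (x + v) * ψ x) v]
    · simp
    · intro x hx; rw [hsub x hx, mul_zero]
    · intro x hx
      rw [hsub (x - v) (fun hx2 => hx (by simpa using hVU1 _ hx2)), mul_zero]
  have e : (∫ x in V, (u (x + v) - u x) * ψ x) = f 1 - f 0 := by
    rw [hf0, hf1]
    refine Eq.trans ?_ (integral_sub (huv.integrable_mul (hψ V)) (huV.integrable_mul (hψ V)))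
    refine integral_congr_ae (ae_of_all _ fun x => ?_)
    simp only; ring
  set N : ℝ := ∫ x in V, ψ x ^ 2 with hN
  set A : ℝ := ∫ x in D, ‖G x‖ ^ 2 with hA
  have hN0 : 0 ≤ N := integral_nonneg fun x => sq_nonneg _
  have hA0 : 0 ≤ A := integral_nonneg fun x => sq_nonneg _
  -- The Green identity turns the derivative of `f` into `∫ ⟪G, v⟫ ψ(· - t v)`. The shifted support
  -- stays in `D ⊆ U`, hence off the plane `x₃ = 0`, and there is no surface term. Cauchy-Schwarz
  -- gives a bound independent of `t`.
  have hbd : ∀ t ∈ Icc (0 : ℝ) 1,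
      ‖∫ z in U, u z * -(fderiv ℝ ψ (z - t • v) v)‖ ≤ √(‖v‖ ^ 2 * A * N) := by
    intro t ht
    have hts : tsupport (fun z => ψ (z - t • v)) ⊆ D := by
      rw [tsupport_comp_sub]
      intro z hz
      simpa using hVD _ (h3 hz) t ht
    have hφ : IsTestFunction U l (fun z => ψ (z - t • v)) :=
      IsTestFunction.of_tsupport_subset hU (h1.comp (contDiff_id.sub contDiff_const))
        (h2.comp_homeomorph (Homeomorph.subRight (t • v))) (hts.trans hDU)
    have hg := h.green_dir hφ v
    have hs0 : v 2 * ∫ y in surfaceStrip l, g y * (fun z => ψ (z - t • v)) (toSurface y) = 0 := by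
      refine mul_eq_zero_of_right _ (integral_eq_zero_of_ae (ae_of_all _ fun y => ?_))
      have : ψ (toSurface y - t • v) = 0 :=
        image_eq_zero_of_notMem_tsupport (f := fun z => ψ (z - t • v)) fun hy => by
          simpa [toSurface] using hlow _ (hDU (hts hy))
      simp [this]
    have hfd : ∀ z, fderiv ℝ (fun z => ψ (z - t • v)) z v = fderiv ℝ ψ (z - t • v) v := by
      intro z
      rw [fderiv_comp_sub]
    have e2 : (∫ z in U, u z * -(fderiv ℝ ψ (z - t • v) v)) =
        ∫ z in D, ⟪G z, v⟫_ℝ * ψ (z - t • v) := by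
      simp only [mul_neg, integral_neg]
      rw [hs0] at hg
      simp only [hfd] at hg
      have e3 : (∫ z in D, ⟪G z, v⟫_ℝ * ψ (z - t • v)) =
          ∫ z in U, ⟪G z, v⟫_ℝ * ψ (z - t • v) := by
        rw [setIntegral_eq_integral_of_forall_compl_eq_zero,
          setIntegral_eq_integral_of_forall_compl_eq_zero]
        · intro x hx
          have : ψ (x - t • v) = 0 :=
            image_eq_zero_of_notMem_tsupport (f := fun z => ψ (z - t • v))
              fun hx2 => hx (hDU (hts hx2))
          rw [this, mul_zero]
        · intro x hx
          have : ψ (x - t • v) = 0 :=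
            image_eq_zero_of_notMem_tsupport (f := fun z => ψ (z - t • v))
              fun hx2 => hx (hts hx2)
          rw [this, mul_zero]
      rw [e3]
      linarith
    rw [e2, Real.norm_eq_abs]
    refine Real.abs_le_sqrt ?_
    have hGv : MemLp (fun x => ⟪G x, v⟫_ℝ) 2 (volume.restrict D) :=
      (h.gradient_inner v).mono_measure (Measure.restrict_mono hDU le_rfl)
    refine (sq_integral_mul_le hGv (hψs t D)).trans ?_
    refine mul_le_mul ?_ ?_ (integral_nonneg fun x => sq_nonneg _) (by positivity)
    · rw [hA, ← integral_const_mul]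
      refine integral_mono hGv.integrable_sq (hGD.norm.integrable_sq.const_mul _) fun x => ?_
      have := abs_real_inner_le_norm (G x) v
      simp only
      rw [← sq_abs, mul_comm, ← mul_pow]
      exact pow_le_pow_left₀ (abs_nonneg _) this 2
    · rw [hN, ← integral_indicator hV.measurableSet]
      have e4 : (fun x => V.indicator (fun x => ψ x ^ 2) x) = fun x => ψ x ^ 2 := by
        funext x
        by_cases hx : x ∈ V
        · rw [indicator_of_mem hx]
        · rw [indicator_of_notMem hx, hsub x hx]; simp
      rw [e4, ← integral_sub_right_eq_self (μ := volume) (fun x => ψ x ^ 2) (t • v)]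
      have := hψs t univ
      rw [Measure.restrict_univ] at this
      exact setIntegral_le_integral this.integrable_sq (ae_of_all _ fun x => sq_nonneg _)
  have hmv := norm_image_sub_le_of_norm_deriv_le_segment_01' (f := f)
    (fun t _ => (h.hasDerivAt_integral_translate v h1 h2 t).hasDerivWithinAt)
    (fun t ht => hbd t (Ico_subset_Icc_self ht))
  rw [e, ← sq_abs, ← Real.norm_eq_abs]
  calc ‖f 1 - f 0‖ ^ 2 ≤ √(‖v‖ ^ 2 * A * N) ^ 2 := pow_le_pow_left₀ (norm_nonneg _) hmv 2
    _ = ‖v‖ ^ 2 * A * N := Real.sq_sqrt (by positivity)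

/-- The translation estimate combined with `|a|² ≤ 2 |b|² + 2 |b - a|²`. This is the device by which
`L²` bounds move from one place of the domain to another. -/
theorem lintegral_sq_le_translate (h : IsEnergyTriple U l u G g) (hU : IsOpen U)
    (hlow : ∀ x ∈ U, x 2 < 0) {V V' D : Set Space} (hV : IsOpen V) (hV' : MeasurableSet V') (hDU : D ⊆ U) (v : Space) (hVD : ∀ x ∈ V, ∀ t ∈ Icc (0 : ℝ) 1, x + t • v ∈ D)
    (hVV' : ∀ x ∈ V, x + v ∈ V') :
    ∫⁻ x in V, ‖u x‖ₑ ^ 2 ≤ 2 * (∫⁻ x in V', ‖u x‖ₑ ^ 2) +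
      2 * (ENNReal.ofReal (‖v‖ ^ 2) * ∫⁻ x in D, ‖G x‖ₑ ^ 2) := by
  have hVU : V ⊆ U := fun x hx => hDU (by simpa using hVD x hx 0 (by simp))
  have hVU1 : ∀ x ∈ V, x + v ∈ U := fun x hx => hDU (by simpa using hVD x hx 1 (by simp))
  have huV : MemLp u 2 (volume.restrict V) := h.fn.mono_measure (Measure.restrict_mono hVU le_rfl)
  have huv := memLp_comp_add h.fn hU.measurableSet v hVU1
  have e1 : ∫⁻ x in V, ‖u (x + v)‖ₑ ^ 2 ≤ ∫⁻ x in V', ‖u x‖ₑ ^ 2 := by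
    rw [← lintegral_indicator hV', ← lintegral_add_right_eq_self (μ := volume) _ v,
      ← lintegral_indicator hV.measurableSet]
    refine lintegral_mono fun x => ?_
    by_cases hx : x ∈ V
    · rw [indicator_of_mem hx, indicator_of_mem (hVV' x hx)]
    · rw [indicator_of_notMem hx]; exact zero_le
  calc ∫⁻ x in V, ‖u x‖ₑ ^ 2
      ≤ ∫⁻ x in V, (2 * ‖u (x + v)‖ₑ ^ 2 + 2 * ‖u (x + v) - u x‖ₑ ^ 2) :=
        lintegral_mono fun x => enorm_sq_le_add _ _
    _ = 2 * (∫⁻ x in V, ‖u (x + v)‖ₑ ^ 2) + 2 * ∫⁻ x in V, ‖u (x + v) - u x‖ₑ ^ 2 := by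
        have m1 : AEMeasurable (fun x => ‖u (x + v)‖ₑ ^ 2) (volume.restrict V) :=
          huv.1.enorm.pow_const 2
        have m2 : AEMeasurable (fun x => ‖u (x + v) - u x‖ₑ ^ 2) (volume.restrict V) :=
          (huv.1.sub huV.1).enorm.pow_const 2
        rw [lintegral_add_left' (m1.const_mul 2), lintegral_const_mul'' _ m1,
          lintegral_const_mul'' _ m2]
    _ ≤ _ := by
        gcongr
        exact h.translation hU hlow hV hDU v hVD

end IsEnergyTriple

/-! ### The Poincaré inequality on convex sets -/

namespace IsEnergyTriple

variable {U : Set Space} {l : ℝ} {u : Space → ℝ} {G : Space → Space} {g : Plane → ℝ}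

/-- With `τ = y - x` as the new variable and Tonelli, the inner integral is the translation
difference for a fixed `τ`. Convexity keeps the segments from `x` to `x + τ` in `Q`, and only `‖τ‖ ≤
s` contributes, whence the volume of the ball. -/
theorem lintegral_lintegral_sub_le (h : IsEnergyTriple U l u G g) (hU : IsOpen U)
    (hlow : ∀ x ∈ U, x 2 < 0) (hum : Measurable u) {Q : Set Space} (hQ : IsOpen Q)
    (hconv : Convex ℝ Q) (hQU : Q ⊆ U) {s : ℝ} (hs : ∀ x ∈ Q, ∀ y ∈ Q, ‖y - x‖ ≤ s) :
    ∫⁻ x in Q, ∫⁻ y in Q, ‖u y - u x‖ₑ ^ 2 ≤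
      volume (Metric.closedBall (0 : Space) s) *
        (ENNReal.ofReal (s ^ 2) * ∫⁻ x in Q, ‖G x‖ₑ ^ 2) := by
  set K : Space → Space → ENNReal := fun x τ =>
    Q.indicator (fun x => Q.indicator (fun y => ‖u y - u x‖ₑ ^ 2) (x + τ)) x with hK
  have hKm : Measurable (Function.uncurry K) := by
    have : Function.uncurry K = fun p : Space × Space =>
        ({p : Space × Space | p.1 ∈ Q ∧ p.1 + p.2 ∈ Q}).indicator
          (fun p => ‖u (p.1 + p.2) - u p.1‖ₑ ^ 2) p := by
      funext p
      by_cases h1 : p.1 ∈ Q <;> by_cases h2 : p.1 + p.2 ∈ Q <;>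
        simp [Function.uncurry, hK, indicator, h1, h2]
    rw [this]
    refine Measurable.indicator ?_ ?_
    · have h1 : Measurable fun p : Space × Space => u (p.1 + p.2) :=
        hum.comp (measurable_fst.add measurable_snd)
      have h2 : Measurable fun p : Space × Space => u p.1 := hum.comp measurable_fst
      exact (h1.sub h2).enorm.pow_const 2
    · exact (hQ.measurableSet.preimage measurable_fst).inter
        (hQ.measurableSet.preimage (measurable_fst.add measurable_snd))
  have e1 : ∫⁻ x in Q, ∫⁻ y in Q, ‖u y - u x‖ₑ ^ 2 = ∫⁻ x, ∫⁻ τ, K x τ := by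
    rw [← lintegral_indicator hQ.measurableSet]
    refine lintegral_congr fun x => ?_
    by_cases hx : x ∈ Q
    · simp only [hK, indicator_of_mem hx]
      rw [lintegral_add_left_eq_self (μ := volume)
        (fun y => Q.indicator (fun y => ‖u y - u x‖ₑ ^ 2) y) x,
        lintegral_indicator hQ.measurableSet]
    · simp only [hK, indicator_of_notMem hx, lintegral_zero]
  rw [e1, lintegral_lintegral_swap hKm.aemeasurable,
    mul_comm, ← setLIntegral_const, ← lintegral_indicator Metric.isClosed_closedBall.measurableSet]
  refine lintegral_mono fun τ => ?_
  set V : Set Space := Q ∩ (fun x => x + τ) ⁻¹' Q with hV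
  have hVo : IsOpen V := hQ.inter (hQ.preimage (continuous_add_const τ))
  have e2 : ∫⁻ x, K x τ = ∫⁻ x in V, ‖u (x + τ) - u x‖ₑ ^ 2 := by
    rw [← lintegral_indicator hVo.measurableSet]
    refine lintegral_congr fun x => ?_
    by_cases h1 : x ∈ Q <;> by_cases h2 : x + τ ∈ Q <;>
        simp [hK, hV, indicator, h1, h2]
  rw [e2]
  by_cases hτ : τ ∈ Metric.closedBall (0 : Space) s
  · rw [indicator_of_mem hτ]
    have hτ' : ‖τ‖ ≤ s := by simpa using hτ
    refine (h.translation hU hlow hVo hQU τ ?_).trans ?_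
    · rintro x ⟨hx1, hx2⟩ t ht
      have := hconv.add_smul_sub_mem hx1 hx2 ht
      simpa using this
    · gcongr
  · have : V = ∅ := by
      rw [Set.eq_empty_iff_forall_notMem]
      rintro x ⟨hx1, hx2⟩
      apply hτ
      simpa using hs x hx1 _ hx2
    rw [this]
    simp

/-- The Poincaré inequality on convex sets. -/
theorem poincare (h : IsEnergyTriple U l u G g) (hU : IsOpen U)
    (hlow : ∀ x ∈ U, x 2 < 0) (hum : Measurable u) {Q : Set Space} (hQ : IsOpen Q)
    (hconv : Convex ℝ Q) (hQU : Q ⊆ U) {s : ℝ} (hs : ∀ x ∈ Q, ∀ y ∈ Q, ‖y - x‖ ≤ s) :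
    volume Q * ∫⁻ x in Q, ‖u x‖ₑ ^ 2 ≤ ENNReal.ofReal ((∫ x in Q, u x) ^ 2) +
      volume (Metric.closedBall (0 : Space) s) *
        (ENNReal.ofReal (s ^ 2) * ∫⁻ x in Q, ‖G x‖ₑ ^ 2) := by
  rcases Q.eq_empty_or_nonempty with rfl | ⟨x₀, hx₀⟩
  · simp
  have hbd : Q ⊆ Metric.closedBall x₀ s := fun y hy => by
    rw [mem_closedBall_iff_norm]; exact hs x₀ hx₀ y hy
  have hfin : volume Q < ⊤ :=
    (measure_mono hbd).trans_lt (isCompact_closedBall x₀ s).measure_lt_top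
  have : IsFiniteMeasure (volume.restrict Q) := ⟨by simpa using hfin⟩
  have hu : MemLp u 2 (volume.restrict Q) := h.fn.mono_measure (Measure.restrict_mono hQU le_rfl)
  have hu1 : Integrable u (volume.restrict Q) := hu.integrable (by norm_num)
  set m := volume.real Q with hm
  set I := ∫ x in Q, u x with hI
  set S := ∫ x in Q, u x ^ 2 with hS
  have hS0 : 0 ≤ S := integral_nonneg fun x => sq_nonneg _
  have hint : ∀ x, ∫ y in Q, (u y - u x) ^ 2 = S - 2 * u x * I + m * u x ^ 2 := by
    intro x
    have : (fun y => (u y - u x) ^ 2) = fun y => (u y ^ 2 - 2 * u x * u y) + u x ^ 2 := by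
      funext y; ring
    have i1 : Integrable (fun y => 2 * u x * u y) (volume.restrict Q) := hu1.const_mul _
    have i2 : Integrable (fun y => u y ^ 2 - 2 * u x * u y) (volume.restrict Q) :=
      hu.integrable_sq.sub i1
    rw [this, integral_add i2 (integrable_const _), integral_sub hu.integrable_sq i1,
      integral_const_mul]
    simp [hm, hI, hS]
  have e1 : ∀ x, ∫⁻ y in Q, ‖u y - u x‖ₑ ^ 2 =
      ENNReal.ofReal (S - 2 * u x * I + m * u x ^ 2) := by
    intro x
    rw [← hint]
    exact lintegral_sq_eq_ofReal (f := fun y => u y - u x) (hu.sub (memLp_const (u x)))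
  have hnn : ∀ x, 0 ≤ S - 2 * u x * I + m * u x ^ 2 := by
    intro x
    rw [← hint]
    exact integral_nonneg fun y => sq_nonneg _
  have e2 : ∫⁻ x in Q, ∫⁻ y in Q, ‖u y - u x‖ₑ ^ 2 = ENNReal.ofReal (2 * (m * S) - 2 * I ^ 2) := by
    simp_rw [e1]
    have i1 : Integrable (fun x => S - 2 * u x * I) (volume.restrict Q) :=
      (integrable_const _).sub ((hu1.const_mul 2).mul_const I)
    have i2 : Integrable (fun x => m * u x ^ 2) (volume.restrict Q) := hu.integrable_sq.const_mul m
    have i3 : Integrable (fun x => S - 2 * u x * I + m * u x ^ 2) (volume.restrict Q) := i1.add i2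
    rw [← ofReal_integral_eq_lintegral_ofReal i3 (ae_of_all _ hnn)]
    congr 1
    rw [integral_add i1 i2, integral_sub (integrable_const _) ((hu1.const_mul 2).mul_const I),
      integral_mul_const, integral_const_mul, integral_const_mul]
    simp [← hm, ← hI, ← hS]
    ring
  have hmain := h.lintegral_lintegral_sub_le hU hlow hum hQ hconv hQU hs
  rw [e2] at hmain
  -- The double integral equals `2 (m S - I²)`. The maximum with `0` makes `ENNReal.ofReal` additive
  -- without first proving nonnegativity, and the superfluous factor `2` is harmless.
  have h2 : m * S ≤ I ^ 2 + (2 * (m * S) - 2 * I ^ 2) ⊔ 0 := by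
    rcases le_total (2 * (m * S) - 2 * I ^ 2) 0 with h0 | h0
    · rw [sup_of_le_right h0]; linarith
    · rw [sup_of_le_left h0]; linarith
  have e3 : volume Q * ∫⁻ x in Q, ‖u x‖ₑ ^ 2 = ENNReal.ofReal (m * S) := by
    rw [lintegral_sq_eq_ofReal hu, ENNReal.ofReal_mul measureReal_nonneg,
      ofReal_measureReal hfin.ne]
  rw [e3]
  refine (ENNReal.ofReal_le_ofReal h2).trans ?_
  rw [ENNReal.ofReal_add (sq_nonneg _) le_sup_right]
  gcongr
  refine le_trans (le_of_eq ?_) hmain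
  rcases le_total (2 * (m * S) - 2 * I ^ 2) 0 with h0 | h0
  · rw [sup_of_le_right h0, ENNReal.ofReal_zero, ENNReal.ofReal_of_nonpos h0]
  · rw [sup_of_le_left h0]

end IsEnergyTriple

/-! ### The trace on the surface and the values in a thin layer -/

/-- Splitting off the coordinate with number `i`. -/
noncomputable def splitCoord (i : Fin 3) : Space ≃ᵐ ℝ × Plane :=
  ((MeasurableEquiv.toLp 2 (Fin 3 → ℝ)).symm.trans
    (MeasurableEquiv.piFinSuccAbove (fun _ => ℝ) i)).trans
    ((MeasurableEquiv.refl ℝ).prodCongr (MeasurableEquiv.toLp 2 (Fin 2 → ℝ)))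

theorem measurePreserving_splitCoord (i : Fin 3) : MeasurePreserving (splitCoord i) := by
  refine MeasurePreserving.trans (MeasurePreserving.trans
    (EuclideanSpace.volume_preserving_symm_measurableEquiv_toLp (Fin 3))
    (volume_preserving_piFinSuccAbove (fun _ => ℝ) i)) ?_
  exact (MeasurePreserving.id volume).prod
    (EuclideanSpace.volume_preserving_symm_measurableEquiv_toLp (Fin 2)).symm

theorem splitCoord_symm_two (t : ℝ) (y : Plane) :
    (splitCoord 2).symm (t, y) = !₂[y 0, y 1, t] := by
  ext j
  fin_cases j <;> simp [splitCoord, MeasurableEquiv.piFinSuccAbove]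
  all_goals rfl

theorem splitCoord_symm_zero (t : ℝ) (y : Plane) :
    (splitCoord 0).symm (t, y) = !₂[t, y 0, y 1] := by
  ext j
  fin_cases j <;> simp [splitCoord, MeasurableEquiv.piFinSuccAbove]
  all_goals rfl

theorem integral_splitLast {F : Type*} [NormedAddCommGroup F] [NormedSpace ℝ F] (f : Space → F) :
    ∫ x, f x = ∫ p : ℝ × Plane, f !₂[p.2 0, p.2 1, p.1] := by
  rw [← (measurePreserving_splitCoord 2).symm.integral_comp']
  simp_rw [← splitCoord_symm_two]

/-- The projection to the plane `x₃ = 0` along the vector `(e, -1)`. -/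
noncomputable def slantedProj (e : Plane) (x : Space) : Plane :=
  !₂[x 0 + x 2 * e 0, x 1 + x 2 * e 1]

theorem contDiff_slantedProj (e : Plane) : ContDiff ℝ ∞ (slantedProj e) := by
  unfold slantedProj
  rw [contDiff_euclidean]
  intro i
  fin_cases i <;> simp <;> fun_prop

theorem slantedProj_split (e y : Plane) (t : ℝ) :
    slantedProj e !₂[y 0, y 1, t] = y + t • e := by
  ext i
  fin_cases i <;> simp [slantedProj]

theorem slantedProj_section (e : Plane) (x : Space) :
    x = toSurface (slantedProj e x) + (-x 2) • !₂[e 0, e 1, -1] := by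
  ext i
  fin_cases i <;> simp [slantedProj, toSurface]

theorem slantedProj_add (e : Plane) (x : Space) (t : ℝ) :
    slantedProj e (x + t • !₂[e 0, e 1, -1]) = slantedProj e x := by
  ext i
  fin_cases i <;> simp [slantedProj] <;> ring

/-- At height `t` the slanted projection is the translation by `t e`. The resulting shear preserves
volume, so the integral factors as it would for `e = 0`. -/
theorem integral_slanted_mul (e : Plane) {ψ : Plane → ℝ} {k : ℝ → ℝ} (hψ : Integrable ψ)
    (hk : Integrable k) :
    Integrable (fun x : Space => ψ (slantedProj e x) * k (x 2)) ∧
    ∫ x : Space, ψ (slantedProj e x) * k (x 2) = (∫ y, ψ y) * ∫ t, k t := by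
  have hshear : MeasurePreserving (fun p : ℝ × Plane => (p.1, p.2 + p.1 • e)) := by
    refine (MeasurePreserving.id (volume : Measure ℝ)).skew_product
      (g := fun t y => y + t • e) (by fun_prop) ?_
    exact ae_of_all _ fun t => (measurePreserving_add_right volume (t • e)).map_eq
  have hint : Integrable (fun p : ℝ × Plane => k p.1 * ψ p.2) := hk.mul_prod hψ
  have hfun : (fun p : ℝ × Plane => (fun x : Space => ψ (slantedProj e x) * k (x 2))
      !₂[p.2 0, p.2 1, p.1]) = (fun p : ℝ × Plane => k p.1 * ψ p.2) ∘
        fun p : ℝ × Plane => (p.1, p.2 + p.1 • e) := by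
    funext p
    simp only [Function.comp, slantedProj_split]
    simp [mul_comm]
  have hemb : MeasurableEmbedding fun p : ℝ × Plane => (p.1, p.2 + p.1 • e) := by
    have hm : Measurable fun p : ℝ × Plane => (p.1, p.2 + p.1 • e) := by fun_prop
    refine hm.measurableEmbedding ?_
    rintro ⟨a, b⟩ ⟨c, d⟩ h
    simp only [Prod.mk.injEq] at h
    obtain ⟨rfl, h2⟩ := h
    simpa using h2
  constructor
  · rw [← (measurePreserving_splitCoord 2).symm.integrable_comp_emb (MeasurableEquiv.measurableEmbedding _)]
    have : (fun x : Space => ψ (slantedProj e x) * k (x 2)) ∘ (splitCoord 2).symm =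
        fun p : ℝ × Plane => (fun x : Space => ψ (slantedProj e x) * k (x 2))
      !₂[p.2 0, p.2 1, p.1] := by
      funext p
      rw [← splitCoord_symm_two]
      rfl
    rw [this, hfun]
    exact hshear.integrable_comp_of_integrable hint
  · rw [integral_splitLast]
    have := hshear.integral_comp hemb (fun p : ℝ × Plane => k p.1 * ψ p.2)
    calc _ = ∫ p : ℝ × Plane, ((fun p : ℝ × Plane => k p.1 * ψ p.2) ∘
        fun p : ℝ × Plane => (p.1, p.2 + p.1 • e)) p := by rw [← hfun]
      _ = ∫ p : ℝ × Plane, k p.1 * ψ p.2 := this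
      _ = _ := by
        rw [Measure.volume_eq_prod, integral_prod_mul (fun t => k t) (fun y => ψ y), mul_comm]

theorem closure_lower {U : Set Space} (hlow : ∀ x ∈ U, x 2 < 0) : ∀ x ∈ closure U, x 2 ≤ 0 := by
  intro x hx
  have hc : IsClosed {x : Space | x 2 ≤ 0} := isClosed_le (by fun_prop) continuous_const
  exact closure_minimal (fun y hy => (hlow y hy).le) hc hx

theorem exists_unit_bump : ∃ β : ℝ → ℝ, ContDiff ℝ ∞ β ∧ HasCompactSupport β ∧ β 0 = 1 ∧
    (∀ t, 1 / 2 < |t| → β t = 0) ∧ ∀ t, 1 / 2 < |t| → deriv β t = 0 := by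
  let β : ContDiffBump (0 : ℝ) := ⟨1 / 4, 1 / 2, by norm_num, by norm_num⟩
  refine ⟨β, β.contDiff, β.hasCompactSupport, β.one_of_mem_closedBall (by simp [β]), ?_, ?_⟩
  · intro t ht
    refine β.zero_of_le_dist ?_
    simpa [β] using ht.le
  · intro t ht
    by_contra hne
    have h1 : t ∈ tsupport β := support_deriv_subset (f := β) hne
    rw [β.tsupport_eq] at h1
    simp only [β, mem_closedBall_zero_iff, Real.norm_eq_abs] at h1
    linarith

/-- A bound of the trace on the free surface by the values in a thin layer. -/
theorem exists_trace_const : ∃ K : ℝ, 0 < K ∧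
    ∀ {U : Set Space} {l : ℝ} {u : Space → ℝ} {G : Space → Space} {g : Plane → ℝ},
      IsEnergyTriple U l u G g → IsOpen U → (∀ x ∈ U, x 2 < 0) →
      ∀ {J : Set Plane} {D : Set Space}, IsOpen J → J ⊆ surfaceStrip l → MeasurableSet D → D ⊆ U →
      ∀ (e : Plane) {s : ℝ}, 0 < s →
      (∀ y ∈ J, ∀ t ∈ Ioo (0 : ℝ) s, toSurface y + t • !₂[e 0, e 1, -1] ∈ D) →
      ∫⁻ y in J, ‖g y‖ₑ ^ 2 ≤ ENNReal.ofReal (K / s) * (∫⁻ x in D, ‖u x‖ₑ ^ 2) +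
        ENNReal.ofReal (K * (‖e‖ ^ 2 + 1) * s) * ∫⁻ x in D, ‖G x‖ₑ ^ 2 := by
  obtain ⟨β, hβc, hβs, hβone, hβzero, hβdzero⟩ := exists_unit_bump
  have hβd : Continuous (deriv β) := hβc.continuous_deriv (by simp)
  have hβi : Integrable (fun t => β t ^ 2) :=
    (hβc.continuous.memLp_of_hasCompactSupport hβs (p := 2)).integrable_sq
  have hβdi : Integrable (fun t => deriv β t ^ 2) :=
    (hβd.memLp_of_hasCompactSupport hβs.deriv (p := 2)).integrable_sq
  obtain ⟨c0, hc0⟩ : ∃ c, c = ∫ t, β t ^ 2 := ⟨_, rfl⟩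
  obtain ⟨c1, hc1⟩ : ∃ c, c = ∫ t, deriv β t ^ 2 := ⟨_, rfl⟩
  have hc0' : 0 ≤ c0 := hc0 ▸ integral_nonneg fun t => sq_nonneg _
  have hc1' : 0 ≤ c1 := hc1 ▸ integral_nonneg fun t => sq_nonneg _
  refine ⟨2 * (c0 + c1) + 1, by positivity, ?_⟩
  intro U l u G g h hU hlow J D hJ hJl hD hDU e s hs hJD
  set ev : Space := !₂[e 0, e 1, -1] with hev
  have hevn : ‖ev‖ ^ 2 = ‖e‖ ^ 2 + 1 := by
    simp [hev, EuclideanSpace.norm_sq_eq, Fin.sum_univ_three, Fin.sum_univ_two]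
  have huD : MemLp u 2 (volume.restrict D) := h.fn.mono_measure (Measure.restrict_mono hDU le_rfl)
  have hGD : MemLp G 2 (volume.restrict D) :=
    h.gradient.mono_measure (Measure.restrict_mono hDU le_rfl)
  have hGv : MemLp (fun x => ⟪G x, ev⟫_ℝ) 2 (volume.restrict D) :=
    (h.gradient_inner ev).mono_measure (Measure.restrict_mono hDU le_rfl)
  have hgJ : MemLp g 2 (volume.restrict J) := h.trace.mono_measure (Measure.restrict_mono hJl le_rfl)
  rw [lintegral_sq_eq_ofReal huD, lintegral_enorm_sq_eq_ofReal hGD]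
  have hA0 : 0 ≤ ∫ x in D, u x ^ 2 := integral_nonneg fun t => sq_nonneg _
  have hB0 : 0 ≤ ∫ x in D, ‖G x‖ ^ 2 := integral_nonneg fun t => sq_nonneg _
  obtain ⟨A, hA⟩ : ∃ A, A = ∫ x in D, u x ^ 2 := ⟨_, rfl⟩
  obtain ⟨B, hB⟩ : ∃ B, B = ∫ x in D, ‖G x‖ ^ 2 := ⟨_, rfl⟩
  rw [← hA] at hA0
  rw [← hB] at hB0
  rw [← hA, ← hB]
  rw [← ENNReal.ofReal_mul (by positivity), ← ENNReal.ofReal_mul (by positivity),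
    ← ENNReal.ofReal_add (by positivity) (by positivity)]
  refine lintegral_sq_le_of_duality hJ hgJ (by positivity) ?_
  intro ψ h1 h2 h3
  set N := ∫ y in J, ψ y ^ 2 with hN
  have hψ2 : MemLp ψ 2 := h1.continuous.memLp_of_hasCompactSupport h2
  have hsub : ∀ x, x ∉ J → ψ x = 0 := fun x hx =>
    image_eq_zero_of_notMem_tsupport fun hx2 => hx (h3 hx2)
  have hNfull : ∫ y, ψ y ^ 2 = N := by
    rw [hN, setIntegral_eq_integral_of_forall_compl_eq_zero]
    intro x hx; rw [hsub x hx]; simp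
  -- `ψ` is extended from the surface as a constant along `ev` and cut off at depth `s / 2`. The
  -- derivative along `ev` then falls on the cutoff alone, which yields the factor `1 / s` at `u`
  -- and `s` at `G`.
  set φ : Space → ℝ := fun x => ψ (slantedProj e x) * β (x 2 / s) with hφd
  -- support
  set Kc : Set Space := (fun p : Plane × ℝ => toSurface p.1 + (-p.2) • ev) ''
    (tsupport ψ ×ˢ Icc (-(s / 2)) (s / 2)) with hKc
  have hKcomp : IsCompact Kc := by
    refine (h2.isCompact.prod isCompact_Icc).image ?_
    have := continuous_toSurface
    fun_prop
  have hβ0 : ∀ t, |t| > s / 2 → β (t / s) = 0 := by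
    intro t ht
    refine hβzero _ ?_
    rw [abs_div, abs_of_pos hs, lt_div_iff₀ hs]; linarith
  have hsupp : ∀ x, φ x ≠ 0 → x ∈ Kc := by
    intro x hx
    refine ⟨(slantedProj e x, x 2), ⟨?_, ?_⟩, ?_⟩
    · exact subset_tsupport _ (left_ne_zero_of_mul hx)
    · rw [mem_Icc, ← abs_le]
      by_contra hcon
      exact hx (by simp only [hφd]; rw [hβ0 _ (not_le.1 hcon), mul_zero])
    · exact (slantedProj_section e x).symm
  have hφtest : IsTestFunction U l φ := by
    refine ⟨?_, HasCompactSupport.intro hKcomp fun x hx => by_contra fun h0 => hx (hsupp x h0), ?_⟩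
    · refine (h1.comp (contDiff_slantedProj e)).mul (hβc.comp ?_)
      fun_prop
    · have hts : tsupport φ ⊆ Kc := closure_minimal (fun x hx => hsupp x hx) hKcomp.isClosed
      rw [Set.disjoint_left]
      intro x hx hx2
      obtain ⟨⟨y, t⟩, ⟨hy, ht⟩, rfl⟩ := hts hx
      have hx3 : (toSurface y + (-t) • ev) 2 = t := by simp [toSurface, hev]
      simp only at hx2 hx3 hy ht
      rcases lt_trichotomy t 0 with h0 | h0 | h0
      · have : toSurface y + (-t) • ev ∈ U := hDU (hJD y (h3 hy) (-t) ⟨by linarith, by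
          linarith [ht.1]⟩)
        have h5 : toSurface y + (-t) • ev ∈ U ∩ frontier U := ⟨this, hx2.1⟩
        rw [hU.inter_frontier_eq] at h5
        exact h5
      · apply hx2.2
        have := hJl (h3 hy)
        simp only [surfaceStrip, mem_ofPred_eq] at this
        simp [freeSurface, h0, toSurface, this]
      · have := closure_lower hlow _ (frontier_subset_closure hx2.1)
        linarith
  have hfd : ∀ x, fderiv ℝ φ x ev = ψ (slantedProj e x) * (-(deriv β (x 2 / s) / s)) := by
    intro x
    have hd : DifferentiableAt ℝ φ x := (hφtest.smooth.differentiable (by simp)) x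
    have hl : HasDerivAt (fun t : ℝ => x + t • ev) ev 0 := by
      simpa using ((hasDerivAt_id (0 : ℝ)).smul_const ev).const_add x
    have hc := HasFDerivAt.comp_hasDerivAt (l := φ) (l' := fderiv ℝ φ x)
      (f := fun t : ℝ => x + t • ev) (0 : ℝ) (by simpa using hd.hasFDerivAt) hl
    have hf2 : φ ∘ (fun t : ℝ => x + t • ev) = fun t => ψ (slantedProj e x) * β ((x 2 - t) / s) := by
      funext t
      simp only [Function.comp, hφd, hev, slantedProj_add]
      simp [sub_eq_add_neg]
    rw [hf2] at hc
    have hl2 : HasDerivAt (fun t : ℝ => (x 2 - t) / s) (-1 / s) 0 := by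
      simpa using ((hasDerivAt_id (0 : ℝ)).const_sub (x 2)).div_const s
    have hb : HasDerivAt β (deriv β (x 2 / s)) ((x 2 - 0) / s) := by
      rw [sub_zero]
      exact ((hβc.differentiable (by simp)) _).hasDerivAt
    have hc2 := (hb.comp (0 : ℝ) hl2).const_mul (ψ (slantedProj e x))
    have := hc.unique hc2
    rw [this]; ring
  -- zero outside D
  have hout : ∀ x ∈ U, x ∉ D → ψ (slantedProj e x) = 0 ∨ |x 2| > s / 2 := by
    intro x hx hxD
    by_contra! hcon
    obtain ⟨ha, hb⟩ := hcon
    apply hxD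
    rw [slantedProj_section e x]
    have hx2 := hlow x hx
    rw [abs_of_neg hx2] at hb
    exact hJD _ (by_contra fun hj => ha (hsub _ hj)) _ ⟨by linarith, by linarith⟩
  have hβ'0 : ∀ t, |t| > s / 2 → deriv β (t / s) = 0 := by
    intro t ht
    refine hβdzero _ ?_
    rw [abs_div, abs_of_pos hs, lt_div_iff₀ hs]; linarith
  have hg := h.green_dir hφtest ev
  have e1 : (∫ x in U, u x * fderiv ℝ φ x ev) = ∫ x in D, u x * fderiv ℝ φ x ev := by
    rw [← integral_indicator hD, ← integral_indicator hU.measurableSet]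
    refine integral_congr_ae (ae_of_all _ fun x => ?_)
    by_cases hx : x ∈ D
    · simp only [indicator_of_mem hx, indicator_of_mem (hDU hx)]
    · by_cases hxU : x ∈ U
      · simp only [indicator_of_notMem hx, indicator_of_mem hxU, hfd]
        rcases hout x hxU hx with h0 | h0
        · rw [h0]; ring
        · rw [hβ'0 _ h0]; ring
      · simp only [indicator_of_notMem hx, indicator_of_notMem hxU]
  have e2 : (∫ x in U, ⟪G x, ev⟫_ℝ * φ x) = ∫ x in D, ⟪G x, ev⟫_ℝ * φ x := by
    rw [← integral_indicator hD, ← integral_indicator hU.measurableSet]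
    refine integral_congr_ae (ae_of_all _ fun x => ?_)
    by_cases hx : x ∈ D
    · simp only [indicator_of_mem hx, indicator_of_mem (hDU hx)]
    · by_cases hxU : x ∈ U
      · simp only [indicator_of_notMem hx, indicator_of_mem hxU, hφd]
        rcases hout x hxU hx with h0 | h0
        · rw [h0]; ring
        · rw [hβ0 _ h0]; ring
      · simp only [indicator_of_notMem hx, indicator_of_notMem hxU]
  have e3 : (∫ y in surfaceStrip l, g y * φ (toSurface y)) = ∫ y in J, g y * ψ y := by
    have hφs : ∀ y, φ (toSurface y) = ψ y := by
      intro y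
      have : slantedProj e (toSurface y) = y := by
        ext i
        fin_cases i <;> simp [slantedProj, toSurface]
      simp only [hφd, this]
      simp [toSurface, hβone]
    simp only [hφs]
    rw [setIntegral_eq_integral_of_forall_compl_eq_zero,
      setIntegral_eq_integral_of_forall_compl_eq_zero]
    · intro x hx; rw [hsub x hx, mul_zero]
    · intro x hx; rw [hsub x fun hj => hx (hJl hj), mul_zero]
  rw [e1, e2, e3] at hg
  have hev2 : ev 2 = -1 := by simp [hev]
  rw [hev2] at hg
  have hsq : Integrable fun y => ψ y ^ 2 := hψ2.integrable_sq
  have k0 : Integrable fun t => β (t / s) ^ 2 := hβi.comp_div hs.ne'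
  have k1 : Integrable fun t => (deriv β (t / s) / s) ^ 2 := by
    have := (hβdi.comp_div hs.ne').div_const (s ^ 2)
    simpa only [div_pow] using this
  have q0 : ∫ x in D, φ x ^ 2 ≤ N * (s * c0) := by
    have hi := integral_slanted_mul e hsq k0
    have hfe : (fun x => φ x ^ 2) = fun x => ψ (slantedProj e x) ^ 2 * β (x 2 / s) ^ 2 := by
      funext x; simp only [hφd]; ring
    rw [hfe]
    refine (setIntegral_le_integral hi.1 (ae_of_all _ fun x => by positivity)).trans ?_
    rw [hi.2, hNfull, Measure.integral_comp_div (fun t => β t ^ 2), abs_of_pos hs, smul_eq_mul,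
      hc0]
  have q1 : ∫ x in D, (fderiv ℝ φ x ev) ^ 2 ≤ N * (c1 / s) := by
    have hi := integral_slanted_mul e hsq k1
    have hfe : (fun x => (fderiv ℝ φ x ev) ^ 2) =
        fun x => ψ (slantedProj e x) ^ 2 * (deriv β (x 2 / s) / s) ^ 2 := by
      funext x; rw [hfd]; ring
    rw [hfe]
    refine (setIntegral_le_integral hi.1 (ae_of_all _ fun x => by positivity)).trans ?_
    simp_rw [div_pow] at hi ⊢
    rw [hi.2, hNfull, integral_div, Measure.integral_comp_div (fun t => deriv β t ^ 2),
      abs_of_pos hs, smul_eq_mul]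
    apply le_of_eq; rw [← hc1]; field_simp
  have hN0 : 0 ≤ N := integral_nonneg fun t => sq_nonneg _
  have p1 : (∫ x in D, u x * fderiv ℝ φ x ev) ^ 2 ≤ A * (N * (c1 / s)) :=
    hA ▸ (sq_integral_mul_le huD (hφtest.memLp_fderiv ev)).trans
      (mul_le_mul_of_nonneg_left q1 (hA ▸ hA0))
  have p2 : (∫ x in D, ⟪G x, ev⟫_ℝ * φ x) ^ 2 ≤ ((‖e‖ ^ 2 + 1) * B) * (N * (s * c0)) := by
    refine (sq_integral_mul_le hGv hφtest.memLp).trans ?_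
    refine mul_le_mul ?_ q0 (integral_nonneg fun x => sq_nonneg _) (by positivity)
    rw [hB, ← integral_const_mul]
    refine integral_mono hGv.integrable_sq (hGD.norm.integrable_sq.const_mul _) fun x => ?_
    have := abs_real_inner_le_norm (G x) ev
    simp only
    rw [← sq_abs, ← hevn, mul_comm, ← mul_pow]
    exact pow_le_pow_left₀ (abs_nonneg _) this 2
  have hfin : (∫ y in J, g y * ψ y) ^ 2 ≤
      2 * (A * (N * (c1 / s))) + 2 * (((‖e‖ ^ 2 + 1) * B) * (N * (s * c0))) := by
    have : (∫ y in J, g y * ψ y) = -((∫ x in D, u x * fderiv ℝ φ x ev) +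
      ∫ x in D, ⟪G x, ev⟫_ℝ * φ x) := by linarith
    rw [this]
    nlinarith [sq_nonneg ((∫ x in D, u x * fderiv ℝ φ x ev) - ∫ x in D, ⟪G x, ev⟫_ℝ * φ x)]
  refine hfin.trans ?_
  have r1 : 2 * (A * (N * (c1 / s))) ≤ (2 * (c0 + c1) + 1) / s * A * N := by
    have : 2 * c1 * (A * N / s) ≤ (2 * (c0 + c1) + 1) * (A * N / s) :=
      mul_le_mul_of_nonneg_right (by linarith) (by positivity)
    calc _ = 2 * c1 * (A * N / s) := by ring
      _ ≤ _ := this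
      _ = _ := by ring
  have r2 : 2 * (((‖e‖ ^ 2 + 1) * B) * (N * (s * c0))) ≤
      (2 * (c0 + c1) + 1) * (‖e‖ ^ 2 + 1) * s * B * N := by
    have : 2 * c0 * ((‖e‖ ^ 2 + 1) * B * N * s) ≤
        (2 * (c0 + c1) + 1) * ((‖e‖ ^ 2 + 1) * B * N * s) :=
      mul_le_mul_of_nonneg_right (by linarith) (by positivity)
    calc _ = 2 * c0 * ((‖e‖ ^ 2 + 1) * B * N * s) := by ring
      _ ≤ _ := this
      _ = _ := by ring
  linarith

/-! ### Propagation of estimates in Lipschitz domains -/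

section Geometry

variable {E : Type*} [NormedAddCommGroup E] [InnerProductSpace ℝ E]

/-- In a graph chart the points of the closure lie on or above the graph, so a shift upwards puts
them strictly above it. Half the radius of the chart is kept so that the shifted point remains in
the chart. -/
theorem IsLipschitzDomain.exists_direction {U : Set E} (hU : IsLipschitzDomain U) {p : E}
    (hp : p ∈ frontier U) : ∃ (e : E) (r : ℝ), ‖e‖ = 1 ∧ 0 < r ∧
      ∀ x ∈ closure U, ‖x - p‖ < r → ∀ t, 0 < t → t < r → x + t • e ∈ U := by
  obtain ⟨e, f, K, r, he, hf, hr, hx⟩ := hU.2 p hp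
  refine ⟨e, r / 2, he, by positivity, fun x hxc hxp t ht0 ht => ?_⟩
  have hee : ⟪e, e⟫_ℝ = 1 := by rw [real_inner_self_eq_norm_sq, he, one_pow]
  have hfc : Continuous fun x => f (x - ⟪e, x⟫_ℝ • e) := hf.continuous.comp (by fun_prop)
  have hle : f (x - ⟪e, x⟫_ℝ • e) ≤ ⟪e, x⟫_ℝ := by
    have hcl : x ∈ closure (U ∩ Metric.ball p r) := by
      have : x ∈ Metric.ball p r := by rw [mem_ball_iff_norm]; linarith
      exact Metric.isOpen_ball.closure_inter  ⟨hxc, this⟩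
    refine closure_minimal (s := U ∩ Metric.ball p r)
      (t := {x | f (x - ⟪e, x⟫_ℝ • e) ≤ ⟪e, x⟫_ℝ}) ?_ (isClosed_le hfc (by fun_prop)) hcl
    rintro y ⟨hy1, hy2⟩
    exact ((hx y hy2).1 hy1).le
  rw [hx]
  · have e1 : ⟪e, x + t • e⟫_ℝ = ⟪e, x⟫_ℝ + t := by
      rw [inner_add_right, inner_smul_right, hee, mul_one]
    have e2 : x + t • e - (⟪e, x⟫_ℝ + t) • e = x - ⟪e, x⟫_ℝ • e := by
      rw [add_smul]; abel
    rw [e1, e2]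
    linarith
  · rw [mem_ball_iff_norm]
    have : x + t • e - p = (x - p) + t • e := by abel
    rw [this]
    refine (norm_add_le _ _).trans_lt ?_
    rw [norm_smul, he, Real.norm_eq_abs, abs_of_pos ht0]
    linarith

/-- A property of sets which is inherited along translations inside `U` spreads from one ball to
all of a connected set `U`. -/
theorem exists_good_ball {U : Set E} (hU : IsOpen U) (hc : IsPreconnected U) {Good : Set E → Prop}
    (htrans : ∀ (V V' : Set E) (v : E), IsOpen V → IsOpen V' →
      (∀ x ∈ V, ∀ t ∈ Icc (0 : ℝ) 1, x + t • v ∈ U) → (∀ x ∈ V, x + v ∈ V') → Good V' → Good V)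
    {p₀ : E} (hp₀ : p₀ ∈ U) {r₀ : ℝ} (hr₀ : 0 < r₀) (hg : Good (Metric.ball p₀ r₀))
    {p : E} (hp : p ∈ U) : ∃ r > 0, Good (Metric.ball p r) := by
  -- Two sufficiently close centres exchange good balls by the translation `q - p`, whose segments
  -- stay in the ball of radius `3 ρ`.
  have move : ∀ p q : E, ∀ ρ > 0, Metric.ball p (3 * ρ) ⊆ U → ‖q - p‖ < ρ →
      (∃ r > 0, Good (Metric.ball q r)) → ∃ r > 0, Good (Metric.ball p r) := by
    rintro p q ρ hρ hball hqp ⟨r, hr, hgr⟩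
    refine ⟨min r ρ, lt_min hr hρ, htrans _ _ (q - p) Metric.isOpen_ball Metric.isOpen_ball ?_ ?_ hgr⟩
    · intro x hx t ht
      apply hball
      rw [mem_ball_iff_norm] at hx ⊢
      have : x + t • (q - p) - p = (x - p) + t • (q - p) := by abel
      rw [this]
      refine (norm_add_le _ _).trans_lt ?_
      rw [norm_smul, Real.norm_eq_abs, abs_of_nonneg ht.1]
      have h1 := lt_of_lt_of_le hx (min_le_right _ _)
      have h2 : t * ‖q - p‖ ≤ 1 * ‖q - p‖ := mul_le_mul_of_nonneg_right ht.2 (norm_nonneg _)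
      linarith
    · intro x hx
      rw [mem_ball_iff_norm] at hx ⊢
      have : x + (q - p) - q = x - p := by abel
      rw [this]
      exact lt_of_lt_of_le hx (min_le_left _ _)
  -- The set of centres of good balls is open and relatively closed in `U` by `move`, so it is all
  -- of the preconnected set `U`.
  have hsub : U ⊆ {p | p ∈ U ∧ ∃ r > 0, Good (Metric.ball p r)} := by
    refine hc.subset_of_closure_inter_subset ?_ ⟨p₀, hp₀, hp₀, r₀, hr₀, hg⟩ ?_
    · rw [Metric.isOpen_iff]
      rintro p ⟨hp, hgp⟩
      obtain ⟨ε, hε, hb⟩ := Metric.isOpen_iff.1 hU p hp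
      refine ⟨ε / 4, by positivity, fun q hq => ?_⟩
      rw [mem_ball_iff_norm] at hq
      refine ⟨hb (by rw [mem_ball_iff_norm]; linarith), move q p (ε / 4) (by positivity) ?_ ?_ hgp⟩
      · intro x hx
        apply hb
        rw [mem_ball_iff_norm] at hx ⊢
        have := norm_add_le (x - q) (q - p)
        rw [sub_add_sub_cancel] at this
        linarith
      · rwa [norm_sub_rev]
    · rintro p ⟨hpc, hpU⟩
      obtain ⟨ε, hε, hb⟩ := Metric.isOpen_iff.1 hU p hpU
      obtain ⟨q, ⟨-, hq2⟩, hq3⟩ := Metric.mem_closure_iff.1 hpc (ε / 3) (by positivity)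
      refine ⟨hpU, move p q (ε / 3) (by positivity) ?_ ?_ hq2⟩
      · have : 3 * (ε / 3) = ε := by ring
        rwa [this]
      · rw [dist_comm, dist_eq_norm] at hq3; exact hq3
  exact (hsub hp).2

/-- The same up to the boundary of a Lipschitz domain. -/
theorem good_inter_of_isCompact {U : Set E} (hU : IsLipschitzDomain U) (hc : IsPreconnected U)
    {Good : Set E → Prop} (hempty : Good ∅) (hmono : ∀ V W, V ⊆ W → Good W → Good V)
    (hunion : ∀ V W, Good V → Good W → Good (V ∪ W))
    (htrans : ∀ (V V' : Set E) (v : E), IsOpen V → IsOpen V' →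
      (∀ x ∈ V, ∀ t ∈ Icc (0 : ℝ) 1, x + t • v ∈ U) → (∀ x ∈ V, x + v ∈ V') → Good V' → Good V)
    {p₀ : E} (hp₀ : p₀ ∈ U) {r₀ : ℝ} (hr₀ : 0 < r₀) (hg : Good (Metric.ball p₀ r₀))
    {K : Set E} (hK : IsCompact K) (hKU : K ⊆ closure U) : Good (U ∩ K) := by
  refine hK.induction_on (p := fun s => Good (U ∩ s)) (by simpa using hempty)
    (fun s t hst ht => hmono _ _ (inter_subset_inter_right _ hst) ht)
    (fun s t hs ht => by rw [inter_union_distrib_left]; exact hunion _ _ hs ht) ?_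
  intro p hpK
  by_cases hpU : p ∈ U
  · obtain ⟨r, hr, hgr⟩ := exists_good_ball hU.1 hc htrans hp₀ hr₀ hg hpU
    exact ⟨Metric.ball p r, mem_nhdsWithin_of_mem_nhds (Metric.ball_mem_nhds p hr),
      hmono _ _ inter_subset_right hgr⟩
  · have hpf : p ∈ frontier U := by
      rw [hU.1.frontier_eq]; exact ⟨hKU hpK, hpU⟩
    -- A neighbourhood of a boundary point in `U` is pushed along the inward direction onto a ball
    -- around an interior point.
    obtain ⟨e, r, he, hr, hdir⟩ := hU.exists_direction hpf
    have hq : p + (r / 2) • e ∈ U :=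
      hdir p (hKU hpK) (by simpa using hr) _ (by positivity) (by linarith)
    obtain ⟨s, hs, hgs⟩ := exists_good_ball hU.1 hc htrans hp₀ hr₀ hg hq
    refine ⟨Metric.ball p (min r s), mem_nhdsWithin_of_mem_nhds (Metric.ball_mem_nhds p
      (lt_min hr hs)), htrans _ _ ((r / 2) • e) (hU.1.inter Metric.isOpen_ball)
      Metric.isOpen_ball ?_ ?_ hgs⟩
    · rintro x ⟨hx1, hx2⟩ t ht
      rw [mem_ball_iff_norm] at hx2
      rcases ht.1.eq_or_lt with h0 | h0
      · rw [← h0]; simpa using hx1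
      · rw [smul_smul]
        refine hdir x (subset_closure hx1) (hx2.trans_le (min_le_left _ _)) _ (by positivity) ?_
        nlinarith [ht.2]
    · rintro x ⟨hx1, hx2⟩
      rw [mem_ball_iff_norm] at hx2 ⊢
      rw [add_sub_add_right_eq_sub]
      exact hx2.trans_le (min_le_right _ _)

end Geometry

/-! ### Odd functions in the slabs of the canal -/

/-- The part `(k, k + 1) × B` of the cylinder over `B`. -/
def slab (k : ℝ) (B : Set Plane) : Set Space := {x | k < x 0 ∧ x 0 < k + 1 ∧ !₂[x 1, x 2] ∈ B}

theorem continuous_crossProj : Continuous fun x : Space => (!₂[x 1, x 2] : Plane) := by fun_prop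

theorem isOpen_slab {k : ℝ} {B : Set Plane} (hB : IsOpen B) : IsOpen (slab k B) := by
  have h1 : IsOpen {x : Space | k < x 0} := isOpen_lt continuous_const (by fun_prop)
  have h2 : IsOpen {x : Space | x 0 < k + 1} := isOpen_lt (by fun_prop) continuous_const
  exact h1.inter (h2.inter (hB.preimage continuous_crossProj))

theorem slab_mono {k : ℝ} {B B' : Set Plane} (h : B ⊆ B') : slab k B ⊆ slab k B' :=
  fun _ hx => ⟨hx.1, hx.2.1, h hx.2.2⟩

theorem convex_slab {k : ℝ} {B : Set Plane} (hB : Convex ℝ B) : Convex ℝ (slab k B) := by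
  intro x hx y hy a b ha hb hab
  refine ⟨?_, ?_, ?_⟩
  · have h1 := (convex_Ioi k) hx.1 hy.1 ha hb hab
    simpa using h1
  · have h1 := (convex_Iio (k + 1)) hx.2.1 hy.2.1 ha hb hab
    simpa using h1
  · have h1 := hB hx.2.2 hy.2.2 ha hb hab
    convert! h1 using 1
    ext i
    fin_cases i <;> simp

/-- The reflection as a linear isometry. -/
noncomputable def reflectIso : Space ≃ₗᵢ[ℝ] Space where
  toFun := reflect
  map_add' x y := by ext i; fin_cases i <;> simp [reflect]; ring
  map_smul' c x := by ext i; fin_cases i <;> simp [reflect]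
  invFun := reflect
  left_inv x := by ext i; fin_cases i <;> simp [reflect]
  right_inv x := by ext i; fin_cases i <;> simp [reflect]
  norm_map' x := by simp [reflect, EuclideanSpace.norm_eq, Fin.sum_univ_three]

theorem measurePreserving_reflect : MeasurePreserving reflect volume volume :=
  reflectIso.measurePreserving

theorem reflect_reflect (x : Space) : reflect (reflect x) = x := by
  ext i; fin_cases i <;> simp [reflect]

theorem continuous_reflect : Continuous reflect := reflectIso.continuous

theorem measurableEmbedding_reflect : MeasurableEmbedding reflect :=
  reflectIso.toHomeomorph.measurableEmbedding

theorem integral_eq_zero_of_odd {Q : Set Space}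
    (hsym : ∀ x, reflect x ∈ Q ↔ x ∈ Q) {u : Space → ℝ}
    (hodd : ∀ᵐ x ∂volume.restrict Q, u (reflect x) = -u x) : ∫ x in Q, u x = 0 := by
  have hpre : reflect ⁻¹' Q = Q := by ext x; exact hsym x
  have h1 := measurePreserving_reflect.setIntegral_preimage_emb measurableEmbedding_reflect u Q
  rw [hpre] at h1
  have h2 : ∫ x in Q, u (reflect x) = ∫ x in Q, -u x := integral_congr_ae hodd
  rw [integral_neg] at h2
  linarith

/-- The functions which vanish in mean by symmetry are controlled on `(k, k + 1) × B` by their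
gradient, uniformly in the position of the slab. -/
def CrossGood (Γ : Set Plane) (l : ℝ) (B : Set Plane) : Prop :=
  ∃ c : ENNReal, c ≠ ⊤ ∧ ∀ (U : Set Space) (u : Space → ℝ) (G : Space → Space) (g : Plane → ℝ)
    (k : ℝ), IsEnergyTriple U l u G g → IsOpen U → (∀ x ∈ U, x 2 < 0) → Measurable u →
    slab k Γ ⊆ U → (∀ᵐ x ∂volume.restrict (slab k Γ), u (reflect x) = -u x) →
    ∫⁻ x in slab k B, ‖u x‖ₑ ^ 2 ≤ c * ∫⁻ x in slab k Γ, ‖G x‖ₑ ^ 2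

theorem crossGood_mono {Γ : Set Plane} {l : ℝ} {B B' : Set Plane} (h : B ⊆ B')
    (hB : CrossGood Γ l B') : CrossGood Γ l B := by
  obtain ⟨c, hc, H⟩ := hB
  exact ⟨c, hc, fun U u G g k h1 h2 h3 h4 h5 h6 =>
    (lintegral_mono_set (slab_mono h)).trans (H U u G g k h1 h2 h3 h4 h5 h6)⟩

theorem crossGood_union {Γ : Set Plane} {l : ℝ} {B B' : Set Plane} (hB : CrossGood Γ l B)
    (hB' : CrossGood Γ l B') : CrossGood Γ l (B ∪ B') := by
  obtain ⟨c, hc, H⟩ := hB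
  obtain ⟨c', hc', H'⟩ := hB'
  refine ⟨c + c', ENNReal.add_ne_top.2 ⟨hc, hc'⟩, fun U u G g k h1 h2 h3 h4 h5 h6 => ?_⟩
  have : slab k (B ∪ B') ⊆ slab k B ∪ slab k B' := by
    rintro x ⟨h1, h2, h3 | h3⟩
    · exact Or.inl ⟨h1, h2, h3⟩
    · exact Or.inr ⟨h1, h2, h3⟩
  calc _ ≤ ∫⁻ x in slab k B ∪ slab k B', ‖u x‖ₑ ^ 2 := lintegral_mono_set this
    _ ≤ _ := lintegral_union_le _ _ _
    _ ≤ _ := by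
      rw [add_mul]
      exact add_le_add (H U u G g k h1 h2 h3 h4 h5 h6) (H' U u G g k h1 h2 h3 h4 h5 h6)

/-- The shift `(0, v)` does not change `x₁`, so it acts inside each slab and the constant is the
same for all slabs. -/
theorem crossGood_translate {Γ : Set Plane} {l : ℝ} {V V' : Set Plane} {v : Plane}
    (hV : IsOpen V) (hV' : IsOpen V') (hVΓ : ∀ x ∈ V, ∀ t ∈ Icc (0 : ℝ) 1, x + t • v ∈ Γ)
    (hVV' : ∀ x ∈ V, x + v ∈ V') (hg : CrossGood Γ l V') : CrossGood Γ l V := by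
  obtain ⟨c, hc, H⟩ := hg
  refine ⟨2 * c + 2 * ENNReal.ofReal (‖(!₂[0, v 0, v 1] : Space)‖ ^ 2), by finiteness,
    fun U u G g k h1 h2 h3 h4 h5 h6 => ?_⟩
  have hadd : ∀ (x : Space) (t : ℝ), (!₂[(x + t • (!₂[0, v 0, v 1] : Space)) 1,
      (x + t • (!₂[0, v 0, v 1] : Space)) 2] : Plane) = !₂[x 1, x 2] + t • v := by
    intro x t
    ext i
    fin_cases i <;> simp
  have key := h1.lintegral_sq_le_translate h2 h3 (isOpen_slab (k := k) hV)
    (isOpen_slab (k := k) hV').measurableSet (D := slab k Γ) h5 !₂[0, v 0, v 1] ?_ ?_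
  · refine key.trans ?_
    rw [add_mul, mul_assoc, mul_assoc]
    gcongr
    exact H U u G g k h1 h2 h3 h4 h5 h6
  · rintro x ⟨hx1, hx2, hx3⟩ t ht
    refine ⟨by simpa using hx1, by simpa using hx2, ?_⟩
    rw [hadd]
    exact hVΓ _ hx3 t ht
  · rintro x ⟨hx1, hx2, hx3⟩
    refine ⟨by simpa using hx1, by simpa using hx2, ?_⟩
    have := hadd x 1
    simp only [one_smul] at this
    rw [this]
    exact hVV' _ hx3

theorem mem_slab_ball {k r : ℝ} {p : Plane} {x : Space} :
    x ∈ slab k (Metric.ball p r) ↔ k < x 0 ∧ x 0 < k + 1 ∧ ‖(!₂[x 1, x 2] : Plane) - p‖ < r := by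
  rw [← mem_ball_iff_norm]; rfl

theorem norm_le_abs_add_norm (x : Space) : ‖x‖ ≤ |x 0| + ‖(!₂[x 1, x 2] : Plane)‖ := by
  have h : x = EuclideanSpace.single 0 (x 0) + !₂[0, x 1, x 2] := by
    ext i; fin_cases i <;> simp
  have h2 : ‖(!₂[0, x 1, x 2] : Space)‖ = ‖(!₂[x 1, x 2] : Plane)‖ := by
    simp [EuclideanSpace.norm_eq, Fin.sum_univ_three, Fin.sum_univ_two]
  calc ‖x‖ = ‖(EuclideanSpace.single 0 (x 0) + !₂[0, x 1, x 2] : Space)‖ := by rw [← h]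
    _ ≤ _ := norm_add_le _ _
    _ = _ := by rw [h2]; simp

theorem norm_crossProj_le (x : Space) : ‖(!₂[x 1, x 2] : Plane)‖ ≤ ‖x‖ := by
  rw [EuclideanSpace.norm_eq, EuclideanSpace.norm_eq]
  apply Real.sqrt_le_sqrt
  simp [Fin.sum_univ_three, Fin.sum_univ_two]
  nlinarith [sq_nonneg (x 0)]

/-- A ball centred on the axis is symmetric, so an odd function has mean zero on the slab over it
and the mean value disappears from the Poincaré inequality. -/
theorem crossGood_ball_axis {Γ : Set Plane} {l : ℝ} {p : Plane} (hp : p 0 = 0) {r : ℝ} (hr : 0 < r)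
    (hball : Metric.ball p r ⊆ Γ) : CrossGood Γ l (Metric.ball p r) := by
  -- `s` bounds the diameter of the slab, which has length `1` and cross-section a ball of radius
  -- `r`; `ρ` is the radius of a ball that fits into it and bounds its volume from below for every
  -- `k`.
  set s : ℝ := 1 + 2 * r
  set ρ : ℝ := min r (1 / 2)
  have hρ : 0 < ρ := lt_min hr (by norm_num)
  have hvol : volume (Metric.ball (0 : Space) ρ) ≠ 0 := (Metric.measure_ball_pos _ _ hρ).ne'
  have hvol2 : volume (Metric.ball (0 : Space) ρ) ≠ ⊤ := measure_ball_lt_top.ne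
  have hvol3 : volume (Metric.closedBall (0 : Space) s) ≠ ⊤ := measure_closedBall_lt_top.ne
  refine ⟨(volume (Metric.ball (0 : Space) ρ))⁻¹ *
    (volume (Metric.closedBall (0 : Space) s) * ENNReal.ofReal (s ^ 2)), ?_,
    fun U u G g k h1 h2 h3 h4 h5 h6 => ?_⟩
  · exact ENNReal.mul_ne_top (ENNReal.inv_ne_top.2 hvol)
      (ENNReal.mul_ne_top hvol3 ENNReal.ofReal_ne_top)
  have hQΓ : slab k (Metric.ball p r) ⊆ slab k Γ := slab_mono hball
  have hQo : IsOpen (slab k (Metric.ball p r)) := isOpen_slab Metric.isOpen_ball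
  have hz : ∫ x in slab k (Metric.ball p r), u x = 0 := by
    refine integral_eq_zero_of_odd ?_ (ae_restrict_of_ae_restrict_of_subset hQΓ h6)
    intro x
    rw [mem_slab_ball, mem_slab_ball]
    have : ‖(!₂[(reflect x) 1, (reflect x) 2] : Plane) - p‖ = ‖(!₂[x 1, x 2] : Plane) - p‖ := by
      simp [EuclideanSpace.norm_eq, Fin.sum_univ_two, reflect, hp]
    rw [this]
    simp [reflect]
  have key := h1.poincare h2 h3 h4 hQo (convex_slab (convex_ball p r)) (hQΓ.trans h5) (s := s) ?_
  · rw [hz] at key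
    simp only [ne_eq, OfNat.ofNat_ne_zero, not_false_eq_true, zero_pow, ENNReal.ofReal_zero,
      zero_add] at key
    have hle : volume (Metric.ball (0 : Space) ρ) ≤ volume (slab k (Metric.ball p r)) := by
      rw [← Measure.addHaar_ball_center volume (!₂[k + 1 / 2, p 0, p 1] : Space) ρ]
      refine measure_mono fun x hx => ?_
      rw [mem_ball_iff_norm] at hx
      rw [mem_slab_ball]
      have ha : |x 0 - (k + 1 / 2)| < 1 / 2 := by
        have := PiLp.norm_apply_le (x - (!₂[k + 1 / 2, p 0, p 1] : Space)) 0
        simp only [PiLp.sub_apply, Real.norm_eq_abs] at this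
        exact (this.trans_lt hx).trans_le (min_le_right _ _)
      rw [abs_lt] at ha
      refine ⟨by linarith [ha.1], by linarith [ha.2], ?_⟩
      have := norm_crossProj_le (x - (!₂[k + 1 / 2, p 0, p 1] : Space))
      have e : (!₂[(x - (!₂[k + 1 / 2, p 0, p 1] : Space)) 1,
          (x - (!₂[k + 1 / 2, p 0, p 1] : Space)) 2] : Plane) = !₂[x 1, x 2] - p := by
        ext i; fin_cases i <;> simp
      rw [e] at this
      exact (this.trans_lt hx).trans_le (min_le_left _ _)
    rw [mul_assoc, ← ENNReal.div_eq_inv_mul, ENNReal.le_div_iff_mul_le (Or.inl hvol) (Or.inl hvol2),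
      mul_comm]
    calc _ ≤ volume (slab k (Metric.ball p r)) * ∫⁻ x in slab k (Metric.ball p r), ‖u x‖ₑ ^ 2 := by
          gcongr
      _ ≤ _ := key
      _ ≤ _ := by
        rw [mul_assoc]
        gcongr
  · intro x hx y hy
    rw [mem_slab_ball] at hx hy
    refine (norm_le_abs_add_norm _).trans ?_
    have ha : |(y - x) 0| ≤ 1 := by
      simp only [PiLp.sub_apply]
      rw [abs_le]
      constructor <;> linarith [hx.1, hx.2.1, hy.1, hy.2.1]
    have e : (!₂[(y - x) 1, (y - x) 2] : Plane) = (!₂[y 1, y 2] - p) - (!₂[x 1, x 2] - p) := by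
      ext i; fin_cases i <;> simp
    rw [e]
    have := norm_sub_le ((!₂[y 1, y 2] : Plane) - p) (!₂[x 1, x 2] - p)
    simp only [s]
    linarith [hx.2.2, hy.2.2]

/-- Let `e` be the inward direction at the middle of the water line. The starting point `(-t e₀, 0)`
is on the water line for small `t`, and the shift by `t e` brings it to the axis inside `Γ`. -/
theorem IsCrossSection.exists_axis {Γ : Set Plane} {l : ℝ} (hl : 0 < l) (hΓ : IsCrossSection Γ l) :
    ∃ p ∈ Γ, p 0 = 0 := by
  have hw : ∀ y, |y| ≤ l → (!₂[y, 0] : Plane) ∈ frontier Γ := by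
    intro y hy
    have : (!₂[y, 0] : Plane) ∈ {p : Plane | |p 0| ≤ l ∧ p 1 = 0} := by simpa using hy
    rw [← hΓ.waterLine] at this
    exact this.1
  obtain ⟨e, r, he, hr, hd⟩ := hΓ.lipschitz.exists_direction (hw 0 (by simpa using hl.le))
  set t := min l r / 2
  have ht : 0 < t := by positivity
  have ht1 : t < l := by have := min_le_left l r; simp only [t]; linarith [lt_min hl hr]
  have ht2 : t < r := by have := min_le_right l r; simp only [t]; linarith [lt_min hl hr]
  have he0 : |e 0| ≤ 1 := by
    have := PiLp.norm_apply_le e 0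
    rwa [he, Real.norm_eq_abs] at this
  have h1 : |-(t * e 0)| ≤ t := by
    rw [abs_neg, abs_mul, abs_of_pos ht]; nlinarith
  refine ⟨!₂[-(t * e 0), 0] + t • e, hd _ (frontier_subset_closure (hw _ (h1.trans ht1.le))) ?_ t ht ht2,
    by simp⟩
  rw [EuclideanSpace.norm_eq, Fin.sum_univ_two]
  simp only [PiLp.sub_apply, Fin.isValue]
  simp
  rw [abs_neg] at h1
  rw [abs_mul] at h1
  rw [Real.sqrt_sq_eq_abs, ← abs_mul, abs_abs, abs_mul] at *
  linarith

/-- The estimate starts from a ball on the axis and is propagated through the connected Lipschitz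
domain `Γ` up to its boundary. This is where symmetry yields a constant depending on `Γ` alone. -/
theorem crossGood_cross_section {Γ : Set Plane} {l : ℝ} (hl : 0 < l) (hΓ : IsCrossSection Γ l) :
    CrossGood Γ l Γ := by
  obtain ⟨p, hpΓ, hp0⟩ := hΓ.exists_axis hl
  obtain ⟨r, hr, hball⟩ := Metric.isOpen_iff.1 hΓ.lipschitz.1 p hpΓ
  have hK : IsCompact (closure Γ) := hΓ.bounded.isCompact_closure
  have := good_inter_of_isCompact hΓ.lipschitz hΓ.connected.isPreconnected (Good := CrossGood Γ l)
    ⟨0, by simp, fun U u G g k _ _ _ _ _ _ => by simp [slab]⟩ (fun V W h => crossGood_mono h)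
    (fun V W => crossGood_union)
    (fun V V' v hV hV' h1 h2 h3 => crossGood_translate hV hV' h1 h2 h3)
    hpΓ hr (crossGood_ball_axis hp0 hr hball) hK le_rfl
  exact crossGood_mono (fun x hx => mem_inter hx (subset_closure hx)) this

/-! ### Trace inequalities with a small factor at the gradient -/

/-- The trace on `J` is controlled by the values in `D`, with a small factor at the gradient. -/
def HasTraceBound (l : ℝ) (J : Set Plane) (D : Set Space) (C τ : ℝ) : Prop :=
  ∀ (U : Set Space) (u : Space → ℝ) (G : Space → Space) (g : Plane → ℝ),
    IsEnergyTriple U l u G g → IsOpen U → (∀ x ∈ U, x 2 < 0) → D ⊆ U → ∀ s, 0 < s → s ≤ τ →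
    ∫⁻ y in J, ‖g y‖ₑ ^ 2 ≤ ENNReal.ofReal (C / s) * (∫⁻ x in D, ‖u x‖ₑ ^ 2) +
      ENNReal.ofReal (C * s) * ∫⁻ x in D, ‖G x‖ₑ ^ 2

theorem HasTraceBound.mono {l : ℝ} {J J' : Set Plane} {D : Set Space} {C τ : ℝ} (hJ : J ⊆ J')
    (h : HasTraceBound l J' D C τ) : HasTraceBound l J D C τ :=
  fun U u G g h1 h2 h3 h4 s h5 h6 => (lintegral_mono_set hJ).trans (h U u G g h1 h2 h3 h4 s h5 h6)

theorem HasTraceBound.union {l : ℝ} {J J' : Set Plane} {D : Set Space} {C C' τ τ' : ℝ}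
    (hC : 0 ≤ C) (hC' : 0 ≤ C')
    (h : HasTraceBound l J D C τ) (h' : HasTraceBound l J' D C' τ') :
    HasTraceBound l (J ∪ J') D (C + C') (min τ τ') := by
  intro U u G g h1 h2 h3 h4 s h5 h6
  refine (lintegral_union_le _ _ _).trans ((add_le_add
    (h U u G g h1 h2 h3 h4 s h5 (h6.trans (min_le_left _ _)))
    (h' U u G g h1 h2 h3 h4 s h5 (h6.trans (min_le_right _ _)))).trans (le_of_eq ?_))
  rw [add_div, add_mul, ENNReal.ofReal_add (by positivity) (by positivity),
    ENNReal.ofReal_add (by positivity) (by positivity)]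
  ring

theorem exists_hasTraceBound : ∃ K : ℝ, 0 < K ∧ ∀ (l : ℝ) (J : Set Plane) (D : Set Space),
    IsOpen J → J ⊆ surfaceStrip l → MeasurableSet D → ∀ (e : Plane) (τ : ℝ),
      (∀ y ∈ J, ∀ t ∈ Ioo (0 : ℝ) τ, toSurface y + t • !₂[e 0, e 1, -1] ∈ D) →
      HasTraceBound l J D (K * (‖e‖ ^ 2 + 1)) τ := by
  obtain ⟨K, hK, H⟩ := exists_trace_const
  refine ⟨K, hK, fun l J D hJ hJl hD e τ hseg U u G g h1 h2 h3 h4 s h5 h6 => ?_⟩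
  refine (H h1 h2 h3 hJ hJl hD h4 e h5 fun y hy t ht => hseg y hy t ⟨ht.1, ht.2.trans_le h6⟩).trans ?_
  gcongr
  nlinarith [sq_nonneg ‖e‖]

theorem isOpen_surfaceStrip (l : ℝ) : IsOpen (surfaceStrip l) :=
  isOpen_lt (by fun_prop : Continuous fun y : Plane => |y 1|) continuous_const

/-- The part `(k, k + 1) × S` of the free surface. -/
def surfaceSlab (l k : ℝ) (S : Set ℝ) : Set Plane :=
  {y | k < y 0 ∧ y 0 < k + 1 ∧ |y 1| < l ∧ y 1 ∈ S}

theorem isOpen_surfaceSlab (l k : ℝ) {S : Set ℝ} (hS : IsOpen S) : IsOpen (surfaceSlab l k S) := by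
  have h1 : IsOpen {x : Plane | k < x 0} := isOpen_lt continuous_const (by fun_prop)
  have h2 : IsOpen {x : Plane | x 0 < k + 1} := isOpen_lt (by fun_prop) continuous_const
  have h3 : IsOpen ((fun x : Plane => x 1) ⁻¹' S) := hS.preimage (by fun_prop)
  exact h1.inter (h2.inter ((isOpen_surfaceStrip l).inter h3))

theorem IsCrossSection.mem_frontier {Γ : Set Plane} {l : ℝ} (hΓ : IsCrossSection Γ l) {y : ℝ}
    (hy : |y| ≤ l) : (!₂[y, 0] : Plane) ∈ frontier Γ := by
  have : (!₂[y, 0] : Plane) ∈ {p : Plane | |p 0| ≤ l ∧ p 1 = 0} := by simpa using hy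
  rw [← hΓ.waterLine] at this
  exact this.1

theorem norm_plane_eq_abs (a b : ℝ) : ‖(!₂[a, 0] : Plane) - !₂[b, 0]‖ = |a - b| := by
  simp [EuclideanSpace.norm_eq, Fin.sum_univ_two, Real.sqrt_sq_eq_abs]

/-- The trace bound in the slabs of the canal. -/
theorem IsCrossSection.exists_slab_traceBound {Γ : Set Plane} {l : ℝ} (hΓ : IsCrossSection Γ l) :
    ∃ C τ : ℝ, 0 < C ∧ 0 < τ ∧
      ∀ k, HasTraceBound l (surfaceSlab l k univ) (slab k Γ) C τ := by
  obtain ⟨K, hK, H⟩ := exists_hasTraceBound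
  have hmain := (isCompact_Icc (a := -l) (b := l)).induction_on
    (p := fun S => ∃ C τ : ℝ, 0 < C ∧ 0 < τ ∧
      ∀ k, HasTraceBound l (surfaceSlab l k S) (slab k Γ) C τ) ?_ ?_ ?_ ?_
  · obtain ⟨C, τ, hC, hτ, h⟩ := hmain
    refine ⟨C, τ, hC, hτ, fun k => (h k).mono ?_⟩
    rintro y ⟨h1, h2, h3, -⟩
    exact ⟨h1, h2, h3, abs_le.1 h3.le⟩
  · refine ⟨1, 1, one_pos, one_pos, fun k U u G g _ _ _ _ s _ _ => ?_⟩
    simp [surfaceSlab]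
  · rintro S T hST ⟨C, τ, hC, hτ, h⟩
    refine ⟨C, τ, hC, hτ, fun k => ?_⟩
    refine (h k).mono ?_
    rintro y ⟨h1, h2, h3, h4⟩
    exact ⟨h1, h2, h3, hST h4⟩
  · rintro S T ⟨C, τ, hC, hτ, h⟩ ⟨C', τ', hC', hτ', h'⟩
    refine ⟨C + C', min τ τ', by positivity, lt_min hτ hτ', fun k =>
      ((h k).union hC.le hC'.le (h' k)).mono ?_⟩
    rintro y ⟨h1, h2, h3, h4 | h4⟩
    · exact Or.inl ⟨h1, h2, h3, h4⟩
    · exact Or.inr ⟨h1, h2, h3, h4⟩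
  · intro y₀ hy₀
    obtain ⟨e, r, he, hr, hd⟩ := hΓ.lipschitz.exists_direction (hΓ.mem_frontier (abs_le.2 hy₀))
    -- The inward direction at the water line points downwards because `Γ` lies in the lower
    -- half-plane.
    have he1 : e 1 < 0 := by
      have := hΓ.lower _ (hd _ (frontier_subset_closure (hΓ.mem_frontier (abs_le.2 hy₀)))
        (by simpa using hr) (r / 2) (by positivity) (by linarith))
      simp at this
      nlinarith
    set c := -e 1 with hc
    have hc0 : 0 < c := by linarith
    -- Division by `c` normalizes the vertical component to `-1`, so depth `t` corresponds to the
    -- length `t / c < r` along `e`. The `x₁` component is zero: the segments remain in the slab,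
    -- and the constants do not depend on `k`.
    refine ⟨Metric.ball y₀ r, mem_nhdsWithin_of_mem_nhds (Metric.ball_mem_nhds _ hr),
      K * (‖(!₂[0, e 0 / c] : Plane)‖ ^ 2 + 1), r * c, by positivity, by positivity, fun k => ?_⟩
    refine H l _ _ (isOpen_surfaceSlab l k Metric.isOpen_ball) (fun y hy => hy.2.2.1)
      (isOpen_slab hΓ.lipschitz.1).measurableSet _ _ ?_
    rintro y ⟨h1, h2, h3, h4⟩ t ⟨ht0, ht⟩
    refine ⟨by simpa [toSurface] using h1, by simpa [toSurface] using h2, ?_⟩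
    have e2 : (!₂[(toSurface y + t • (!₂[(!₂[0, e 0 / c] : Plane) 0,
        (!₂[0, e 0 / c] : Plane) 1, -1] : Space)) 1,
        (toSurface y + t • (!₂[(!₂[0, e 0 / c] : Plane) 0,
        (!₂[0, e 0 / c] : Plane) 1, -1] : Space)) 2] : Plane) = !₂[y 1, 0] + (t / c) • e := by
      ext i
      fin_cases i
      · simp [toSurface]; field_simp
      · simp [toSurface, hc]; field_simp; rw [div_self he1.ne]
    rw [e2]
    refine hd _ (frontier_subset_closure (hΓ.mem_frontier h3.le)) ?_ _ (by positivity) ?_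
    · rw [norm_plane_eq_abs]; rwa [mem_ball_iff_norm, Real.norm_eq_abs] at h4
    · rwa [div_lt_iff₀ hc0]

/-- The trace bound on bounded parts of the free surface. -/
theorem exists_bounded_traceBound {U : Set Space} {l : ℝ} (hU : IsLipschitzDomain U)
    (hlow : ∀ x ∈ U, x 2 < 0) (hfr : ∀ y : Plane, |y 1| ≤ l → toSurface y ∈ frontier U) (R : ℝ) :
    ∃ C τ : ℝ, 0 < C ∧ 0 < τ ∧
      HasTraceBound l {y | |y 0| ≤ R ∧ |y 1| < l} (U ∩ {x | |x 0| < R + 1}) C τ := by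
  obtain ⟨K, hK, H⟩ := exists_hasTraceBound
  have hopen : IsOpen (U ∩ {x : Space | |x 0| < R + 1}) :=
    hU.1.inter (isOpen_lt (by fun_prop) continuous_const)
  have hcomp : IsCompact {y : Plane | |y 0| ≤ R ∧ |y 1| ≤ l} := by
    refine Metric.isCompact_of_isClosed_isBounded ?_ ?_
    · exact (isClosed_le (by fun_prop : Continuous fun y : Plane => |y 0|) continuous_const).inter
        (isClosed_le (by fun_prop : Continuous fun y : Plane => |y 1|) continuous_const)
    · refine (Metric.isBounded_iff_subset_closedBall 0).2 ⟨R + l, fun y hy => ?_⟩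
      rw [mem_closedBall_zero_iff, EuclideanSpace.norm_eq, Fin.sum_univ_two]
      refine Real.sqrt_le_iff.2 ⟨by linarith [abs_nonneg (y 0), abs_nonneg (y 1), hy.1, hy.2], ?_⟩
      simp only [Real.norm_eq_abs]
      nlinarith [abs_nonneg (y 0), abs_nonneg (y 1), hy.1, hy.2]
  have hmain := hcomp.induction_on
    (p := fun S => ∃ C τ : ℝ, 0 < C ∧ 0 < τ ∧
      HasTraceBound l (surfaceStrip l ∩ S ∩ {y | |y 0| < R + 1 / 2})
        (U ∩ {x | |x 0| < R + 1}) C τ) ?_ ?_ ?_ ?_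
  · obtain ⟨C, τ, hC, hτ, h⟩ := hmain
    refine ⟨C, τ, hC, hτ, h.mono ?_⟩
    rintro y ⟨h1, h2⟩
    refine ⟨⟨h2, h1, h2.le⟩, ?_⟩
    simp only [mem_ofPred_eq]; linarith
  · refine ⟨1, 1, one_pos, one_pos, fun U u G g _ _ _ _ s _ _ => ?_⟩
    simp
  · rintro S T hST ⟨C, τ, hC, hτ, h⟩
    refine ⟨C, τ, hC, hτ, ?_⟩
    refine h.mono ?_
    rintro y ⟨⟨h1, h2⟩, h3⟩
    exact ⟨⟨h1, hST h2⟩, h3⟩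
  · rintro S T ⟨C, τ, hC, hτ, h⟩ ⟨C', τ', hC', hτ', h'⟩
    refine ⟨C + C', min τ τ', by positivity, lt_min hτ hτ', (h.union hC.le hC'.le h').mono ?_⟩
    rintro y ⟨⟨h1, h2 | h2⟩, h3⟩
    · exact Or.inl ⟨⟨h1, h2⟩, h3⟩
    · exact Or.inr ⟨⟨h1, h2⟩, h3⟩
  · intro y₀ hy₀
    obtain ⟨e, r', he, hr', hd'⟩ := hU.exists_direction (hfr y₀ hy₀.2)
    -- The segments drift by less than `1 / 2` in `x₁`. Together with the margin `1 / 2` allowed on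
    -- the surface, this keeps them in `|x₁| < R + 1`.
    set r := min r' (1 / 2) with hrdef
    have hr : 0 < r := lt_min hr' (by norm_num)
    have he2 : e 2 < 0 := by
      have := hlow _ (hd' _ (frontier_subset_closure (hfr y₀ hy₀.2))
        (by simpa using hr') (r' / 2) (by positivity) (by linarith))
      simp [toSurface] at this
      nlinarith
    set c := -e 2 with hc
    have hc0 : 0 < c := by linarith
    refine ⟨Metric.ball y₀ r, mem_nhdsWithin_of_mem_nhds (Metric.ball_mem_nhds _ hr),
      K * (‖(!₂[e 0 / c, e 1 / c] : Plane)‖ ^ 2 + 1), r * c, by positivity, by positivity, ?_⟩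
    refine H l _ _ (((isOpen_surfaceStrip l).inter Metric.isOpen_ball).inter
      (isOpen_lt (by fun_prop) continuous_const)) (fun y hy => hy.1.1) hopen.measurableSet _ _ ?_
    rintro y ⟨⟨h1, h2⟩, h3⟩ t ⟨ht0, ht⟩
    have e2 : toSurface y + t • (!₂[(!₂[e 0 / c, e 1 / c] : Plane) 0,
        (!₂[e 0 / c, e 1 / c] : Plane) 1, -1] : Space) = toSurface y + (t / c) • e := by
      ext i
      fin_cases i
      · simp [toSurface]; field_simp
      · simp [toSurface]; field_simp
      · simp [toSurface, hc]; field_simp; rw [div_self he2.ne]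
    have htc : t / c < r := by rwa [div_lt_iff₀ hc0]
    rw [e2]
    refine ⟨hd' _ (frontier_subset_closure (hfr y (le_of_lt h1))) ?_ _ (by positivity)
      (htc.trans_le (min_le_left _ _)), ?_⟩
    · rw [mem_ball_iff_norm] at h2
      have : ‖toSurface y - toSurface y₀‖ = ‖y - y₀‖ := by
        simp [toSurface, EuclideanSpace.norm_eq, Fin.sum_univ_three, Fin.sum_univ_two]
      rw [this]
      exact h2.trans_le (min_le_left _ _)
    · have he0 : |e 0| ≤ 1 := by
        have := PiLp.norm_apply_le e 0
        rwa [he, Real.norm_eq_abs] at this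
      have ht2 : t / c < 1 / 2 := htc.trans_le (min_le_right _ _)
      have h0 : 0 < t / c := by positivity
      simp only [mem_ofPred_eq] at h3 ⊢
      have : |(t / c) * e 0| ≤ t / c := by
        rw [abs_mul, abs_of_pos h0]; nlinarith
      have h5 := abs_add_le (y 0) ((t / c) * e 0)
      simp [toSurface]
      linarith

/-- In the slabs, the trace of an odd function is controlled by the gradient. -/
theorem IsCrossSection.exists_slab_odd_bound {Γ : Set Plane} {l : ℝ} (hl : 0 < l)
    (hΓ : IsCrossSection Γ l) : ∃ c : ENNReal, c ≠ ⊤ ∧ ∀ (U : Set Space) (u : Space → ℝ)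
      (G : Space → Space) (g : Plane → ℝ) (k : ℝ), IsEnergyTriple U l u G g → IsOpen U →
      (∀ x ∈ U, x 2 < 0) → Measurable u → slab k Γ ⊆ U →
      (∀ᵐ x ∂volume.restrict (slab k Γ), u (reflect x) = -u x) →
      ∫⁻ x in slab k Γ, ‖u x‖ₑ ^ 2 ≤ c * (∫⁻ x in slab k Γ, ‖G x‖ₑ ^ 2) ∧
      ∫⁻ y in surfaceSlab l k univ, ‖g y‖ₑ ^ 2 ≤ c * ∫⁻ x in slab k Γ, ‖G x‖ₑ ^ 2 := by
  obtain ⟨c, hc, H⟩ := crossGood_cross_section hl hΓ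
  obtain ⟨C, τ, hC, hτ, H'⟩ := hΓ.exists_slab_traceBound
  refine ⟨c + (ENNReal.ofReal (C / τ) * c + ENNReal.ofReal (C * τ)), by finiteness,
    fun U u G g k h1 h2 h3 h4 h5 h6 => ?_⟩
  have a1 := H U u G g k h1 h2 h3 h4 h5 h6
  have a2 := H' k U u G g h1 h2 h3 h5 τ hτ le_rfl
  constructor
  · refine a1.trans ?_
    gcongr
    exact le_self_add
  · refine a2.trans ?_
    rw [add_mul, add_mul, mul_assoc]
    refine le_trans ?_ le_add_self
    gcongr

/-! ### Rellich's theorem: smallness up to finitely many means -/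

theorem volume_coord_eq {n : ℕ} (i : Fin n) (c : ℝ) :
    volume {x : EuclideanSpace ℝ (Fin n) | x i = c} = 0 := by
  have h := (PiLp.volume_preserving_ofLp (Fin n)).measure_preimage
    (s := {f : Fin n → ℝ | f i = c}) ?_
  · exact h.trans (Measure.pi_hyperplane (fun _ : Fin n => (volume : Measure ℝ)) i c)
  · exact (measurableSet_eq_fun (measurable_pi_apply i) measurable_const).nullMeasurableSet

/-- `V` is a set on which `u` is small up to finitely many mean values. -/
def SmallUpToMeans (U : Set Space) (l : ℝ) (V : Set Space) (δ : ℝ) : Prop :=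
  ∃ (ι : Type) (_ : Fintype ι) (Q : ι → Set Space) (c : ℝ), 0 ≤ c ∧
    (∀ i, Q i ⊆ U ∧ MeasurableSet (Q i) ∧ volume (Q i) < ⊤) ∧
    ∀ (u : Space → ℝ) (G : Space → Space) (g : Plane → ℝ), IsEnergyTriple U l u G g →
      Measurable u → ∫⁻ x in V, ‖u x‖ₑ ^ 2 ≤
        ENNReal.ofReal δ * (∫⁻ x in U, ‖G x‖ₑ ^ 2) +
          ENNReal.ofReal (c * ∑ i, (∫ x in Q i, u x) ^ 2)

theorem SmallUpToMeans.mono {U : Set Space} {l : ℝ} {V V' : Set Space} {δ : ℝ} (hV : V ⊆ V')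
    (h : SmallUpToMeans U l V' δ) : SmallUpToMeans U l V δ := by
  obtain ⟨ι, hι, Q, c, hc, hQ, H⟩ := h
  exact ⟨ι, hι, Q, c, hc, hQ, fun u G g h1 h2 => (lintegral_mono_set hV).trans (H u G g h1 h2)⟩

theorem SmallUpToMeans.union {U : Set Space} {l : ℝ} {V V' : Set Space} {δ δ' : ℝ} (hδ : 0 ≤ δ)
    (hδ' : 0 ≤ δ') (h : SmallUpToMeans U l V δ) (h' : SmallUpToMeans U l V' δ') :
    SmallUpToMeans U l (V ∪ V') (δ + δ') := by
  obtain ⟨ι, hι, Q, c, hc, hQ, H⟩ := h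
  obtain ⟨ι', hι', Q', c', hc', hQ', H'⟩ := h'
  refine ⟨ι ⊕ ι', inferInstance, Sum.elim Q Q', c + c', by positivity, ?_, fun u G g h1 h2 => ?_⟩
  · rintro (i | i)
    · exact hQ i
    · exact hQ' i
  · refine (lintegral_union_le _ _ _).trans
      ((add_le_add (H u G g h1 h2) (H' u G g h1 h2)).trans ?_)
    rw [ENNReal.ofReal_add hδ hδ', add_mul, add_add_add_comm]
    gcongr
    rw [← ENNReal.ofReal_add (by positivity) (by positivity), Fintype.sum_sum_type]
    apply ENNReal.ofReal_le_ofReal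
    simp only [Sum.elim_inl, Sum.elim_inr]
    have a1 : 0 ≤ ∑ i, (∫ x in Q i, u x) ^ 2 := by positivity
    have a2 : 0 ≤ ∑ i, (∫ x in Q' i, u x) ^ 2 := by positivity
    nlinarith

/-- The open cubes of a lattice. -/
def latticeCell (s : ℝ) (z : Fin 3 → ℤ) : Set Space := {x | ∀ i, s * z i < x i ∧ x i < s * (z i + 1)}

theorem isOpen_latticeCell (s : ℝ) (z : Fin 3 → ℤ) : IsOpen (latticeCell s z) := by
  have : latticeCell s z = ⋂ i, ({x : Space | s * z i < x i} ∩ {x : Space | x i < s * (z i + 1)}) := by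
    ext x; simp [latticeCell]
  rw [this]
  exact isOpen_iInter_of_finite fun i =>
    (isOpen_lt continuous_const (by fun_prop)).inter (isOpen_lt (by fun_prop) continuous_const)

theorem convex_latticeCell (s : ℝ) (z : Fin 3 → ℤ) : Convex ℝ (latticeCell s z) := by
  intro x hx y hy a b ha hb hab i
  have h1 := (convex_Ioo (s * z i) (s * (z i + 1))) (hx i) (hy i) ha hb hab
  simpa using h1

theorem norm_sub_le_of_mem_latticeCell {s : ℝ} {z : Fin 3 → ℤ} {x y : Space}
    (hs : 0 < s) (hx : x ∈ latticeCell s z) (hy : y ∈ latticeCell s z) : ‖y - x‖ ≤ 2 * s := by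
  have h : ∀ i, ‖(y - x) i‖ ^ 2 ≤ s ^ 2 := by
    intro i
    rw [Real.norm_eq_abs, sq_abs]
    have h1 := hx i
    have h2 := hy i
    simp only [PiLp.sub_apply]
    exact sq_le_sq' (by nlinarith) (by nlinarith)
  rw [EuclideanSpace.norm_eq]
  refine Real.sqrt_le_iff.2 ⟨by positivity, ?_⟩
  rw [Fin.sum_univ_three]
  nlinarith [h 0, h 1, h 2]

theorem ball_subset_latticeCell (s : ℝ) (z : Fin 3 → ℤ) :
    Metric.ball (WithLp.toLp 2 fun i => s * (z i + 1 / 2) : Space) (s / 2) ⊆ latticeCell s z := by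
  intro x hx i
  rw [mem_ball_iff_norm] at hx
  have := (PiLp.norm_apply_le (x - (WithLp.toLp 2 fun i => s * (z i + 1 / 2) : Space)) i).trans_lt hx
  simp only [PiLp.sub_apply, Real.norm_eq_abs] at this
  rw [abs_lt] at this
  constructor <;> linarith [this.1, this.2]

theorem exists_mem_latticeCell {s : ℝ} (hs : 0 < s) :
    ∀ᵐ x : Space, x ∈ latticeCell s fun i => ⌊x i / s⌋ := by
  have h : ∀ (i : Fin 3) (m : ℤ), ∀ᵐ x : Space, x i ≠ s * m := fun i m => by
    rw [ae_iff]; simpa using volume_coord_eq i (s * m)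
  have h' : ∀ᵐ x : Space, ∀ (i : Fin 3) (m : ℤ), x i ≠ s * m := by
    rw [ae_all_iff]; intro i; rw [ae_all_iff]; exact h i
  filter_upwards [h'] with x hx i
  have h1 := Int.floor_le (x i / s)
  have h2 := Int.lt_floor_add_one (x i / s)
  rw [le_div_iff₀ hs] at h1
  rw [div_lt_iff₀ hs] at h2
  refine ⟨lt_of_le_of_ne (by linarith) (hx i _).symm, by linarith⟩

/-- On cubes of side `s` the Poincaré inequality has a factor of order `s²` at the gradient.
Finitely many cubes cover the ball up to a null set, and their mean values form the
finite-dimensional remainder. -/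
theorem smallUpToMeans_ball {U : Set Space} {l : ℝ} (hU : IsOpen U) (hlow : ∀ x ∈ U, x 2 < 0)
    {p : Space} {r : ℝ} (hr : 0 < r) (hball : Metric.ball p (2 * r) ⊆ U) {δ : ℝ} (hδ : 0 < δ) :
    SmallUpToMeans U l (Metric.ball p r) δ := by
  -- Since `2 s ≤ r`, cubes meeting the ball stay in the ball of radius `2 r`. The factor at the
  -- gradient is `64 (2 s)² = 256 s²`, at most `256 s ≤ δ` because `s ≤ 1`.
  set s : ℝ := min (r / 2) (min 1 (δ / 256)) with hsdef
  have hs : 0 < s := by positivity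
  have hsr : 2 * s ≤ r := by
    have := min_le_left (r / 2) (min 1 (δ / 256)); simp only [s]; linarith
  have hs1 : s ≤ 1 := (min_le_right _ _).trans (min_le_left _ _)
  have hsδ : 256 * s ≤ δ := by
    have : s ≤ δ / 256 := (min_le_right _ _).trans (min_le_right _ _)
    linarith
  obtain ⟨M, hM⟩ : ∃ M : ℤ, ∀ x ∈ Metric.ball p r, ∀ i, |⌊x i / s⌋| ≤ M := by
    refine ⟨⌈(‖p‖ + r) / s + 1⌉, fun x hx i => ?_⟩
    have h1 : |x i| ≤ ‖p‖ + r := by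
      have h2 := PiLp.norm_apply_le x i
      have h3 : ‖x‖ ≤ ‖p‖ + ‖x - p‖ := by simpa using norm_add_le p (x - p)
      rw [mem_ball_iff_norm] at hx
      rw [Real.norm_eq_abs] at h2
      linarith
    have h4 : |x i / s| ≤ (‖p‖ + r) / s := by
      rw [abs_div, abs_of_pos hs]; gcongr
    rw [abs_le] at h4
    have h5 := Int.le_ceil ((‖p‖ + r) / s + 1)
    rw [abs_le]
    constructor
    · have h6 := Int.lt_floor_add_one (x i / s)
      have : (-(⌈(‖p‖ + r) / s + 1⌉ : ℤ) : ℝ) ≤ (⌊x i / s⌋ : ℝ) := by linarith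
      exact_mod_cast this
    · have h6 := Int.floor_le (x i / s)
      have : (⌊x i / s⌋ : ℝ) ≤ (⌈(‖p‖ + r) / s + 1⌉ : ℤ) := by linarith
      exact_mod_cast this
  classical
  set Z : Finset (Fin 3 → ℤ) :=
    (Fintype.piFinset fun _ => Finset.Icc (-M) M).filter fun z => latticeCell s z ⊆ U with hZ
  set B := volume (Metric.ball (0 : Space) (s / 2)) with hB
  have hB0 : B ≠ 0 := (Metric.measure_ball_pos _ _ (by positivity)).ne'
  have hB1 : B ≠ ⊤ := measure_ball_lt_top.ne
  have hcell : ∀ z, B ≤ volume (latticeCell s z) := fun z => by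
    rw [hB, ← Measure.addHaar_ball_center volume
      (WithLp.toLp 2 fun i => s * (z i + 1 / 2) : Space)]
    exact measure_mono (ball_subset_latticeCell s z)
  -- The radii `2 s` and `s / 2` have ratio `4`, and `4³ = 64`.
  have hratio : volume (Metric.closedBall (0 : Space) (2 * s)) = ENNReal.ofReal 64 * B := by
    have e1 := Measure.addHaar_closedBall volume (0 : Space) (r := 2 * s) (by positivity)
    have e2 := Measure.addHaar_ball volume (0 : Space) (r := s / 2) (by positivity)
    rw [hB, e1, e2, ← mul_assoc, ← ENNReal.ofReal_mul (by norm_num)]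
    congr 2
    simp
    ring
  refine ⟨Z, inferInstance, fun z => latticeCell s z, B.toReal⁻¹, by positivity, ?_, ?_⟩
  · rintro ⟨z, hz⟩
    refine ⟨(Finset.mem_filter.1 hz).2, (isOpen_latticeCell s z).measurableSet, ?_⟩
    refine (measure_mono (t := Metric.closedBall
      (WithLp.toLp 2 fun i => s * (z i + 1 / 2) : Space) (2 * s)) fun x hx => ?_).trans_lt
      measure_closedBall_lt_top
    rw [mem_closedBall_iff_norm]
    exact norm_sub_le_of_mem_latticeCell hs
      (ball_subset_latticeCell s z (Metric.mem_ball_self (by positivity))) hx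
  · intro u G g h hum
    have hcover : ∀ᵐ x : Space, x ∈ Metric.ball p r → x ∈ ⋃ z ∈ Z, latticeCell s z := by
      filter_upwards [exists_mem_latticeCell hs] with x hx hxb
      simp only [mem_iUnion]
      refine ⟨_, ?_, hx⟩
      rw [hZ, Finset.mem_filter, Fintype.mem_piFinset]
      refine ⟨fun i => by rw [Finset.mem_Icc, ← abs_le]; exact hM x hxb i, fun y hy => hball ?_⟩
      have := norm_sub_le_of_mem_latticeCell hs hx hy
      rw [mem_ball_iff_norm] at hxb ⊢
      have h3 := norm_add_le (y - x) (x - p)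
      rw [sub_add_sub_cancel] at h3
      linarith
    have hpoin : ∀ z ∈ Z, ∫⁻ x in latticeCell s z, ‖u x‖ₑ ^ 2 ≤
        ENNReal.ofReal (B.toReal⁻¹ * (∫ x in latticeCell s z, u x) ^ 2) +
          ENNReal.ofReal δ * ∫⁻ x in latticeCell s z, ‖G x‖ₑ ^ 2 := by
      intro z hz
      have key := h.poincare hU hlow hum (isOpen_latticeCell s z) (convex_latticeCell s z)
        (Finset.mem_filter.1 hz).2 (s := 2 * s)
        (fun x hx y hy => norm_sub_le_of_mem_latticeCell hs hx hy)
      have h1 : B * ∫⁻ x in latticeCell s z, ‖u x‖ₑ ^ 2 ≤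
          volume (latticeCell s z) * ∫⁻ x in latticeCell s z, ‖u x‖ₑ ^ 2 := by
        gcongr; exact hcell z
      have h2 := h1.trans key
      rw [hratio] at h2
      have h3 : ∫⁻ x in latticeCell s z, ‖u x‖ₑ ^ 2 ≤ B⁻¹ * (ENNReal.ofReal
          ((∫ x in latticeCell s z, u x) ^ 2) + ENNReal.ofReal 64 * B *
            (ENNReal.ofReal ((2 * s) ^ 2) * ∫⁻ x in latticeCell s z, ‖G x‖ₑ ^ 2)) := by
        rw [← ENNReal.div_eq_inv_mul, ENNReal.le_div_iff_mul_le (Or.inl hB0) (Or.inl hB1), mul_comm]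
        exact h2
      refine h3.trans ?_
      rw [mul_add]
      gcongr ?_ + ?_
      · rw [ENNReal.ofReal_mul (by positivity),
          ENNReal.ofReal_inv_of_pos (ENNReal.toReal_pos hB0 hB1), ENNReal.ofReal_toReal hB1]
      · calc _ = (B⁻¹ * B) * (ENNReal.ofReal 64 * ENNReal.ofReal ((2 * s) ^ 2)) *
              ∫⁻ x in latticeCell s z, ‖G x‖ₑ ^ 2 := by ring
          _ ≤ _ := by
            rw [ENNReal.inv_mul_cancel hB0 hB1, one_mul, ← ENNReal.ofReal_mul (by norm_num)]
            gcongr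
            nlinarith
    have hdisj : (Z : Set (Fin 3 → ℤ)).PairwiseDisjoint (latticeCell s) := by
      intro z _ z' _ hne
      rw [Function.onFun, Set.disjoint_left]
      intro x hx hx'
      apply hne
      funext i
      have a := hx i
      have b := hx' i
      have c1 : (z i : ℝ) < z' i + 1 := by
        by_contra! hcon
        nlinarith
      have c2 : (z' i : ℝ) < z i + 1 := by
        by_contra! hcon
        nlinarith
      have c3 : z i < z' i + 1 := by exact_mod_cast c1
      have c4 : z' i < z i + 1 := by exact_mod_cast c2
      omega
    have hsumG : ∑ z ∈ Z, ∫⁻ x in latticeCell s z, ‖G x‖ₑ ^ 2 ≤ ∫⁻ x in U, ‖G x‖ₑ ^ 2 := by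
      rw [← lintegral_biUnion_finset hdisj fun z _ => (isOpen_latticeCell s z).measurableSet]
      exact lintegral_mono_set (iUnion₂_subset fun z hz => (Finset.mem_filter.1 hz).2)
    calc ∫⁻ x in Metric.ball p r, ‖u x‖ₑ ^ 2
        ≤ ∫⁻ x in ⋃ z ∈ Z, latticeCell s z, ‖u x‖ₑ ^ 2 := lintegral_mono_set' hcover
      _ = ∑ z ∈ Z, ∫⁻ x in latticeCell s z, ‖u x‖ₑ ^ 2 :=
        lintegral_biUnion_finset hdisj (fun z _ => (isOpen_latticeCell s z).measurableSet) _
      _ ≤ ∑ z ∈ Z, (ENNReal.ofReal (B.toReal⁻¹ * (∫ x in latticeCell s z, u x) ^ 2) +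
          ENNReal.ofReal δ * ∫⁻ x in latticeCell s z, ‖G x‖ₑ ^ 2) := Finset.sum_le_sum hpoin
      _ = ENNReal.ofReal δ * (∑ z ∈ Z, ∫⁻ x in latticeCell s z, ‖G x‖ₑ ^ 2) +
          ENNReal.ofReal (B.toReal⁻¹ * ∑ z : Z, (∫ x in latticeCell s z, u x) ^ 2) := by
        rw [Finset.sum_add_distrib, add_comm, Finset.mul_sum, Finset.mul_sum,
          ENNReal.ofReal_sum_of_nonneg fun z _ => by positivity]
        congr 1
        exact (Finset.sum_coe_sort Z fun z =>
          ENNReal.ofReal (B.toReal⁻¹ * (∫ x in latticeCell s z, u x) ^ 2)).symm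
      _ ≤ _ := by gcongr

/-- A quantitative form of Rellich's theorem: on bounded parts of a Lipschitz domain, functions
with finite energy are small in `L²` up to finitely many mean values. -/
theorem IsLipschitzDomain.smallUpToMeans {U : Set Space} {l : ℝ} (hU : IsLipschitzDomain U)
    (hlow : ∀ x ∈ U, x 2 < 0) {K : Set Space} (hK : IsCompact K) (hKU : K ⊆ closure U) {δ : ℝ}
    (hδ : 0 < δ) : SmallUpToMeans U l (U ∩ K) δ := by
  have hempty : ∀ ε : ℝ, 0 < ε → SmallUpToMeans U l ∅ ε := fun ε _ =>
    ⟨Empty, inferInstance, fun _ => ∅, 0, le_rfl, fun i => i.elim, fun u G g _ _ => by simp⟩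
  have hint : ∀ K : Set Space, IsCompact K → K ⊆ U → ∀ ε > 0, SmallUpToMeans U l K ε := by
    intro K hK hKU
    refine hK.induction_on (p := fun S => ∀ ε > 0, SmallUpToMeans U l S ε) hempty
      (fun S T hST hT ε hε => (hT ε hε).mono hST) (fun S T hS hT ε hε => ?_) ?_
    · have := (hS (ε / 2) (by positivity)).union (by positivity) (by positivity)
        (hT (ε / 2) (by positivity))
      rwa [add_halves] at this
    · intro p hp
      obtain ⟨r, hr, hb⟩ := Metric.isOpen_iff.1 hU.1 p (hKU hp)
      refine ⟨Metric.ball p (r / 2), mem_nhdsWithin_of_mem_nhds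
        (Metric.ball_mem_nhds _ (by positivity)), fun ε hε =>
        smallUpToMeans_ball hU.1 hlow (by positivity) ?_ hε⟩
      rwa [mul_div_cancel₀ r two_ne_zero]
  refine hK.induction_on (p := fun S => ∀ ε > 0, SmallUpToMeans U l (U ∩ S) ε)
    (by simpa using hempty)
    (fun S T hST hT ε hε => (hT ε hε).mono (inter_subset_inter_right _ hST))
    (fun S T hS hT ε hε => ?_) ?_ δ hδ
  · have := (hS (ε / 2) (by positivity)).union (by positivity) (by positivity)
      (hT (ε / 2) (by positivity))
    rw [add_halves] at this
    rwa [inter_union_distrib_left]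
  · intro p hp
    by_cases hpU : p ∈ U
    · obtain ⟨r, hr, hb⟩ := Metric.isOpen_iff.1 hU.1 p hpU
      refine ⟨Metric.ball p (r / 2), mem_nhdsWithin_of_mem_nhds
        (Metric.ball_mem_nhds _ (by positivity)), fun ε hε =>
        (smallUpToMeans_ball hU.1 hlow (by positivity) ?_ hε).mono inter_subset_right⟩
      rwa [mul_div_cancel₀ r two_ne_zero]
    · have hpf : p ∈ frontier U := by
        rw [hU.1.frontier_eq]; exact ⟨hKU hp, hpU⟩
      obtain ⟨e, r, he, hr, hdir⟩ := hU.exists_direction hpf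
      refine ⟨Metric.ball p (r / 2), mem_nhdsWithin_of_mem_nhds
        (Metric.ball_mem_nhds _ (by positivity)), fun ε hε => ?_⟩
      -- The shift by `t e` maps the closed half-ball piece at the boundary to a compact subset of
      -- `U`, where the interior case applies with `ε / 4`. The shift itself costs `t² ≤ t ≤ ε / 4`;
      -- both contributions are doubled and add up to `ε`.
      set t : ℝ := min (r / 2) (min 1 (ε / 4)) with htdef
      have ht : 0 < t := by positivity
      have htr : t < r := (min_le_left _ _).trans_lt (by linarith)
      have ht1 : t ≤ 1 := (min_le_right _ _).trans (min_le_left _ _)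
      have htε : t ≤ ε / 4 := (min_le_right _ _).trans (min_le_right _ _)
      set Kc : Set Space := (fun x => x + t • e) '' (closure U ∩ Metric.closedBall p (r / 2))
      have hKc : IsCompact Kc :=
        ((isCompact_closedBall p (r / 2)).inter_left isClosed_closure).image (by fun_prop)
      have hKcU : Kc ⊆ U := by
        rintro _ ⟨x, ⟨hx1, hx2⟩, rfl⟩
        rw [mem_closedBall_iff_norm] at hx2
        exact hdir x hx1 (by linarith) t ht htr
      obtain ⟨ι, hι, Q, c, hc, hQ, H⟩ := hint Kc hKc hKcU (ε / 4) (by positivity)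
      refine ⟨ι, hι, Q, 2 * c, by positivity, hQ, fun u G g h1 h2 => ?_⟩
      have key := h1.lintegral_sq_le_translate hU.1 hlow (hU.1.inter Metric.isOpen_ball)
        (V := U ∩ Metric.ball p (r / 2)) hKc.isClosed.measurableSet (le_refl U) (t • e) ?_ ?_
      · refine key.trans ?_
        calc _ ≤ 2 * (ENNReal.ofReal (ε / 4) * (∫⁻ x in U, ‖G x‖ₑ ^ 2) +
                ENNReal.ofReal (c * ∑ i, (∫ x in Q i, u x) ^ 2)) +
              2 * (ENNReal.ofReal (ε / 4) * ∫⁻ x in U, ‖G x‖ₑ ^ 2) := by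
              gcongr
              · exact H u G g h1 h2
              · rw [norm_smul, he, mul_one, Real.norm_eq_abs, sq_abs]
                nlinarith
          _ = _ := by
            have e1 : ENNReal.ofReal ε = 4 * ENNReal.ofReal (ε / 4) := by
              rw [show (4 : ENNReal) = ENNReal.ofReal 4 by simp,
                ← ENNReal.ofReal_mul (by norm_num)]
              congr 1; ring
            rw [e1, mul_assoc 2 c, ENNReal.ofReal_mul (by norm_num : (0 : ℝ) ≤ 2)]
            simp only [ENNReal.ofReal_ofNat]
            ring
      · rintro x ⟨hx1, hx2⟩ τ hτ
        rw [mem_ball_iff_norm] at hx2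
        rcases hτ.1.eq_or_lt with h0 | h0
        · rw [← h0]; simpa using hx1
        · rw [smul_smul]
          exact hdir x (subset_closure hx1) (by linarith) _ (by positivity) (by nlinarith [hτ.2])
      · rintro x ⟨hx1, hx2⟩
        exact ⟨x, ⟨subset_closure hx1, Metric.ball_subset_closedBall hx2⟩, rfl⟩

/-! ### Odd functions in the water domain -/

section WaterDomain

variable {Γ : Set Plane} {l : ℝ} {Θ : Set Space}

theorem waterDomain_lower (hΓ : IsCrossSection Γ l) : ∀ x ∈ waterDomain Γ Θ, x 2 < 0 := by
  intro x hx
  simpa using hΓ.lower _ hx.1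

/-- The body is disjoint only from the open surface, so for `|x₂| < l` the point is a limit of
water. The edges `|x₂| = l` are then reached as limits of such points. -/
theorem toSurface_mem_frontier (hl : 0 < l) (hΓ : IsCrossSection Γ l)
    (hΘ : IsSubmergedBody Γ l Θ) (y : Plane) (hy : |y 1| ≤ l) :
    toSurface y ∈ frontier (waterDomain Γ Θ) := by
  have hin : ∀ y : Plane, |y 1| < l → toSurface y ∈ closure (waterDomain Γ Θ) := by
    intro y hy
    have hnot : toSurface y ∈ (closure Θ)ᶜ := fun h =>
      Set.disjoint_left.1 hΘ.submerged h (by simpa [freeSurface, toSurface] using hy)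
    have hcan : toSurface y ∈ closure (canal Γ) := by
      have hc : Continuous fun p : Plane => (!₂[y 0, p 0, p 1] : Space) := by fun_prop
      have hm : MapsTo (fun p : Plane => (!₂[y 0, p 0, p 1] : Space)) Γ (canal Γ) := by
        intro p hp
        have : (!₂[p 0, p 1] : Plane) = p := by ext i; fin_cases i <;> simp
        simpa [canal, this] using hp
      have := map_mem_closure hc (frontier_subset_closure (hΓ.mem_frontier hy.le)) hm
      simpa [toSurface] using this
    have := isClosed_closure.isOpen_compl.closure_inter (s := canal Γ) (t := (closure Θ)ᶜ)
    exact isClosed_closure.isOpen_compl.closure_inter ⟨hcan, hnot⟩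
  have hcl : toSurface y ∈ closure (waterDomain Γ Θ) := by
    have ht : Tendsto (fun s : ℝ => toSurface !₂[y 0, s * y 1]) (𝓝[<] 1) (𝓝 (toSurface y)) := by
      have hc : Continuous fun s : ℝ => toSurface !₂[y 0, s * y 1] :=
        continuous_toSurface.comp (by fun_prop)
      have h1 := (hc.tendsto 1).mono_left (nhdsWithin_le_nhds (s := Iio 1))
      simpa [toSurface] using h1
    refine isClosed_closure.mem_of_tendsto ht ?_
    have hpos : ∀ᶠ s : ℝ in 𝓝[<] 1, 0 < s ∧ s < 1 := by
      have : Ioo (0 : ℝ) 1 ∈ 𝓝[<] 1 := Ioo_mem_nhdsLT one_pos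
      exact this
    filter_upwards [hpos] with s hs
    refine hin _ ?_
    simp only [Matrix.cons_val_one, Matrix.cons_val_fin_one]
    rw [abs_mul, abs_of_pos hs.1]
    rcases (abs_nonneg (y 1)).eq_or_lt with h0 | h0
    · rw [← h0]; simpa using hl
    · nlinarith [hs.2]
  rw [hΘ.lipschitz.1.frontier_eq]
  refine ⟨hcl, fun h => ?_⟩
  have := waterDomain_lower hΓ _ h
  simp [toSurface] at this

theorem IsSubmergedBody.exists_radius (hΘ : IsSubmergedBody Γ l Θ) : ∃ R : ℕ, 0 < R ∧
    ∀ x : Space, (R : ℝ) ≤ |x 0| → (x ∈ waterDomain Γ Θ ↔ x ∈ canal Γ) := by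
  obtain ⟨R, hR⟩ := (Metric.isBounded_iff_subset_closedBall 0).1 hΘ.bounded.closure
  obtain ⟨n, hn⟩ := exists_nat_gt (max R 0)
  have hn0 : (0 : ℝ) < n := (le_max_right _ _).trans_lt hn
  refine ⟨n, by exact_mod_cast hn0, fun x hx => ⟨fun h => h.1, fun h => ⟨h, fun hc => ?_⟩⟩⟩
  have h1 := hR hc
  rw [mem_closedBall_zero_iff] at h1
  have h2 := PiLp.norm_apply_le x 0
  rw [Real.norm_eq_abs] at h2
  linarith [le_max_left R 0]

theorem slab_subset_waterDomain {R : ℝ} (hR0 : 0 < R)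
    (hR : ∀ x : Space, R ≤ |x 0| → (x ∈ waterDomain Γ Θ ↔ x ∈ canal Γ)) {k : ℝ}
    (hk : R ≤ k ∨ k + 1 ≤ -R) : slab k Γ ⊆ waterDomain Γ Θ := by
  rintro x ⟨h1, h2, h3⟩
  refine (hR x ?_).2 h3
  rcases hk with hk | hk
  · exact (hk.trans h1.le).trans (le_abs_self _)
  · rw [abs_of_neg (by linarith)]; linarith

theorem exists_isCompact_near (hΓ : IsCrossSection Γ l) (R : ℝ) : ∃ K : Set Space, IsCompact K ∧
    K ⊆ closure (waterDomain Γ Θ) ∧ {x ∈ waterDomain Γ Θ | |x 0| ≤ R} ⊆ K := by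
  obtain ⟨b, hb⟩ := (Metric.isBounded_iff_subset_closedBall 0).1 hΓ.bounded
  refine ⟨closure (waterDomain Γ Θ) ∩ Metric.closedBall 0 (R + b),
    (isCompact_closedBall _ _).inter_left isClosed_closure, inter_subset_left, ?_⟩
  rintro x ⟨h1, h2⟩
  refine ⟨subset_closure h1, ?_⟩
  rw [mem_closedBall_zero_iff]
  have h3 := hb h1.1
  rw [mem_closedBall_zero_iff] at h3
  linarith [norm_le_abs_add_norm x]

/-- The function `u` is odd in `x₂` on `U`. -/
def OddOn (U : Set Space) (u : Space → ℝ) : Prop :=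
  ∀ᵐ x ∂volume.restrict U, u (reflect x) = -u x

/-- The indices of the slabs away from the body. -/
def FarIndex (R : ℕ) : Type := {k : ℤ // (R : ℤ) ≤ k ∨ k + 1 ≤ -R}

instance (R : ℕ) : Countable (FarIndex R) := inferInstanceAs (Countable {_k : ℤ // _})

theorem FarIndex.real {R : ℕ} (k : FarIndex R) : (R : ℝ) ≤ (k.1 : ℝ) ∨ (k.1 : ℝ) + 1 ≤ -(R : ℝ) := by
  rcases k.2 with h | h
  · left; exact_mod_cast h
  · right; exact_mod_cast h

theorem exists_farIndex {R : ℕ} {t : ℝ} (ht : (R : ℝ) < |t|) (hint : ∀ m : ℤ, t ≠ m) :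
    ∃ k : FarIndex R, (k.1 : ℝ) < t ∧ t < k.1 + 1 := by
  have h1 : (⌊t⌋ : ℝ) < t := lt_of_le_of_ne (Int.floor_le t) (hint _).symm
  have h2 := Int.lt_floor_add_one t
  refine ⟨⟨⌊t⌋, ?_⟩, h1, h2⟩
  rcases lt_abs.1 ht with h | h
  · left; exact Int.le_floor.2 (by exact_mod_cast h.le)
  · right
    have : (⌊t⌋ : ℝ) < -(R : ℝ) := by linarith
    have : ⌊t⌋ < -(R : ℤ) := by exact_mod_cast this
    omega

theorem ae_not_int {n : ℕ} (i : Fin n) : ∀ᵐ x : EuclideanSpace ℝ (Fin n), ∀ m : ℤ, x i ≠ m := by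
  rw [ae_all_iff]
  intro m
  rw [ae_iff]; simpa using volume_coord_eq i (m : ℝ)

theorem lintegral_far_le {R : ℕ} {U : Set Space} {f : Space → ENNReal}
    (hΓ : IsOpen Γ) (hU : ∀ k : FarIndex R, slab k.1 Γ ⊆ U) :
    ∑' k : FarIndex R, ∫⁻ x in slab k.1 Γ, f x ≤ ∫⁻ x in U, f x := by
  rw [← lintegral_iUnion (fun k => (isOpen_slab hΓ).measurableSet)]
  · exact lintegral_mono_set (iUnion_subset hU)
  · intro k k' hne
    rw [Function.onFun, Set.disjoint_left]
    rintro x ⟨h1, h2, -⟩ ⟨h3, h4, -⟩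
    apply hne
    apply Subtype.ext
    have a : (k.1 : ℝ) < k'.1 + 1 := by linarith
    have b : (k'.1 : ℝ) < k.1 + 1 := by linarith
    have a' : k.1 < k'.1 + 1 := by exact_mod_cast a
    have b' : k'.1 < k.1 + 1 := by exact_mod_cast b
    omega

/-- Away from the body, odd functions and their traces are controlled by the gradient, with a
constant depending only on the cross-section. -/
theorem exists_far_bound (hl : 0 < l) (hΓ : IsCrossSection Γ l) : ∃ c : ENNReal, c ≠ ⊤ ∧
    ∀ (Θ : Set Space) (R : ℕ), IsSubmergedBody Γ l Θ → 0 < R →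
      (∀ x : Space, (R : ℝ) ≤ |x 0| → (x ∈ waterDomain Γ Θ ↔ x ∈ canal Γ)) →
      ∀ (u : Space → ℝ) (G : Space → Space) (g : Plane → ℝ),
        IsEnergyTriple (waterDomain Γ Θ) l u G g → Measurable u → OddOn (waterDomain Γ Θ) u →
        ∫⁻ x in {x ∈ waterDomain Γ Θ | R < |x 0|}, ‖u x‖ₑ ^ 2 ≤
          c * (∫⁻ x in waterDomain Γ Θ, ‖G x‖ₑ ^ 2) ∧
        ∫⁻ y in {y ∈ surfaceStrip l | R < |y 0|}, ‖g y‖ₑ ^ 2 ≤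
          c * ∫⁻ x in waterDomain Γ Θ, ‖G x‖ₑ ^ 2 := by
  obtain ⟨c, hc, H⟩ := hΓ.exists_slab_odd_bound hl
  refine ⟨c, hc, fun Θ R hΘ hR0 hR u G g h hum hodd => ?_⟩
  have hsub : ∀ k : FarIndex R, slab k.1 Γ ⊆ waterDomain Γ Θ := fun k =>
    slab_subset_waterDomain (by exact_mod_cast hR0) hR k.real
  have hk : ∀ k : FarIndex R, _ := fun k =>
    H _ u G g k.1 h hΘ.lipschitz.1 (waterDomain_lower hΓ) hum (hsub k)
      (ae_restrict_of_ae_restrict_of_subset (hsub k) hodd)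
  have hsum : ∑' k : FarIndex R, c * ∫⁻ x in slab k.1 Γ, ‖G x‖ₑ ^ 2 ≤
      c * ∫⁻ x in waterDomain Γ Θ, ‖G x‖ₑ ^ 2 := by
    rw [ENNReal.tsum_mul_left]
    gcongr
    exact lintegral_far_le hΓ.lipschitz.1 hsub
  constructor
  · calc _ ≤ ∫⁻ x in ⋃ k : FarIndex R, slab k.1 Γ, ‖u x‖ₑ ^ 2 := by
          refine lintegral_mono_set' ?_
          filter_upwards [ae_not_int (0 : Fin 3)] with x hx hx2
          obtain ⟨k, h1, h2⟩ := exists_farIndex hx2.2 hx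
          exact mem_iUnion.2 ⟨k, h1, h2, hx2.1.1⟩
      _ ≤ ∑' k : FarIndex R, ∫⁻ x in slab k.1 Γ, ‖u x‖ₑ ^ 2 := lintegral_iUnion_le _ _
      _ ≤ ∑' k : FarIndex R, c * ∫⁻ x in slab k.1 Γ, ‖G x‖ₑ ^ 2 :=
        ENNReal.tsum_le_tsum fun k => (hk k).1
      _ ≤ _ := hsum
  · calc _ ≤ ∫⁻ x in ⋃ k : FarIndex R, surfaceSlab l k.1 univ, ‖g x‖ₑ ^ 2 := by
          refine lintegral_mono_set' ?_
          filter_upwards [ae_not_int (0 : Fin 2)] with x hx hx2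
          obtain ⟨k, h1, h2⟩ := exists_farIndex hx2.2 hx
          exact mem_iUnion.2 ⟨k, h1, h2, hx2.1, mem_univ _⟩
      _ ≤ ∑' k : FarIndex R, ∫⁻ x in surfaceSlab l k.1 univ, ‖g x‖ₑ ^ 2 := lintegral_iUnion_le _ _
      _ ≤ ∑' k : FarIndex R, c * ∫⁻ x in slab k.1 Γ, ‖G x‖ₑ ^ 2 :=
        ENNReal.tsum_le_tsum fun k => (hk k).2
      _ ≤ _ := hsum

/-- The Poincaré inequality for odd functions. -/
theorem IsSubmergedBody.exists_odd_poincare (hl : 0 < l) (hΓ : IsCrossSection Γ l)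
    (hΘ : IsSubmergedBody Γ l Θ) : ∃ c : ENNReal, c ≠ ⊤ ∧
      ∀ (u : Space → ℝ) (G : Space → Space) (g : Plane → ℝ),
        IsEnergyTriple (waterDomain Γ Θ) l u G g → Measurable u → OddOn (waterDomain Γ Θ) u →
        ∫⁻ x in waterDomain Γ Θ, ‖u x‖ₑ ^ 2 ≤ c * ∫⁻ x in waterDomain Γ Θ, ‖G x‖ₑ ^ 2 := by
  obtain ⟨cf, hcf, Hf⟩ := exists_far_bound hl hΓ
  obtain ⟨R, hR0, hR⟩ := hΘ.exists_radius
  obtain ⟨K, hK, hKU, hnear⟩ := exists_isCompact_near (Θ := Θ) hΓ R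
  have hR0' : (0 : ℝ) < R := by exact_mod_cast hR0
  have hslab : slab R Γ ⊆ waterDomain Γ Θ := slab_subset_waterDomain hR0' hR (Or.inl le_rfl)
  obtain ⟨p, hp⟩ := hΓ.connected.nonempty
  have hp0 : (!₂[(R : ℝ) + 1 / 2, p 0, p 1] : Space) ∈ slab R Γ := by
    have : (!₂[p 0, p 1] : Plane) = p := by ext i; fin_cases i <;> simp
    refine ⟨by simp, ?_, by simpa [this] using hp⟩
    simp; norm_num
  obtain ⟨r, hr, hball⟩ := Metric.isOpen_iff.1 (isOpen_slab hΓ.lipschitz.1) _ hp0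
  -- The starting ball lies in a slab beyond the body, where the uniform far estimate holds.
  -- Connectedness of the water carries it to the compact part near the body. The constant obtained
  -- depends on the body, which is allowed because it enters only coercivity and the rate of decay.
  have hgood := good_inter_of_isCompact hΘ.lipschitz hΘ.connected.isPreconnected
    (Good := fun V => ∃ c : ENNReal, c ≠ ⊤ ∧
      ∀ (u : Space → ℝ) (G : Space → Space) (g : Plane → ℝ),
        IsEnergyTriple (waterDomain Γ Θ) l u G g → Measurable u → OddOn (waterDomain Γ Θ) u →
        ∫⁻ x in V, ‖u x‖ₑ ^ 2 ≤ c * ∫⁻ x in waterDomain Γ Θ, ‖G x‖ₑ ^ 2)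
    ⟨0, by simp, fun u G g _ _ _ => by simp⟩ ?_ ?_ ?_ (hslab hp0) hr ?_ hK hKU
  · obtain ⟨c, hc, H⟩ := hgood
    refine ⟨c + cf, ENNReal.add_ne_top.2 ⟨hc, hcf⟩, fun u G g h1 h2 h3 => ?_⟩
    have hsub : waterDomain Γ Θ ⊆ (waterDomain Γ Θ ∩ K) ∪ {x ∈ waterDomain Γ Θ | R < |x 0|} := by
      intro x hx
      rcases le_or_gt |x 0| (R : ℝ) with h | h
      · exact Or.inl ⟨hx, hnear ⟨hx, h⟩⟩
      · exact Or.inr ⟨hx, h⟩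
    calc _ ≤ _ := lintegral_mono_set hsub
      _ ≤ _ := lintegral_union_le _ _ _
      _ ≤ _ := by
        rw [add_mul]
        exact add_le_add (H u G g h1 h2 h3) (Hf Θ R hΘ hR0 hR u G g h1 h2 h3).1
  · rintro V W hVW ⟨c, hc, H⟩
    exact ⟨c, hc, fun u G g h1 h2 h3 => (lintegral_mono_set hVW).trans (H u G g h1 h2 h3)⟩
  · rintro V W ⟨c, hc, H⟩ ⟨c', hc', H'⟩
    refine ⟨c + c', ENNReal.add_ne_top.2 ⟨hc, hc'⟩, fun u G g h1 h2 h3 => ?_⟩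
    rw [add_mul]
    exact (lintegral_union_le _ _ _).trans (add_le_add (H u G g h1 h2 h3) (H' u G g h1 h2 h3))
  · rintro V V' v hV hV' hs1 hs2 ⟨c, hc, H⟩
    refine ⟨2 * c + 2 * ENNReal.ofReal (‖v‖ ^ 2), by finiteness, fun u G g h1 h2 h3 => ?_⟩
    refine (h1.lintegral_sq_le_translate hΘ.lipschitz.1 (waterDomain_lower hΓ) hV
      hV'.measurableSet le_rfl v hs1 hs2).trans ?_
    rw [add_mul, mul_assoc, mul_assoc]
    gcongr
    exact H u G g h1 h2 h3
  · refine ⟨cf, hcf, fun u G g h1 h2 h3 =>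
      le_trans (lintegral_mono_set ?_) (Hf Θ R hΘ hR0 hR u G g h1 h2 h3).1⟩
    intro x hx
    have := hball hx
    exact ⟨hslab this, lt_of_lt_of_le this.1 (le_abs_self _)⟩

/-- Bounded parts of the free surface: the trace is small up to finitely many mean values. -/
theorem IsSubmergedBody.trace_smallUpToMeans (hl : 0 < l) (hΓ : IsCrossSection Γ l)
    (hΘ : IsSubmergedBody Γ l Θ) (R : ℝ) {δ : ℝ} (hδ : 0 < δ) :
    ∃ (ι : Type) (_ : Fintype ι) (Q : ι → Set Space) (c : ℝ), 0 ≤ c ∧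
      (∀ i, Q i ⊆ waterDomain Γ Θ ∧ MeasurableSet (Q i) ∧ volume (Q i) < ⊤) ∧
      ∀ (u : Space → ℝ) (G : Space → Space) (g : Plane → ℝ),
        IsEnergyTriple (waterDomain Γ Θ) l u G g → Measurable u →
        ∫⁻ y in {y | |y 0| ≤ R ∧ |y 1| < l}, ‖g y‖ₑ ^ 2 ≤
          ENNReal.ofReal δ * (∫⁻ x in waterDomain Γ Θ, ‖G x‖ₑ ^ 2) +
            ENNReal.ofReal (c * ∑ i, (∫ x in Q i, u x) ^ 2) := by
  obtain ⟨C, τ, hC, hτ, H⟩ := exists_bounded_traceBound hΘ.lipschitz (waterDomain_lower hΓ)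
    (toSurface_mem_frontier hl hΓ hΘ) R
  -- The gradient term of the trace bound takes `C s ≤ δ / 2`. The bulk term has the factor `C / s`,
  -- hence the accuracy `δ / 2 * (s / C)` in Rellich's theorem and the other half of `δ`.
  set s := min τ (δ / (2 * C)) with hsdef
  have hs : 0 < s := by positivity
  have hsδ : C * s ≤ δ / 2 := by
    have : s ≤ δ / (2 * C) := min_le_right _ _
    calc C * s ≤ C * (δ / (2 * C)) := by gcongr
      _ = δ / 2 := by field_simp
  obtain ⟨K, hK, hKU, hnear⟩ := exists_isCompact_near (Θ := Θ) hΓ (R + 1)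
  obtain ⟨ι, hι, Q, c, hc, hQ, H'⟩ := hΘ.lipschitz.smallUpToMeans (l := l) (waterDomain_lower hΓ) hK hKU
    (δ := δ / 2 * (s / C)) (by positivity)
  refine ⟨ι, hι, Q, C / s * c, by positivity, hQ, fun u G g h1 h2 => ?_⟩
  have hsub : waterDomain Γ Θ ∩ {x | |x 0| < R + 1} ⊆ waterDomain Γ Θ ∩ K := by
    rintro x ⟨hx1, hx2⟩
    exact ⟨hx1, hnear ⟨hx1, le_of_lt hx2⟩⟩
  refine (H _ u G g h1 hΘ.lipschitz.1 (waterDomain_lower hΓ) inter_subset_left s hs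
    (min_le_left _ _)).trans ?_
  calc _ ≤ ENNReal.ofReal (C / s) * (ENNReal.ofReal (δ / 2 * (s / C)) *
          (∫⁻ x in waterDomain Γ Θ, ‖G x‖ₑ ^ 2) +
            ENNReal.ofReal (c * ∑ i, (∫ x in Q i, u x) ^ 2)) +
        ENNReal.ofReal (δ / 2) * ∫⁻ x in waterDomain Γ Θ, ‖G x‖ₑ ^ 2 := by
        gcongr
        · exact (lintegral_mono_set hsub).trans (H' u G g h1 h2)
        · exact inter_subset_left
    _ = _ := by
      rw [mul_add, ← mul_assoc, ← ENNReal.ofReal_mul (by positivity),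
        ← ENNReal.ofReal_mul (by positivity), add_right_comm, ← add_mul,
        ← ENNReal.ofReal_add (by positivity) (by positivity), mul_assoc (C / s) c]
      congr 3
      field_simp; ring

end WaterDomain

/-! ### Maximizers of Rayleigh quotients on a Hilbert space -/

section Spectral

theorem eq_zero_of_forall_quadratic {a b : ℝ} (h : ∀ t : ℝ, 0 ≤ 2 * t * a + t ^ 2 * b) : a = 0 := by
  by_contra ha
  have hb : 0 ≤ b := by
    have h1 := h 1
    have h2 := h (-1)
    linarith
  -- The minimum of the quadratic is at `-a / b`; the shift `b + 1` also covers `b = 0`.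
  have h3 := h (-a / (b + 1))
  have hb1 : 0 < b + 1 := by linarith
  have e : 2 * (-a / (b + 1)) * a + (-a / (b + 1)) ^ 2 * b =
      -(a ^ 2 * (b + 2)) / (b + 1) ^ 2 := by
    field_simp; ring
  rw [e] at h3
  have : 0 < a ^ 2 * (b + 2) / (b + 1) ^ 2 := by positivity
  rw [neg_div] at h3
  linarith

variable {H K L M : Type*} [NormedAddCommGroup H] [InnerProductSpace ℝ H] [CompleteSpace H]
  [NormedAddCommGroup K] [InnerProductSpace ℝ K] [NormedAddCommGroup L] [InnerProductSpace ℝ L]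
  [NormedAddCommGroup M] [NormedSpace ℝ M] [FiniteDimensional ℝ M]

/-- If `‖B v‖² ≤ κ ‖A v‖²` up to a finite dimensional perturbation, and the supremum of the Rayleigh
quotient `‖B v‖² / ‖A v‖²` over `F` exceeds `κ`, then it is attained. -/
theorem exists_rayleigh_maximizer (A : H →L[ℝ] K) (B : H →L[ℝ] L) (ℓ : H →L[ℝ] M)
    (F : Submodule ℝ H) (hF : IsClosed (F : Set H)) {c κ μ : ℝ}
    (hcoer : ∀ v ∈ F, ‖v‖ ^ 2 ≤ c * ‖A v‖ ^ 2)
    (hκ : ∀ v ∈ F, ‖B v‖ ^ 2 ≤ κ * ‖A v‖ ^ 2 + ‖ℓ v‖ ^ 2) (hμκ : κ < μ)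
    {x : H} (hxF : x ∈ F) (hx : x ≠ 0) (hxμ : μ * ‖A x‖ ^ 2 < ‖B x‖ ^ 2) :
    ∃ (m : ℝ) (w : H), μ < m ∧ w ∈ F ∧ ‖A w‖ = 1 ∧
      ∀ v ∈ F, ⟪B w, B v⟫_ℝ = m * ⟪A w, A v⟫_ℝ := by
  have hpos : ∀ v ∈ F, v ≠ 0 → 0 < ‖A v‖ := by
    intro v hv hv0
    rw [norm_pos_iff]
    intro h0
    have := hcoer v hv
    rw [h0, norm_zero] at this
    simp at this
    exact hv0 this
  set T : Set ℝ := {r | ∃ v ∈ F, ‖A v‖ = 1 ∧ ‖B v‖ ^ 2 = r} with hT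
  have hnormal : ∀ v ∈ F, v ≠ 0 → ‖B v‖ ^ 2 / ‖A v‖ ^ 2 ∈ T := by
    intro v hv hv0
    have h0 := hpos v hv hv0
    refine ⟨‖A v‖⁻¹ • v, F.smul_mem _ hv, ?_, ?_⟩
    · rw [map_smul, norm_smul, norm_inv, norm_norm, inv_mul_cancel₀ h0.ne']
    · rw [map_smul, norm_smul, norm_inv, norm_norm, mul_pow, inv_pow]; field_simp
  have hbdd : BddAbove T := by
    refine ⟨‖B‖ ^ 2 * c, ?_⟩
    rintro r ⟨v, hv, h1, rfl⟩
    have h2 := hcoer v hv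
    rw [h1] at h2
    calc ‖B v‖ ^ 2 ≤ (‖B‖ * ‖v‖) ^ 2 := by gcongr; exact B.le_opNorm v
      _ = ‖B‖ ^ 2 * ‖v‖ ^ 2 := by ring
      _ ≤ ‖B‖ ^ 2 * c := by gcongr; linarith
  have hne : T.Nonempty := ⟨_, hnormal x hxF hx⟩
  set m := sSup T with hm
  have hmμ : μ < m := by
    refine lt_of_lt_of_le ?_ (le_csSup hbdd (hnormal x hxF hx))
    rw [lt_div_iff₀ (by have := hpos x hxF hx; positivity)]
    exact hxμ
  -- A quadratic form that is nonnegative on `F` and zero exactly at maximizers after normalization;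
  -- along a maximizing sequence it tends to `0`.
  set q : H → ℝ := fun v => m * ‖A v‖ ^ 2 - ‖B v‖ ^ 2 with hq
  have hq0 : ∀ v ∈ F, 0 ≤ q v := by
    intro v hv
    by_cases hv0 : v = 0
    · simp [hq, hv0]
    · have h1 := le_csSup hbdd (hnormal v hv hv0)
      have h2 := hpos v hv hv0
      rw [div_le_iff₀ (by positivity)] at h1
      simp only [hq]; linarith
  have hpar : ∀ v w : H, q (v - w) + q (v + w) = 2 * q v + 2 * q w := by
    intro v w
    have h1 := parallelogram_law_with_norm ℝ (A v) (A w)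
    have h2 := parallelogram_law_with_norm ℝ (B v) (B w)
    simp only [hq, map_sub, map_add, sq]
    linear_combination m * h1 - h2
  obtain ⟨ρ, -, hρ, hρT⟩ := exists_seq_tendsto_sSup hne hbdd
  choose v hvF hvA hvB using hρT
  have hvc : ∀ n, ‖v n‖ ^ 2 ≤ c := fun n => by simpa [hvA n] using hcoer (v n) (hvF n)
  have hc0 : 0 ≤ c := (sq_nonneg _).trans (hvc 0)
  have hℓb : ∀ n, ℓ (v n) ∈ Metric.closedBall (0 : M) (‖ℓ‖ * √c) := fun n => by
    rw [mem_closedBall_zero_iff]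
    refine (ℓ.le_opNorm _).trans ?_
    gcongr
    exact Real.le_sqrt_of_sq_le (hvc n)
  have : ProperSpace M := FiniteDimensional.proper ℝ M
  obtain ⟨z, -, φ, hφ, hz⟩ := tendsto_subseq_of_bounded Metric.isBounded_closedBall hℓb
  have hqv : Tendsto (fun n => q (v (φ n))) atTop (𝓝 0) := by
    have h1 : ∀ n, q (v n) = m - ρ n := fun n => by simp [hq, hvA n, hvB n]
    simp_rw [h1]
    have := (tendsto_const_nhds (x := m)).sub (hρ.comp hφ.tendsto_atTop)
    rwa [← hm, sub_self] at this
  -- By the parallelogram law `q d ≤ 2 q (v i) + 2 q (v j)` for the difference `d`, while `hκ` gives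
  -- `(m - κ) ‖A d‖² ≤ q d + ‖ℓ d‖²`. The values of `ℓ` converge along the subsequence, so the total
  -- is below `2 η + 2 η + η`, and coercivity passes this to `‖d‖`.
  have hcauchy : CauchySeq fun n => v (φ n) := by
    rw [Metric.cauchySeq_iff]
    intro ε hε
    have hmκ : 0 < m - κ := by linarith
    set η : ℝ := ε ^ 2 * (m - κ) / (8 * (c + 1)) with hη
    have hη0 : 0 < η := by positivity
    have hz' := hz.cauchySeq
    rw [Metric.cauchySeq_iff] at hz'
    obtain ⟨N1, hN1⟩ := hz' (√η) (Real.sqrt_pos.2 hη0)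
    obtain ⟨N2, hN2⟩ := eventually_atTop.1 (hqv.eventually (gt_mem_nhds hη0))
    refine ⟨max N1 N2, fun i hi j hj => ?_⟩
    have hi2 := hN2 i ((le_max_right _ _).trans hi)
    have hj2 := hN2 j ((le_max_right _ _).trans hj)
    have hij := hN1 i ((le_max_left _ _).trans hi) j ((le_max_left _ _).trans hj)
    set d := v (φ i) - v (φ j) with hd
    have hdF : d ∈ F := F.sub_mem (hvF _) (hvF _)
    have e1 : ‖ℓ d‖ ^ 2 < η := by
      rw [dist_eq_norm] at hij
      simp only [Function.comp] at hij
      rw [← map_sub] at hij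
      exact (Real.lt_sqrt (norm_nonneg _)).1 hij
    have e2 := hpar (v (φ i)) (v (φ j))
    have e3 := hq0 _ (F.add_mem (hvF (φ i)) (hvF (φ j)))
    have e4 := hκ d hdF
    have e5 : (m - κ) * ‖A d‖ ^ 2 < 5 * η := by
      have : q d = m * ‖A d‖ ^ 2 - ‖B d‖ ^ 2 := rfl
      nlinarith
    have e6 := hcoer d hdF
    rw [dist_eq_norm]
    by_contra! hcon
    have e7 : ε ^ 2 ≤ ‖d‖ ^ 2 := by gcongr
    have e8 : (m - κ) * ε ^ 2 ≤ c * (5 * η) := by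
      calc (m - κ) * ε ^ 2 ≤ (m - κ) * (c * ‖A d‖ ^ 2) := by gcongr; linarith
        _ = c * ((m - κ) * ‖A d‖ ^ 2) := by ring
        _ ≤ c * (5 * η) := by gcongr
    have e9 : 8 * (c + 1) * η = (m - κ) * ε ^ 2 := by rw [hη]; field_simp
    nlinarith
  obtain ⟨w, hw⟩ := cauchySeq_tendsto_of_complete hcauchy
  have hwF : w ∈ F := hF.mem_of_tendsto hw (Eventually.of_forall fun n => hvF _)
  have hwA : ‖A w‖ = 1 := by
    have h1 := ((A.continuous.tendsto w).comp hw).norm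
    exact tendsto_nhds_unique h1 (by simp [hvA])
  have hqw : q w = 0 := by
    have hc : Continuous q := by
      simp only [hq]; fun_prop
    exact tendsto_nhds_unique ((hc.tendsto w).comp hw) hqv
  refine ⟨m, w, hmμ, hwF, hwA, fun u hu => ?_⟩
  -- First order condition for the minimum of `q` on `F`, attained at `w` with value `0`.
  have h0 := eq_zero_of_forall_quadratic (a := m * ⟪A w, A u⟫_ℝ - ⟪B w, B u⟫_ℝ) (b := q u) ?_
  · linarith
  · intro t
    have h1 := hq0 _ (F.add_mem hwF (F.smul_mem t hu))
    have h2 : q (w + t • u) = q w + 2 * t * (m * ⟪A w, A u⟫_ℝ - ⟪B w, B u⟫_ℝ) + t ^ 2 * q u := by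
      simp only [hq, map_add, map_smul, norm_add_sq_real, norm_smul, inner_smul_right,
        Real.norm_eq_abs, mul_pow, sq_abs]
      ring
    rw [h2, hqw] at h1
    linarith

/-- Existence of `N` eigenvectors of `‖B v‖²` relative to `‖A v‖²` on a closed subspace. -/
theorem exists_eigenvectors (A : H →L[ℝ] K) (B : H →L[ℝ] L) (ℓ : H →L[ℝ] M)
    (S : Submodule ℝ H) (hS : IsClosed (S : Set H)) {c κ μ : ℝ}
    (hcoer : ∀ v ∈ S, ‖v‖ ^ 2 ≤ c * ‖A v‖ ^ 2)
    (hκ : ∀ v ∈ S, ‖B v‖ ^ 2 ≤ κ * ‖A v‖ ^ 2 + ‖ℓ v‖ ^ 2) (hμκ : κ < μ)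
    {N : ℕ} (X : Fin N → H) (hXS : ∀ j, X j ∈ S)
    (hX : ∀ α : Fin N → ℝ, α ≠ 0 → ∑ j, α j • X j ≠ 0 ∧
      μ * ‖A (∑ j, α j • X j)‖ ^ 2 < ‖B (∑ j, α j • X j)‖ ^ 2) :
    ∃ (m : Fin N → ℝ) (w : Fin N → H), LinearIndependent ℝ w ∧ ∀ k, μ < m k ∧ w k ∈ S ∧
      ∀ v ∈ S, ⟪B (w k), B v⟫_ℝ = m k * ⟪A (w k), A v⟫_ℝ := by
  have key : ∀ k ≤ N, ∃ (m : Fin k → ℝ) (w : Fin k → H),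
      (∀ i, ‖A (w i)‖ = 1) ∧ (∀ i j, i ≠ j → ⟪A (w i), A (w j)⟫_ℝ = 0) ∧
      ∀ i, μ < m i ∧ w i ∈ S ∧ ∀ v ∈ S, ⟪B (w i), B v⟫_ℝ = m i * ⟪A (w i), A v⟫_ℝ := by
    intro k
    induction k with
    | zero => exact fun _ => ⟨fun i => i.elim0, fun i => i.elim0, fun i => i.elim0,
        fun i => i.elim0, fun i => i.elim0⟩
    | succ k ih =>
      intro hk
      obtain ⟨m, w, hw1, hw2, hw3⟩ := ih (by omega)
      -- The vectors of `S` that are orthogonal, in the inner product of `A`, to the eigenvectors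
      -- already found.
      set F : Submodule ℝ H := S ⊓ ⨅ i, LinearMap.ker ((innerSL ℝ (A (w i))) ∘L A : H →L[ℝ] ℝ).toLinearMap
        with hFdef
      have hFmem : ∀ v, v ∈ F ↔ v ∈ S ∧ ∀ i, ⟪A (w i), A v⟫_ℝ = 0 := by
        intro v
        simp [hFdef, Submodule.mem_iInf]
      have hFc : IsClosed (F : Set H) := by
        have : (F : Set H) = (S : Set H) ∩ ⋂ i, {v | ⟪A (w i), A v⟫_ℝ = 0} := by
          ext v; simp [hFmem]
        rw [this]
        exact hS.inter (isClosed_iInter fun i => isClosed_eq (by fun_prop) continuous_const)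
      -- There are `k < N` linear conditions on `N` coefficients, so some nonzero combination of the
      -- trial vectors lies in `F`.
      obtain ⟨α, hα0, hα⟩ : ∃ α : Fin N → ℝ, α ≠ 0 ∧ ∀ i, ⟪A (w i), A (∑ j, α j • X j)⟫_ℝ = 0 := by
        set f : (Fin N → ℝ) →ₗ[ℝ] (Fin k → ℝ) := LinearMap.pi fun i =>
          ((innerSL ℝ (A (w i))) ∘L A : H →L[ℝ] ℝ).toLinearMap ∘ₗ Fintype.linearCombination ℝ X
        have hker : LinearMap.ker f ≠ ⊥ := LinearMap.ker_ne_bot_of_finrank_lt (by simp; omega)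
        obtain ⟨α, hα, hα0⟩ := Submodule.exists_mem_ne_zero_of_ne_bot hker
        refine ⟨α, hα0, fun i => ?_⟩
        have := congrFun (LinearMap.mem_ker.1 hα) i
        simpa [f, Fintype.linearCombination_apply] using this
      have hxF : ∑ j, α j • X j ∈ F :=
        (hFmem _).2 ⟨S.sum_mem fun j _ => S.smul_mem _ (hXS j), hα⟩
      obtain ⟨m', w', h1, h2, h3, h4⟩ := exists_rayleigh_maximizer A B ℓ F hFc
        (fun v hv => hcoer v ((hFmem v).1 hv).1) (fun v hv => hκ v ((hFmem v).1 hv).1) hμκ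
        hxF (hX α hα0).1 (hX α hα0).2
      obtain ⟨hw'S, hw'o⟩ := (hFmem w').1 h2
      -- The equation is known for tests in `F` only. A general `v` differs from an element of `F`
      -- by its projection `p` onto the earlier eigenvectors, and both pairings of `w'` with `p`
      -- vanish: the first by orthogonality, the second by the equations of those eigenvectors.
      have horth : ∀ v ∈ S, ⟪B w', B v⟫_ℝ = m' * ⟪A w', A v⟫_ℝ := by
        intro v hv
        set p := ∑ i, ⟪A (w i), A v⟫_ℝ • w i with hp
        have hpS : p ∈ S := S.sum_mem fun i _ => S.smul_mem _ (hw3 i).2.1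
        have hvp : v - p ∈ F := by
          refine (hFmem _).2 ⟨S.sub_mem hv hpS, fun i => ?_⟩
          rw [map_sub, inner_sub_right, hp, map_sum, inner_sum]
          rw [Finset.sum_eq_single i]
          · rw [map_smul, inner_smul_right, real_inner_self_eq_norm_sq, hw1]; ring
          · intro j _ hj
            rw [map_smul, inner_smul_right, hw2 i j (Ne.symm hj), mul_zero]
          · simp
        have hA : ⟪A w', A p⟫_ℝ = 0 := by
          rw [hp, map_sum, inner_sum]
          refine Finset.sum_eq_zero fun i _ => ?_
          rw [map_smul, inner_smul_right, real_inner_comm (A (w i)), hw'o i, mul_zero]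
        have hB : ⟪B w', B p⟫_ℝ = 0 := by
          rw [hp, map_sum, inner_sum]
          refine Finset.sum_eq_zero fun i _ => ?_
          rw [map_smul, inner_smul_right, real_inner_comm (B (w i)), (hw3 i).2.2 w' hw'S, hw'o i]
          ring
        have := h4 _ hvp
        rw [map_sub, map_sub, inner_sub_right, inner_sub_right, hA, hB] at this
        simpa using this
      refine ⟨Fin.snoc m m', Fin.snoc w w', ?_, ?_, ?_⟩
      · intro i
        refine Fin.lastCases ?_ (fun i => ?_) i
        · simpa using h3
        · simpa using hw1 i
      · intro i j
        refine Fin.lastCases ?_ (fun i => ?_) i <;> refine Fin.lastCases ?_ (fun j => ?_) j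
        · simp
        · intro _; simpa [real_inner_comm] using hw'o j
        · intro _; simpa using hw'o i
        · intro hij; simpa using hw2 i j (fun h => hij (by rw [h]))
      · intro i
        refine Fin.lastCases ?_ (fun i => ?_) i
        · simpa using ⟨h1, hw'S, horth⟩
        · simpa using hw3 i
  obtain ⟨m, w, h1, h2, h3⟩ := key N le_rfl
  refine ⟨m, w, ?_, h3⟩
  have hli : LinearIndependent ℝ fun i => A (w i) :=
    linearIndependent_of_ne_zero_of_inner_eq_zero
      (fun i h0 => by have := h1 i; rw [h0, norm_zero] at this; exact zero_ne_one this)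
      (fun i j hij => h2 i j hij)
  exact LinearIndependent.of_comp A.toLinearMap hli

end Spectral

/-! ### The energy space as a Hilbert space -/

section Structure

variable {U : Set Space} {l : ℝ}

theorem EnergySpace.ext_ae {v w : EnergySpace U l}
    (h1 : potential v =ᵐ[volume.restrict U] potential w)
    (h2 : grad v =ᵐ[volume.restrict U] grad w)
    (h3 : surfaceTrace v =ᵐ[volume.restrict (surfaceStrip l)] surfaceTrace w) : v = w := by
  apply Subtype.ext
  have e1 := Lp.ext h1
  have e2 := Lp.ext h2
  have e3 := Lp.ext h3
  apply WithLp.ofLp_injective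
  refine Prod.ext e1 ?_
  apply WithLp.ofLp_injective
  exact Prod.ext e2 e3

theorem inner_eq_integral_of_ae {α : Type*} [MeasurableSpace α] {μ : Measure α}
    {f : Lp ℝ 2 μ} {g k : α → ℝ} (hg : MemLp g 2 μ) (hk : f =ᵐ[μ] k) :
    ⟪hg.toLp g, f⟫_ℝ = ∫ x, k x * g x ∂μ := by
  rw [L2.inner_def]
  refine integral_congr_ae ?_
  filter_upwards [hg.coeFn_toLp, hk] with x hx hx2
  rw [hx, hx2]
  simp

/-- Each Green identity is a condition on continuous linear functionals, because its integrals are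
inner products with fixed `L²` functions. Completeness follows, and with it the existence of limits
of maximizing sequences. -/
theorem isClosed_energySpace : IsClosed (EnergySpace U l : Set (Triples U l)) := by
  have : (EnergySpace U l : Set (Triples U l)) =
      ⋂ (φ : Space → ℝ) (_ : IsTestFunction U l φ) (i : Fin 3), {w | GreenIdentity U l w φ i} := by
    ext w; simp [EnergySpace]
  rw [this]
  refine isClosed_iInter fun φ => isClosed_iInter fun hφ => isClosed_iInter fun i => ?_
  have c1 : Continuous fun w : Triples U l =>
      ∫ x in U, w.fst x * fderiv ℝ φ x (EuclideanSpace.single i 1) := by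
    have : ∀ w : Triples U l, (∫ x in U, w.fst x * fderiv ℝ φ x (EuclideanSpace.single i 1)) =
        ⟪(hφ.memLp_fderiv (V := U) (EuclideanSpace.single i 1)).toLp _,
          WithLp.fstL 2 ℝ _ _ w⟫_ℝ := fun w =>
      (inner_eq_integral_of_ae _ (ae_eq_refl _)).symm
    simp_rw [this]
    fun_prop
  have c2 : Continuous fun w : Triples U l => ∫ x in U, w.snd.fst x i * φ x := by
    have : ∀ w : Triples U l, (∫ x in U, w.snd.fst x i * φ x) =
        ⟪(hφ.memLp (V := U)).toLp _, (EuclideanSpace.proj (𝕜 := ℝ) i).compLpL 2 (volume.restrict U)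
          (WithLp.fstL 2 ℝ _ _ (WithLp.sndL 2 ℝ _ _ w))⟫_ℝ := fun w => by
      rw [inner_eq_integral_of_ae _ (ContinuousLinearMap.coeFn_compLpL _ _)]
      rfl
    simp_rw [this]
    fun_prop
  have c3 : Continuous fun w : Triples U l =>
      ∫ y in surfaceStrip l, w.snd.snd y * φ (toSurface y) := by
    have : ∀ w : Triples U l, (∫ y in surfaceStrip l, w.snd.snd y * φ (toSurface y)) =
        ⟪(hφ.memLp_surface (V := surfaceStrip l)).toLp _,
          WithLp.sndL 2 ℝ _ _ (WithLp.sndL 2 ℝ _ _ w)⟫_ℝ := fun w =>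
      (inner_eq_integral_of_ae _ (ae_eq_refl _)).symm
    simp_rw [this]
    fun_prop
  unfold GreenIdentity
  split_ifs
  · exact isClosed_eq (c1.add c2) c3
  · exact isClosed_eq (c1.add c2) continuous_const

instance : CompleteSpace (EnergySpace U l) := isClosed_energySpace.completeSpace_coe

variable (U l) in
/-- The potential as a bounded operator. -/
noncomputable def potentialL : EnergySpace U l →L[ℝ] Lp ℝ 2 (volume.restrict U) :=
  WithLp.fstL 2 ℝ _ _ ∘L (EnergySpace U l).subtypeL

variable (U l) in
/-- The gradient as a bounded operator. -/
noncomputable def gradL : EnergySpace U l →L[ℝ] Lp Space 2 (volume.restrict U) :=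
  WithLp.fstL 2 ℝ _ _ ∘L WithLp.sndL 2 ℝ _ _ ∘L (EnergySpace U l).subtypeL

variable (U l) in
/-- The trace as a bounded operator. -/
noncomputable def traceL : EnergySpace U l →L[ℝ] Lp ℝ 2 (volume.restrict (surfaceStrip l)) :=
  WithLp.sndL 2 ℝ _ _ ∘L WithLp.sndL 2 ℝ _ _ ∘L (EnergySpace U l).subtypeL

@[simp] theorem potentialL_apply (w : EnergySpace U l) : potentialL U l w = potential w := rfl
@[simp] theorem gradL_apply (w : EnergySpace U l) : gradL U l w = grad w := rfl
@[simp] theorem traceL_apply (w : EnergySpace U l) : traceL U l w = surfaceTrace w := rfl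

theorem grad_add (v w : EnergySpace U l) : grad (v + w) = grad v + grad w :=
  map_add (gradL U l) v w

theorem grad_sub (v w : EnergySpace U l) : grad (v - w) = grad v - grad w :=
  map_sub (gradL U l) v w

theorem grad_neg (w : EnergySpace U l) : grad (-w) = -grad w :=
  map_neg (gradL U l) w

theorem grad_smul (c : ℝ) (w : EnergySpace U l) : grad (c • w) = c • grad w :=
  map_smul (gradL U l) c w

theorem surfaceTrace_add (v w : EnergySpace U l) : surfaceTrace (v + w) = surfaceTrace v + surfaceTrace w :=
  map_add (traceL U l) v w

theorem surfaceTrace_sub (v w : EnergySpace U l) : surfaceTrace (v - w) = surfaceTrace v - surfaceTrace w :=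
  map_sub (traceL U l) v w

theorem surfaceTrace_neg (w : EnergySpace U l) : surfaceTrace (-w) = -surfaceTrace w :=
  map_neg (traceL U l) w

theorem surfaceTrace_smul (c : ℝ) (w : EnergySpace U l) : surfaceTrace (c • w) = c • surfaceTrace w :=
  map_smul (traceL U l) c w

theorem EnergySpace.norm_sq_eq (w : EnergySpace U l) :
    ‖w‖ ^ 2 = ‖potential w‖ ^ 2 + ‖grad w‖ ^ 2 + ‖surfaceTrace w‖ ^ 2 := by
  rw [Submodule.coe_norm, WithLp.prod_norm_sq_eq_of_L2, WithLp.prod_norm_sq_eq_of_L2, ← add_assoc]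
  rfl

end Structure

/-! ### The reflection and the odd subspace -/

section Reflection

variable {U : Set Space} {l : ℝ}

/-- The reflection `(x₁, x₂) ↦ (x₁, -x₂)`. -/
noncomputable def reflectPlane (y : Plane) : Plane := !₂[y 0, -y 1]

/-- The reflection of the plane as a linear isometry. -/
noncomputable def reflectPlaneIso : Plane ≃ₗᵢ[ℝ] Plane where
  toFun := reflectPlane
  map_add' x y := by ext i; fin_cases i <;> simp [reflectPlane]; ring
  map_smul' c x := by ext i; fin_cases i <;> simp [reflectPlane]
  invFun := reflectPlane
  left_inv x := by ext i; fin_cases i <;> simp [reflectPlane]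
  right_inv x := by ext i; fin_cases i <;> simp [reflectPlane]
  norm_map' x := by simp [reflectPlane, EuclideanSpace.norm_eq, Fin.sum_univ_two]

theorem measurePreserving_reflectPlane : MeasurePreserving reflectPlane volume volume :=
  reflectPlaneIso.measurePreserving

theorem measurePreserving_reflect_restrict (hsym : ∀ x, x ∈ U ↔ reflect x ∈ U)
    (hU : MeasurableSet U) : MeasurePreserving reflect (volume.restrict U) (volume.restrict U) := by
  have := measurePreserving_reflect.restrict_preimage hU
  rwa [show reflect ⁻¹' U = U from Set.ext fun x => (hsym x).symm] at this

theorem measurePreserving_reflectPlane_restrict : MeasurePreserving reflectPlane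
    (volume.restrict (surfaceStrip l)) (volume.restrict (surfaceStrip l)) := by
  have := measurePreserving_reflectPlane.restrict_preimage (isOpen_surfaceStrip l).measurableSet
  rwa [show reflectPlane ⁻¹' surfaceStrip l = surfaceStrip l from
    Set.ext fun x => by simp [reflectPlane, surfaceStrip]] at this

theorem reflectPlane_reflectPlane (y : Plane) : reflectPlane (reflectPlane y) = y := by
  ext i; fin_cases i <;> simp [reflectPlane]

theorem toSurface_reflectPlane (y : Plane) : toSurface (reflectPlane y) = reflect (toSurface y) := by
  ext i; fin_cases i <;> simp [reflectPlane, reflect, toSurface]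

theorem measurableEmbedding_reflectPlane : MeasurableEmbedding reflectPlane :=
  reflectPlaneIso.toHomeomorph.measurableEmbedding

theorem inner_reflect (x y : Space) : ⟪reflect x, reflect y⟫_ℝ = ⟪x, y⟫_ℝ := by
  simp [PiLp.inner_apply, Fin.sum_univ_three, reflect]

theorem integral_reflect {F : Type*} [NormedAddCommGroup F] [NormedSpace ℝ F]
    (hsym : ∀ x, x ∈ U ↔ reflect x ∈ U) (hU : MeasurableSet U)
    (f : Space → F) : ∫ x in U, f (reflect x) = ∫ x in U, f x :=
  (measurePreserving_reflect_restrict hsym hU).integral_comp measurableEmbedding_reflect f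

theorem integral_reflectPlane (f : Plane → ℝ) :
    ∫ y in surfaceStrip l, f (reflectPlane y) = ∫ y in surfaceStrip l, f y :=
  measurePreserving_reflectPlane_restrict.integral_comp measurableEmbedding_reflectPlane f

theorem IsTestFunction.reflect {φ : Space → ℝ} (hsym : ∀ x, x ∈ U ↔ reflect x ∈ U)
    (hφ : IsTestFunction U l φ) : IsTestFunction U l fun x => φ (reflect x) := by
  have ht : tsupport (fun x => φ (WaterWave.reflect x)) = WaterWave.reflect ⁻¹' tsupport φ :=
    tsupport_comp_eq_preimage φ reflectIso.toHomeomorph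
  have hf : frontier U = WaterWave.reflect ⁻¹' frontier U := by
    have h := reflectIso.toHomeomorph.preimage_frontier U
    have e : (reflectIso.toHomeomorph : Space → Space) = WaterWave.reflect := rfl
    rw [e] at h
    rw [h, show WaterWave.reflect ⁻¹' U = U from Set.ext fun x => (hsym x).symm]
  refine ⟨hφ.smooth.comp reflectIso.contDiff, hφ.compact.comp_homeomorph reflectIso.toHomeomorph, ?_⟩
  rw [ht, Set.disjoint_left]
  rintro x hx ⟨h1, h2⟩
  refine Set.disjoint_left.1 hφ.vanishes hx ⟨?_, fun h => h2 ?_⟩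
  · rw [hf] at h1; exact h1
  · simpa [freeSurface, WaterWave.reflect] using h

/-- A change of variables moves the reflection to the test function. The symmetry of `U` and of the
free surface makes the reflected function admissible, and the identity is used in the reflected
coordinate direction. -/
theorem IsEnergyTriple.reflect {u : Space → ℝ} {G : Space → Space} {g : Plane → ℝ}
    (hsym : ∀ x, x ∈ U ↔ reflect x ∈ U) (hU : MeasurableSet U) (h : IsEnergyTriple U l u G g) :
    IsEnergyTriple U l (fun x => u (reflect x)) (fun x => reflect (G (reflect x)))
      (fun y => g (reflectPlane y)) := by
  have mp := measurePreserving_reflect_restrict hsym hU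
  refine ⟨h.fn.comp_measurePreserving mp, ?_,
    h.trace.comp_measurePreserving measurePreserving_reflectPlane_restrict, ?_⟩
  · exact reflectIso.toContinuousLinearEquiv.toContinuousLinearMap.comp_memLp'
      (h.gradient.comp_measurePreserving mp)
  · intro φ hφ i
    have hd : ∀ x v, fderiv ℝ (fun x => φ (WaterWave.reflect x)) x v =
        fderiv ℝ φ (WaterWave.reflect x) (WaterWave.reflect v) := by
      intro x v
      have h1 : HasFDerivAt φ (fderiv ℝ φ (WaterWave.reflect x)) (reflectIso x) :=
        (hφ.smooth.differentiable (by simp)).differentiableAt.hasFDerivAt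
      have h2 := h1.comp x reflectIso.toContinuousLinearEquiv.hasFDerivAt
      have h3 : HasFDerivAt (fun x => φ (WaterWave.reflect x)) _ x := h2
      rw [h3.fderiv]; rfl
    have key := h.green_dir (hφ.reflect hsym) (WaterWave.reflect (EuclideanSpace.single i 1))
    simp only [hd, reflect_reflect] at key
    have e1 : ∫ x in U, u (WaterWave.reflect x) * fderiv ℝ φ x (EuclideanSpace.single i 1) =
        ∫ x in U, u x * fderiv ℝ φ (WaterWave.reflect x) (EuclideanSpace.single i 1) := by
      rw [← integral_reflect hsym hU]; simp only [reflect_reflect]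
    have e2 : ∫ x in U, (WaterWave.reflect (G (WaterWave.reflect x))) i * φ x =
        ∫ x in U, ⟪G x, WaterWave.reflect (EuclideanSpace.single i 1)⟫_ℝ *
          φ (WaterWave.reflect x) := by
      rw [← integral_reflect hsym hU]
      simp only [reflect_reflect]
      refine integral_congr_ae (ae_of_all _ fun x => ?_)
      simp only
      rw [← inner_reflect, reflect_reflect, EuclideanSpace.inner_single_right]
      simp
    have e3 : ∫ y in surfaceStrip l, g (reflectPlane y) * φ (toSurface y) =
        ∫ y in surfaceStrip l, g y * φ (WaterWave.reflect (toSurface y)) := by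
      rw [← integral_reflectPlane]
      simp only [reflectPlane_reflectPlane, toSurface_reflectPlane]
    rw [e1, e2, key, e3]
    fin_cases i <;> simp [WaterWave.reflect]

/-- The reflection of the elements of the energy space of a symmetric domain. -/
noncomputable def reflectEnergy (hsym : ∀ x, x ∈ U ↔ reflect x ∈ U) (hU : MeasurableSet U)
    (w : EnergySpace U l) : EnergySpace U l :=
  ((isEnergyTriple w).reflect hsym hU).toEnergySpace

variable (hsym : ∀ x, x ∈ U ↔ reflect x ∈ U) (hU : MeasurableSet U)

theorem potential_reflectEnergy (w : EnergySpace U l) :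
    potential (reflectEnergy hsym hU w) =ᵐ[volume.restrict U] fun x => potential w (reflect x) :=
  IsEnergyTriple.potential_toEnergySpace _

theorem grad_reflectEnergy (w : EnergySpace U l) :
    grad (reflectEnergy hsym hU w) =ᵐ[volume.restrict U] fun x => reflect (grad w (reflect x)) :=
  IsEnergyTriple.grad_toEnergySpace _

theorem surfaceTrace_reflectEnergy (w : EnergySpace U l) :
    surfaceTrace (reflectEnergy hsym hU w) =ᵐ[volume.restrict (surfaceStrip l)]
      fun y => surfaceTrace w (reflectPlane y) :=
  IsEnergyTriple.surfaceTrace_toEnergySpace _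

theorem inner_grad_reflectEnergy (v w : EnergySpace U l) :
    ⟪grad (reflectEnergy hsym hU v), grad (reflectEnergy hsym hU w)⟫_ℝ = ⟪grad v, grad w⟫_ℝ := by
  rw [L2.inner_def, L2.inner_def, ← integral_reflect hsym hU]
  refine integral_congr_ae ?_
  have mp := (measurePreserving_reflect_restrict hsym hU).quasiMeasurePreserving
  filter_upwards [mp.ae_eq_comp (grad_reflectEnergy hsym hU v),
    mp.ae_eq_comp (grad_reflectEnergy hsym hU w)] with x h1 h2
  simp only [Function.comp] at h1 h2
  rw [h1, h2, inner_reflect, reflect_reflect]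

theorem inner_surfaceTrace_reflectEnergy (v w : EnergySpace U l) :
    ⟪surfaceTrace (reflectEnergy hsym hU v), surfaceTrace (reflectEnergy hsym hU w)⟫_ℝ =
      ⟪surfaceTrace v, surfaceTrace w⟫_ℝ := by
  rw [L2.inner_def, L2.inner_def, ← integral_reflectPlane]
  refine integral_congr_ae ?_
  have mp := (measurePreserving_reflectPlane_restrict (l := l)).quasiMeasurePreserving
  filter_upwards [mp.ae_eq_comp (surfaceTrace_reflectEnergy hsym hU v),
    mp.ae_eq_comp (surfaceTrace_reflectEnergy hsym hU w)] with x h1 h2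
  simp only [Function.comp] at h1 h2
  rw [h1, h2, reflectPlane_reflectPlane]

theorem reflectEnergy_add (v w : EnergySpace U l) :
    reflectEnergy hsym hU (v + w) = reflectEnergy hsym hU v + reflectEnergy hsym hU w := by
  have mp := (measurePreserving_reflect_restrict hsym hU).quasiMeasurePreserving
  have mp2 := (measurePreserving_reflectPlane_restrict (l := l)).quasiMeasurePreserving
  refine EnergySpace.ext_ae ?_ ?_ ?_
  · filter_upwards [potential_reflectEnergy hsym hU (v + w), potential_reflectEnergy hsym hU v,
      potential_reflectEnergy hsym hU w, mp.ae_eq_comp (Lp.coeFn_add (potential v) (potential w)),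
      Lp.coeFn_add (potential (reflectEnergy hsym hU v)) (potential (reflectEnergy hsym hU w))]
      with x h1 h2 h3 h4 h5
    rw [h1]; refine Eq.trans h4 (Eq.trans ?_ h5.symm)
    simp [h2, h3]
  · filter_upwards [grad_reflectEnergy hsym hU (v + w), grad_reflectEnergy hsym hU v,
      grad_reflectEnergy hsym hU w, mp.ae_eq_comp (Lp.coeFn_add (grad v) (grad w)),
      Lp.coeFn_add (grad (reflectEnergy hsym hU v)) (grad (reflectEnergy hsym hU w))]
      with x h1 h2 h3 h4 h5
    rw [h1]; refine Eq.trans (congrArg reflect h4) (Eq.trans ?_ h5.symm)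
    rw [Pi.add_apply, h2, h3]
    exact map_add reflectIso _ _
  · filter_upwards [surfaceTrace_reflectEnergy hsym hU (v + w), surfaceTrace_reflectEnergy hsym hU v,
      surfaceTrace_reflectEnergy hsym hU w,
      mp2.ae_eq_comp (Lp.coeFn_add (surfaceTrace v) (surfaceTrace w)),
      Lp.coeFn_add (surfaceTrace (reflectEnergy hsym hU v))
        (surfaceTrace (reflectEnergy hsym hU w))] with x h1 h2 h3 h4 h5
    rw [h1]; refine Eq.trans h4 (Eq.trans ?_ h5.symm)
    simp [h2, h3]

theorem reflectEnergy_smul (c : ℝ) (w : EnergySpace U l) :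
    reflectEnergy hsym hU (c • w) = c • reflectEnergy hsym hU w := by
  have mp := (measurePreserving_reflect_restrict hsym hU).quasiMeasurePreserving
  have mp2 := (measurePreserving_reflectPlane_restrict (l := l)).quasiMeasurePreserving
  refine EnergySpace.ext_ae ?_ ?_ ?_
  · filter_upwards [potential_reflectEnergy hsym hU (c • w), potential_reflectEnergy hsym hU w,
      mp.ae_eq_comp (Lp.coeFn_smul c (potential w)),
      Lp.coeFn_smul c (potential (reflectEnergy hsym hU w))] with x h1 h2 h4 h5
    rw [h1]; refine Eq.trans h4 (Eq.trans ?_ h5.symm)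
    simp [h2]
  · filter_upwards [grad_reflectEnergy hsym hU (c • w), grad_reflectEnergy hsym hU w,
      mp.ae_eq_comp (Lp.coeFn_smul c (grad w)),
      Lp.coeFn_smul c (grad (reflectEnergy hsym hU w))] with x h1 h2 h4 h5
    rw [h1]; refine Eq.trans (congrArg reflect h4) (Eq.trans ?_ h5.symm)
    rw [Pi.smul_apply, h2]
    exact map_smul reflectIso _ _
  · filter_upwards [surfaceTrace_reflectEnergy hsym hU (c • w), surfaceTrace_reflectEnergy hsym hU w,
      mp2.ae_eq_comp (Lp.coeFn_smul c (surfaceTrace w)),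
      Lp.coeFn_smul c (surfaceTrace (reflectEnergy hsym hU w))] with x h1 h2 h4 h5
    rw [h1]; refine Eq.trans h4 (Eq.trans ?_ h5.symm)
    simp [h2]

theorem norm_reflectEnergy (w : EnergySpace U l) : ‖reflectEnergy hsym hU w‖ = ‖w‖ := by
  have h1 := inner_grad_reflectEnergy hsym hU w w
  have h2 := inner_surfaceTrace_reflectEnergy hsym hU w w
  have h3 : ‖potential (reflectEnergy hsym hU w)‖ = ‖potential w‖ := by
    have e : potential (reflectEnergy hsym hU w) =
        Lp.compMeasurePreserving reflect (measurePreserving_reflect_restrict hsym hU)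
          (potential w) := by
      refine Lp.ext ((potential_reflectEnergy hsym hU w).trans ?_)
      exact (Lp.coeFn_compMeasurePreserving _ _).symm
    rw [e, Lp.norm_compMeasurePreserving]
  rw [real_inner_self_eq_norm_sq, real_inner_self_eq_norm_sq] at h1 h2
  have h4 := EnergySpace.norm_sq_eq (reflectEnergy hsym hU w)
  rw [h1, h2, h3, ← EnergySpace.norm_sq_eq w] at h4
  exact (sq_eq_sq₀ (norm_nonneg _) (norm_nonneg _)).1 h4

/-- The reflection as an isometry of the energy space. -/
noncomputable def reflectEnergyL : EnergySpace U l →ₗᵢ[ℝ] EnergySpace U l where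
  toFun := reflectEnergy hsym hU
  map_add' := reflectEnergy_add hsym hU
  map_smul' := reflectEnergy_smul hsym hU
  norm_map' := norm_reflectEnergy hsym hU

/-- The subspace of functions which are odd with respect to the plane `x₂ = 0`. -/
noncomputable def oddSubspace : Submodule ℝ (EnergySpace U l) :=
  LinearMap.ker ((reflectEnergyL hsym hU).toContinuousLinearMap +
    ContinuousLinearMap.id ℝ (EnergySpace U l)).toLinearMap

theorem mem_oddSubspace {w : EnergySpace U l} :
    w ∈ oddSubspace hsym hU ↔ reflectEnergy hsym hU w = -w := by
  rw [eq_neg_iff_add_eq_zero]; rfl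

theorem isClosed_oddSubspace :
    IsClosed (oddSubspace (l := l) hsym hU : Set (EnergySpace U l)) :=
  ContinuousLinearMap.isClosed_ker _

theorem reflectEnergy_reflectEnergy (w : EnergySpace U l) :
    reflectEnergy hsym hU (reflectEnergy hsym hU w) = w := by
  have mp := (measurePreserving_reflect_restrict hsym hU).quasiMeasurePreserving
  have mp2 := (measurePreserving_reflectPlane_restrict (l := l)).quasiMeasurePreserving
  refine EnergySpace.ext_ae ?_ ?_ ?_
  · filter_upwards [potential_reflectEnergy hsym hU (reflectEnergy hsym hU w),
      mp.ae_eq_comp (potential_reflectEnergy hsym hU w)] with x h1 h2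
    rw [h1]; exact h2.trans (by simp only [Function.comp, reflect_reflect])
  · filter_upwards [grad_reflectEnergy hsym hU (reflectEnergy hsym hU w),
      mp.ae_eq_comp (grad_reflectEnergy hsym hU w)] with x h1 h2
    rw [h1]; exact (congrArg reflect h2).trans (by simp only [Function.comp, reflect_reflect])
  · filter_upwards [surfaceTrace_reflectEnergy hsym hU (reflectEnergy hsym hU w),
      mp2.ae_eq_comp (surfaceTrace_reflectEnergy hsym hU w)] with x h1 h2
    rw [h1]; exact h2.trans (by simp only [Function.comp, reflectPlane_reflectPlane])

theorem sub_reflectEnergy_mem (w : EnergySpace U l) :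
    w - reflectEnergy hsym hU w ∈ oddSubspace hsym hU := by
  rw [mem_oddSubspace]
  have := (reflectEnergyL hsym hU).map_sub w (reflectEnergy hsym hU w)
  refine this.trans ?_
  change reflectEnergy hsym hU w - reflectEnergy hsym hU (reflectEnergy hsym hU w) = _
  rw [reflectEnergy_reflectEnergy, neg_sub]

theorem oddOn_of_mem {w : EnergySpace U l} (hw : w ∈ oddSubspace hsym hU) :
    OddOn U (potential w) := by
  rw [mem_oddSubspace] at hw
  have h1 := potential_reflectEnergy hsym hU w
  rw [hw] at h1
  filter_upwards [h1, Lp.coeFn_neg (potential w)] with x h2 h3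
  rw [← h2]; exact h3

theorem grad_reflect_of_mem {w : EnergySpace U l} (hw : w ∈ oddSubspace hsym hU) :
    ∀ᵐ x ∂volume.restrict U, reflect (grad w (reflect x)) = -grad w x := by
  rw [mem_oddSubspace] at hw
  have h1 := grad_reflectEnergy hsym hU w
  rw [hw] at h1
  filter_upwards [h1, Lp.coeFn_neg (grad w)] with x h2 h3
  rw [← h2]; exact h3

theorem surfaceTrace_reflect_of_mem {w : EnergySpace U l} (hw : w ∈ oddSubspace hsym hU) :
    ∀ᵐ y ∂volume.restrict (surfaceStrip l), surfaceTrace w (reflectPlane y) = -surfaceTrace w y := by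
  rw [mem_oddSubspace] at hw
  have h1 := surfaceTrace_reflectEnergy hsym hU w
  rw [hw] at h1
  filter_upwards [h1, Lp.coeFn_neg (surfaceTrace w)] with x h2 h3
  rw [← h2]; exact h3

theorem toEnergySpace_mem_odd {u : Space → ℝ} {G : Space → Space} {g : Plane → ℝ}
    (h : IsEnergyTriple U l u G g)
    (h1 : ∀ᵐ x ∂volume.restrict U, u (reflect x) = -u x)
    (h2 : ∀ᵐ x ∂volume.restrict U, reflect (G (reflect x)) = -G x)
    (h3 : ∀ᵐ y ∂volume.restrict (surfaceStrip l), g (reflectPlane y) = -g y) :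
    h.toEnergySpace ∈ oddSubspace hsym hU := by
  rw [mem_oddSubspace]
  have mp := (measurePreserving_reflect_restrict hsym hU).quasiMeasurePreserving
  have mp2 := (measurePreserving_reflectPlane_restrict (l := l)).quasiMeasurePreserving
  refine EnergySpace.ext_ae ?_ ?_ ?_
  · filter_upwards [potential_reflectEnergy hsym hU h.toEnergySpace, h.potential_toEnergySpace,
      mp.ae_eq_comp h.potential_toEnergySpace, h1, Lp.coeFn_neg (potential h.toEnergySpace)]
      with x k1 k2 k3 k4 k5
    refine Eq.trans ?_ k5.symm
    rw [k1, Pi.neg_apply, k2, ← k4]; exact k3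
  · filter_upwards [grad_reflectEnergy hsym hU h.toEnergySpace, h.grad_toEnergySpace,
      mp.ae_eq_comp h.grad_toEnergySpace, h2, Lp.coeFn_neg (grad h.toEnergySpace)]
      with x k1 k2 k3 k4 k5
    refine Eq.trans ?_ k5.symm
    rw [k1, Pi.neg_apply, k2, ← k4]; exact congrArg reflect k3
  · filter_upwards [surfaceTrace_reflectEnergy hsym hU h.toEnergySpace, h.surfaceTrace_toEnergySpace,
      mp2.ae_eq_comp h.surfaceTrace_toEnergySpace, h3, Lp.coeFn_neg (surfaceTrace h.toEnergySpace)]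
      with x k1 k2 k3 k4 k5
    refine Eq.trans ?_ k5.symm
    rw [k1, Pi.neg_apply, k2, ← k4]; exact k3

/-- The eigenvalue equation on odd functions implies the eigenvalue equation. -/
theorem isEigenfunction_of_odd {w : EnergySpace U l} (hw : w ∈ oddSubspace hsym hU) (hw0 : w ≠ 0)
    {lam : ℝ} (h : ∀ v ∈ oddSubspace hsym hU,
      ⟪grad w, grad v⟫_ℝ = lam * ⟪surfaceTrace w, surfaceTrace v⟫_ℝ) :
    IsEigenfunction U l lam w := by
  refine ⟨hw0, fun Ψ => ?_⟩
  -- The antisymmetrization `Ψ - RΨ` is an admissible odd test. Since `w` is odd and `R` preserves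
  -- both inner products, pairing with `-RΨ` repeats the pairing with `Ψ`, so the result is twice
  -- the desired equation.
  have h1 := h _ (sub_reflectEnergy_mem hsym hU Ψ)
  have h2 := inner_grad_reflectEnergy hsym hU w Ψ
  have h3 := inner_surfaceTrace_reflectEnergy hsym hU w Ψ
  rw [(mem_oddSubspace hsym hU).1 hw] at h2 h3
  rw [grad_neg, inner_neg_left] at h2
  rw [surfaceTrace_neg, inner_neg_left] at h3
  rw [grad_sub, surfaceTrace_sub, inner_sub_right, inner_sub_right] at h1
  have h4 : ⟪surfaceTrace w, surfaceTrace (reflectEnergy hsym hU Ψ)⟫_ℝ =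
    -⟪surfaceTrace w, surfaceTrace Ψ⟫_ℝ := by linarith
  rw [h4] at h1
  linarith

end Reflection

/-! ### Odd eigenfunctions from trial functions -/

section OddSpectrum

variable {Γ : Set Plane} {Θ : Set Space} {l : ℝ}

theorem measurable_potential {U : Set Space} (w : EnergySpace U l) : Measurable (potential w) :=
  (Lp.stronglyMeasurable (potential w)).measurable

theorem grad_zero {U : Set Space} : grad (0 : EnergySpace U l) = 0 := map_zero (gradL U l)

theorem surfaceTrace_zero {U : Set Space} : surfaceTrace (0 : EnergySpace U l) = 0 :=
  map_zero (traceL U l)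

/-- Away from the body, the traces and the potentials of odd functions are bounded by the gradients,
with a constant which is independent of the body. -/
def HasFarBound (Γ : Set Plane) (l c : ℝ) : Prop :=
  ∀ (Θ : Set Space) (R : ℕ), IsSubmergedBody Γ l Θ → 0 < R →
    (∀ x : Space, (R : ℝ) ≤ |x 0| → (x ∈ waterDomain Γ Θ ↔ x ∈ canal Γ)) →
    ∀ (u : Space → ℝ) (G : Space → Space) (g : Plane → ℝ),
      IsEnergyTriple (waterDomain Γ Θ) l u G g → Measurable u → OddOn (waterDomain Γ Θ) u →
      ∫⁻ y in {y ∈ surfaceStrip l | R < |y 0|}, ‖g y‖ₑ ^ 2 ≤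
        ENNReal.ofReal c * ∫⁻ x in waterDomain Γ Θ, ‖G x‖ₑ ^ 2

theorem exists_hasFarBound (hl : 0 < l) (hΓ : IsCrossSection Γ l) :
    ∃ c : ℝ, 0 < c ∧ HasFarBound Γ l c := by
  obtain ⟨c, hc, H⟩ := exists_far_bound hl hΓ
  refine ⟨c.toReal + 1, by positivity, fun Θ R h1 h2 h3 u G g h4 h5 h6 => ?_⟩
  refine ((H Θ R h1 h2 h3 u G g h4 h5 h6).2).trans ?_
  gcongr
  rw [ENNReal.ofReal_add (by positivity) zero_le_one, ENNReal.ofReal_toReal hc]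
  exact le_self_add

/-- The means of a square integrable function over a finite family of sets, as a bounded
operator. -/
theorem exists_means_operator {U : Set Space} {ι : Type} [Fintype ι] {Q : ι → Set Space}
    (hQ : ∀ i, Q i ⊆ U ∧ MeasurableSet (Q i) ∧ volume (Q i) < ⊤) {c : ℝ} (hc : 0 ≤ c) :
    ∃ ℓ : Lp ℝ 2 (volume.restrict U) →L[ℝ] EuclideanSpace ℝ ι,
      ∀ f, ‖ℓ f‖ ^ 2 = c * ∑ i, (∫ x in Q i, f x) ^ 2 := by
  have hm : ∀ i, MemLp ((Q i).indicator fun _ => (1 : ℝ)) 2 (volume.restrict U) := fun i =>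
    memLp_indicator_const 2 (hQ i).2.1 1 (Or.inr (by
      refine ne_of_lt (lt_of_le_of_lt (Measure.restrict_apply_le _ _) (hQ i).2.2)))
  refine ⟨√c • (PiLp.continuousLinearEquiv 2 ℝ fun _ : ι => ℝ).symm.toContinuousLinearMap ∘L
    ContinuousLinearMap.pi fun i => innerSL ℝ ((hm i).toLp _), fun f => ?_⟩
  rw [EuclideanSpace.norm_sq_eq, Finset.mul_sum]
  refine Finset.sum_congr rfl fun i _ => ?_
  have e : ⟪(hm i).toLp _, f⟫_ℝ = ∫ x in Q i, f x := by
    rw [inner_eq_integral_of_ae _ (ae_eq_refl _)]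
    have : ∀ x, f x * (Q i).indicator (fun _ => (1 : ℝ)) x = (Q i).indicator f x := by
      intro x; by_cases hx : x ∈ Q i <;> simp [hx]
    simp_rw [this]
    rw [integral_indicator (hQ i).2.1, Measure.restrict_restrict (hQ i).2.1,
      inter_eq_left.2 (hQ i).1]
  rw [← e]
  simp [mul_pow, Real.sq_sqrt hc]

theorem ofReal_norm_sq_trace_le {U : Set Space} (w : EnergySpace U l) (R : ℝ) :
    ENNReal.ofReal (‖surfaceTrace w‖ ^ 2) ≤
      (∫⁻ y in {y | |y 0| ≤ R ∧ |y 1| < l}, ‖surfaceTrace w y‖ₑ ^ 2) +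
        ∫⁻ y in {y ∈ surfaceStrip l | R < |y 0|}, ‖surfaceTrace w y‖ₑ ^ 2 := by
  rw [ofReal_norm_sq]
  refine le_trans (lintegral_mono_set fun y hy => ?_) (lintegral_union_le _ _ _)
  by_cases h : |y 0| ≤ R
  · exact Or.inl ⟨h, hy⟩
  · exact Or.inr ⟨hy, not_le.1 h⟩

variable (hsym : ∀ x, x ∈ waterDomain Γ Θ ↔ reflect x ∈ waterDomain Γ Θ)
  (hU : MeasurableSet (waterDomain Γ Θ))

/-- The far part of the trace costs the constant `c`, the near part costs `κ - c` and finitely many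
means. This is the finite rank perturbation that makes maximizers of the Rayleigh quotient exist
above the threshold. -/
theorem exists_trace_operator (hl : 0 < l) (hΓ : IsCrossSection Γ l) (hΘ : IsSubmergedBody Γ l Θ)
    {c κ : ℝ} (hc : 0 < c) (hfar : HasFarBound Γ l c) (hκ : c < κ) :
    ∃ (ι : Type) (_ : Fintype ι)
      (ℓ : Lp ℝ 2 (volume.restrict (waterDomain Γ Θ)) →L[ℝ] EuclideanSpace ℝ ι),
      ∀ w ∈ oddSubspace (l := l) hsym hU,
        ‖surfaceTrace w‖ ^ 2 ≤ κ * ‖grad w‖ ^ 2 + ‖ℓ (potential w)‖ ^ 2 := by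
  obtain ⟨R, hR0, hR⟩ := hΘ.exists_radius
  obtain ⟨ι, hι, Q, c', hc', hQ, H⟩ :=
    hΘ.trace_smallUpToMeans hl hΓ R (δ := κ - c) (by linarith)
  obtain ⟨ℓ, hℓ⟩ := exists_means_operator hQ hc'
  refine ⟨ι, hι, ℓ, fun w hw => ?_⟩
  have h1 := ofReal_norm_sq_trace_le w R
  have h2 := H _ _ _ (isEnergyTriple w) (measurable_potential w)
  have h3 := hfar Θ R hΘ hR0 hR _ _ _ (isEnergyTriple w) (measurable_potential w)
    (oddOn_of_mem hsym hU hw)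
  rw [← ofReal_norm_sq] at h2 h3
  have h4 := h1.trans (add_le_add h2 h3)
  rw [← hℓ, ← ENNReal.ofReal_mul (by linarith), ← ENNReal.ofReal_mul hc.le,
    ← ENNReal.ofReal_add (by have : 0 < κ - c := by linarith
                             positivity) (by positivity),
    ← ENNReal.ofReal_add (by have : 0 < κ - c := by linarith
                             positivity) (by positivity)] at h4
  rw [ENNReal.ofReal_le_ofReal_iff (by have : 0 < κ - c := by linarith
                                       positivity)] at h4
  linarith

theorem exists_odd_coercive (hl : 0 < l) (hΓ : IsCrossSection Γ l) (hΘ : IsSubmergedBody Γ l Θ) :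
    ∃ c : ℝ, 0 < c ∧ ∀ w ∈ oddSubspace (l := l) hsym hU,
      ‖potential w‖ ^ 2 ≤ c * ‖grad w‖ ^ 2 := by
  obtain ⟨c, hc, H⟩ := hΘ.exists_odd_poincare hl hΓ
  refine ⟨c.toReal + 1, by positivity, fun w hw => ?_⟩
  have h1 := H _ _ _ (isEnergyTriple w) (measurable_potential w) (oddOn_of_mem hsym hU hw)
  rw [← ofReal_norm_sq, ← ofReal_norm_sq, ← ENNReal.ofReal_toReal hc,
    ← ENNReal.ofReal_mul (by positivity), ENNReal.ofReal_le_ofReal_iff (by positivity)] at h1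
  nlinarith [sq_nonneg ‖grad w‖]

set_option maxHeartbeats 2000000 in
/-- Trial functions with large Rayleigh quotients give odd eigenfunctions. -/
theorem exists_odd_eigenfunctions (hl : 0 < l) (hΓ : IsCrossSection Γ l)
    (hΘ : IsSubmergedBody Γ l Θ) {c μ : ℝ} (hc : 0 < c) (hfar : HasFarBound Γ l c) (hμ : c < μ)
    {N : ℕ} (X : Fin N → EnergySpace (waterDomain Γ Θ) l)
    (hXS : ∀ j, X j ∈ oddSubspace hsym hU)
    (hX : ∀ α : Fin N → ℝ, α ≠ 0 →
      μ * ‖grad (∑ j, α j • X j)‖ ^ 2 < ‖surfaceTrace (∑ j, α j • X j)‖ ^ 2) :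
    ∃ (lam : Fin N → ℝ) (w : Fin N → EnergySpace (waterDomain Γ Θ) l), LinearIndependent ℝ w ∧
      ∀ k, 0 < lam k ∧ lam k < 1 / μ ∧ w k ∈ oddSubspace hsym hU ∧
        IsEigenfunction (waterDomain Γ Θ) l (lam k) (w k) := by
  -- Any value strictly between `c` and `μ` serves: it leaves room for the near part of the trace
  -- and stays below the trial quotients.
  obtain ⟨ι, hι, ℓ, hℓ⟩ := exists_trace_operator hsym hU hl hΓ hΘ hc hfar
    (κ := (c + μ) / 2) (by linarith)
  obtain ⟨b, hb, hpot⟩ := exists_odd_coercive hsym hU hl hΓ hΘ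
  have hne : ∀ α : Fin N → ℝ, α ≠ 0 → ∑ j, α j • X j ≠ 0 := by
    intro α hα h0
    have := hX α hα
    rw [h0, grad_zero, surfaceTrace_zero, norm_zero, norm_zero, zero_pow two_ne_zero, mul_zero] at this
    exact lt_irrefl _ this
  have hcoer : ∀ v ∈ oddSubspace (l := l) hsym hU,
      ‖v‖ ^ 2 ≤ (b + 1 + ((c + μ) / 2 + ‖ℓ‖ ^ 2 * b)) * ‖gradL (waterDomain Γ Θ) l v‖ ^ 2 := by
    intro v hv
    have h1 := hℓ v hv
    have h2 := hpot v hv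
    have h3 : ‖ℓ (potential v)‖ ^ 2 ≤ ‖ℓ‖ ^ 2 * (b * ‖grad v‖ ^ 2) := by
      calc ‖ℓ (potential v)‖ ^ 2 ≤ (‖ℓ‖ * ‖potential v‖) ^ 2 := by gcongr; exact ℓ.le_opNorm _
        _ = ‖ℓ‖ ^ 2 * ‖potential v‖ ^ 2 := by ring
        _ ≤ _ := by gcongr
    rw [EnergySpace.norm_sq_eq, gradL_apply]
    linarith
  have hμ' : (c + μ) / 2 < μ := by linarith
  obtain ⟨m, w, hw1, hw2⟩ := exists_eigenvectors (gradL (waterDomain Γ Θ) l)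
    (traceL (waterDomain Γ Θ) l) (ℓ ∘L potentialL (waterDomain Γ Θ) l) (oddSubspace hsym hU)
    (isClosed_oddSubspace hsym hU) hcoer hℓ hμ' X hXS fun α hα => ⟨hne α hα, hX α hα⟩
  have hμ0 : 0 < μ := hc.trans hμ
  -- The quotient is trace over gradient, so its stationary values are the reciprocals of the
  -- eigenvalues.
  refine ⟨fun k => 1 / m k, w, hw1, fun k => ?_⟩
  obtain ⟨h1, h2, h3⟩ := hw2 k
  have hm : 0 < m k := hμ0.trans h1
  refine ⟨by positivity, one_div_lt_one_div_of_lt hμ0 h1, h2, ?_⟩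
  refine isEigenfunction_of_odd hsym hU h2 (hw1.ne_zero k) fun v hv => ?_
  have h4 : ⟪surfaceTrace (w k), surfaceTrace v⟫_ℝ = m k * ⟪grad (w k), grad v⟫_ℝ := h3 v hv
  rw [h4]
  field_simp

end OddSpectrum

/-! ### Multiplication by functions of `x₁` and the exponential weight -/

section Multiplication

variable {U : Set Space} {l : ℝ} {u : Space → ℝ} {G : Space → Space} {g : Plane → ℝ}

/-- Functions of `x₁` with bounded derivative act on the energy triples by multiplication. -/
theorem IsEnergyTriple.mul_first (h : IsEnergyTriple U l u G g) {χ : ℝ → ℝ} (hχ : ContDiff ℝ ∞ χ)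
    {B : ℝ} (hB : ∀ t, |χ t| ≤ B) (hB' : ∀ t, |deriv χ t| ≤ B) :
    IsEnergyTriple U l (fun x => χ (x 0) * u x)
      (fun x => χ (x 0) • G x + (deriv χ (x 0) * u x) • EuclideanSpace.single 0 1)
      (fun y => χ (y 0) * g y) := by
  have hcχ : Continuous χ := hχ.continuous
  have hcχ' : Continuous (deriv χ) := hχ.continuous_deriv (by simp)
  have hd : ∀ x : Space, HasFDerivAt (fun x : Space => χ (x 0))
      (deriv χ (x 0) • (EuclideanSpace.proj (𝕜 := ℝ) (0 : Fin 3))) x := fun x => by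
    have h1 : HasDerivAt χ (deriv χ (x 0)) (EuclideanSpace.proj (𝕜 := ℝ) (0 : Fin 3) x) :=
      ((hχ.differentiable (by simp)).differentiableAt).hasDerivAt
    exact h1.comp_hasFDerivAt x (EuclideanSpace.proj (𝕜 := ℝ) (0 : Fin 3)).hasFDerivAt
  refine ⟨?_, ?_, ?_, ?_⟩
  · refine MemLp.of_le_mul (c := B) h.fn ?_ (ae_of_all _ fun x => ?_)
    · exact (Continuous.aestronglyMeasurable (by fun_prop)).mul h.fn.1
    · rw [norm_mul]; gcongr; exact hB _
  · refine MemLp.add ?_ ?_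
    · refine MemLp.of_le_mul (c := B) h.gradient ?_ (ae_of_all _ fun x => ?_)
      · exact (Continuous.aestronglyMeasurable (f := fun x : Space => χ (x 0)) (by fun_prop)).smul
          h.gradient.1
      · rw [norm_smul]; gcongr; exact hB _
    · refine MemLp.of_le_mul (c := B) h.fn ?_ (ae_of_all _ fun x => ?_)
      · exact ((Continuous.aestronglyMeasurable (by fun_prop)).mul h.fn.1).smul_const _
      · rw [norm_smul, norm_mul, PiLp.norm_single, norm_one, mul_one]
        gcongr; exact hB' _
  · refine MemLp.of_le_mul (c := B) h.trace ?_ (ae_of_all _ fun x => ?_)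
    · exact (Continuous.aestronglyMeasurable (by fun_prop)).mul h.trace.1
    · rw [norm_mul]; gcongr; exact hB _
  · intro φ hφ i
    -- The multiplier is moved to the test function. The identity for `u` tested with `χ φ` is the
    -- one for `χ u` tested with `φ`, with the term `χ' u φ` in the axial direction.
    have hφ' : IsTestFunction U l fun x => χ (x 0) * φ x := by
      refine ⟨(hχ.comp (EuclideanSpace.proj (𝕜 := ℝ) (0 : Fin 3)).contDiff).mul hφ.smooth,
        hφ.compact.mul_left, ?_⟩
      exact hφ.vanishes.mono_left (tsupport_mul_subset_right (f := fun x : Space => χ (x 0)))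
    have key := h.green _ hφ' i
    have e : ∀ x, fderiv ℝ (fun x => χ (x 0) * φ x) x (EuclideanSpace.single i 1) =
        χ (x 0) * fderiv ℝ φ x (EuclideanSpace.single i 1) +
          deriv χ (x 0) * (EuclideanSpace.single i (1 : ℝ) : Space) 0 * φ x := by
      intro x
      have h2 := (hd x).mul (hφ.smooth.differentiable (by simp)).differentiableAt.hasFDerivAt
      have h3 : HasFDerivAt (fun x => χ (x 0) * φ x) _ x := h2
      rw [h3.fderiv]
      simp
      ring_nf
    have i1 : Integrable (fun x => u x * (χ (x 0) * fderiv ℝ φ x (EuclideanSpace.single i 1)))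
        (volume.restrict U) := by
      refine MemLp.integrable_mul (q := 2) h.fn ?_
      refine MemLp.of_le_mul (c := B) (hφ.memLp_fderiv (EuclideanSpace.single i 1)) ?_
        (ae_of_all _ fun x => ?_)
      · exact (Continuous.aestronglyMeasurable (by fun_prop)).mul (hφ.memLp_fderiv _).1
      · rw [norm_mul]; gcongr; exact hB _
    have i2 : Integrable (fun x => u x * (deriv χ (x 0) *
        (EuclideanSpace.single i (1 : ℝ) : Space) 0 * φ x)) (volume.restrict U) := by
      refine MemLp.integrable_mul (q := 2) h.fn ?_
      refine MemLp.of_le_mul (c := B) (hφ.memLp) ?_ (ae_of_all _ fun x => ?_)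
      · exact (Continuous.aestronglyMeasurable (by fun_prop)).mul hφ.memLp.1
      · have : |(EuclideanSpace.single i (1 : ℝ) : Space) 0| ≤ 1 := by
          fin_cases i <;> simp
        rw [norm_mul, norm_mul]
        gcongr
        calc _ ≤ B * 1 := mul_le_mul (hB' _) this (abs_nonneg _) ((abs_nonneg _).trans (hB 0))
          _ = B := mul_one _
    have i3 : Integrable (fun x => G x i * (χ (x 0) * φ x)) (volume.restrict U) :=
      (h.gradient_apply i).integrable_mul hφ'.memLp
    have e1 : ∫ x in U, u x * fderiv ℝ (fun x => χ (x 0) * φ x) x (EuclideanSpace.single i 1) =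
        (∫ x in U, χ (x 0) * u x * fderiv ℝ φ x (EuclideanSpace.single i 1)) +
          ∫ x in U, u x * (deriv χ (x 0) * (EuclideanSpace.single i (1 : ℝ) : Space) 0 * φ x) := by
      simp_rw [e, mul_add]
      rw [integral_add i1 i2]
      congr 1
      refine integral_congr_ae (ae_of_all _ fun x => ?_)
      simp only; ring
    have e2 : ∫ x in U, (χ (x 0) • G x + (deriv χ (x 0) * u x) • EuclideanSpace.single 0 1 : Space) i
          * φ x = (∫ x in U, G x i * (χ (x 0) * φ x)) +
          ∫ x in U, u x * (deriv χ (x 0) * (EuclideanSpace.single i (1 : ℝ) : Space) 0 * φ x) := by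
      rw [← integral_add i3 i2]
      refine integral_congr_ae (ae_of_all _ fun x => ?_)
      have : (EuclideanSpace.single i (1 : ℝ) : Space) 0 = (EuclideanSpace.single 0 (1 : ℝ) : Space) i := by
        fin_cases i <;> simp
      simp only [this, PiLp.add_apply, PiLp.smul_apply, smul_eq_mul]; ring
    have e3 : ∫ y in surfaceStrip l, χ (y 0) * g y * φ (toSurface y) =
        ∫ y in surfaceStrip l, g y * (χ (toSurface y 0) * φ (toSurface y)) := by
      refine integral_congr_ae (ae_of_all _ fun y => ?_)
      simp [toSurface]; ring
    rw [e2, e3, ← key, e1]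
    ring

end Multiplication

section Decay

variable {U : Set Space} {l : ℝ}

/-- The weight which approximates `exp (θ √(1 + t²))` as `δ → 0`. -/
noncomputable def decayWeight (θ δ t : ℝ) : ℝ := (Real.exp (-(θ * √(1 + t ^ 2))) + δ)⁻¹

variable {θ δ : ℝ}

theorem decayWeight_pos (hδ : 0 < δ) (t : ℝ) : 0 < decayWeight θ δ t := by
  unfold decayWeight; positivity

theorem decayWeight_le (hδ : 0 < δ) (t : ℝ) : decayWeight θ δ t ≤ δ⁻¹ := by
  unfold decayWeight
  gcongr
  linarith [Real.exp_pos (-(θ * √(1 + t ^ 2)))]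

theorem decayWeight_le_exp (hδ : 0 < δ) (t : ℝ) :
    decayWeight θ δ t ≤ Real.exp (θ * √(1 + t ^ 2)) := by
  unfold decayWeight
  rw [Real.exp_neg, ← inv_inv (Real.exp (θ * √(1 + t ^ 2)))]
  gcongr
  · rw [inv_inv]; linarith

theorem contDiff_decayWeight (hδ : 0 < δ) : ContDiff ℝ ∞ (decayWeight θ δ) := by
  unfold decayWeight
  refine ContDiff.inv (((contDiff_const.mul (ContDiff.sqrt (by fun_prop) fun t => ?_)).neg.exp).add
    contDiff_const) fun t => ?_
  · positivity
  · positivity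

/-- The function `√(1 + t²)` has slope at most `1`, and `δ` only enlarges the denominator. The
logarithmic derivative is thus bounded by `θ` uniformly in `δ`. -/
theorem abs_deriv_decayWeight_le (hθ : 0 ≤ θ) (hδ : 0 < δ) (t : ℝ) :
    |deriv (decayWeight θ δ) t| ≤ θ * decayWeight θ δ t := by
  have h0 : 0 < 1 + t ^ 2 := by positivity
  have h1 : HasDerivAt (fun t : ℝ => 1 + t ^ 2) (2 * t) t := by
    simpa using (hasDerivAt_pow 2 t).const_add 1
  have h2 := ((((h1.sqrt h0.ne').const_mul θ).neg).exp.add_const δ).inv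
    (by positivity : Real.exp (-(θ * √(1 + t ^ 2))) + δ ≠ 0)
  have h3 : HasDerivAt (decayWeight θ δ) _ t := h2
  rw [h3.deriv]
  simp only [Pi.neg_apply]
  set E := Real.exp (-(θ * √(1 + t ^ 2))) with hE
  have hE0 : 0 < E := Real.exp_pos _
  have hs : 0 < √(1 + t ^ 2) := Real.sqrt_pos.2 h0
  have ht : |t| ≤ √(1 + t ^ 2) := Real.abs_le_sqrt (by linarith)
  have e1 : |2 * t / (2 * √(1 + t ^ 2))| ≤ 1 := by
    rw [abs_div, div_le_one (by positivity), abs_mul, abs_mul, abs_of_pos hs]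
    gcongr
  rw [abs_div, abs_neg, abs_mul, abs_of_pos hE0, abs_neg, abs_mul, abs_of_nonneg hθ,
    abs_of_pos (by positivity : 0 < (E + δ) ^ 2)]
  unfold decayWeight
  rw [← hE, div_le_iff₀ (by positivity)]
  calc E * (θ * |2 * t / (2 * √(1 + t ^ 2))|) ≤ (E + δ) * (θ * 1) := by gcongr; linarith
    _ = θ * (E + δ)⁻¹ * (E + δ) ^ 2 := by field_simp

theorem tendsto_decayWeight (t : ℝ) :
    Tendsto (fun n : ℕ => decayWeight θ (1 / ((n : ℝ) + 1)) t) atTop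
      (𝓝 (Real.exp (θ * √(1 + t ^ 2)))) := by
  unfold decayWeight
  have h1 := (tendsto_one_div_add_atTop_nhds_zero_nat (𝕜 := ℝ)).const_add
    (Real.exp (-(θ * √(1 + t ^ 2))))
  rw [add_zero] at h1
  have h2 := h1.inv₀ (Real.exp_pos _).ne'
  rwa [← Real.exp_neg, neg_neg] at h2

/-- Fatou's lemma for square integrable functions. -/
theorem memLp_two_of_tendsto {α F : Type*} [MeasurableSpace α] [NormedAddCommGroup F]
    {μ : Measure α} {f : ℕ → α → F} {k : α → F} (hf : ∀ n, AEStronglyMeasurable (f n) μ)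
    (hlim : ∀ x, Tendsto (fun n => f n x) atTop (𝓝 (k x))) {B : ENNReal} (hB : B ≠ ⊤)
    (hfB : ∀ n, ∫⁻ x, ‖f n x‖ₑ ^ 2 ∂μ ≤ B) : MemLp k 2 μ := by
  have hk : AEStronglyMeasurable k μ := aestronglyMeasurable_of_tendsto_ae atTop hf
    (ae_of_all _ hlim)
  refine memLp_two_of_lintegral hk (lt_of_le_of_lt ?_ hB.lt_top)
  calc ∫⁻ x, ‖k x‖ₑ ^ 2 ∂μ = ∫⁻ x, liminf (fun n => ‖f n x‖ₑ ^ 2) atTop ∂μ := by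
        refine lintegral_congr fun x => ?_
        have h1 : Tendsto (fun n => ‖f n x‖ₑ ^ 2) atTop (𝓝 (‖k x‖ₑ ^ 2)) :=
          ((ENNReal.continuous_pow 2).tendsto _).comp ((hlim x).enorm)
        exact h1.liminf_eq.symm
    _ ≤ liminf (fun n => ∫⁻ x, ‖f n x‖ₑ ^ 2 ∂μ) atTop :=
        lintegral_liminf_le' fun n => ((hf n).enorm).pow_const 2
    _ ≤ B := liminf_le_of_le (by isBoundedDefault) fun b hb => by
        obtain ⟨n, hn⟩ := hb.exists
        exact hn.trans (hfB n)

/-- Multiplication of an element of the energy space by a function of `x₁`. -/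
noncomputable def mulFirst (w : EnergySpace U l) {χ : ℝ → ℝ} (hχ : ContDiff ℝ ∞ χ)
    {B : ℝ} (hB : ∀ t, |χ t| ≤ B) (hB' : ∀ t, |deriv χ t| ≤ B) : EnergySpace U l :=
  ((isEnergyTriple w).mul_first hχ hB hB').toEnergySpace

section

variable (w : EnergySpace U l) {χ : ℝ → ℝ} (hχ : ContDiff ℝ ∞ χ)
    {B : ℝ} (hB : ∀ t, |χ t| ≤ B) (hB' : ∀ t, |deriv χ t| ≤ B)

theorem potential_mulFirst : potential (mulFirst w hχ hB hB') =ᵐ[volume.restrict U]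
    fun x => χ (x 0) * potential w x := IsEnergyTriple.potential_toEnergySpace _

theorem grad_mulFirst : grad (mulFirst w hχ hB hB') =ᵐ[volume.restrict U]
    fun x => χ (x 0) • grad w x + (deriv χ (x 0) * potential w x) • EuclideanSpace.single 0 1 :=
  IsEnergyTriple.grad_toEnergySpace _

theorem surfaceTrace_mulFirst :
    surfaceTrace (mulFirst w hχ hB hB') =ᵐ[volume.restrict (surfaceStrip l)]
      fun y => χ (y 0) * surfaceTrace w y := IsEnergyTriple.surfaceTrace_toEnergySpace _

theorem mulFirst_mem_odd (hsym : ∀ x, x ∈ U ↔ reflect x ∈ U) (hU : MeasurableSet U)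
    (hw : w ∈ oddSubspace hsym hU) : mulFirst w hχ hB hB' ∈ oddSubspace hsym hU := by
  refine toEnergySpace_mem_odd hsym hU _ ?_ ?_ ?_
  · filter_upwards [oddOn_of_mem hsym hU hw] with x hx
    rw [hx]; simp [reflect]
  · filter_upwards [oddOn_of_mem hsym hU hw, grad_reflect_of_mem hsym hU hw] with x hx hx2
    have e : ∀ (a b : ℝ) (v z : Space), reflect (a • v + b • z) = a • reflect v + b • reflect z := by
      intro a b v z
      have := map_add reflectIso (a • v) (b • z)
      rw [map_smul, map_smul] at this
      exact this
    have e0 : reflect (EuclideanSpace.single 0 1) = EuclideanSpace.single 0 1 := by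
      ext i; fin_cases i <;> simp [reflect]
    rw [e, hx, hx2, e0]
    simp [reflect, neg_add_rev, add_comm]
  · filter_upwards [surfaceTrace_reflect_of_mem hsym hU hw] with y hy
    rw [hy]; simp [reflectPlane]

end

/-- One factor `χ` is shifted to the other side, so that the right side of the equation tested with
`χ² w` becomes the norm of the trace of `χ w`. -/
theorem norm_sq_surfaceTrace_mulFirst (w : EnergySpace U l) {χ : ℝ → ℝ} (hχ : ContDiff ℝ ∞ χ)
    {B B₂ : ℝ} (hB : ∀ t, |χ t| ≤ B) (hB' : ∀ t, |deriv χ t| ≤ B) (hχ2 : ContDiff ℝ ∞ fun t => χ t ^ 2)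
    (hB2 : ∀ t, |χ t ^ 2| ≤ B₂) (hB2' : ∀ t, |deriv (fun t => χ t ^ 2) t| ≤ B₂) :
    ‖surfaceTrace (mulFirst w hχ hB hB')‖ ^ 2 =
      ⟪surfaceTrace w, surfaceTrace (mulFirst w hχ2 hB2 hB2')⟫_ℝ := by
  rw [← real_inner_self_eq_norm_sq, L2.inner_def, L2.inner_def]
  refine integral_congr_ae ?_
  filter_upwards [surfaceTrace_mulFirst w hχ hB hB', surfaceTrace_mulFirst w hχ2 hB2 hB2']
    with y h1 h2
  rw [h1, h2]
  simp only [RCLike.inner_apply, conj_trivial]; ring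

/-- Pointwise, `|∇(χ w)|² = ∇w · ∇(χ² w) + |χ'|² w²`. This is the identity behind Agmon estimates:
the mixed terms cancel and only the square of `χ'` is left. -/
theorem norm_sq_grad_mulFirst_le (w : EnergySpace U l) {χ : ℝ → ℝ} (hχ : ContDiff ℝ ∞ χ)
    {B B₂ θ : ℝ} (hB : ∀ t, |χ t| ≤ B) (hB' : ∀ t, |deriv χ t| ≤ B)
    (hχ2 : ContDiff ℝ ∞ fun t => χ t ^ 2)
    (hB2 : ∀ t, |χ t ^ 2| ≤ B₂) (hB2' : ∀ t, |deriv (fun t => χ t ^ 2) t| ≤ B₂)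
    (hd : ∀ t, |deriv χ t| ≤ θ * |χ t|) :
    ‖grad (mulFirst w hχ hB hB')‖ ^ 2 ≤ ⟪grad w, grad (mulFirst w hχ2 hB2 hB2')⟫_ℝ +
      θ ^ 2 * ‖potential (mulFirst w hχ hB hB')‖ ^ 2 := by
  rw [← real_inner_self_eq_norm_sq, ← real_inner_self_eq_norm_sq, L2.inner_def, L2.inner_def,
    L2.inner_def, ← integral_const_mul, ← integral_add (L2.integrable_inner _ _)
      ((L2.integrable_inner _ _).const_mul _)]
  refine integral_mono_ae (L2.integrable_inner _ _) ((L2.integrable_inner _ _).add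
      ((L2.integrable_inner _ _).const_mul _)) ?_
  filter_upwards [potential_mulFirst w hχ hB hB', grad_mulFirst w hχ hB hB',
    grad_mulFirst w hχ2 hB2 hB2'] with x h1 h2 h3
  have hd2 : deriv (fun t => χ t ^ 2) (x 0) = 2 * χ (x 0) * deriv χ (x 0) := by
    have h : HasDerivAt (fun t => χ t ^ 2) _ (x 0) :=
      ((hχ.differentiable (by simp)).differentiableAt (x := x 0)).hasDerivAt.pow 2
    rw [h.deriv]; simp
  simp only [h1, h2, h3, hd2]
  have e : ∀ v : Space, ⟪v, EuclideanSpace.single 0 1⟫_ℝ = v 0 := fun v => by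
    rw [EuclideanSpace.inner_single_right]; simp
  simp only [inner_add_left, inner_add_right, inner_smul_left, inner_smul_right, e,
    real_inner_comm _ (EuclideanSpace.single 0 (1 : ℝ) : Space), real_inner_self_eq_norm_sq,
    mul_pow, norm_mul, Real.norm_eq_abs, sq_abs]
  have h5 : deriv χ (x 0) ^ 2 ≤ θ ^ 2 * χ (x 0) ^ 2 := by
    have := pow_le_pow_left₀ (abs_nonneg _) (hd (x 0)) 2
    rwa [sq_abs, mul_pow, sq_abs] at this
  have h6 := mul_le_mul_of_nonneg_right h5 (sq_nonneg (potential w x))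
  simp only [conj_trivial, PiLp.add_apply, PiLp.smul_apply, smul_eq_mul, PiLp.single_apply, if_true]
  linear_combination h6

theorem abs_decayWeight_le (hθ : 0 ≤ θ) (hδ : 0 < δ) (t : ℝ) :
    |decayWeight θ δ t| ≤ (1 + θ) * δ⁻¹ := by
  rw [abs_of_pos (decayWeight_pos hδ t)]
  have h1 := decayWeight_le (θ := θ) hδ t
  have h2 : 0 ≤ θ * δ⁻¹ := by positivity
  linarith

theorem abs_deriv_decayWeight_le' (hθ : 0 ≤ θ) (hδ : 0 < δ) (t : ℝ) :
    |deriv (decayWeight θ δ) t| ≤ (1 + θ) * δ⁻¹ := by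
  have h1 := abs_deriv_decayWeight_le hθ hδ t
  have h2 := mul_le_mul_of_nonneg_left (decayWeight_le (θ := θ) hδ t) hθ
  have h3 : 0 < δ⁻¹ := by positivity
  linarith

theorem abs_decayWeight_sq_le (hθ : 0 ≤ θ) (hδ : 0 < δ) (t : ℝ) :
    |decayWeight θ δ t ^ 2| ≤ (1 + 2 * θ) * δ⁻¹ ^ 2 := by
  rw [abs_of_pos (by have := decayWeight_pos (θ := θ) hδ t; positivity)]
  have h1 := pow_le_pow_left₀ (decayWeight_pos (θ := θ) hδ t).le (decayWeight_le (θ := θ) hδ t) 2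
  have h2 : 0 ≤ 2 * θ * δ⁻¹ ^ 2 := by positivity
  linarith

theorem abs_deriv_decayWeight_sq_le (hθ : 0 ≤ θ) (hδ : 0 < δ) (t : ℝ) :
    |deriv (fun t => decayWeight θ δ t ^ 2) t| ≤ (1 + 2 * θ) * δ⁻¹ ^ 2 := by
  have h : HasDerivAt (fun t => decayWeight θ δ t ^ 2) _ t :=
    (((contDiff_decayWeight hδ).differentiable (by simp)).differentiableAt (x := t)).hasDerivAt.pow 2
  rw [h.deriv]
  have h0 := decayWeight_pos (θ := θ) hδ t
  have h1 := abs_deriv_decayWeight_le hθ hδ t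
  have h2 := decayWeight_le (θ := θ) hδ t
  have h4 : 0 < δ⁻¹ := by positivity
  rw [abs_mul, abs_mul, abs_pow, abs_of_pos h0]
  simp only [Nat.cast_ofNat, Nat.abs_ofNat, Nat.add_one_sub_one, pow_one]
  calc 2 * decayWeight θ δ t * |deriv (decayWeight θ δ) t|
      ≤ 2 * δ⁻¹ * (θ * δ⁻¹) := by
        gcongr; exact h1.trans (by gcongr)
    _ ≤ _ := by nlinarith [sq_nonneg δ⁻¹]

/-- Multiplication of an element of the energy space by the regularized exponential weight. -/
noncomputable def weighted (w : EnergySpace U l) (hθ : 0 ≤ θ) (hδ : 0 < δ) : EnergySpace U l :=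
  mulFirst w (contDiff_decayWeight hδ) (abs_decayWeight_le hθ hδ) (abs_deriv_decayWeight_le' hθ hδ)

end Decay

/-! ### Exponential decay of odd eigenfunctions -/

section DecayEigen

variable {Γ : Set Plane} {Θ : Set Space} {l : ℝ}
  (hsym : ∀ x, x ∈ waterDomain Γ Θ ↔ reflect x ∈ waterDomain Γ Θ)
  (hU : MeasurableSet (waterDomain Γ Θ))

/-- For `|x₁| ≤ R` the weight is at most `exp (θ √(1 + R²))` for every `δ`. Beyond `R` the far bound
applies to the weighted function itself, which is still odd because the weight depends on `x₁`
alone. -/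
theorem norm_sq_surfaceTrace_weighted_le {c : ℝ} (hc : 0 < c) (hfar : HasFarBound Γ l c)
    (hΘ : IsSubmergedBody Γ l Θ) {w : EnergySpace (waterDomain Γ Θ) l}
    (hw : w ∈ oddSubspace hsym hU) {θ : ℝ} (hθ : 0 ≤ θ) :
    ∃ K : ℝ, 0 ≤ K ∧ ∀ (δ : ℝ) (hδ : 0 < δ), ‖surfaceTrace (weighted w hθ hδ)‖ ^ 2 ≤
      K * ‖surfaceTrace w‖ ^ 2 + c * ‖grad (weighted w hθ hδ)‖ ^ 2 := by
  obtain ⟨R, hR0, hR⟩ := hΘ.exists_radius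
  refine ⟨Real.exp (θ * √(1 + (R : ℝ) ^ 2)) ^ 2, by positivity, fun δ hδ => ?_⟩
  set v := weighted w hθ hδ with hv
  have h1 := ofReal_norm_sq_trace_le v R
  have h3 := hfar Θ R hΘ hR0 hR _ _ _ (isEnergyTriple v) (measurable_potential v)
    (oddOn_of_mem hsym hU (mulFirst_mem_odd w _ _ _ hsym hU hw))
  have hsub : {y : Plane | |y 0| ≤ R ∧ |y 1| < l} ⊆ surfaceStrip l := fun y hy => hy.2
  have h2 : ∫⁻ y in {y : Plane | |y 0| ≤ R ∧ |y 1| < l}, ‖surfaceTrace v y‖ₑ ^ 2 ≤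
      ENNReal.ofReal (Real.exp (θ * √(1 + (R : ℝ) ^ 2)) ^ 2) *
        ∫⁻ y in surfaceStrip l, ‖surfaceTrace w y‖ₑ ^ 2 := by
    rw [← lintegral_const_mul' _ _ ENNReal.ofReal_ne_top]
    refine le_trans ?_ (lintegral_mono_set hsub)
    have hmeas : MeasurableSet {y : Plane | |y 0| ≤ R ∧ |y 1| < l} :=
      (isClosed_le (by fun_prop : Continuous fun y : Plane => |y 0|)
        continuous_const).measurableSet.inter (isOpen_surfaceStrip l).measurableSet
    refine lintegral_mono_ae ?_
    filter_upwards [ae_restrict_of_ae_restrict_of_subset hsub (surfaceTrace_mulFirst w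
      (contDiff_decayWeight hδ) (abs_decayWeight_le hθ hδ) (abs_deriv_decayWeight_le' hθ hδ)),
      ae_restrict_mem hmeas] with y hy hy2
    have hy3 : surfaceTrace v y = decayWeight θ δ (y 0) * surfaceTrace w y := hy
    rw [hy3, enorm_mul, mul_pow, ENNReal.ofReal_pow (by positivity)]
    gcongr
    rw [Real.enorm_eq_ofReal (decayWeight_pos hδ _).le]
    refine ENNReal.ofReal_le_ofReal ((decayWeight_le_exp hδ _).trans ?_)
    have : y 0 ^ 2 ≤ (R : ℝ) ^ 2 := sq_le_sq' (abs_le.1 hy2.1).1 (abs_le.1 hy2.1).2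
    gcongr
  rw [← ofReal_norm_sq] at h2 h3
  have h4 := h1.trans (add_le_add h2 h3)
  rw [← ENNReal.ofReal_mul (by positivity), ← ENNReal.ofReal_mul hc.le,
    ← ENNReal.ofReal_add (by positivity) (by positivity),
    ENNReal.ofReal_le_ofReal_iff (by positivity)] at h4
  exact h4

/-- The equation tested with `W² w` bounds the weighted gradient by `λ` times the weighted trace and
`θ²` times the weighted potential. Up to a term independent of `δ`, both are fractions of the same
gradient, so they can be absorbed. -/
theorem exists_weighted_bound (hl : 0 < l) (hΓ : IsCrossSection Γ l) {c lam : ℝ} (hc : 0 < c)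
    (hfar : HasFarBound Γ l c) (hlam : 0 < lam) (hlamc : lam * c ≤ 1 / 2)
    (hΘ : IsSubmergedBody Γ l Θ) {w : EnergySpace (waterDomain Γ Θ) l}
    (hw : w ∈ oddSubspace hsym hU) (heig : IsEigenfunction (waterDomain Γ Θ) l lam w) :
    ∃ (θ : ℝ) (hθ : 0 < θ) (B : ℝ), ∀ (δ : ℝ) (hδ : 0 < δ),
      ‖potential (weighted w hθ.le hδ)‖ ^ 2 ≤ B ∧ ‖grad (weighted w hθ.le hδ)‖ ^ 2 ≤ B ∧
      ‖surfaceTrace (weighted w hθ.le hδ)‖ ^ 2 ≤ B := by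
  obtain ⟨b, hb, hpot⟩ := exists_odd_coercive hsym hU hl hΓ hΘ
  have hθ : 0 < 1 / (2 * √b) := by positivity
  obtain ⟨K, hK, htr⟩ := norm_sq_surfaceTrace_weighted_le hsym hU hc hfar hΘ hw hθ.le
  -- With `b` the constant of the Poincaré inequality for odd functions, this makes the potential
  -- term at most a quarter of the gradient term.
  set θ := 1 / (2 * √b) with hθdef
  have hθb : θ ^ 2 * b = 1 / 4 := by
    rw [hθdef, div_pow, mul_pow, Real.sq_sqrt hb.le]; field_simp; norm_num
  set T := K * ‖surfaceTrace w‖ ^ 2 with hT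
  have hT0 : 0 ≤ T := by positivity
  refine ⟨θ, hθ, b * (4 * lam * T) + 4 * lam * T + (T + c * (4 * lam * T)), fun δ hδ => ?_⟩
  have h1 := htr δ hδ
  have hvodd : weighted w hθ.le hδ ∈ oddSubspace hsym hU := mulFirst_mem_odd w _ _ _ hsym hU hw
  have h2 := hpot _ hvodd
  have h3 := norm_sq_grad_mulFirst_le w (contDiff_decayWeight hδ) (abs_decayWeight_le hθ.le hδ)
    (abs_deriv_decayWeight_le' hθ.le hδ) ((contDiff_decayWeight hδ).pow 2)
    (abs_decayWeight_sq_le hθ.le hδ) (abs_deriv_decayWeight_sq_le hθ.le hδ) (θ := θ) fun t => by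
      rw [abs_of_pos (decayWeight_pos hδ t)]; exact abs_deriv_decayWeight_le hθ.le hδ t
  rw [heig.2, ← norm_sq_surfaceTrace_mulFirst w (contDiff_decayWeight hδ)
    (abs_decayWeight_le hθ.le hδ) (abs_deriv_decayWeight_le' hθ.le hδ)] at h3
  change ‖grad (weighted w hθ.le hδ)‖ ^ 2 ≤ lam * ‖surfaceTrace (weighted w hθ.le hδ)‖ ^ 2 +
    θ ^ 2 * ‖potential (weighted w hθ.le hδ)‖ ^ 2 at h3
  have hx0 : 0 ≤ ‖grad (weighted w hθ.le hδ)‖ ^ 2 := by positivity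
  have hz0 : 0 ≤ ‖potential (weighted w hθ.le hδ)‖ ^ 2 := by positivity
  generalize ‖grad (weighted w hθ.le hδ)‖ ^ 2 = x at h1 h2 h3 hx0 ⊢
  have h4 : 0 ≤ ‖surfaceTrace (weighted w hθ.le hδ)‖ ^ 2 := by positivity
  generalize ‖surfaceTrace (weighted w hθ.le hδ)‖ ^ 2 = y at h1 h3 h4 ⊢
  generalize ‖potential (weighted w hθ.le hδ)‖ ^ 2 = z at h2 h3 hz0 ⊢
  have h5 : 0 ≤ z := hz0
  have h6 : lam * y ≤ lam * T + 1 / 2 * x := by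
    calc lam * y ≤ lam * (T + c * x) := by gcongr
      _ = lam * T + lam * c * x := by ring
      _ ≤ _ := by gcongr
  have h7 : θ ^ 2 * z ≤ 1 / 4 * x := by
    calc θ ^ 2 * z ≤ θ ^ 2 * (b * x) := by gcongr
      _ = _ := by rw [← mul_assoc, hθb]
  -- Absorption: `x ≤ λ T + x / 2 + x / 4`. It is legitimate since the weight is bounded for fixed
  -- `δ`, so `x` is finite.
  have h8 : x ≤ 4 * lam * T := by linarith
  have h9 : b * x ≤ b * (4 * lam * T) := by gcongr
  have h10 : c * x ≤ c * (4 * lam * T) := by gcongr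
  have h11 : 0 ≤ lam * T := by positivity
  have h12 : 0 ≤ b * (4 * lam * T) := by positivity
  have h13 : 0 ≤ c * (4 * lam * T) := by positivity
  refine ⟨by linarith, by linarith, by linarith⟩

/-- The weights with `δ = 1 / (n + 1)` increase to the exponential, and the norms are bounded
uniformly in `n`, so Fatou's lemma applies to all three components. -/
theorem decaysExponentially_of_odd (hl : 0 < l) (hΓ : IsCrossSection Γ l) {c lam : ℝ} (hc : 0 < c)
    (hfar : HasFarBound Γ l c) (hlam : 0 < lam) (hlamc : lam * c ≤ 1 / 2)
    (hΘ : IsSubmergedBody Γ l Θ) {w : EnergySpace (waterDomain Γ Θ) l}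
    (hw : w ∈ oddSubspace hsym hU) (heig : IsEigenfunction (waterDomain Γ Θ) l lam w) :
    DecaysExponentially w := by
  obtain ⟨θ, hθ, B, H⟩ := exists_weighted_bound hsym hU hl hΓ hc hfar hlam hlamc hΘ hw heig
  have hδ : ∀ n : ℕ, 0 < 1 / ((n : ℝ) + 1) := fun n => by positivity
  have hcont : ∀ n : ℕ, Continuous (decayWeight θ (1 / ((n : ℝ) + 1))) := fun n =>
    (contDiff_decayWeight (hδ n)).continuous
  refine ⟨θ, hθ, ?_, ?_, ?_⟩
  · refine memLp_two_of_tendsto (B := ENNReal.ofReal B)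
      (f := fun n x => decayWeight θ (1 / ((n : ℝ) + 1)) (x 0) * potential w x)
      (fun n => ?_) (fun x => (tendsto_decayWeight _).mul_const _) ENNReal.ofReal_ne_top fun n => ?_
    · have := hcont n
      exact (Continuous.aestronglyMeasurable (by fun_prop)).mul (Lp.memLp _).1
    · refine le_trans (le_of_eq ?_) (ENNReal.ofReal_le_ofReal (H _ (hδ n)).1)
      rw [ofReal_norm_sq]
      refine lintegral_congr_ae ?_
      filter_upwards [potential_mulFirst w (contDiff_decayWeight (hδ n))
        (abs_decayWeight_le hθ.le (hδ n)) (abs_deriv_decayWeight_le' hθ.le (hδ n))] with x hx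
      rw [← hx]; rfl
  -- The bound concerns the gradient of the weighted function. The weighted gradient differs from it
  -- by `W' w e₁`, which `|W'| ≤ θ W` controls by the weighted potential.
  · refine memLp_two_of_tendsto (B := 2 * ENNReal.ofReal B + 2 * (ENNReal.ofReal (θ ^ 2) *
      ENNReal.ofReal B))
      (f := fun n x => decayWeight θ (1 / ((n : ℝ) + 1)) (x 0) • grad w x)
      (fun n => ?_) (fun x => (tendsto_decayWeight _).smul_const _) (by
        finiteness) fun n => ?_
    · have := hcont n
      exact (Continuous.aestronglyMeasurable
        (f := fun x : Space => decayWeight θ (1 / ((n : ℝ) + 1)) (x 0)) (by fun_prop)).smul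
          (Lp.memLp (grad w)).1
    · have h1 := ENNReal.ofReal_le_ofReal (H _ (hδ n)).1
      have h2 := ENNReal.ofReal_le_ofReal (H _ (hδ n)).2.1
      rw [ofReal_norm_sq] at h1 h2
      refine le_trans ?_ (add_le_add (mul_le_mul_right h2 2)
        (mul_le_mul_right (mul_le_mul_right h1 (ENNReal.ofReal (θ ^ 2))) 2))
      rw [← lintegral_const_mul' _ _ (by finiteness), ← lintegral_const_mul' _ _ (by finiteness),
        ← lintegral_const_mul' _ _ (by finiteness), ← lintegral_add_left' (by
          exact (((Lp.aestronglyMeasurable _).enorm).pow_const 2).const_mul _)]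
      refine lintegral_mono_ae ?_
      filter_upwards [potential_mulFirst w (contDiff_decayWeight (hδ n))
        (abs_decayWeight_le hθ.le (hδ n)) (abs_deriv_decayWeight_le' hθ.le (hδ n)),
        grad_mulFirst w (contDiff_decayWeight (hδ n))
        (abs_decayWeight_le hθ.le (hδ n)) (abs_deriv_decayWeight_le' hθ.le (hδ n))] with x h3 h4
      refine (enorm_sq_le_add _ (grad (weighted w hθ.le (hδ n)) x)).trans ?_
      gcongr
      have h5 : grad (weighted w hθ.le (hδ n)) x = _ := h4
      have h6 : potential (weighted w hθ.le (hδ n)) x = _ := h3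
      rw [h5, h6, add_sub_cancel_left, enorm_smul, enorm_mul, enorm_mul, mul_pow, mul_pow, mul_pow,
        ← mul_assoc, ENNReal.ofReal_pow hθ.le]
      have h7 : ‖(EuclideanSpace.single 0 1 : Space)‖ₑ = 1 := by
        rw [← ofReal_norm, PiLp.norm_single]; simp
      rw [h7, one_pow, mul_one, ← mul_pow, ← mul_pow, ← mul_pow]
      gcongr
      · rw [Real.enorm_eq_ofReal_abs, Real.enorm_eq_ofReal (decayWeight_pos (hδ n) _).le,
          ← ENNReal.ofReal_mul hθ.le]
        exact ENNReal.ofReal_le_ofReal (abs_deriv_decayWeight_le hθ.le (hδ n) _)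
  · refine memLp_two_of_tendsto (B := ENNReal.ofReal B)
      (f := fun n y => decayWeight θ (1 / ((n : ℝ) + 1)) (y 0) * surfaceTrace w y)
      (fun n => ?_) (fun x => (tendsto_decayWeight _).mul_const _) ENNReal.ofReal_ne_top fun n => ?_
    · have := hcont n
      exact (Continuous.aestronglyMeasurable (by fun_prop)).mul (Lp.memLp _).1
    · refine le_trans (le_of_eq ?_) (ENNReal.ofReal_le_ofReal (H _ (hδ n)).2.2)
      rw [ofReal_norm_sq]
      refine lintegral_congr_ae ?_
      filter_upwards [surfaceTrace_mulFirst w (contDiff_decayWeight (hδ n))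
        (abs_decayWeight_le hθ.le (hδ n)) (abs_deriv_decayWeight_le' hθ.le (hδ n))] with x hx
      rw [← hx]; rfl

end DecayEigen

/-! ### Green's identity for smooth functions on a part of the domain -/

section GreenFlat

theorem splitCoord_symm_one (t : ℝ) (y : Plane) :
    (splitCoord 1).symm (t, y) = !₂[y 0, t, y 1] := by
  ext j
  fin_cases j <;> simp [splitCoord, MeasurableEquiv.piFinSuccAbove]
  all_goals rfl

theorem splitCoord_symm_eq_add (i : Fin 3) (t : ℝ) (y : Plane) :
    (splitCoord i).symm (t, y) = (splitCoord i).symm (0, y) + t • EuclideanSpace.single i 1 := by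
  fin_cases i
  · change (splitCoord 0).symm (t, y) = (splitCoord 0).symm (0, y) + t • EuclideanSpace.single 0 1
    rw [splitCoord_symm_zero, splitCoord_symm_zero]
    ext j; fin_cases j <;> simp
  · change (splitCoord 1).symm (t, y) = (splitCoord 1).symm (0, y) + t • EuclideanSpace.single 1 1
    rw [splitCoord_symm_one, splitCoord_symm_one]
    ext j; fin_cases j <;> simp
  · change (splitCoord 2).symm (t, y) = (splitCoord 2).symm (0, y) + t • EuclideanSpace.single 2 1
    rw [splitCoord_symm_two, splitCoord_symm_two]
    ext j; fin_cases j <;> simp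

theorem hasDerivAt_splitCoord_symm (i : Fin 3) (t : ℝ) (y : Plane) :
    HasDerivAt (fun t => (splitCoord i).symm (t, y)) (EuclideanSpace.single i 1) t := by
  have : (fun t => (splitCoord i).symm (t, y)) = fun t =>
      (splitCoord i).symm (0, y) + t • EuclideanSpace.single i 1 :=
    funext fun t => splitCoord_symm_eq_add i t y
  rw [this]
  simpa using ((hasDerivAt_id t).smul_const (EuclideanSpace.single i (1 : ℝ) : Space)).const_add
    ((splitCoord i).symm (0, y))

/-- The jump of the indicator is invisible because `Ξ` vanishes in a neighbourhood of the boundary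
point. -/
theorem hasFDerivAt_indicator {V : Set Space} (hV : IsOpen V) {Ξ : Space → ℝ}
    (hΞ : Differentiable ℝ Ξ) {x : Space} (hx : x ∈ frontier V → x ∉ tsupport Ξ) :
    HasFDerivAt (V.indicator Ξ) (V.indicator (fderiv ℝ Ξ) x) x := by
  by_cases hxV : x ∈ V
  · rw [indicator_of_mem hxV]
    refine (hΞ x).hasFDerivAt.congr_of_eventuallyEq ?_
    filter_upwards [hV.mem_nhds hxV] with z hz
    rw [indicator_of_mem hz]
  · rw [indicator_of_notMem hxV]
    refine (hasFDerivAt_const (0 : ℝ) x).congr_of_eventuallyEq ?_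
    by_cases hxc : x ∈ closure V
    · have hfr : x ∈ frontier V := ⟨hxc, fun h => hxV (interior_subset h)⟩
      filter_upwards [(isClosed_tsupport Ξ).isOpen_compl.mem_nhds (hx hfr)] with z hz
      rw [indicator_apply_eq_zero]
      exact fun _ => image_eq_zero_of_notMem_tsupport hz
    · filter_upwards [isClosed_closure.isOpen_compl.mem_nhds hxc] with z hz
      exact indicator_of_notMem (fun h => hz (subset_closure h)) _

/-- The divergence theorem for a function which vanishes near the part of the boundary of `V` lying
below the plane `x₃ = 0`. -/
theorem setIntegral_fderiv_eq {V : Set Space} (hV : IsOpen V) (hlow : ∀ x ∈ V, x 2 < 0)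
    {Ξ : Space → ℝ} (hΞ : ContDiff ℝ ∞ Ξ) (hc : HasCompactSupport Ξ)
    (hfr : ∀ x ∈ frontier V, x ∈ tsupport Ξ → 0 ≤ x 2) {k : Plane → ℝ}
    (hlim : ∀ y : Plane, Tendsto (fun t : ℝ => V.indicator Ξ !₂[y 0, y 1, t]) (𝓝[<] 0) (𝓝 (k y)))
    (i : Fin 3) :
    ∫ x in V, fderiv ℝ Ξ x (EuclideanSpace.single i 1) = if i = 2 then ∫ y, k y else 0 := by
  set F : Space → ℝ := V.indicator fun x => fderiv ℝ Ξ x (EuclideanSpace.single i 1) with hF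
  have hd : ∀ x : Space, x 2 < 0 → HasFDerivAt (V.indicator Ξ) (V.indicator (fderiv ℝ Ξ) x) x :=
    fun x hx => hasFDerivAt_indicator hV (hΞ.differentiable (by simp)) fun h1 h2 =>
      absurd (hfr x h1 h2) (not_le.2 hx)
  have hFd : ∀ x, V.indicator (fderiv ℝ Ξ) x (EuclideanSpace.single i 1) = F x := fun x => by
    by_cases hx : x ∈ V <;> simp [hF, hx]
  have hline : ∀ (y : Plane) (t : ℝ), (splitCoord i).symm (t, y) 2 < 0 →
      HasDerivAt (fun t => V.indicator Ξ ((splitCoord i).symm (t, y)))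
        (F ((splitCoord i).symm (t, y))) t := fun y t ht => by
    rw [← hFd]
    exact (hd _ ht).comp_hasDerivAt t (hasDerivAt_splitCoord_symm i t y)
  have hcont : Continuous fun x => fderiv ℝ Ξ x (EuclideanSpace.single i 1) :=
    (hΞ.continuous_fderiv (by simp)).clm_apply continuous_const
  have hFi : Integrable F := by
    refine Integrable.indicator ?_ hV.measurableSet
    exact hcont.integrable_of_hasCompactSupport (hc.fderiv_apply ℝ _)
  have hfi : Integrable (V.indicator Ξ) :=
    (hΞ.continuous.integrable_of_hasCompactSupport hc).indicator hV.measurableSet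
  have mp := (measurePreserving_splitCoord i).symm
  have hFi2 : Integrable (fun p => F ((splitCoord i).symm p)) (volume.prod volume) :=
    mp.integrable_comp_of_integrable hFi
  have hfi2 : Integrable (fun p => V.indicator Ξ ((splitCoord i).symm p)) (volume.prod volume) :=
    mp.integrable_comp_of_integrable hfi
  have hzero : ∀ x : Space, 0 ≤ x 2 → F x = 0 := fun x hx =>
    indicator_of_notMem (fun h => absurd (hlow x h) (not_lt.2 hx)) _
  -- Fubini along the lines in the direction `i`, on which the integral is one of a derivative.
  have main : ∫ x in V, fderiv ℝ Ξ x (EuclideanSpace.single i 1) =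
      ∫ y : Plane, ∫ t : ℝ, F ((splitCoord i).symm (t, y)) := by
    rw [← integral_indicator hV.measurableSet, ← mp.integral_comp', ← hF]
    exact integral_prod_symm _ hFi2
  rw [main]
  by_cases hi : i = 2
  · subst hi
    rw [if_pos rfl]
    refine integral_congr_ae ?_
    filter_upwards [hFi2.prod_left_ae, hfi2.prod_left_ae] with y h1 h2
    simp only [splitCoord_symm_two] at h1 h2 hline ⊢
    have e : ∫ t : ℝ, F !₂[y 0, y 1, t] = ∫ t in Iic (0 : ℝ), F !₂[y 0, y 1, t] := by
      rw [setIntegral_eq_integral_of_forall_compl_eq_zero]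
      intro t ht
      refine hzero _ ?_
      simpa using (not_le.1 ht).le
    rw [e]
    -- `V` lies strictly below the plane, so the indicator is zero at `t = 0`. Its value there is
    -- replaced by the one-sided limit `k y`, which makes the fundamental theorem of calculus on
    -- `(-∞, 0]` applicable.
    have hl2 : ∀ t ∈ Iio (0 : ℝ), HasDerivAt (Function.update
        (fun t => V.indicator Ξ !₂[y 0, y 1, t]) 0 (k y)) (F !₂[y 0, y 1, t]) t := by
      intro t ht
      refine (hline y t (by simpa using ht)).congr_of_eventuallyEq ?_
      filter_upwards [isOpen_ne.mem_nhds (ne_of_lt ht)] with s hs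
      rw [Function.update_of_ne hs]
    have hl3 : ContinuousWithinAt (Function.update
        (fun t => V.indicator Ξ !₂[y 0, y 1, t]) 0 (k y)) (Iic 0) 0 := by
      rw [continuousWithinAt_update_same]
      simpa using hlim y
    have hbot : Tendsto (Function.update (fun t => V.indicator Ξ !₂[y 0, y 1, t]) 0 (k y)) atBot
        (𝓝 0) := by
      refine tendsto_zero_of_hasDerivAt_of_integrableOn_Iic (a := -1)
        (fun t ht => hl2 t (lt_of_le_of_lt (mem_Iic.1 ht) (by norm_num : (-1 : ℝ) < 0))) h1.integrableOn ?_
      refine h2.integrableOn.congr_fun (fun t ht => ?_) measurableSet_Iic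
      rw [Function.update_of_ne]
      exact ne_of_lt (lt_of_le_of_lt (mem_Iic.1 ht) (by norm_num : (-1 : ℝ) < 0))
    rw [integral_Iic_of_hasDerivAt_of_tendsto hl3 hl2 h1.integrableOn hbot]
    simp
  -- A horizontal line lies either below the surface, where the integral of an integrable derivative
  -- over the whole line is zero, or in `x₃ ≥ 0`, where `F` vanishes.
  · rw [if_neg hi]
    refine integral_eq_zero_of_ae ?_
    filter_upwards [hFi2.prod_left_ae, hfi2.prod_left_ae] with y h1 h2
    have hconst : ∀ t, (splitCoord i).symm (t, y) 2 = (splitCoord i).symm (0, y) 2 := fun t => by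
      rw [splitCoord_symm_eq_add]
      have : (2 : Fin 3) ≠ i := fun h => hi h.symm
      simp [this]
    by_cases hneg : (splitCoord i).symm (0, y) 2 < 0
    · exact integral_eq_zero_of_hasDerivAt_of_integrable
        (fun t => hline y t (by rw [hconst]; exact hneg)) h1 h2
    · refine integral_eq_zero_of_ae (ae_of_all _ fun t => hzero _ ?_)
      rw [hconst]; exact not_lt.1 hneg

/-- The restriction of a smooth function to a part `V` of `U` is an energy triple if `V` has no
boundary inside `U` where this function does not vanish. -/
theorem isEnergyTriple_indicator {U V : Set Space} {l : ℝ} {J : Set Plane} (hV : IsOpen V)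
    (hVU : V ⊆ U) (hlow : ∀ x ∈ V, x 2 < 0)
    (hJl : J ⊆ surfaceStrip l) {Z : Space → ℝ} (hZ : ContDiff ℝ ∞ Z)
    (m1 : MemLp (V.indicator Z) 2 (volume.restrict U))
    (m2 : MemLp (V.indicator (gradient Z)) 2 (volume.restrict U))
    (m3 : MemLp (J.indicator fun y => Z (toSurface y)) 2 (volume.restrict (surfaceStrip l)))
    (hfr : ∀ φ, IsTestFunction U l φ → ∀ x ∈ frontier V, x ∈ tsupport φ → x ∈ tsupport Z → 0 ≤ x 2)
    (hlim : ∀ φ, IsTestFunction U l φ → ∀ y : Plane,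
      Tendsto (fun t : ℝ => V.indicator (fun x => Z x * φ x) !₂[y 0, y 1, t]) (𝓝[<] 0)
        (𝓝 (J.indicator (fun y => Z (toSurface y) * φ (toSurface y)) y))) :
    IsEnergyTriple U l (V.indicator Z) (V.indicator (gradient Z))
      (J.indicator fun y => Z (toSurface y)) := by
  refine ⟨m1, m2, m3, fun φ hφ i => ?_⟩
  have key := setIntegral_fderiv_eq hV hlow (hZ.mul hφ.smooth) (hφ.compact.mul_left (f := Z))
    (fun x h1 h2 => hfr φ hφ x h1 (tsupport_mul_subset_right h2) (tsupport_mul_subset_left h2))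
    (hlim φ hφ) i
  have hgrad : ∀ x, gradient Z x i = fderiv ℝ Z x (EuclideanSpace.single i 1) := fun x => by
    have : ⟪gradient Z x, EuclideanSpace.single i 1⟫_ℝ = fderiv ℝ Z x (EuclideanSpace.single i 1) := by
      rw [gradient, InnerProductSpace.toDual_symm_apply]
    rw [← this, EuclideanSpace.inner_single_right]; simp
  have e1 : ∫ x in U, V.indicator Z x * fderiv ℝ φ x (EuclideanSpace.single i 1) =
      ∫ x in V, Z x * fderiv ℝ φ x (EuclideanSpace.single i 1) := by
    have : ∀ x, V.indicator Z x * fderiv ℝ φ x (EuclideanSpace.single i 1) =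
        V.indicator (fun x => Z x * fderiv ℝ φ x (EuclideanSpace.single i 1)) x := fun x => by
      by_cases hx : x ∈ V <;> simp [hx]
    simp_rw [this]
    rw [integral_indicator hV.measurableSet, Measure.restrict_restrict hV.measurableSet,
      inter_eq_left.2 hVU]
  have e2 : ∫ x in U, V.indicator (gradient Z) x i * φ x =
      ∫ x in V, fderiv ℝ Z x (EuclideanSpace.single i 1) * φ x := by
    have : ∀ x, V.indicator (gradient Z) x i * φ x =
        V.indicator (fun x => fderiv ℝ Z x (EuclideanSpace.single i 1) * φ x) x := fun x => by
      by_cases hx : x ∈ V <;> simp [hx, hgrad]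
    simp_rw [this]
    rw [integral_indicator hV.measurableSet, Measure.restrict_restrict hV.measurableSet,
      inter_eq_left.2 hVU]
  have e3 : ∫ y in surfaceStrip l, J.indicator (fun y => Z (toSurface y)) y * φ (toSurface y) =
      ∫ y, J.indicator (fun y => Z (toSurface y) * φ (toSurface y)) y := by
    have : ∀ y, J.indicator (fun y => Z (toSurface y)) y * φ (toSurface y) =
        J.indicator (fun y => Z (toSurface y) * φ (toSurface y)) y := fun y => by
      by_cases hy : y ∈ J <;> simp [hy]
    simp_rw [this]
    rw [setIntegral_eq_integral_of_forall_compl_eq_zero]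
    exact fun y hy => indicator_of_notMem (fun h => hy (hJl h)) _
  have hcomp : ∀ {f : Space → ℝ}, Continuous f → HasCompactSupport f → IntegrableOn f V :=
    fun h1 h2 => (h1.integrable_of_hasCompactSupport h2).integrableOn
  have hZd : Continuous fun x => fderiv ℝ Z x (EuclideanSpace.single i 1) :=
    (hZ.continuous_fderiv (by simp)).clm_apply continuous_const
  have hφd : Continuous fun x => fderiv ℝ φ x (EuclideanSpace.single i 1) :=
    (hφ.smooth.continuous_fderiv (by simp)).clm_apply continuous_const
  rw [e1, e2, e3, ← key, ← integral_add]
  · refine integral_congr_ae (ae_of_all _ fun x => ?_)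
    have h1 := (hZ.differentiable (by simp) x).hasFDerivAt.mul
      (hφ.smooth.differentiable (by simp) x).hasFDerivAt
    have h2 : HasFDerivAt (fun x => Z x * φ x) _ x := h1
    simp only
    rw [h2.fderiv]
    simp [mul_comm]
  · exact hcomp (hZ.continuous.mul hφd) (hφ.compact.fderiv_apply ℝ _).mul_left
  · exact hcomp (hZd.mul hφ.smooth.continuous) hφ.compact.mul_left

theorem tendsto_vertical (y : Plane) :
    Tendsto (fun t : ℝ => (!₂[y 0, y 1, t] : Space)) (𝓝[<] 0) (𝓝 (toSurface y)) := by
  have h : Continuous fun t : ℝ => (!₂[y 0, y 1, t] : Space) := by fun_prop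
  exact (h.tendsto 0).mono_left nhdsWithin_le_nhds

theorem tendsto_indicator_of_eventually_mem {V : Set Space} {J : Set Plane} {f : Space → ℝ}
    (hf : Continuous f) {y : Plane} (hy : y ∈ J)
    (h : ∀ᶠ t : ℝ in 𝓝[<] 0, !₂[y 0, y 1, t] ∈ V) :
    Tendsto (fun t : ℝ => V.indicator f !₂[y 0, y 1, t]) (𝓝[<] 0)
      (𝓝 (J.indicator (fun y => f (toSurface y)) y)) := by
  rw [indicator_of_mem hy]
  refine ((hf.tendsto _).comp (tendsto_vertical y)).congr' ?_
  filter_upwards [h] with t ht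
  simp [ht]

theorem tendsto_indicator_of_notMem_tsupport {V : Set Space} {J : Set Plane} {f : Space → ℝ}
    {y : Plane} (hy : toSurface y ∉ tsupport f) :
    Tendsto (fun t : ℝ => V.indicator f !₂[y 0, y 1, t]) (𝓝[<] 0)
      (𝓝 (J.indicator (fun y => f (toSurface y)) y)) := by
  have e : J.indicator (fun y => f (toSurface y)) y = 0 := by
    rw [indicator_apply_eq_zero]
    exact fun _ => image_eq_zero_of_notMem_tsupport hy
  rw [e]
  refine tendsto_const_nhds.congr' ?_
  filter_upwards [(tendsto_vertical y).eventually
    ((isClosed_tsupport f).isOpen_compl.mem_nhds hy)] with t ht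
  symm
  rw [indicator_apply_eq_zero]
  exact fun _ => image_eq_zero_of_notMem_tsupport ht

theorem tendsto_indicator_of_notMem_closure {V : Set Space} {J : Set Plane} {f : Space → ℝ}
    {y : Plane} (hyJ : y ∉ J) (hy : toSurface y ∉ closure V) :
    Tendsto (fun t : ℝ => V.indicator f !₂[y 0, y 1, t]) (𝓝[<] 0)
      (𝓝 (J.indicator (fun y => f (toSurface y)) y)) := by
  rw [indicator_of_notMem hyJ]
  refine tendsto_const_nhds.congr' ?_
  filter_upwards [(tendsto_vertical y).eventually
    (isClosed_closure.isOpen_compl.mem_nhds hy)] with t ht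
  exact (indicator_of_notMem (fun h => ht (subset_closure h)) _).symm

end GreenFlat

/-! ### Trial functions on the rectangle -/

section TrialFunctions

/-- The open rectangle `{|y_i| < A_i / 2}`. -/
def rectangle (A : Fin 2 → ℝ) : Set Plane := {y | |y 0| < A 0 / 2 ∧ |y 1| < A 1 / 2}

theorem isOpen_rectangle (A : Fin 2 → ℝ) : IsOpen (rectangle A) :=
  (isOpen_lt (by fun_prop : Continuous fun y : Plane => |y 0|) continuous_const).inter
    (isOpen_lt (by fun_prop : Continuous fun y : Plane => |y 1|) continuous_const)

/-- Products of bumps in `x₁` with disjoint supports and one fixed odd function of `x₂`.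
Disjointness makes the traces orthogonal, so lower bounds for linear combinations need no
diagonalization. -/
theorem exists_trial_functions {A : Fin 2 → ℝ} (hA : ∀ i, 0 < A i) (N : ℕ) :
    ∃ ζ : Fin N → Plane → ℝ, (∀ k, ContDiff ℝ ∞ (ζ k) ∧ HasCompactSupport (ζ k) ∧
      tsupport (ζ k) ⊆ rectangle A ∧ (∀ y, ζ k (reflectPlane y) = -ζ k y) ∧
      0 < ∫ y, ζ k y ^ 2) ∧ ∀ i j, i ≠ j → ∀ y, ζ i y * ζ j y = 0 := by
  have hA0 := hA 0
  have hA1 := hA 1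
  rcases Nat.eq_zero_or_pos N with hN | hN
  · subst hN
    exact ⟨fun _ _ => 0, fun k => k.elim0, fun i => i.elim0⟩
  have hN' : (0 : ℝ) < N := by exact_mod_cast hN
  -- Midpoints of `N` equal subintervals. The bumps have outer radius one quarter of the spacing, so
  -- they are disjoint and stay away from the ends of the rectangle.
  let c : Fin N → ℝ := fun k => -(A 0 / 2) + A 0 / N * (k + 1 / 2)
  let b : ∀ k, ContDiffBump (c k) := fun k =>
    ⟨A 0 / (8 * N), A 0 / (4 * N), by positivity, by gcongr; norm_num⟩
  let b' : ContDiffBump (0 : ℝ) := ⟨A 1 / 8, A 1 / 4, by positivity, by gcongr; norm_num⟩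
  have hbz : ∀ k t, b k t ≠ 0 → |t - c k| < A 0 / (4 * N) := fun k t ht => by
    by_contra h
    exact ht ((b k).zero_of_le_dist (by rw [Real.dist_eq]; exact not_lt.1 h))
  have hbz' : ∀ t, b' t ≠ 0 → |t| < A 1 / 4 := fun t ht => by
    by_contra h
    exact ht (b'.zero_of_le_dist (by rw [Real.dist_eq, sub_zero]; exact not_lt.1 h))
  let ζ : Fin N → Plane → ℝ := fun k y => b k (y 0) * (y 1 * b' (y 1))
  have hs : ∀ k, ContDiff ℝ ∞ (ζ k) := fun k => by
    have h0 : ContDiff ℝ ∞ fun y : Plane => y 0 := by fun_prop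
    have h1 : ContDiff ℝ ∞ fun y : Plane => y 1 := by fun_prop
    exact ((b k).contDiff.comp h0).mul (h1.mul (b'.contDiff.comp h1))
  have hnz : ∀ k y, ζ k y ≠ 0 → |y 0 - c k| < A 0 / (4 * N) ∧ |y 1| < A 1 / 4 := fun k y h => by
    simp only [ζ, mul_ne_zero_iff] at h
    exact ⟨hbz k _ h.1, hbz' _ h.2.2⟩
  have hck : ∀ k t, |t - c k| ≤ A 0 / (4 * N) → |t| < A 0 / 2 := fun k t ht => by
    have hk : ((k : ℕ) : ℝ) + 1 ≤ N := by exact_mod_cast k.2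
    have hk0 : (0 : ℝ) ≤ (k : ℕ) := by positivity
    set q := A 0 / (4 * N) with hq
    have hq0 : 0 < q := by positivity
    have e1 : A 0 / N = 4 * q := by rw [hq]; field_simp
    have e2 : A 0 / 2 = 2 * (N * q) := by rw [hq]; field_simp; norm_num
    have e3 : c k = -(A 0 / 2) + 4 * q * (k + 1 / 2) := by simp only [c]; rw [e1]
    have h4 := mul_le_mul_of_nonneg_right hk hq0.le
    have h5 := mul_nonneg hk0 hq0.le
    rw [abs_le] at ht
    rw [abs_lt]
    constructor <;> nlinarith
  have hcpt : ∀ k, HasCompactSupport (ζ k) := fun k => by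
    refine HasCompactSupport.intro (isCompact_closedBall (0 : Plane) (A 0 + A 1)) fun y hy => ?_
    by_contra h
    obtain ⟨h1, h2⟩ := hnz k y h
    have h3 := hck k _ h1.le
    apply hy
    rw [mem_closedBall_zero_iff, EuclideanSpace.norm_eq, Fin.sum_univ_two]
    refine Real.sqrt_le_iff.2 ⟨by positivity, ?_⟩
    simp only [Real.norm_eq_abs, sq_abs]
    nlinarith [abs_nonneg (y 0), abs_nonneg (y 1), sq_abs (y 0), sq_abs (y 1)]
  refine ⟨ζ, fun k => ⟨hs k, hcpt k, ?_, fun y => ?_, ?_⟩, ?_⟩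
  · have hcl : IsClosed {y : Plane | |y 0 - c k| ≤ A 0 / (4 * N) ∧ |y 1| ≤ A 1 / 4} :=
      (isClosed_le (by fun_prop : Continuous fun y : Plane => |y 0 - c k|) continuous_const).inter
        (isClosed_le (by fun_prop : Continuous fun y : Plane => |y 1|) continuous_const)
    refine (closure_minimal (fun y hy => ?_) hcl).trans fun y hy => ?_
    · exact ⟨(hnz k y hy).1.le, (hnz k y hy).2.le⟩
    · exact ⟨hck k _ hy.1, by linarith [hy.2]⟩
  · simp [ζ, reflectPlane, b'.neg]
  · refine Continuous.integral_pos_of_hasCompactSupport_nonneg_nonzero (x := !₂[c k, A 1 / 8])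
      ((hs k).continuous.pow 2) ?_ (fun y => sq_nonneg _) ?_
    · exact (hcpt k).comp_left (g := fun t => t ^ 2) (by simp)
    · have h1 : 0 < b k (c k) := (b k).pos_of_mem_ball (Metric.mem_ball_self (b k).rOut_pos)
      have h2 : 0 < b' (A 1 / 8) := b'.pos_of_mem_ball (by
        change dist (A 1 / 8) 0 < A 1 / 4
        rw [Real.dist_eq, sub_zero, abs_of_pos (by positivity)]; linarith)
      simp [ζ, h1.ne', h2.ne', hA1.ne']
  · intro i j hij y
    by_contra h
    rw [← ne_eq, mul_ne_zero_iff] at h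
    have h1 := (hnz i y h.1).1
    have h2 := (hnz j y h.2).1
    set q := A 0 / (4 * N) with hq
    have hq0 : 0 < q := by positivity
    have e1 : A 0 / N = 4 * q := by rw [hq]; field_simp
    have h3 : |c i - c j| < 2 * q := by
      have := abs_sub_le (c i) (y 0) (c j)
      rw [abs_sub_comm (c i) (y 0)] at this
      linarith
    have e3 : c i - c j = 4 * q * ((i : ℕ) - (j : ℕ) : ℝ) := by simp only [c]; rw [e1]; ring
    rw [e3, abs_mul, abs_of_pos (by positivity)] at h3
    have h4 : (1 : ℝ) ≤ |((i : ℕ) : ℝ) - (j : ℕ)| := by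
      have : (1 : ℤ) ≤ |((i : ℕ) : ℤ) - (j : ℕ)| := by
        refine Int.one_le_abs ?_
        intro h0
        apply hij
        ext
        omega
      exact_mod_cast this
    nlinarith

end TrialFunctions

/-! ### Geometry of the periodic plate -/

section Plate

variable {ε h H : ℝ} {a A : Fin 2 → ℝ} {n : Fin 2 → ℕ} {C : Set Space}

theorem closure_scaledCell_subset (hε : 0 < ε) (hC : C ⊆ cellBox a H) (j : Fin 2 → ℕ) :
    closure (scaledCell ε a n C j) ⊆ {x | -(ε * H) ≤ x 2} := by
  refine closure_minimal (fun x hx => ?_) (isClosed_le continuous_const (by fun_prop))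
  have h1 := (hC hx).2.2.1
  simp only [Matrix.cons_val] at h1
  rw [lt_div_iff₀ hε] at h1
  simp only [mem_ofPred_eq]; linarith

theorem plate_subset (hε : 0 < ε) (hC : C ⊆ cellBox a H) :
    plate ε a n C ⊆ {x | -(ε * H) ≤ x 2} :=
  interior_subset.trans (iUnion₂_subset fun j _ => closure_scaledCell_subset hε hC j)

/-- In units of `L` counted from the left end of the array, the point is `t = s / L + k / 2`, and
`⌊t⌋` is the number of a closed cell that contains it. -/
theorem exists_index {L : ℝ} {k : ℕ} {s : ℝ} (hL : 0 < L) (hs : |s| < L * k / 2) :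
    ∃ j < k, |s - ((j : ℝ) - ((k : ℝ) - 1) / 2) * L| ≤ L / 2 := by
  rw [abs_lt] at hs
  set t := s / L + k / 2 with ht
  have hst : s = L * (t - k / 2) := by rw [ht]; field_simp; ring
  have ht0 : 0 < t := by
    by_contra hcon
    have : L * t ≤ 0 := mul_nonpos_of_nonneg_of_nonpos hL.le (not_lt.1 hcon)
    linarith [hs.1, mul_sub L t (k / 2), mul_div_assoc L (k : ℝ) 2]
  have htk : t < k := by
    by_contra hcon
    have : L * k ≤ L * t := mul_le_mul_of_nonneg_left (not_lt.1 hcon) hL.le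
    linarith [hs.2, mul_sub L t (k / 2), mul_div_assoc L (k : ℝ) 2]
  refine ⟨⌊t⌋₊, (Nat.floor_lt ht0.le).2 htk, ?_⟩
  have h1 := Nat.floor_le ht0.le
  have h2 := Nat.lt_floor_add_one t
  have e : s - ((⌊t⌋₊ : ℝ) - ((k : ℝ) - 1) / 2) * L = (t - ⌊t⌋₊ - 1 / 2) * L := by rw [hst]; ring
  rw [e, abs_mul, abs_of_pos hL]
  have : |t - ⌊t⌋₊ - 1 / 2| ≤ 1 / 2 := by rw [abs_le]; constructor <;> linarith
  nlinarith

/-- The flat layer under the rectangle is contained in the plate. -/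
theorem layer_subset_plate (hε : 0 < ε) (ha : ∀ i, 0 < a i) (hA : ∀ i, A i = ε * a i * n i)
    (hC : cellBox a h ⊆ C) :
    {x : Space | |x 0| < A 0 / 2 ∧ |x 1| < A 1 / 2 ∧ -(ε * h) < x 2 ∧ x 2 < 0} ⊆
      plate ε a n C := by
  refine interior_maximal ?_ ?_
  · rintro x ⟨h0, h1, h2, h3⟩
    rw [hA] at h0 h1
    obtain ⟨j0, hj0, hs0⟩ := exists_index (mul_pos hε (ha 0)) h0
    obtain ⟨j1, hj1, hs1⟩ := exists_index (mul_pos hε (ha 1)) h1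
    refine mem_iUnion₂.2 ⟨![j0, j1], ?_, ?_⟩
    · intro i; fin_cases i <;> simpa
    · set s0 := x 0 - ((j0 : ℝ) - ((n 0 : ℝ) - 1) / 2) * (ε * a 0) with hs0'
      set s1 := x 1 - ((j1 : ℝ) - ((n 1 : ℝ) - 1) / 2) * (ε * a 1) with hs1'
      -- The point may lie on a face between cells. Contraction towards the vertical axis of the
      -- cell moves it into the open cell for `0 < t < 1`, so `x` is in the closure.
      have hcont : Continuous fun t : ℝ => (!₂[x 0 - t * s0, x 1 - t * s1, x 2] : Space) := by
        fun_prop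
      have hlim : Tendsto (fun t : ℝ => (!₂[x 0 - t * s0, x 1 - t * s1, x 2] : Space)) (𝓝[>] 0)
          (𝓝 x) := by
        have := (hcont.tendsto 0).mono_left (nhdsWithin_le_nhds (s := Ioi 0))
        convert this using 2
        ext i; fin_cases i <;> simp
      refine mem_closure_of_tendsto hlim ?_
      filter_upwards [Ioo_mem_nhdsGT (zero_lt_one (α := ℝ))] with t ht
      apply hC
      have ht1 : 0 < 1 - t := by linarith [ht.2]
      have key : ∀ {s L : ℝ}, 0 < L → |s| ≤ ε * L / 2 → |(1 - t) * s / ε| < L / 2 := by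
        intro s L hL hs
        rw [abs_div, abs_mul, abs_of_pos hε, abs_of_pos ht1, div_lt_iff₀ hε]
        have h5 : 0 < ε * L / 2 := by positivity
        calc (1 - t) * |s| ≤ (1 - t) * (ε * L / 2) := by gcongr
          _ < 1 * (ε * L / 2) := by gcongr; linarith [ht.1]
          _ = L / 2 * ε := by ring
      have e0 : (x 0 - t * s0) / ε - ((j0 : ℝ) - ((n 0 : ℝ) - 1) / 2) * a 0 = (1 - t) * s0 / ε := by
        rw [hs0']; field_simp; ring
      have e1 : (x 1 - t * s1) / ε - ((j1 : ℝ) - ((n 1 : ℝ) - 1) / 2) * a 1 = (1 - t) * s1 / ε := by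
        rw [hs1']; field_simp; ring
      simp only [cellBox, mem_ofPred_eq, Matrix.cons_val, Fin.isValue]
      refine ⟨?_, ?_, ?_, ?_⟩
      · rw [e0]; exact key (ha 0) hs0
      · rw [e1]; exact key (ha 1) hs1
      · rw [lt_div_iff₀ hε]; linarith
      · exact div_neg_of_neg_of_pos h3 hε
  · have h1 : IsOpen {x : Space | |x 0| < A 0 / 2} := isOpen_lt (by fun_prop) continuous_const
    have h2 : IsOpen {x : Space | |x 1| < A 1 / 2} := isOpen_lt (by fun_prop) continuous_const
    have h3 : IsOpen {x : Space | -(ε * h) < x 2} := isOpen_lt continuous_const (by fun_prop)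
    have h4 : IsOpen {x : Space | x 2 < 0} := isOpen_lt (by fun_prop) continuous_const
    exact h1.inter (h2.inter (h3.inter h4))

end Plate

/-! ### Trial elements of the energy space supported by the plate -/

section TrialElements

variable {Γ : Set Plane} {Θ : Set Space} {l ε h H : ℝ} {a A : Fin 2 → ℝ} {n : Fin 2 → ℕ}
  {C : Set Space}

/-- The projection `(x₁, x₂, x₃) ↦ (x₁, x₂)`. -/
noncomputable def horizontalL : Space →L[ℝ] Plane :=
  (PiLp.continuousLinearEquiv 2 ℝ fun _ : Fin 2 => ℝ).symm.toContinuousLinearMap ∘L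
    ContinuousLinearMap.pi ![EuclideanSpace.proj (𝕜 := ℝ) (0 : Fin 3), EuclideanSpace.proj 1]

theorem horizontalL_apply (x : Space) : horizontalL x = !₂[x 0, x 1] := by
  ext i; fin_cases i <;> simp [horizontalL]

theorem horizontalL_toSurface (y : Plane) : horizontalL (toSurface y) = y := by
  rw [horizontalL_apply]; ext i; fin_cases i <;> simp [toSurface]

theorem horizontalL_reflect (x : Space) : horizontalL (reflect x) = reflectPlane (horizontalL x) := by
  rw [horizontalL_apply, horizontalL_apply]
  ext i; fin_cases i <;> simp [reflect, reflectPlane]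

/-- The part of the plate which is symmetric and lies under the open rectangle. -/
def plateCore (A : Fin 2 → ℝ) (Ω : Set Space) : Set Space :=
  {x | x ∈ Ω ∧ reflect x ∈ Ω ∧ horizontalL x ∈ rectangle A ∧ x 2 < 0}

theorem isOpen_plateCore {Ω : Set Space} (hΩ : IsOpen Ω) : IsOpen (plateCore A Ω) :=
  hΩ.inter ((hΩ.preimage continuous_reflect).inter
    (((isOpen_rectangle A).preimage horizontalL.continuous).inter
      (isOpen_lt (by fun_prop : Continuous fun x : Space => x 2) continuous_const)))

theorem reflect_mem_plateCore {Ω : Set Space} (x : Space) :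
    reflect x ∈ plateCore A Ω ↔ x ∈ plateCore A Ω := by
  simp only [plateCore, mem_ofPred_eq, reflect_reflect, horizontalL_reflect, rectangle]
  simp [reflect, reflectPlane]
  tauto

theorem volume_box_le {τ : ℝ} (hA : ∀ i, 0 < A i) :
    volume {x : Space | horizontalL x ∈ rectangle A ∧ -τ ≤ x 2 ∧ x 2 < 0} ≤
      ENNReal.ofReal (A 0 * A 1 * τ) := by
  have hA0 := hA 0
  have hA1 := hA 1
  have mp := EuclideanSpace.volume_preserving_symm_measurableEquiv_toLp (Fin 3)
  have h1 := mp.measure_preimage (s := Icc ![-(A 0 / 2), -(A 1 / 2), -τ] ![A 0 / 2, A 1 / 2, 0])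
    measurableSet_Icc.nullMeasurableSet
  rw [Real.volume_Icc_pi, Fin.prod_univ_three] at h1
  have e : A 0 * A 1 * τ = (A 0 / 2 - -(A 0 / 2)) * (A 1 / 2 - -(A 1 / 2)) * (0 - -τ) := by ring
  rw [e, ENNReal.ofReal_mul (mul_nonneg (by linarith) (by linarith)),
    ENNReal.ofReal_mul (by linarith)]
  refine le_trans (measure_mono fun x hx => ?_) h1.le
  obtain ⟨h2, h3, h4⟩ := hx
  rw [horizontalL_apply] at h2
  simp only [rectangle, mem_ofPred_eq] at h2
  have h5 := abs_lt.1 h2.1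
  have h6 := abs_lt.1 h2.2
  simp at h5 h6
  constructor <;> intro i <;> fin_cases i <;> simp <;> linarith

/-- If the rectangle were wider than the water line, there would be points `(s, 0)` with `s > l`
that are limits of points of `Γ`, hence boundary points on `x₃ = 0` outside the water line. -/
theorem width_le (hΓ : IsCrossSection Γ l) (hA : ∀ i, 0 < A i) {τ : ℝ} (hτ : 0 < τ)
    (hlayer : {x : Space | |x 0| < A 0 / 2 ∧ |x 1| < A 1 / 2 ∧ -τ < x 2 ∧ x 2 < 0} ⊆
      canal Γ) : A 1 / 2 ≤ l := by
  by_contra hcon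
  have hA1 := hA 1
  obtain ⟨s, hls, hs⟩ := exists_between (max_lt (not_le.1 hcon) (by positivity : 0 < A 1 / 2))
  have h0 : 0 < s := (le_max_right _ _).trans_lt hls
  have hl : l < s := (le_max_left _ _).trans_lt hls
  have h1 : (!₂[s, 0] : Plane) ∈ closure Γ := by
    have hcont : Continuous fun t : ℝ => (!₂[s, t] : Plane) := by fun_prop
    have hlim := (hcont.tendsto 0).mono_left (nhdsWithin_le_nhds (s := Iio 0))
    refine mem_closure_of_tendsto hlim ?_
    filter_upwards [Ioo_mem_nhdsLT (by linarith : -τ < 0)] with t ht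
    have : (!₂[0, s, t] : Space) ∈ canal Γ := hlayer (by
      have := hA 0
      simp only [mem_ofPred_eq, Matrix.cons_val, abs_zero, abs_of_pos h0, Fin.isValue]
      exact ⟨by positivity, hs, ht.1, ht.2⟩)
    simpa [canal] using this
  have h2 : (!₂[s, 0] : Plane) ∈ frontier Γ ∩ {p | p 1 = 0} := by
    refine ⟨⟨h1, fun hin => ?_⟩, by simp⟩
    have := hΓ.lower _ (interior_subset hin)
    simp at this
  rw [hΓ.waterLine] at h2
  have := h2.1
  simp at this
  exact absurd ((le_abs_self _).trans this) (not_le.2 hl)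

theorem norm_gradient_le {ζ : Plane → ℝ} (hζ : ContDiff ℝ ∞ ζ) {M : ℝ}
    (hM : ∀ y, ‖fderiv ℝ ζ y‖ ≤ M) (x : Space) :
    ‖gradient (fun x => ζ (horizontalL x)) x‖ ≤ M * ‖horizontalL‖ := by
  have h1 : HasFDerivAt (fun x => ζ (horizontalL x))
      ((fderiv ℝ ζ (horizontalL x)).comp horizontalL) x :=
    ((hζ.differentiable (by simp)).differentiableAt.hasFDerivAt).comp x horizontalL.hasFDerivAt
  rw [gradient, LinearIsometryEquiv.norm_map, h1.fderiv]
  refine (ContinuousLinearMap.opNorm_comp_le _ _).trans ?_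
  gcongr
  exact hM _

theorem reflect_gradient {Z : Space → ℝ} (hZ : ContDiff ℝ ∞ Z) (hodd : ∀ x, Z (reflect x) = -Z x)
    (x : Space) : reflect (gradient Z (reflect x)) = -gradient Z x := by
  refine ext_inner_right ℝ fun v => ?_
  have h1 : HasFDerivAt (fun x => Z (reflect x))
      ((fderiv ℝ Z (reflect x)).comp (reflectIso.toContinuousLinearEquiv : Space →L[ℝ] Space)) x :=
    HasFDerivAt.comp x (f := reflectIso) (hZ.differentiable (by simp) _).hasFDerivAt
      reflectIso.toContinuousLinearEquiv.hasFDerivAt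
  have h2 : HasFDerivAt (fun x => Z (reflect x)) (-fderiv ℝ Z x) x := by
    simp_rw [hodd]
    exact (hZ.differentiable (by simp) x).hasFDerivAt.neg
  have h3 := congrArg (fun L : Space →L[ℝ] ℝ => L v) (h1.unique h2)
  have h4 : fderiv ℝ Z (reflect x) (reflect v) = -fderiv ℝ Z x v := h3
  have e : ⟪reflect (gradient Z (reflect x)), v⟫_ℝ = ⟪gradient Z (reflect x), reflect v⟫_ℝ := by
    rw [← inner_reflect, reflect_reflect]
  rw [e, inner_neg_left, gradient, gradient, InnerProductSpace.toDual_symm_apply,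
    InnerProductSpace.toDual_symm_apply, h4]

/-- Boundary points of the core of the plate inside the water lie outside the rectangle. -/
theorem nonneg_of_mem_frontier_plateCore
    (hsym : ∀ x, x ∈ waterDomain Γ Θ ↔ reflect x ∈ waterDomain Γ Θ)
    {Ω : Set Space} (hΩo : IsOpen Ω)
    (hΩ : Ω ⊆ waterDomain Γ Θ) (hbase : lowerBase A Ω ⊆ frontier Θ) {φ : Space → ℝ}
    (hφ : IsTestFunction (waterDomain Γ Θ) l φ) {x : Space} (hx : x ∈ frontier (plateCore A Ω))
    (hxφ : x ∈ tsupport φ) (hxA : horizontalL x ∈ rectangle A) : 0 ≤ x 2 := by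
  by_contra hneg
  rw [not_le] at hneg
  have hcl : x ∈ closure (plateCore A Ω) := hx.1
  -- Otherwise `x` is a boundary point of the water below the surface, where test functions vanish.
  have hxU : x ∈ waterDomain Γ Θ := by
    by_contra hcon
    have h1 : x ∈ frontier (waterDomain Γ Θ) :=
      ⟨closure_mono (fun z hz => hΩ hz.1) hcl, fun h => hcon (interior_subset h)⟩
    exact Set.disjoint_left.1 hφ.vanishes hxφ ⟨h1, fun h => hneg.ne h.2⟩
  -- A boundary point of the plate under the rectangle belongs to the lower base, hence to `∂Θ`, and
  -- so it cannot lie in the water.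
  have key : ∀ z, z ∈ closure Ω → z ∈ waterDomain Γ Θ → horizontalL z ∈ rectangle A → z 2 < 0 →
      z ∈ Ω := by
    intro z h1 h2 h3 h4
    by_contra hcon
    have h5 : z ∈ lowerBase A Ω := by
      rw [horizontalL_apply] at h3
      simp only [rectangle, mem_ofPred_eq] at h3
      exact ⟨⟨h1, fun h => hcon (interior_subset h)⟩, by simpa using h3.1, by simpa using h3.2, h4⟩
    exact h2.2 (hbase h5).1
  have h1 : x ∈ Ω := key x (closure_mono (fun z hz => hz.1) hcl) hxU hxA hneg
  have h2 : reflect x ∈ Ω := by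
    refine key _ ?_ ((hsym x).1 hxU) ?_ (by simpa [reflect] using hneg)
    · have : x ∈ closure (reflect ⁻¹' Ω) := closure_mono (fun z hz => hz.2.1) hcl
      exact continuous_reflect.closure_preimage_subset Ω this
    · rw [horizontalL_reflect]
      simpa [rectangle, reflectPlane] using hxA
  have h3 : x ∈ plateCore A Ω := ⟨h1, h2, hxA, hneg⟩
  rw [(isOpen_plateCore hΩo).frontier_eq] at hx
  exact hx.2 h3

set_option maxHeartbeats 2000000 in
-- The element is `ζ(x₁, x₂)` on `V` and zero elsewhere. The zero extension creates no jump where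
-- test functions live: under the support of `ζ`, the boundary of `V` below the surface is invisible
-- to them. The energy is at most the volume of `V` times the squared bound for the gradient, hence
-- proportional to the thickness.
theorem exists_trial_element {U V : Set Space} (hsym : ∀ x, x ∈ U ↔ reflect x ∈ U)
    (hU : MeasurableSet U) (hA : ∀ i, 0 < A i) (hAstrip : rectangle A ⊆ surfaceStrip l)
    (hVo : IsOpen V) (hVU : V ⊆ U) (hVsym : ∀ x, reflect x ∈ V ↔ x ∈ V)
    (hVlow : ∀ x ∈ V, x 2 < 0) {τ T : ℝ} (hτ : 0 < τ) (hT : 0 ≤ T)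
    (hVvol : volume V ≤ ENNReal.ofReal (A 0 * A 1 * T))
    (hlayer : ∀ y ∈ rectangle A, ∀ t ∈ Ioo (-τ) 0, !₂[y 0, y 1, t] ∈ V)
    (hfr : ∀ φ, IsTestFunction U l φ → ∀ x ∈ frontier V, x ∈ tsupport φ →
      horizontalL x ∈ rectangle A → 0 ≤ x 2)
    {ζ : Plane → ℝ} (hζ : ContDiff ℝ ∞ ζ) (hζc : HasCompactSupport ζ)
    (hζA : tsupport ζ ⊆ rectangle A) (hodd : ∀ y, ζ (reflectPlane y) = -ζ y) {M : ℝ}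
    (hM : ∀ y, ‖fderiv ℝ ζ y‖ ≤ M) :
    ∃ X : EnergySpace U l, X ∈ oddSubspace hsym hU ∧
      ‖grad X‖ ^ 2 ≤ (M * ‖horizontalL‖) ^ 2 * (A 0 * A 1 * T) ∧
      surfaceTrace X =ᵐ[volume.restrict (surfaceStrip l)] ζ := by
  set Z : Space → ℝ := fun x => ζ (horizontalL x) with hZdef
  have hZ : ContDiff ℝ ∞ Z := hζ.comp horizontalL.contDiff
  have hVfin : volume V < ⊤ := hVvol.trans_lt ENNReal.ofReal_lt_top
  have hZsupp : ∀ x ∈ tsupport Z, horizontalL x ∈ rectangle A := fun x hx =>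
    hζA ((tsupport_comp_subset_preimage ζ horizontalL.continuous) hx)
  obtain ⟨B, hB⟩ := hζ.continuous.bounded_above_of_compact_support hζc
  have hgradc : Continuous (gradient Z) :=
    (InnerProductSpace.toDual ℝ Space).symm.continuous.comp (hZ.continuous_fderiv (by simp))
  have hG := norm_gradient_le hζ hM
  have hrestr : (volume.restrict U).restrict V = volume.restrict V := by
    rw [Measure.restrict_restrict hVo.measurableSet, inter_eq_left.2 hVU]
  have hfm : IsFiniteMeasure (volume.restrict V) := ⟨by simpa using hVfin⟩
  have m1 : MemLp (V.indicator Z) 2 (volume.restrict U) := by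
    rw [memLp_indicator_iff_restrict hVo.measurableSet, hrestr]
    exact MemLp.of_bound hZ.continuous.aestronglyMeasurable B (ae_of_all _ fun x => hB _)
  have m2 : MemLp (V.indicator (gradient Z)) 2 (volume.restrict U) := by
    rw [memLp_indicator_iff_restrict hVo.measurableSet, hrestr]
    exact MemLp.of_bound hgradc.aestronglyMeasurable _ (ae_of_all _ fun x => hG x)
  have hind : ((rectangle A).indicator fun y => Z (toSurface y)) = ζ := by
    funext y
    simp only [hZdef, horizontalL_toSurface]
    by_cases hy : y ∈ rectangle A
    · rw [indicator_of_mem hy]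
    · rw [indicator_of_notMem hy]
      exact (image_eq_zero_of_notMem_tsupport fun h => hy (hζA h)).symm
  have m3 : MemLp ((rectangle A).indicator fun y => Z (toSurface y)) 2
      (volume.restrict (surfaceStrip l)) := by
    rw [hind]
    exact (hζ.continuous.memLp_of_hasCompactSupport hζc).restrict _
  -- Over the rectangle the limit at the surface exists because the layer belongs to `V`; elsewhere
  -- `Z` vanishes near the surface point.
  have htrip := isEnergyTriple_indicator (U := U) (l := l) hVo hVU hVlow hAstrip hZ
    m1 m2 m3 (fun φ hφ x h1 h2 h3 =>
      hfr φ hφ x h1 h2 (hZsupp x h3)) (by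
      intro φ hφ y
      by_cases hy : y ∈ rectangle A
      · refine tendsto_indicator_of_eventually_mem (hZ.continuous.mul hφ.smooth.continuous) hy ?_
        filter_upwards [Ioo_mem_nhdsLT (by linarith : -τ < 0)] with t ht
        exact hlayer y hy t ht
      · refine tendsto_indicator_of_notMem_tsupport fun h => hy ?_
        have := hZsupp _ (tsupport_mul_subset_left h)
        rwa [horizontalL_toSurface] at this)
  have hZodd : ∀ x, Z (reflect x) = -Z x := fun x => by
    simp only [hZdef, horizontalL_reflect, hodd]
  refine ⟨htrip.toEnergySpace, ?_, ?_, ?_⟩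
  · refine toEnergySpace_mem_odd hsym hU htrip ?_ ?_ ?_
    · refine ae_of_all _ fun x => ?_
      by_cases hx : x ∈ V
      · rw [indicator_of_mem hx, indicator_of_mem ((hVsym x).2 hx), hZodd]
      · rw [indicator_of_notMem hx, indicator_of_notMem (fun h => hx ((hVsym x).1 h)),
          neg_zero]
    · refine ae_of_all _ fun x => ?_
      by_cases hx : x ∈ V
      · rw [indicator_of_mem hx, indicator_of_mem ((hVsym x).2 hx)]
        exact reflect_gradient hZ hZodd x
      · rw [indicator_of_notMem hx, indicator_of_notMem (fun h => hx ((hVsym x).1 h)),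
          neg_zero]
        exact map_zero reflectIso
    · rw [hind]
      exact ae_of_all _ hodd
  · have h1 := ofReal_norm_sq (grad htrip.toEnergySpace)
    have h2 : ∫⁻ x in U, ‖grad htrip.toEnergySpace x‖ₑ ^ 2 ≤
        ENNReal.ofReal ((M * ‖horizontalL‖) ^ 2) * ENNReal.ofReal (A 0 * A 1 * T) := by
      calc ∫⁻ x in U, ‖grad htrip.toEnergySpace x‖ₑ ^ 2
          = ∫⁻ x in U, V.indicator (fun x => ‖gradient Z x‖ₑ ^ 2) x := by
            refine lintegral_congr_ae ?_
            filter_upwards [htrip.grad_toEnergySpace] with x hx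
            rw [hx]
            by_cases hxV : x ∈ V <;> simp [hxV]
        _ = ∫⁻ x in V, ‖gradient Z x‖ₑ ^ 2 := by
            rw [lintegral_indicator hVo.measurableSet, hrestr]
        _ ≤ ∫⁻ x in V, ENNReal.ofReal ((M * ‖horizontalL‖) ^ 2) := by
            refine lintegral_mono fun x => ?_
            rw [← ofReal_norm, ← ENNReal.ofReal_pow (norm_nonneg _)]
            refine ENNReal.ofReal_le_ofReal ?_
            gcongr
            exact hG x
        _ ≤ _ := by
            rw [setLIntegral_const]
            gcongr
    have hA0 := hA 0
    have hA1 := hA 1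
    rw [← h1, ← ENNReal.ofReal_mul (by positivity), ENNReal.ofReal_le_ofReal_iff (by positivity)] at h2
    exact h2
  · exact htrip.surfaceTrace_toEnergySpace.trans (ae_of_all _ fun y => congrFun hind y)

/-- Trial functions supported by the core of the plate. -/
theorem exists_plate_element
    (hsym : ∀ x, x ∈ waterDomain Γ Θ ↔ reflect x ∈ waterDomain Γ Θ)
    (hU : MeasurableSet (waterDomain Γ Θ)) (hΓ : IsCrossSection Γ l) (hA : ∀ i, 0 < A i)
    {Ω : Set Space} (hΩo : IsOpen Ω) (hΩ : Ω ⊆ waterDomain Γ Θ)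
    (hbase : lowerBase A Ω ⊆ frontier Θ) {τ T : ℝ} (hτ : 0 < τ) (hT : 0 ≤ T)
    (hlayer : {x : Space | |x 0| < A 0 / 2 ∧ |x 1| < A 1 / 2 ∧ -τ < x 2 ∧ x 2 < 0} ⊆ Ω)
    (hthin : Ω ⊆ {x | -T ≤ x 2}) :
    rectangle A ⊆ surfaceStrip l ∧
    ∀ {ζ : Plane → ℝ}, ContDiff ℝ ∞ ζ → HasCompactSupport ζ → tsupport ζ ⊆ rectangle A →
      (∀ y, ζ (reflectPlane y) = -ζ y) → ∀ {M : ℝ}, (∀ y, ‖fderiv ℝ ζ y‖ ≤ M) →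
      ∃ X : EnergySpace (waterDomain Γ Θ) l, X ∈ oddSubspace hsym hU ∧
        ‖grad X‖ ^ 2 ≤ (M * ‖horizontalL‖) ^ 2 * (A 0 * A 1 * T) ∧
        surfaceTrace X =ᵐ[volume.restrict (surfaceStrip l)] ζ := by
  have hAl : A 1 / 2 ≤ l := width_le hΓ hA hτ (hlayer.trans fun x hx => (hΩ hx).1)
  have hAstrip : rectangle A ⊆ surfaceStrip l := fun y hy => lt_of_lt_of_le hy.2 hAl
  have hvol : volume (plateCore A Ω) ≤ ENNReal.ofReal (A 0 * A 1 * T) :=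
    (measure_mono (t := {x : Space | horizontalL x ∈ rectangle A ∧ -T ≤ x 2 ∧ x 2 < 0})
      fun x hx => ⟨hx.2.2.1, hthin hx.1, hx.2.2.2⟩).trans (volume_box_le hA)
  refine ⟨hAstrip, fun {ζ} h1 h2 h3 h4 {M} h5 => ?_⟩
  -- The periodicity cell need not be symmetric. The core of the plate is symmetric, as odd trial
  -- functions require, and it still contains the flat layer that carries the traces.
  refine exists_trial_element hsym hU hA hAstrip (isOpen_plateCore (A := A) hΩo)
    (fun x hx => hΩ hx.1) reflect_mem_plateCore (fun x hx => hx.2.2.2) hτ hT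
    hvol (fun y hy t ht => ⟨hlayer ?_, hlayer ?_, ?_, ?_⟩)
    (fun φ hφ x h1 h2 h3 => nonneg_of_mem_frontier_plateCore hsym hΩo hΩ hbase hφ h1 h2 h3)
    h1 h2 h3 h4 h5
  · simpa using ⟨hy.1, hy.2, ht.1, ht.2⟩
  · simpa [reflect] using ⟨hy.1, hy.2, ht.1, ht.2⟩
  · rw [horizontalL_apply]; simpa [rectangle] using hy
  · simpa using ht.2

end TrialElements

/-! ### Existence of trapped modes under thin plates -/

section TrappedModes

variable {Γ : Set Plane} {l : ℝ}

theorem norm_sum_sq_le {E : Type*} [NormedAddCommGroup E] [NormedSpace ℝ E] {N : ℕ}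
    (α : Fin N → ℝ) (x : Fin N → E) {b : ℝ} (hx : ∀ j, ‖x j‖ ^ 2 ≤ b) :
    ‖∑ j, α j • x j‖ ^ 2 ≤ N * b * ∑ j, α j ^ 2 := by
  calc ‖∑ j, α j • x j‖ ^ 2 ≤ (∑ j, |α j| * ‖x j‖) ^ 2 := by
        gcongr
        refine (norm_sum_le _ _).trans (Finset.sum_le_sum fun j _ => ?_)
        rw [norm_smul, Real.norm_eq_abs]
    _ ≤ (∑ j, |α j| ^ 2) * ∑ j, ‖x j‖ ^ 2 := Finset.sum_mul_sq_le_sq_mul_sq _ _ _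
    _ ≤ (∑ j, |α j| ^ 2) * ∑ _j : Fin N, b := by
        gcongr with j
        exact hx j
    _ = _ := by simp [sq_abs]; ring

theorem norm_sum_sq_of_orthogonal {E : Type*} [NormedAddCommGroup E] [InnerProductSpace ℝ E] {N : ℕ}
    (α : Fin N → ℝ) (x : Fin N → E) (hx : ∀ i j, i ≠ j → ⟪x i, x j⟫_ℝ = 0) {m : ℝ}
    (hm : ∀ j, m ≤ ‖x j‖ ^ 2) : m * ∑ j, α j ^ 2 ≤ ‖∑ j, α j • x j‖ ^ 2 := by
  rw [← real_inner_self_eq_norm_sq, sum_inner, Finset.mul_sum]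
  refine Finset.sum_le_sum fun i _ => ?_
  rw [inner_sum, Finset.sum_eq_single i]
  · rw [inner_smul_left, inner_smul_right, real_inner_self_eq_norm_sq]
    simp only [conj_trivial]
    nlinarith [hm i, sq_nonneg (α i)]
  · intro j _ hj
    rw [inner_smul_left, inner_smul_right, hx i j hj.symm]; simp
  · simp

theorem grad_sum {U : Set Space} {N : ℕ} (α : Fin N → ℝ) (X : Fin N → EnergySpace U l) :
    grad (∑ j, α j • X j) = ∑ j, α j • grad (X j) := by
  simp only [← gradL_apply, map_sum, map_smul]

theorem surfaceTrace_sum {U : Set Space} {N : ℕ} (α : Fin N → ℝ) (X : Fin N → EnergySpace U l) :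
    surfaceTrace (∑ j, α j • X j) = ∑ j, α j • surfaceTrace (X j) := by
  simp only [← traceL_apply, map_sum, map_smul]

/-- Under a thin plate there are many odd eigenfunctions with small eigenvalues, which decay
exponentially. -/
theorem exists_trapped_modes (hl : 0 < l) (hΓ : IsCrossSection Γ l) {a A : Fin 2 → ℝ}
    (ha : ∀ i, 0 < a i) (hA : ∀ i, 0 < A i) {h H : ℝ} (hh : 0 < h) (hH : h ≤ H) {C : Set Space}
    (hC₁ : cellBox a h ⊆ C) (hC₂ : C ⊆ cellBox a H) {d : ℝ} (hd : 0 < d) (N : ℕ) :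
    ∃ ε₀ : ℝ, 0 < ε₀ ∧ ∀ ε : ℝ, 0 < ε → ε < ε₀ →
      ∀ n : Fin 2 → ℕ, (∀ i, A i = ε * a i * n i) →
      ∀ Θ : Set Space, IsSubmergedBody Γ l Θ →
        (∀ x, x ∈ waterDomain Γ Θ ↔ reflect x ∈ waterDomain Γ Θ) →
        plate ε a n C ⊆ waterDomain Γ Θ →
        lowerBase A (plate ε a n C) ⊆ frontier Θ →
        ∃ (lam : Fin N → ℝ) (Φ : Fin N → EnergySpace (waterDomain Γ Θ) l),
          LinearIndependent ℝ Φ ∧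
          ∀ k, 0 < lam k ∧ lam k < d ∧
            IsEigenfunction (waterDomain Γ Θ) l (lam k) (Φ k) ∧ DecaysExponentially (Φ k) := by
  obtain ⟨c, hc, hfar⟩ := exists_hasFarBound hl hΓ
  obtain ⟨ζ, hζ, hζo⟩ := exists_trial_functions hA N
  -- From `λ < 1 / μ`, the first entry gives `λ < d` and the second `λ c < 1 / 2`, as the decay
  -- requires; it also puts `μ` above the threshold `c`.
  set μ := max (1 / d) (2 * c) with hμ
  have hμ0 : 0 < μ := lt_max_of_lt_right (by positivity)
  have hcμ : c < μ := lt_of_lt_of_le (by linarith) (le_max_right _ _)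
  obtain ⟨M, hM0, hM⟩ : ∃ M : ℝ, 0 ≤ M ∧ ∀ k y, ‖fderiv ℝ (ζ k) y‖ ≤ M := by
    have h1 : ∀ k, ∃ M, ∀ y, ‖fderiv ℝ (ζ k) y‖ ≤ M := fun k =>
      ((hζ k).1.continuous_fderiv (by simp)).bounded_above_of_compact_support ((hζ k).2.1.fderiv ℝ)
    choose M hM using h1
    refine ⟨∑ k, |M k|, Finset.sum_nonneg fun _ _ => abs_nonneg _, fun k y => ?_⟩
    exact (hM k y).trans ((le_abs_self _).trans
      (Finset.single_le_sum (f := fun k => |M k|) (fun _ _ => abs_nonneg _) (Finset.mem_univ k)))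
  obtain ⟨m, hm0, hm⟩ : ∃ m : ℝ, 0 < m ∧ ∀ k, m ≤ ∫ y, ζ k y ^ 2 := by
    rcases isEmpty_or_nonempty (Fin N) with hN | hN
    · exact ⟨1, one_pos, fun k => hN.elim k⟩
    · obtain ⟨k, hk⟩ := Finite.exists_min fun k => ∫ y, ζ k y ^ 2
      exact ⟨_, (hζ k).2.2.2.2, hk⟩
  have hA0 := hA 0
  have hA1 := hA 1
  have hH0 : 0 < H := hh.trans_le hH
  -- For a combination with coefficients `α`, the gradient term is at most `q ε ∑ α²` (the factor
  -- `N` is due to Cauchy-Schwarz) and the trace term at least `m ∑ α²`. So `q ε < m` suffices, and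
  -- `q + 1` avoids a zero denominator.
  set q := μ * (N * ((M * ‖horizontalL‖) ^ 2 * (A 0 * A 1 * H))) with hq
  have hq0 : 0 ≤ q := by positivity
  refine ⟨m / (q + 1), by positivity, fun ε hε hεlt n hn Θ hΘ hsym hΩ hbase => ?_⟩
  have hqε : q * ε < m := by
    rw [lt_div_iff₀ (by positivity)] at hεlt
    linarith
  have hU : MeasurableSet (waterDomain Γ Θ) := hΘ.lipschitz.1.measurableSet
  obtain ⟨hstrip, htrial⟩ := exists_plate_element hsym hU hΓ hA isOpen_interior hΩ hbase
    (mul_pos hε hh) (mul_pos hε hH0).le (layer_subset_plate hε ha hn hC₁) (plate_subset hε hC₂)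
  have hX : ∀ k, _ := fun k =>
    htrial (hζ k).1 (hζ k).2.1 (hζ k).2.2.1 (hζ k).2.2.2.1 (hM k)
  choose X hXodd hXgrad hXtrace using hX
  have hXinner : ∀ i j, ⟪surfaceTrace (X i), surfaceTrace (X j)⟫_ℝ =
      ∫ y in surfaceStrip l, ζ i y * ζ j y := fun i j => by
    rw [L2.inner_def]
    refine integral_congr_ae ?_
    filter_upwards [hXtrace i, hXtrace j] with y h1 h2
    rw [h1, h2]; simp [mul_comm]
  have horth : ∀ i j, i ≠ j → ⟪surfaceTrace (X i), surfaceTrace (X j)⟫_ℝ = 0 := fun i j hij => by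
    rw [hXinner]; simp [hζo i j hij]
  have hnorm : ∀ j, m ≤ ‖surfaceTrace (X j)‖ ^ 2 := fun j => by
    rw [← real_inner_self_eq_norm_sq, hXinner, setIntegral_eq_integral_of_forall_compl_eq_zero]
    · simpa [sq] using hm j
    · intro y hy
      rw [image_eq_zero_of_notMem_tsupport fun h => hy (hstrip ((hζ j).2.2.1 h)), zero_mul]
  obtain ⟨lam, w, hw, hlam⟩ := exists_odd_eigenfunctions hsym hU hl hΓ hΘ hc hfar hcμ X hXodd (by
    intro α hα
    rw [grad_sum, surfaceTrace_sum]
    have h1 := norm_sum_sq_le α _ hXgrad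
    have h2 := norm_sum_sq_of_orthogonal α _ horth hnorm
    have h3 : 0 < ∑ j, α j ^ 2 := by
      obtain ⟨k, hk⟩ := Function.ne_iff.1 hα
      exact Finset.sum_pos' (fun _ _ => sq_nonneg _) ⟨k, Finset.mem_univ k, by
        have : α k ≠ 0 := hk
        positivity⟩
    refine lt_of_le_of_lt (mul_le_mul_of_nonneg_left h1 hμ0.le) (lt_of_lt_of_le ?_ h2)
    have e : μ * (N * ((M * ‖horizontalL‖) ^ 2 * (A 0 * A 1 * (ε * H))) * ∑ j, α j ^ 2) =
        q * ε * ∑ j, α j ^ 2 := by rw [hq]; ring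
    rw [e]
    gcongr)
  refine ⟨lam, w, hw, fun k => ?_⟩
  obtain ⟨h1, h2, h3, h4⟩ := hlam k
  have h5 : lam k * μ < 1 := by rwa [lt_div_iff₀ hμ0] at h2
  refine ⟨h1, ?_, h4, decaysExponentially_of_odd hsym hU hl hΓ hc hfar h1 ?_ hΘ h3 h4⟩
  · have h6 : lam k * (1 / d) < 1 := lt_of_le_of_lt (by gcongr; exact le_max_left _ _) h5
    rw [mul_one_div, div_lt_one hd] at h6
    exact h6
  · have h6 : lam k * (2 * c) ≤ lam k * μ := by gcongr; exact le_max_right _ _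
    linarith

end TrappedModes

/-! ### Cutoff functions and tensor products in cylindrical ends -/

/-- Smooth functions with compact support in `(R, ∞)`. -/
structure IsCutoff (R : ℝ) (ρ : ℝ → ℝ) : Prop where
  smooth : ContDiff ℝ ∞ ρ
  compact : HasCompactSupport ρ
  support : tsupport ρ ⊆ Ioi R

namespace IsCutoff

variable {R : ℝ} {ρ σ : ℝ → ℝ}

theorem eq_zero (h : IsCutoff R ρ) {t : ℝ} (ht : t ≤ R) : ρ t = 0 :=
  image_eq_zero_of_notMem_tsupport fun hm => not_lt.2 ht (h.support hm)

theorem deriv (h : IsCutoff R ρ) : IsCutoff R (deriv ρ) :=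
  ⟨h.smooth.deriv' , h.compact.deriv, tsupport_deriv_subset.trans h.support⟩

theorem add (h : IsCutoff R ρ) (h' : IsCutoff R σ) : IsCutoff R fun t => ρ t + σ t :=
  ⟨h.smooth.add h'.smooth, h.compact.add h'.compact,
    (tsupport_add ρ σ).trans (union_subset h.support h'.support)⟩

theorem mul_left (h : IsCutoff R ρ) (hσ : ContDiff ℝ ∞ σ) : IsCutoff R fun t => σ t * ρ t :=
  ⟨hσ.mul h.smooth, h.compact.mul_left, tsupport_mul_subset_right.trans h.support⟩

theorem memLp (h : IsCutoff R ρ) {ν : Measure ℝ} [IsFiniteMeasureOnCompacts ν] : MemLp ρ 2 ν :=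
  h.smooth.continuous.memLp_of_hasCompactSupport h.compact

end IsCutoff

section Tensor

set_option linter.unusedSectionVars false

variable {X Y F F' : Type*} [MeasurableSpace X] [MeasurableSpace Y] {μ : Measure Y} {ν : Measure X}
  [SigmaFinite ν] [NormedAddCommGroup F] [InnerProductSpace ℝ F] [NormedAddCommGroup F']
  [InnerProductSpace ℝ F'] {R : ℝ} {c : Y → ℝ} {p : Y → X}

/-- The part `{R < c}` of the space `Y` is the product of `(R, ∞)` and `X`. -/
def IsCylindrical (R : ℝ) (c : Y → ℝ) (p : Y → X) (μ : Measure Y) (ν : Measure X) : Prop :=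
  Measurable c ∧ MeasurePreserving (fun y => (c y, p y)) (μ.restrict {y | R < c y})
    ((volume.restrict (Ioi R)).prod ν)

theorem IsCylindrical.measurableSet (h : IsCylindrical R c p μ ν) : MeasurableSet {y | R < c y} :=
  measurableSet_lt measurable_const h.1

theorem IsCylindrical.ae (h : IsCylindrical R c p μ ν) {P : X → Prop} (hP : ∀ᵐ x ∂ν, P x) :
    ∀ᵐ y ∂μ, R < c y → P (p y) := by
  have h1 := (Measure.quasiMeasurePreserving_snd (μ := volume.restrict (Ioi R)) (ν := ν)).ae hP
  have h2 := h.2.quasiMeasurePreserving.ae h1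
  rwa [ae_restrict_iff' h.measurableSet] at h2

theorem IsCylindrical.aestronglyMeasurable (h : IsCylindrical R c p μ ν) {f : ℝ × X → F}
    (hf : AEStronglyMeasurable f ((volume.restrict (Ioi R)).prod ν)) (h0 : ∀ z, z.1 ≤ R → f z = 0) :
    AEStronglyMeasurable (fun y => f (c y, p y)) μ := by
  have h1 := hf.comp_measurePreserving h.2
  have h2 : (fun y => f (c y, p y)) = {y | R < c y}.indicator fun y => f (c y, p y) := by
    funext y
    by_cases hy : R < c y
    · rw [indicator_of_mem (show y ∈ {y | R < c y} from hy)]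
    · rw [indicator_of_notMem (show y ∉ {y | R < c y} from hy)]; exact h0 _ (not_lt.1 hy)
  rw [h2, aestronglyMeasurable_indicator_iff h.measurableSet]
  exact h1

theorem IsCylindrical.lintegral (h : IsCylindrical R c p μ ν) {f : ℝ × X → ENNReal}
    (hf : AEMeasurable f ((volume.restrict (Ioi R)).prod ν)) (h0 : ∀ z, z.1 ≤ R → f z = 0) :
    ∫⁻ y, f (c y, p y) ∂μ = ∫⁻ z, f z ∂((volume.restrict (Ioi R)).prod ν) := by
  rw [← h.2.map_eq, lintegral_map' (by rwa [h.2.map_eq]) h.2.measurable.aemeasurable,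
    ← lintegral_indicator h.measurableSet]
  refine lintegral_congr fun y => ?_
  by_cases hy : R < c y
  · rw [indicator_of_mem (show y ∈ {y | R < c y} from hy)]
  · rw [indicator_of_notMem (show y ∉ {y | R < c y} from hy)]; exact h0 _ (not_lt.1 hy)

theorem IsCylindrical.integral (h : IsCylindrical R c p μ ν) {f : ℝ × X → ℝ}
    (hf : AEStronglyMeasurable f ((volume.restrict (Ioi R)).prod ν)) (h0 : ∀ z, z.1 ≤ R → f z = 0) :
    ∫ y, f (c y, p y) ∂μ = ∫ z, f z ∂((volume.restrict (Ioi R)).prod ν) := by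
  rw [← h.2.map_eq, integral_map h.2.measurable.aemeasurable (by rwa [h.2.map_eq]),
    setIntegral_eq_integral_of_forall_compl_eq_zero]
  exact fun y hy => h0 _ (not_lt.1 hy)

theorem aestronglyMeasurable_tensor {ρ : ℝ → ℝ} (hρ : Continuous ρ) {v : X → F}
    (hv : AEStronglyMeasurable v ν) :
    AEStronglyMeasurable (fun z : ℝ × X => ρ z.1 • v z.2) ((volume.restrict (Ioi R)).prod ν) :=
  (hρ.comp_aestronglyMeasurable (measurable_fst.aestronglyMeasurable)).smul hv.comp_snd

/-- Tonelli on the half-cylinder; since the cutoff vanishes up to `R`, the rest of the space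
contributes nothing. Consequently the tensor operators are isometries up to the factor `‖ρ‖`. -/
theorem IsCylindrical.lintegral_tensor (h : IsCylindrical R c p μ ν) {ρ : ℝ → ℝ} (hρ : IsCutoff R ρ)
    {v : X → F} (hv : AEStronglyMeasurable v ν) :
    ∫⁻ y, ‖ρ (c y) • v (p y)‖ₑ ^ 2 ∂μ = (∫⁻ t, ‖ρ t‖ₑ ^ 2) * ∫⁻ x, ‖v x‖ₑ ^ 2 ∂ν := by
  have h1 := h.lintegral (f := fun z => ‖ρ z.1 • v z.2‖ₑ ^ 2)
    ((aestronglyMeasurable_tensor hρ.smooth.continuous hv).enorm.pow_const 2)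
    (fun z hz => by simp [hρ.eq_zero hz])
  rw [h1]
  simp_rw [enorm_smul, mul_pow]
  have h2 := lintegral_prod_mul (μ := volume.restrict (Ioi R)) (ν := ν)
    (f := fun t => ‖ρ t‖ₑ ^ 2) (g := fun x => ‖v x‖ₑ ^ 2)
    ((hρ.smooth.continuous.enorm.measurable.pow_const 2).aemeasurable) (hv.enorm.pow_const 2)
  rw [h2, ← lintegral_indicator measurableSet_Ioi]
  congr 1
  refine lintegral_congr fun t => ?_
  by_cases ht : t ∈ Ioi R
  · rw [indicator_of_mem ht]
  · rw [indicator_of_notMem ht, hρ.eq_zero (not_lt.1 ht)]; simp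

theorem IsCylindrical.memLp_tensor (h : IsCylindrical R c p μ ν) {ρ : ℝ → ℝ} (hρ : IsCutoff R ρ)
    {v : X → F} (hv : MemLp v 2 ν) : MemLp (fun y => ρ (c y) • v (p y)) 2 μ := by
  refine memLp_two_of_lintegral (h.aestronglyMeasurable (f := fun z => ρ z.1 • v z.2)
    (aestronglyMeasurable_tensor hρ.smooth.continuous hv.1)
    fun z hz => by simp [hρ.eq_zero hz]) ?_
  rw [h.lintegral_tensor hρ hv.1]
  exact ENNReal.mul_lt_top (lintegral_enorm_sq_lt_top hρ.memLp) (lintegral_enorm_sq_lt_top hv)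

/-- The operator `v ↦ ρ ⊗ J v`. -/
noncomputable def tensorOp (h : IsCylindrical R c p μ ν) {ρ : ℝ → ℝ} (hρ : IsCutoff R ρ)
    (J : F →ₗᵢ[ℝ] F') : Lp F 2 ν →L[ℝ] Lp F' 2 μ :=
  LinearMap.mkContinuous
    { toFun := fun v => (J.toContinuousLinearMap.comp_memLp'
        (h.memLp_tensor hρ (Lp.memLp v))).toLp _
      map_add' := fun v w => by
        refine Lp.ext ?_
        filter_upwards [MemLp.coeFn_toLp (J.toContinuousLinearMap.comp_memLp'
          (h.memLp_tensor hρ (Lp.memLp (v + w)))), MemLp.coeFn_toLp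
          (J.toContinuousLinearMap.comp_memLp' (h.memLp_tensor hρ (Lp.memLp v))),
          MemLp.coeFn_toLp (J.toContinuousLinearMap.comp_memLp' (h.memLp_tensor hρ (Lp.memLp w))),
          Lp.coeFn_add ((J.toContinuousLinearMap.comp_memLp'
            (h.memLp_tensor hρ (Lp.memLp v))).toLp _) ((J.toContinuousLinearMap.comp_memLp'
            (h.memLp_tensor hρ (Lp.memLp w))).toLp _), h.ae (Lp.coeFn_add v w)] with y h1 h2 h3 h4 h5
        rw [h1, h4, Pi.add_apply, h2, h3]
        by_cases hy : R < c y
        · simp only [Function.comp, h5 hy, Pi.add_apply, smul_add, map_add]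
        · simp [hρ.eq_zero (not_lt.1 hy)]
      map_smul' := fun a v => by
        refine Lp.ext ?_
        filter_upwards [MemLp.coeFn_toLp (J.toContinuousLinearMap.comp_memLp'
          (h.memLp_tensor hρ (Lp.memLp (a • v)))), MemLp.coeFn_toLp
          (J.toContinuousLinearMap.comp_memLp' (h.memLp_tensor hρ (Lp.memLp v))),
          Lp.coeFn_smul a ((J.toContinuousLinearMap.comp_memLp'
            (h.memLp_tensor hρ (Lp.memLp v))).toLp _), h.ae (Lp.coeFn_smul a v)] with y h1 h2 h4 h5
        rw [RingHom.id_apply, h1, h4, Pi.smul_apply, h2]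
        by_cases hy : R < c y
        · simp only [Function.comp, h5 hy, Pi.smul_apply, smul_comm _ a, map_smul]
        · simp [hρ.eq_zero (not_lt.1 hy)] }
    (√(∫ t, ρ t ^ 2)) fun v => by
      refine abs_le_of_sq_le_sq' ?_ (by positivity) |>.2
      rw [norm_sq_eq_toReal, mul_pow, Real.sq_sqrt (integral_nonneg fun t => sq_nonneg _),
        norm_sq_eq_toReal v]
      have e : ∫⁻ y, ‖(J.toContinuousLinearMap.comp_memLp'
          (h.memLp_tensor hρ (Lp.memLp v))).toLp _ y‖ₑ ^ 2 ∂μ =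
          (∫⁻ t, ‖ρ t‖ₑ ^ 2) * ∫⁻ x, ‖v x‖ₑ ^ 2 ∂ν := by
        rw [← h.lintegral_tensor hρ (Lp.memLp v).1]
        refine lintegral_congr_ae ?_
        filter_upwards [MemLp.coeFn_toLp (J.toContinuousLinearMap.comp_memLp'
          (h.memLp_tensor hρ (Lp.memLp v)))] with y hy
        rw [hy]
        congr 1
        exact J.enorm_map _
      refine (le_of_eq ?_)
      refine Eq.trans (congrArg ENNReal.toReal e) ?_
      rw [ENNReal.toReal_mul, lintegral_sq_eq_ofReal hρ.memLp,
        ENNReal.toReal_ofReal (integral_nonneg fun t => sq_nonneg _)]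

variable (h : IsCylindrical R c p μ ν) {ρ : ℝ → ℝ} (hρ : IsCutoff R ρ) (J : F →ₗᵢ[ℝ] F')

theorem coeFn_tensorOp (v : Lp F 2 ν) :
    tensorOp h hρ J v =ᵐ[μ] fun y => ρ (c y) • J (v (p y)) := by
  refine (MemLp.coeFn_toLp (J.toContinuousLinearMap.comp_memLp'
    (h.memLp_tensor hρ (Lp.memLp v)))).trans (ae_of_all _ fun y => ?_)
  simp

theorem norm_tensorOp_sq (v : Lp F 2 ν) :
    ‖tensorOp h hρ J v‖ ^ 2 = (∫ t, ρ t ^ 2) * ‖v‖ ^ 2 := by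
  rw [norm_sq_eq_toReal, norm_sq_eq_toReal v]
  have e : ∫⁻ y, ‖tensorOp h hρ J v y‖ₑ ^ 2 ∂μ = (∫⁻ t, ‖ρ t‖ₑ ^ 2) * ∫⁻ x, ‖v x‖ₑ ^ 2 ∂ν := by
    rw [← h.lintegral_tensor hρ (Lp.memLp v).1]
    refine lintegral_congr_ae ?_
    filter_upwards [coeFn_tensorOp h hρ J v] with y hy
    rw [hy, ← map_smul]
    congr 1
    exact J.enorm_map _
  rw [e, ENNReal.toReal_mul, lintegral_sq_eq_ofReal hρ.memLp,
    ENNReal.toReal_ofReal (integral_nonneg fun t => sq_nonneg _)]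

end Tensor

section Pairing

variable {X Y : Type*} [MeasurableSpace X] [MeasurableSpace Y] {μ : Measure Y} {ν : Measure X}
  [IsFiniteMeasure ν] {R : ℝ} {c : Y → ℝ} {p : Y → X}

theorem IsCutoff.integrable_tensor_mul {ρ : ℝ → ℝ} (hρ : IsCutoff R ρ) {v : X → ℝ}
    (hv : MemLp v 2 ν) {η : ℝ × X → ℝ} (hη : AEStronglyMeasurable η ((volume.restrict (Ioi R)).prod ν))
    {B : ℝ} (hB : ∀ z, ‖η z‖ ≤ B) :
    Integrable (fun z : ℝ × X => ρ z.1 * v z.2 * η z) ((volume.restrict (Ioi R)).prod ν) :=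
  (((hρ.smooth.continuous.integrable_of_hasCompactSupport hρ.compact).restrict).mul_prod
    (hv.integrable (by norm_num))).mul_bdd (c := B) hη (ae_of_all _ hB)

theorem IsCylindrical.integral_tensor_mul (h : IsCylindrical R c p μ ν) {ρ : ℝ → ℝ}
    (hρ : IsCutoff R ρ) {v : X → ℝ} (hv : MemLp v 2 ν) {η : ℝ × X → ℝ}
    (hη : AEStronglyMeasurable η ((volume.restrict (Ioi R)).prod ν)) {B : ℝ} (hB : ∀ z, ‖η z‖ ≤ B) :
    ∫ y, ρ (c y) * v (p y) * η (c y, p y) ∂μ = ∫ t in Ioi R, ρ t * ∫ x, v x * η (t, x) ∂ν := by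
  have hi := hρ.integrable_tensor_mul hv hη hB
  rw [h.integral (f := fun z => ρ z.1 * v z.2 * η z) hi.1 (fun z hz => by simp [hρ.eq_zero hz]),
    integral_prod _ hi]
  simp_rw [mul_assoc, integral_const_mul]

theorem IsCutoff.integrable_tensor_integral {ρ : ℝ → ℝ} (hρ : IsCutoff R ρ) {v : X → ℝ}
    (hv : MemLp v 2 ν) {η : ℝ × X → ℝ} (hη : AEStronglyMeasurable η ((volume.restrict (Ioi R)).prod ν))
    {B : ℝ} (hB : ∀ z, ‖η z‖ ≤ B) :
    Integrable (fun t => ρ t * ∫ x, v x * η (t, x) ∂ν) (volume.restrict (Ioi R)) := by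
  have h := (hρ.integrable_tensor_mul hv hη hB).integral_prod_left
  simp_rw [mul_assoc, integral_const_mul] at h
  exact h

theorem IsCylindrical.integral_tensor_mul_symm (h : IsCylindrical R c p μ ν) {ρ : ℝ → ℝ}
    (hρ : IsCutoff R ρ) {v : X → ℝ} (hv : MemLp v 2 ν) {η : ℝ × X → ℝ}
    (hη : AEStronglyMeasurable η ((volume.restrict (Ioi R)).prod ν)) {B : ℝ} (hB : ∀ z, ‖η z‖ ≤ B) :
    ∫ y, ρ (c y) * v (p y) * η (c y, p y) ∂μ = ∫ x, v x * (∫ t, ρ t * η (t, x)) ∂ν := by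
  have hi := hρ.integrable_tensor_mul hv hη hB
  rw [h.integral (f := fun z => ρ z.1 * v z.2 * η z) hi.1 (fun z hz => by simp [hρ.eq_zero hz]),
    integral_prod_symm _ hi]
  refine integral_congr_ae (ae_of_all _ fun x => ?_)
  have : ∀ t, ρ t * v x * η (t, x) = v x * (ρ t * η (t, x)) := fun t => by ring
  simp only [this, integral_const_mul]
  congr 1
  exact setIntegral_eq_integral_of_forall_compl_eq_zero fun t ht => by
    rw [hρ.eq_zero (not_lt.1 ht), zero_mul]

end Pairing

/-! ### The cylindrical end and weak derivatives in its cross-section -/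

/-- The part `{R < x₁}` of the domain `U` is the half-cylinder over `Γ`. -/
structure HasCylindricalEnd (Γ : Set Plane) (U : Set Space) (R : ℝ) : Prop where
  isOpen : IsOpen U
  isOpen_base : IsOpen Γ
  bounded : Bornology.IsBounded Γ
  lower : ∀ x ∈ U, x 2 < 0
  mem_iff : ∀ x : Space, R < x 0 → (x ∈ U ↔ !₂[x 1, x 2] ∈ Γ)

namespace HasCylindricalEnd

variable {Γ : Set Plane} {U : Set Space} {R : ℝ}

theorem measure_lt_top (h : HasCylindricalEnd Γ U R) : volume Γ < ⊤ := h.bounded.measure_lt_top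

theorem isCylindrical (h : HasCylindricalEnd Γ U R) :
    IsCylindrical R (fun x : Space => x 0) (fun x => (!₂[x 1, x 2] : Plane)) (volume.restrict U)
      (volume.restrict Γ) := by
  have hm : Measurable fun x : Space => x 0 := by fun_prop
  refine ⟨hm, ?_⟩
  have e : (fun x : Space => (x 0, (!₂[x 1, x 2] : Plane))) = splitCoord 0 := by
    funext x
    have := splitCoord_symm_zero (x 0) !₂[x 1, x 2]
    rw [← (splitCoord 0).apply_symm_apply (x 0, (!₂[x 1, x 2] : Plane)), this]
    congr 1
    ext j; fin_cases j <;> rfl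
  have h1 := (measurePreserving_splitCoord 0).restrict_preimage
    (s := Ioi R ×ˢ Γ) (measurableSet_Ioi.prod h.isOpen_base.measurableSet)
  rw [← e, Measure.volume_eq_prod, ← Measure.prod_restrict] at h1
  rw [Measure.restrict_restrict (measurableSet_lt measurable_const hm)]
  have hset : {y : Space | R < y 0} ∩ U =
      (fun x : Space => (x 0, (!₂[x 1, x 2] : Plane))) ⁻¹' Ioi R ×ˢ Γ := by
    ext x
    exact and_congr_right fun hx => h.mem_iff x hx
  rw [hset]
  exact h1

end HasCylindricalEnd

theorem isCylindrical_strip (l R : ℝ) :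
    IsCylindrical R (fun y : Plane => y 0) (fun y : Plane => y 1) (volume.restrict (surfaceStrip l))
      (volume.restrict (Ioo (-l) l)) := by
  have hm : Measurable fun x : Plane => x 0 := by fun_prop
  refine ⟨hm, ?_⟩
  have h1 := (((volume_preserving_finTwoArrow ℝ).comp
    (EuclideanSpace.volume_preserving_symm_measurableEquiv_toLp (Fin 2))).restrict_preimage
    (s := Ioi R ×ˢ Ioo (-l) l) (measurableSet_Ioi.prod measurableSet_Ioo))
  rw [Measure.volume_eq_prod, ← Measure.prod_restrict] at h1
  rw [Measure.restrict_restrict (measurableSet_lt measurable_const hm)]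
  have hset : {y : Plane | R < y 0} ∩ surfaceStrip l =
      (fun y : Plane => (y 0, y 1)) ⁻¹' Ioi R ×ˢ Ioo (-l) l := by
    ext y
    exact and_congr_right fun _ => abs_lt (a := y 1) (b := l)
  rw [hset]
  exact h1

/-- Smooth compactly supported functions on the plane of the cross-section that vanish near the
part of the boundary outside of the water line. -/
structure IsCrossTest (Γ : Set Plane) (l : ℝ) (φ : Plane → ℝ) : Prop where
  smooth : ContDiff ℝ ∞ φ
  compact : HasCompactSupport φ
  vanishes : Disjoint (tsupport φ) (frontier Γ \ {p | |p 0| < l ∧ p 1 = 0})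

namespace IsCrossTest

variable {Γ : Set Plane} {l : ℝ} {φ : Plane → ℝ}

theorem memLp_fderiv (h : IsCrossTest Γ l φ) (i : Fin 2) :
    MemLp (fun p => fderiv ℝ φ p (EuclideanSpace.single i 1)) 2 (volume.restrict Γ) := by
  have hc : Continuous fun x => fderiv ℝ φ x (EuclideanSpace.single i 1) :=
    (h.smooth.continuous_fderiv (by simp)).clm_apply continuous_const
  exact (hc.memLp_of_hasCompactSupport (h.compact.fderiv_apply ℝ _)).restrict Γ

theorem memLp_single (h : IsCrossTest Γ l φ) (i : Fin 2) :
    MemLp (fun p => φ p • (EuclideanSpace.single i 1 : Plane)) 2 (volume.restrict Γ) := by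
  have hc : Continuous fun p => φ p • (EuclideanSpace.single i 1 : Plane) :=
    h.smooth.continuous.smul continuous_const
  exact (hc.memLp_of_hasCompactSupport h.compact.smul_right).restrict Γ

theorem memLp_trace (h : IsCrossTest Γ l φ) :
    MemLp (fun s : ℝ => φ !₂[s, 0]) 2 (volume.restrict (Ioo (-l) l)) := by
  have hc : Continuous fun s : ℝ => φ !₂[s, 0] := h.smooth.continuous.comp (by fun_prop)
  refine (hc.memLp_of_hasCompactSupport ?_).restrict _
  obtain ⟨B, hB⟩ := h.compact.isCompact.isBounded.subset_closedBall 0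
  refine HasCompactSupport.intro (isCompact_closedBall (0 : ℝ) B) fun s hs => ?_
  by_contra hne
  have h1 := hB (subset_tsupport φ hne)
  simp only [mem_closedBall_zero_iff] at h1 hs
  refine hs (le_trans ?_ h1)
  have := norm_plane_eq_abs s 0
  rw [Real.norm_eq_abs, ← sub_zero s, ← this, sub_zero s]
  simp [EuclideanSpace.norm_eq]

end IsCrossTest

/-- In the cross-section, `G` is the weak gradient of `v`, and `g` is the trace of `v` on the water
line. -/
def IsCrossElement {Γ : Set Plane} {l : ℝ} (v : Lp ℝ 2 (volume.restrict Γ))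
    (G : Lp Plane 2 (volume.restrict Γ)) (g : Lp ℝ 2 (volume.restrict (Ioo (-l) l))) : Prop :=
  ∀ φ, ∀ h : IsCrossTest Γ l φ, ∀ i : Fin 2,
    ⟪(h.memLp_fderiv i).toLp _, v⟫_ℝ + ⟪(h.memLp_single i).toLp _, G⟫_ℝ =
      if i = 1 then ⟪h.memLp_trace.toLp _, g⟫_ℝ else 0

section Algebra

variable {Γ : Set Plane} {l : ℝ} {v v' : Lp ℝ 2 (volume.restrict Γ)}
  {G G' : Lp Plane 2 (volume.restrict Γ)} {g g' : Lp ℝ 2 (volume.restrict (Ioo (-l) l))}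

theorem IsCrossElement.add_smul (h : IsCrossElement v G g) (h' : IsCrossElement v' G' g') (a : ℝ) :
    IsCrossElement (v + a • v') (G + a • G') (g + a • g') := by
  intro φ hφ i
  have h1 := h φ hφ i
  have h2 := h' φ hφ i
  simp only [inner_add_right, real_inner_smul_right]
  split_ifs at * <;> linear_combination h1 + a * h2

theorem IsCrossElement.integral_identity (h : IsCrossElement v G g) {φ : Plane → ℝ}
    (hφ : IsCrossTest Γ l φ) (i : Fin 2) :
    (∫ p in Γ, v p * fderiv ℝ φ p (EuclideanSpace.single i 1)) + ∫ p in Γ, G p i * φ p =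
      if i = 1 then ∫ s in Ioo (-l) l, g s * φ !₂[s, 0] else 0 := by
  have h1 := h φ hφ i
  rw [inner_eq_integral_of_ae _ (ae_eq_refl _), inner_eq_integral_of_ae _ (ae_eq_refl _)] at h1
  rw [← h1]
  congr 1
  rw [L2.inner_def]
  refine integral_congr_ae ?_
  filter_upwards [(hφ.memLp_single i).coeFn_toLp] with p hp
  rw [hp, real_inner_smul_left, EuclideanSpace.inner_single_left]
  simp [mul_comm]

end Algebra

/-- The projection `x ↦ (x₂, x₃)`. -/
noncomputable def crossL : Space →L[ℝ] Plane :=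
  LinearMap.toContinuousLinearMap
    { toFun := fun x => !₂[x 1, x 2]
      map_add' := fun x y => by ext i; fin_cases i <;> simp
      map_smul' := fun c x => by ext i; fin_cases i <;> simp }

theorem crossL_apply (x : Space) : crossL x = !₂[x 1, x 2] := rfl

/-- The embedding `(p₁, p₂) ↦ (0, p₁, p₂)`. -/
noncomputable def crossEmb : Plane →ₗᵢ[ℝ] Space where
  toFun p := !₂[0, p 0, p 1]
  map_add' p q := by ext i; fin_cases i <;> simp
  map_smul' c p := by ext i; fin_cases i <;> simp
  norm_map' p := by simp [EuclideanSpace.norm_eq, Fin.sum_univ_three, Fin.sum_univ_two]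

/-- The embedding `a ↦ (a, 0, 0)`. -/
noncomputable def axialEmb : ℝ →ₗᵢ[ℝ] Space where
  toFun a := !₂[a, 0, 0]
  map_add' p q := by ext i; fin_cases i <;> simp
  map_smul' c p := by ext i; fin_cases i <;> simp
  norm_map' p := by simp [EuclideanSpace.norm_eq, Fin.sum_univ_three, Real.sqrt_sq_eq_abs]

theorem crossEmb_apply (p : Plane) : crossEmb p = !₂[0, p 0, p 1] := rfl
theorem axialEmb_apply (a : ℝ) : axialEmb a = !₂[a, 0, 0] := rfl

theorem inner_axialEmb_crossEmb (a : ℝ) (p : Plane) : ⟪axialEmb a, crossEmb p⟫_ℝ = 0 := by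
  simp [crossEmb_apply, axialEmb_apply, PiLp.inner_apply, Fin.sum_univ_three]

theorem crossL_single_succ (i : Fin 2) :
    crossL (EuclideanSpace.single i.succ 1) = EuclideanSpace.single i 1 := by
  ext j
  fin_cases i <;> fin_cases j <;> simp [crossL_apply]

theorem surjective_crossL : Function.Surjective crossL := fun p =>
  ⟨crossEmb p, by ext i; fin_cases i <;> simp [crossEmb_apply, crossL_apply]⟩

/-- The point with the axial coordinate `t` and the transversal coordinates `p`. -/
noncomputable def joinCoord (z : ℝ × Plane) : Space := !₂[z.1, z.2 0, z.2 1]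

theorem continuous_joinCoord : Continuous joinCoord := by unfold joinCoord; fun_prop

theorem joinCoord_split (x : Space) : joinCoord (x 0, crossL x) = x := by
  ext i; fin_cases i <;> simp [joinCoord, crossL_apply]

theorem crossL_joinCoord (z : ℝ × Plane) : crossL (joinCoord z) = z.2 := by
  ext i; fin_cases i <;> simp [joinCoord, crossL_apply]

theorem joinCoord_eq (t : ℝ) (p : Plane) :
    joinCoord (t, p) = t • EuclideanSpace.single 0 1 + crossEmb p := by
  ext i; fin_cases i <;> simp [joinCoord, crossEmb_apply]

theorem hasDerivAt_joinCoord {ψ : Space → ℝ} (hψ : ContDiff ℝ ∞ ψ) (t : ℝ) (p : Plane) :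
    HasDerivAt (fun t => ψ (joinCoord (t, p)))
      (fderiv ℝ ψ (joinCoord (t, p)) (EuclideanSpace.single 0 1)) t := by
  have h1 : HasDerivAt (fun t : ℝ => joinCoord (t, p)) (EuclideanSpace.single 0 1) t := by
    simp_rw [joinCoord_eq]
    simpa using ((hasDerivAt_id t).smul_const (EuclideanSpace.single 0 (1 : ℝ))).add_const (crossEmb p)
  exact ((hψ.differentiable (by simp)) _).hasFDerivAt.comp_hasDerivAt t h1

theorem fderiv_joinCoord {ψ : Space → ℝ} (hψ : ContDiff ℝ ∞ ψ) (t : ℝ) (p : Plane) (i : Fin 2) :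
    fderiv ℝ (fun p => ψ (joinCoord (t, p))) p (EuclideanSpace.single i 1) =
      fderiv ℝ ψ (joinCoord (t, p)) (EuclideanSpace.single i.succ 1) := by
  have h1 : HasFDerivAt (fun p => joinCoord (t, p)) crossEmb.toContinuousLinearMap p := by
    simp_rw [joinCoord_eq]
    exact (crossEmb.toContinuousLinearMap.hasFDerivAt).const_add _
  have h2 := ((hψ.differentiable (by simp)) (joinCoord (t, p))).hasFDerivAt.comp p h1
  rw [show (fun p => ψ (joinCoord (t, p))) = ψ ∘ fun p => joinCoord (t, p) from rfl, h2.fderiv]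
  simp only [ContinuousLinearMap.comp_apply]
  congr 1
  ext j
  fin_cases i <;> fin_cases j <;> simp [crossEmb_apply]

namespace HasCylindricalEnd

variable {Γ : Set Plane} {U : Set Space} {R l : ℝ}

/-- The frontier is a local notion, and `crossL` is an open continuous map, so preimages under it
commute with frontiers. -/
theorem mem_frontier_iff (h : HasCylindricalEnd Γ U R) {x : Space} (hx : R < x 0) :
    x ∈ frontier U ↔ crossL x ∈ frontier Γ := by
  have hV : IsOpen {x : Space | R < x 0} := isOpen_lt continuous_const (by fun_prop)
  have e : U ∩ {x : Space | R < x 0} = crossL ⁻¹' Γ ∩ {x : Space | R < x 0} := by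
    ext y
    exact and_congr_left fun hy => h.mem_iff y hy
  have h1 := frontier_inter_open_inter (s := U) hV
  rw [e, frontier_inter_open_inter hV, ← (crossL.isOpenMap surjective_crossL).preimage_frontier_eq_frontier_preimage
    crossL.continuous] at h1
  have h2 := Set.ext_iff.1 h1 x
  exact ⟨fun hf => (h2.2 ⟨hf, hx⟩).1, fun hf => (h2.1 ⟨hf, hx⟩).1⟩

/-- Together with `isCrossTest_slice` this is the dictionary between test functions in the domain
and in the cross-section: one direction yields slices of elements, the other products. -/
theorem isTestFunction_mul (h : HasCylindricalEnd Γ U R) {ρ : ℝ → ℝ} (hρ : IsCutoff R ρ)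
    {φ : Plane → ℝ} (hφ : IsCrossTest Γ l φ) :
    IsTestFunction U l fun x => ρ (x 0) * φ (crossL x) := by
  have hsub : tsupport (fun x : Space => ρ (x 0) * φ (crossL x)) ⊆
      {x | x 0 ∈ tsupport ρ ∧ crossL x ∈ tsupport φ} := by
    refine closure_minimal (fun x hx => ?_) ?_
    · exact ⟨subset_tsupport _ (left_ne_zero_of_mul hx), subset_tsupport _ (right_ne_zero_of_mul hx)⟩
    · exact ((isClosed_tsupport ρ).preimage (by fun_prop)).inter
        ((isClosed_tsupport φ).preimage crossL.continuous)
  refine ⟨?_, ?_, ?_⟩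
  · exact (hρ.smooth.comp (by fun_prop)).mul (hφ.smooth.comp crossL.contDiff)
  · refine HasCompactSupport.of_support_subset_isCompact
      ((hρ.compact.isCompact.prod hφ.compact.isCompact).image continuous_joinCoord) fun x hx => ?_
    exact ⟨(x 0, crossL x), hsub (subset_tsupport _ hx), joinCoord_split x⟩
  · rw [Set.disjoint_left]
    rintro x hx ⟨h1, h2⟩
    obtain ⟨h3, h4⟩ := hsub hx
    refine Set.disjoint_left.1 hφ.vanishes h4 ⟨(h.mem_frontier_iff (hρ.support h3)).1 h1, fun h5 => h2 ?_⟩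
    exact h5

theorem isCrossTest_slice (h : HasCylindricalEnd Γ U R) {ψ : Space → ℝ} (hψ : IsTestFunction U l ψ)
    {t : ℝ} (ht : R < t) : IsCrossTest Γ l fun p => ψ (joinCoord (t, p)) := by
  have hc : Continuous fun p => joinCoord (t, p) := continuous_joinCoord.comp (by fun_prop)
  refine ⟨hψ.smooth.comp ?_, ?_, ?_⟩
  · simp_rw [joinCoord_eq]
    exact contDiff_const.add crossEmb.toContinuousLinearMap.contDiff
  · refine HasCompactSupport.of_support_subset_isCompact
      (hψ.compact.isCompact.image crossL.continuous) fun p hp => ?_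
    exact ⟨joinCoord (t, p), subset_tsupport _ hp, crossL_joinCoord _⟩
  · rw [Set.disjoint_left]
    rintro p hp ⟨h1, h2⟩
    have h3 : joinCoord (t, p) ∈ tsupport ψ := tsupport_comp_subset_preimage ψ hc hp
    refine Set.disjoint_left.1 hψ.vanishes h3 ⟨(h.mem_frontier_iff ht).2 ?_, h2⟩
    rwa [crossL_joinCoord]

/-- The operator `v ↦ ρ v` from functions in the cross-section to functions in `U`. -/
noncomputable def fnOp (h : HasCylindricalEnd Γ U R) {ρ : ℝ → ℝ} (hρ : IsCutoff R ρ) :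
    Lp ℝ 2 (volume.restrict Γ) →L[ℝ] Lp ℝ 2 (volume.restrict U) :=
  tensorOp h.isCylindrical hρ LinearIsometry.id

/-- The operator `v ↦ ρ v` from functions in the cross-section to axial vector fields in `U`. -/
noncomputable def axialOp (h : HasCylindricalEnd Γ U R) {ρ : ℝ → ℝ} (hρ : IsCutoff R ρ) :
    Lp ℝ 2 (volume.restrict Γ) →L[ℝ] Lp Space 2 (volume.restrict U) :=
  tensorOp h.isCylindrical hρ axialEmb

/-- The operator `G ↦ ρ G` from vector fields in the cross-section to transversal vector fields
in `U`. -/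
noncomputable def crossOp (h : HasCylindricalEnd Γ U R) {ρ : ℝ → ℝ} (hρ : IsCutoff R ρ) :
    Lp Plane 2 (volume.restrict Γ) →L[ℝ] Lp Space 2 (volume.restrict U) :=
  tensorOp h.isCylindrical hρ crossEmb

end HasCylindricalEnd

/-- The operator `g ↦ ρ g` from functions on the water line to functions on the free surface. -/
noncomputable def stripOp (l : ℝ) {R : ℝ} {ρ : ℝ → ℝ} (hρ : IsCutoff R ρ) :
    Lp ℝ 2 (volume.restrict (Ioo (-l) l)) →L[ℝ] Lp ℝ 2 (volume.restrict (surfaceStrip l)) :=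
  tensorOp (isCylindrical_strip l R) hρ LinearIsometry.id

section Ae

variable {Γ : Set Plane} {U : Set Space} {R l : ℝ}

theorem HasCylindricalEnd.coeFn_fnOp (h : HasCylindricalEnd Γ U R) {ρ : ℝ → ℝ} (hρ : IsCutoff R ρ)
    {v : Lp ℝ 2 (volume.restrict Γ)} {k : Plane → ℝ} (hk : v =ᵐ[volume.restrict Γ] k) :
    h.fnOp hρ v =ᵐ[volume.restrict U] fun x => ρ (x 0) * k (crossL x) := by
  filter_upwards [coeFn_tensorOp h.isCylindrical hρ LinearIsometry.id v, h.isCylindrical.ae hk]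
    with x h1 h2
  refine h1.trans ?_
  by_cases hx : R < x 0
  · rw [h2 hx]; rfl
  · simp [hρ.eq_zero (not_lt.1 hx)]

theorem HasCylindricalEnd.coeFn_axialOp (h : HasCylindricalEnd Γ U R) {ρ : ℝ → ℝ}
    (hρ : IsCutoff R ρ) (v : Lp ℝ 2 (volume.restrict Γ)) :
    h.axialOp hρ v =ᵐ[volume.restrict U] fun x => ρ (x 0) • axialEmb (v (crossL x)) :=
  coeFn_tensorOp h.isCylindrical hρ axialEmb v

theorem HasCylindricalEnd.coeFn_crossOp (h : HasCylindricalEnd Γ U R) {ρ : ℝ → ℝ}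
    (hρ : IsCutoff R ρ) {G : Lp Plane 2 (volume.restrict Γ)} {k : Plane → Plane}
    (hk : G =ᵐ[volume.restrict Γ] k) :
    h.crossOp hρ G =ᵐ[volume.restrict U] fun x => ρ (x 0) • crossEmb (k (crossL x)) := by
  filter_upwards [coeFn_tensorOp h.isCylindrical hρ crossEmb G, h.isCylindrical.ae hk] with x h1 h2
  refine h1.trans ?_
  by_cases hx : R < x 0
  · rw [h2 hx]; rfl
  · simp [hρ.eq_zero (not_lt.1 hx)]

theorem coeFn_stripOp {ρ : ℝ → ℝ} (hρ : IsCutoff R ρ) {g : Lp ℝ 2 (volume.restrict (Ioo (-l) l))}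
    {k : ℝ → ℝ} (hk : g =ᵐ[volume.restrict (Ioo (-l) l)] k) :
    stripOp l hρ g =ᵐ[volume.restrict (surfaceStrip l)] fun y => ρ (y 0) * k (y 1) := by
  filter_upwards [coeFn_tensorOp (isCylindrical_strip l R) hρ LinearIsometry.id g,
    (isCylindrical_strip l R).ae hk] with y h1 h2
  refine h1.trans ?_
  by_cases hx : R < y 0
  · rw [h2 hx]; rfl
  · simp [hρ.eq_zero (not_lt.1 hx)]

theorem inner_eq_integral_ae {α : Type*} [MeasurableSpace α] {μ : Measure α}
    {f f' : Lp ℝ 2 μ} {k k' : α → ℝ} (hk : f =ᵐ[μ] k) (hk' : f' =ᵐ[μ] k') :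
    ⟪f, f'⟫_ℝ = ∫ x, k' x * k x ∂μ := by
  rw [L2.inner_def]
  refine integral_congr_ae ?_
  filter_upwards [hk, hk'] with x h1 h2
  rw [h1, h2]
  simp

end Ae

/-! ### Slices and products: passage between the domain and the cross-section -/

namespace HasCylindricalEnd

variable {Γ : Set Plane} {U : Set Space} {R l : ℝ}

theorem fderiv_mul_cross {ρ : ℝ → ℝ} (hρ : ContDiff ℝ ∞ ρ) {φ : Plane → ℝ} (hφ : ContDiff ℝ ∞ φ)
    (x e : Space) : fderiv ℝ (fun x : Space => ρ (x 0) * φ (crossL x)) x e =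
      ρ (x 0) * fderiv ℝ φ (crossL x) (crossL e) + φ (crossL x) * (deriv ρ (x 0) * e 0) := by
  have h1 : HasFDerivAt (fun x : Space => ρ (x 0))
      (deriv ρ (x 0) • (EuclideanSpace.proj (𝕜 := ℝ) (0 : Fin 3) : Space →L[ℝ] ℝ)) x :=
    ((hρ.differentiable (by simp)) _).hasDerivAt.comp_hasFDerivAt x
      (EuclideanSpace.proj (𝕜 := ℝ) (0 : Fin 3)).hasFDerivAt
  have h2 : HasFDerivAt (fun x : Space => φ (crossL x)) (fderiv ℝ φ (crossL x) ∘L crossL) x :=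
    ((hφ.differentiable (by simp)) _).hasFDerivAt.comp x crossL.hasFDerivAt
  have h3 : HasFDerivAt (fun x : Space => ρ (x 0) * φ (crossL x)) _ x := h1.mul h2
  rw [h3.fderiv]
  simp

/-- The slices of functions of finite energy are functions of finite energy in the
cross-section. -/
theorem isCrossElement_slice (h : HasCylindricalEnd Γ U R) {ρ : ℝ → ℝ} (hρ : IsCutoff R ρ)
    (Ψ : EnergySpace U l) :
    IsCrossElement (l := l) ((h.fnOp hρ).adjoint (potential Ψ)) ((h.crossOp hρ).adjoint (grad Ψ))
      ((stripOp l hρ).adjoint (surfaceTrace Ψ)) := by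
  intro φ hφ i
  -- The adjoint of `v ↦ ρ v` averages over `x₁` with weight `ρ`. The identity for the averages is
  -- the Green identity tested with `ρ φ` in a transversal direction, where `ρ` is not
  -- differentiated.
  have hψ := h.isTestFunction_mul hρ hφ
  have green := Ψ.2 _ hψ i.succ
  unfold GreenIdentity at green
  have a1 := (ContinuousLinearMap.adjoint_inner_right (h.fnOp hρ) ((hφ.memLp_fderiv i).toLp _)
    (potential Ψ)).trans (inner_eq_integral_ae (h.coeFn_fnOp hρ (hφ.memLp_fderiv i).coeFn_toLp)
      (ae_eq_refl _))
  have a2 := (ContinuousLinearMap.adjoint_inner_right (stripOp l hρ) (hφ.memLp_trace.toLp _)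
    (surfaceTrace Ψ)).trans (inner_eq_integral_ae (coeFn_stripOp hρ hφ.memLp_trace.coeFn_toLp)
      (ae_eq_refl _))
  have a3 := (ContinuousLinearMap.adjoint_inner_right (h.crossOp hρ) ((hφ.memLp_single i).toLp _)
    (grad Ψ)).trans (L2.inner_def _ _)
  have e2 : ∫ x in U, ⟪h.crossOp hρ ((hφ.memLp_single i).toLp _) x, grad Ψ x⟫_ℝ =
      ∫ x in U, grad Ψ x i.succ * (ρ (x 0) * φ (crossL x)) := by
    refine integral_congr_ae ?_
    filter_upwards [h.coeFn_crossOp hρ (hφ.memLp_single i).coeFn_toLp] with x hx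
    have e3 : crossEmb (EuclideanSpace.single i 1) = EuclideanSpace.single i.succ 1 := by
      ext j; fin_cases i <;> fin_cases j <;> simp [crossEmb_apply]
    rw [hx, map_smul, e3, smul_smul, real_inner_smul_left, EuclideanSpace.inner_single_left]
    simp [mul_comm]
  refine (congrArg₂ (· + ·) a1 (a3.trans e2)).trans ?_
  have e1 : ∀ x : Space, fderiv ℝ (fun x : Space => ρ (x 0) * φ (crossL x)) x
      (EuclideanSpace.single i.succ 1) =
        ρ (x 0) * fderiv ℝ φ (crossL x) (EuclideanSpace.single i 1) := fun x => by
    rw [fderiv_mul_cross hρ.smooth hφ.smooth, crossL_single_succ]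
    simp
  simp only [e1] at green
  refine green.trans ?_
  have e4 : (i.succ = (2 : Fin 3)) ↔ i = 1 := by fin_cases i <;> simp
  simp only [e4]
  split_ifs with hi
  · refine Eq.trans ?_ a2.symm
    refine integral_congr_ae (ae_of_all _ fun y => ?_)
    have : crossL (toSurface y) = !₂[y 1, 0] := by
      ext j; fin_cases j <;> simp [crossL_apply, toSurface]
    simp only [this]
    simp only [toSurface]
    rfl
  · rfl

theorem isFiniteMeasure (h : HasCylindricalEnd Γ U R) : IsFiniteMeasure (volume.restrict Γ) :=
  ⟨by simpa using h.measure_lt_top⟩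

theorem exists_bound_joinCoord {η : Space → ℝ} (hη : Continuous η) (hc : HasCompactSupport η)
    (ν : Measure Plane) [SFinite ν] :
    AEStronglyMeasurable (fun z => η (joinCoord z)) ((volume.restrict (Ioi R)).prod ν) ∧
      ∃ B, ∀ z, ‖η (joinCoord z)‖ ≤ B := by
  obtain ⟨B, hB⟩ := hη.bounded_above_of_compact_support hc
  exact ⟨(hη.comp continuous_joinCoord).aestronglyMeasurable, B, fun z => hB _⟩

theorem integral_mul_test (h : HasCylindricalEnd Γ U R) {ρ : ℝ → ℝ} (hρ : IsCutoff R ρ)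
    {v : Plane → ℝ} (hv : MemLp v 2 (volume.restrict Γ)) {η : Space → ℝ} (hη : Continuous η)
    (hc : HasCompactSupport η) :
    ∫ x in U, ρ (x 0) * v (crossL x) * η x =
      ∫ t in Ioi R, ρ t * ∫ p in Γ, v p * η (joinCoord (t, p)) := by
  have := h.isFiniteMeasure
  obtain ⟨h1, B, hB⟩ := exists_bound_joinCoord (R := R) hη hc (volume.restrict Γ)
  rw [← h.isCylindrical.integral_tensor_mul hρ hv h1 hB]
  refine integral_congr_ae (ae_of_all _ fun x => ?_)
  have := joinCoord_split x
  rw [crossL_apply] at this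
  simp only [this, crossL_apply]

theorem integral_mul_test_symm (h : HasCylindricalEnd Γ U R) {ρ : ℝ → ℝ} (hρ : IsCutoff R ρ)
    {v : Plane → ℝ} (hv : MemLp v 2 (volume.restrict Γ)) {η : Space → ℝ} (hη : Continuous η)
    (hc : HasCompactSupport η) :
    ∫ x in U, ρ (x 0) * v (crossL x) * η x =
      ∫ p in Γ, v p * ∫ t, ρ t * η (joinCoord (t, p)) := by
  have := h.isFiniteMeasure
  obtain ⟨h1, B, hB⟩ := exists_bound_joinCoord (R := R) hη hc (volume.restrict Γ)
  rw [← h.isCylindrical.integral_tensor_mul_symm hρ hv h1 hB]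
  refine integral_congr_ae (ae_of_all _ fun x => ?_)
  have := joinCoord_split x
  rw [crossL_apply] at this
  simp only [this, crossL_apply]

theorem integral_cutoff_deriv {ρ : ℝ → ℝ} (hρ : IsCutoff R ρ) {ψ : Space → ℝ}
    (hψ : ContDiff ℝ ∞ ψ) (p : Plane) :
    ∫ t, ρ t * fderiv ℝ ψ (joinCoord (t, p)) (EuclideanSpace.single 0 1) =
      -∫ t, deriv ρ t * ψ (joinCoord (t, p)) := by
  have hj : Continuous fun t => joinCoord (t, p) := continuous_joinCoord.comp (by fun_prop)
  have c1 : Continuous fun t => fderiv ℝ ψ (joinCoord (t, p)) (EuclideanSpace.single 0 1) :=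
    ((hψ.continuous_fderiv (by simp)).comp hj).clm_apply continuous_const
  have c2 : Continuous fun t => ψ (joinCoord (t, p)) := hψ.continuous.comp hj
  refine integral_mul_deriv_eq_deriv_mul_of_integrable (u := ρ) (u' := _root_.deriv ρ)
    (v := fun t => ψ (joinCoord (t, p)))
    (fun t _ => ((hρ.smooth.differentiable (by simp)) t).hasDerivAt)
    (fun t _ => hasDerivAt_joinCoord hψ t p) ?_ ?_ ?_
  · exact (hρ.smooth.continuous.mul c1).integrable_of_hasCompactSupport hρ.compact.mul_right
  · exact (hρ.deriv.smooth.continuous.mul c2).integrable_of_hasCompactSupport hρ.deriv.compact.mul_right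
  · exact (hρ.smooth.continuous.mul c2).integrable_of_hasCompactSupport hρ.compact.mul_right

theorem memLp_coord_plane {Γ : Set Plane} (G : Lp Plane 2 (volume.restrict Γ)) (i : Fin 2) :
    MemLp (fun x => G x i) 2 (volume.restrict Γ) :=
  (EuclideanSpace.proj (𝕜 := ℝ) i).comp_memLp' (Lp.memLp G)

end HasCylindricalEnd

namespace HasCylindricalEnd

variable {Γ : Set Plane} {U : Set Space} {R l : ℝ} {v : Lp ℝ 2 (volume.restrict Γ)}
  {G : Lp Plane 2 (volume.restrict Γ)} {g : Lp ℝ 2 (volume.restrict (Ioo (-l) l))}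

theorem integral_strip_mul_test {ρ : ℝ → ℝ} (hρ : IsCutoff R ρ)
    {g : ℝ → ℝ} (hg : MemLp g 2 (volume.restrict (Ioo (-l) l))) {η : Space → ℝ} (hη : Continuous η)
    (hc : HasCompactSupport η) :
    ∫ y in surfaceStrip l, ρ (y 0) * g (y 1) * η (toSurface y) =
      ∫ t in Ioi R, ρ t * ∫ s in Ioo (-l) l, g s * η (joinCoord (t, !₂[s, 0])) := by
  obtain ⟨B, hB⟩ := hη.bounded_above_of_compact_support hc
  have hj : Continuous fun z : ℝ × ℝ => joinCoord (z.1, !₂[z.2, 0]) :=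
    continuous_joinCoord.comp (by fun_prop)
  rw [← (isCylindrical_strip l R).integral_tensor_mul hρ hg
    (η := fun z => η (joinCoord (z.1, !₂[z.2, 0]))) (hη.comp hj).aestronglyMeasurable
    (fun z => hB _)]
  rfl

/-- Fubini with the axial variable inside: the half-cylinder has no axial boundary on the support of
`ρ`, and the derivative falls on `ρ`. Thus `v` needs no regularity. -/
theorem integral_axial_green (h : HasCylindricalEnd Γ U R) {ρ : ℝ → ℝ} (hρ : IsCutoff R ρ)
    {v : Plane → ℝ} (hv : MemLp v 2 (volume.restrict Γ)) {ψ : Space → ℝ} (hψ : ContDiff ℝ ∞ ψ)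
    (hc : HasCompactSupport ψ) :
    (∫ x in U, ρ (x 0) * v (crossL x) * fderiv ℝ ψ x (EuclideanSpace.single 0 1)) +
      ∫ x in U, deriv ρ (x 0) * v (crossL x) * ψ x = 0 := by
  have c1 : Continuous fun x => fderiv ℝ ψ x (EuclideanSpace.single 0 1) :=
    (hψ.continuous_fderiv (by simp)).clm_apply continuous_const
  rw [h.integral_mul_test_symm hρ hv c1 (hc.fderiv_apply ℝ _),
    h.integral_mul_test_symm hρ.deriv hv hψ.continuous hc]
  simp_rw [integral_cutoff_deriv hρ hψ, mul_neg, integral_neg]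
  exact neg_add_cancel _

/-- Fubini with the axial variable outside: for each `t > R` the slice of the test function is
admissible in the cross-section. -/
theorem integral_cross_green (h : HasCylindricalEnd Γ U R) {ρ : ℝ → ℝ} (hρ : IsCutoff R ρ)
    (hv : IsCrossElement v G g) {ψ : Space → ℝ} (hψ : IsTestFunction U l ψ) (i : Fin 2) :
    (∫ x in U, ρ (x 0) * v (crossL x) * fderiv ℝ ψ x (EuclideanSpace.single i.succ 1)) +
      ∫ x in U, ρ (x 0) * G (crossL x) i * ψ x =
      if i = 1 then ∫ y in surfaceStrip l, ρ (y 0) * g (y 1) * ψ (toSurface y) else 0 := by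
  have := h.isFiniteMeasure
  have c1 : Continuous fun x => fderiv ℝ ψ x (EuclideanSpace.single i.succ 1) :=
    (hψ.smooth.continuous_fderiv (by simp)).clm_apply continuous_const
  obtain ⟨m1, B1, b1⟩ := exists_bound_joinCoord (R := R) c1 (hψ.compact.fderiv_apply ℝ _)
    (volume.restrict Γ)
  obtain ⟨m2, B2, b2⟩ := exists_bound_joinCoord (R := R) hψ.smooth.continuous hψ.compact
    (volume.restrict Γ)
  rw [h.integral_mul_test hρ (Lp.memLp v) c1 (hψ.compact.fderiv_apply ℝ _),
    h.integral_mul_test hρ (memLp_coord_plane G i) hψ.smooth.continuous hψ.compact,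
    integral_strip_mul_test hρ (Lp.memLp g) hψ.smooth.continuous hψ.compact,
    ← integral_add (hρ.integrable_tensor_integral (Lp.memLp v) m1 b1)
      (hρ.integrable_tensor_integral (memLp_coord_plane G i) m2 b2)]
  have key : ∀ t ∈ Ioi R, ρ t * (∫ p in Γ, v p *
        fderiv ℝ ψ (joinCoord (t, p)) (EuclideanSpace.single i.succ 1)) +
      ρ t * (∫ p in Γ, G p i * ψ (joinCoord (t, p))) =
      ρ t * if i = 1 then ∫ s in Ioo (-l) l, g s * ψ (joinCoord (t, !₂[s, 0])) else 0 := by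
    intro t ht
    rw [← hv.integral_identity (h.isCrossTest_slice hψ ht) i, mul_add]
    simp only [fderiv_joinCoord hψ.smooth]
  rw [setIntegral_congr_fun measurableSet_Ioi key]
  split_ifs <;> simp

theorem isEnergyTriple_product (h : HasCylindricalEnd Γ U R) {ρ : ℝ → ℝ} (hρ : IsCutoff R ρ)
    (hv : IsCrossElement v G g) :
    IsEnergyTriple U l (h.fnOp hρ v) (h.axialOp hρ.deriv v + h.crossOp hρ G : Lp Space 2 _)
      (stripOp l hρ g) := by
  refine ⟨Lp.memLp _, Lp.memLp _, Lp.memLp _, fun ψ hψ i => ?_⟩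
  have e1 : ∀ j, ∫ x in U, h.fnOp hρ v x * fderiv ℝ ψ x (EuclideanSpace.single j 1) =
      ∫ x in U, ρ (x 0) * v (crossL x) * fderiv ℝ ψ x (EuclideanSpace.single j 1) := fun j => by
    refine integral_congr_ae ?_
    filter_upwards [h.coeFn_fnOp hρ (ae_eq_refl v)] with x hx
    rw [hx]
  have e2 : (h.axialOp hρ.deriv v + h.crossOp hρ G : Lp Space 2 (volume.restrict U)) =ᵐ[volume.restrict U] fun x =>
      deriv ρ (x 0) • axialEmb (v (crossL x)) + ρ (x 0) • crossEmb (G (crossL x)) := by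
    filter_upwards [Lp.coeFn_add (h.axialOp hρ.deriv v) (h.crossOp hρ G),
      h.coeFn_axialOp hρ.deriv v, h.coeFn_crossOp hρ (ae_eq_refl G)] with x h1 h2 h3
    rw [h1, Pi.add_apply, h2, h3]
  rw [e1]
  have e3 : ∫ x in U, (h.axialOp hρ.deriv v + h.crossOp hρ G : Lp Space 2 (volume.restrict U)) x i * ψ x =
      ∫ x in U, (deriv ρ (x 0) • axialEmb (v (crossL x)) + ρ (x 0) • crossEmb (G (crossL x))) i * ψ x := by
    refine integral_congr_ae ?_
    filter_upwards [e2] with x hx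
    rw [hx]
  have e4 : ∫ y in surfaceStrip l, stripOp l hρ g y * ψ (toSurface y) =
      ∫ y in surfaceStrip l, ρ (y 0) * g (y 1) * ψ (toSurface y) := by
    refine integral_congr_ae ?_
    filter_upwards [coeFn_stripOp hρ (ae_eq_refl g)] with x hx
    rw [hx]
  rw [e3, e4]
  induction i using Fin.cases with
  | zero =>
    have := h.integral_axial_green hρ (Lp.memLp v) hψ.smooth hψ.compact
    simpa [axialEmb_apply, crossEmb_apply] using this
  | succ i =>
    have := h.integral_cross_green hρ hv hψ i
    have e5 : ∀ x : Space, (deriv ρ (x 0) • axialEmb (v (crossL x)) +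
        ρ (x 0) • crossEmb (G (crossL x))) i.succ = ρ (x 0) * G (crossL x) i := fun x => by
      fin_cases i <;> simp [axialEmb_apply, crossEmb_apply]
    simp only [e5]
    rw [this]
    fin_cases i <;> simp

/-- The product of a cutoff function and a function of finite energy in the cross-section. -/
theorem exists_product (h : HasCylindricalEnd Γ U R) {ρ : ℝ → ℝ} (hρ : IsCutoff R ρ)
    (hv : IsCrossElement v G g) : ∃ Φ : EnergySpace U l, potential Φ = h.fnOp hρ v ∧
      grad Φ = h.axialOp hρ.deriv v + h.crossOp hρ G ∧ surfaceTrace Φ = stripOp l hρ g :=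
  ⟨(h.isEnergyTriple_product hρ hv).toEnergySpace, Lp.toLp_coeFn _ (Lp.memLp _),
    Lp.toLp_coeFn _ (Lp.memLp _), Lp.toLp_coeFn _ (Lp.memLp _)⟩

theorem eq_zero_of_inner_testSubmodule {V : Set Plane} (hV : IsOpen V)
    {f : Lp ℝ 2 (volume.restrict V)} (hf : ∀ k ∈ testSubmodule V, ⟪k, f⟫_ℝ = 0) : f = 0 := by
  rw [← Submodule.mem_bot ℝ, ← testSubmodule_orthogonal hV, Submodule.mem_orthogonal]
  exact hf

set_option maxHeartbeats 1000000 in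
/-- Integration by parts in the axial direction. -/
theorem inner_axialOp_grad (h : HasCylindricalEnd Γ U R) {ρ : ℝ → ℝ} (hρ : IsCutoff R ρ)
    (v : Lp ℝ 2 (volume.restrict Γ)) (Ψ : EnergySpace U l) :
    ⟪h.axialOp hρ v, grad Ψ⟫_ℝ = -⟪h.fnOp hρ.deriv v, potential Ψ⟫_ℝ := by
  -- The claim is that a function in `L²(Γ)` vanishes, so by density it is enough to test it with
  -- smooth functions supported in `Γ`, where the Green identity in the direction `x₁` is available.
  have key : (h.axialOp hρ).adjoint (grad Ψ) + (h.fnOp hρ.deriv).adjoint (potential Ψ) = 0 := by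
    refine eq_zero_of_inner_testSubmodule h.isOpen_base ?_
    rintro f ⟨φ, f1, f2, f3, f4⟩
    have hφ : IsCrossTest Γ l φ := by
      refine ⟨f1, f2, Set.disjoint_left.2 fun p hp hq => ?_⟩
      exact (h.isOpen_base.frontier_eq ▸ hq.1).2 (f3 hp)
    have green := Ψ.2 _ (h.isTestFunction_mul hρ hφ) 0
    unfold GreenIdentity at green
    have a1 := (ContinuousLinearMap.adjoint_inner_right (h.fnOp hρ.deriv) f (potential Ψ)).trans
      (inner_eq_integral_ae (h.coeFn_fnOp hρ.deriv f4) (ae_eq_refl _))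
    have a2 := (ContinuousLinearMap.adjoint_inner_right (h.axialOp hρ) f (grad Ψ)).trans
      (L2.inner_def _ _)
    refine (inner_add_right _ _ _).trans ((congrArg₂ (· + ·) a2 a1).trans ?_)
    have e0 : ∀ x : Space, fderiv ℝ (fun x : Space => ρ (x 0) * φ (crossL x)) x
        (EuclideanSpace.single 0 1) = deriv ρ (x 0) * φ (crossL x) := fun x => by
      have : crossL (EuclideanSpace.single 0 1) = 0 := by
        ext j; fin_cases j <;> simp [crossL_apply]
      rw [fderiv_mul_cross hρ.smooth f1, this]
      simp [mul_comm]
    simp only [e0] at green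
    have e1 : ∫ x in U, ⟪h.axialOp hρ f x, grad Ψ x⟫_ℝ =
        ∫ x in U, grad Ψ x 0 * (ρ (x 0) * φ (crossL x)) := by
      refine integral_congr_ae ?_
      filter_upwards [h.coeFn_axialOp hρ f, h.isCylindrical.ae f4] with x hx hx2
      rw [hx]
      by_cases hR : R < x 0
      · have hx3 : f (crossL x) = φ (crossL x) := hx2 hR
        rw [hx3, real_inner_smul_left]
        simp [axialEmb_apply, PiLp.inner_apply, Fin.sum_univ_three]
        ring
      · simp [hρ.eq_zero (not_lt.1 hR)]
    rw [e1]
    exact (add_comm _ _).trans green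
  have e1 := ContinuousLinearMap.adjoint_inner_right (h.axialOp hρ) v (grad Ψ)
  have e2 := ContinuousLinearMap.adjoint_inner_right (h.fnOp hρ.deriv) v (potential Ψ)
  have e3 : ⟪v, (h.axialOp hρ).adjoint (grad Ψ) + (h.fnOp hρ.deriv).adjoint (potential Ψ)⟫_ℝ = 0 := by
    rw [key, inner_zero_right]
  rw [inner_add_right] at e3
  exact eq_neg_of_add_eq_zero_left ((congrArg₂ (· + ·) e1 e2).symm.trans e3)

end HasCylindricalEnd

/-- Immediately below the water line there is water. -/
theorem IsCrossSection.eventually_mem {Γ : Set Plane} {l : ℝ} (hΓ : IsCrossSection Γ l) {y : ℝ}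
    (hy : |y| < l) : ∀ᶠ t : ℝ in 𝓝[<] 0, (!₂[y, t] : Plane) ∈ Γ := by
  obtain ⟨e, r, he, hr, H⟩ := hΓ.lipschitz.exists_direction (hΓ.mem_frontier hy.le)
  have he1 : e 1 < 0 := by
    have h1 := hΓ.lower _ (H _ (frontier_subset_closure (hΓ.mem_frontier hy.le)) (by simpa using hr)
      (r / 2) (by positivity) (by linarith))
    simp at h1
    by_contra hcon
    have := mul_nonneg (half_pos hr).le (not_lt.1 hcon)
    linarith
  have he0 : |e 0| ≤ 1 := by
    rw [← he]; simpa using PiLp.norm_apply_le e 0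
  set m := min r (l - |y|) with hm
  have hm0 : 0 < m := lt_min hr (by linarith)
  have hev : ∀ᶠ t : ℝ in 𝓝[<] 0, m * e 1 < t := by
    have : m * e 1 < 0 := mul_neg_of_pos_of_neg hm0 he1
    exact nhdsWithin_le_nhds (lt_mem_nhds this)
  filter_upwards [hev, self_mem_nhdsWithin] with t ht ht0
  have hs0 : 0 < t / e 1 := div_pos_of_neg_of_neg ht0 he1
  have hs : t / e 1 < m := by rwa [div_lt_iff_of_neg he1]
  have hse : |t / e 1 * e 0| ≤ t / e 1 := by
    rw [abs_mul, abs_of_pos hs0]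
    exact mul_le_of_le_one_right hs0.le he0
  have hq : |y - t / e 1 * e 0| ≤ l := by
    have h1 := abs_sub y (t / e 1 * e 0)
    have h2 := min_le_right r (l - |y|)
    linarith
  have h3 := H _ (frontier_subset_closure (hΓ.mem_frontier hq)) (by
    rw [norm_plane_eq_abs, sub_sub_cancel_left, abs_neg]
    exact (hse.trans_lt hs).trans_le (min_le_left _ _)) _ hs0 (hs.trans_le (min_le_left _ _))
  convert h3 using 1
  ext i
  fin_cases i
  · simp
  · simp [he1.ne]

theorem IsCrossSection.notMem_frontier {Γ : Set Plane} {l : ℝ} (hΓ : IsCrossSection Γ l) {y : ℝ}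
    (hy : l < |y|) : (!₂[y, 0] : Plane) ∉ frontier Γ := by
  intro h
  have : (!₂[y, 0] : Plane) ∈ frontier Γ ∩ {p | p 1 = 0} := ⟨h, by simp⟩
  rw [hΓ.waterLine] at this
  have h1 : |y| ≤ l := by simpa using this.1
  linarith

namespace HasCylindricalEnd

variable {Γ : Set Plane} {U : Set Space} {R l : ℝ}

theorem norm_fnOp_sq (h : HasCylindricalEnd Γ U R) {ρ : ℝ → ℝ} (hρ : IsCutoff R ρ)
    (v : Lp ℝ 2 (volume.restrict Γ)) : ‖h.fnOp hρ v‖ ^ 2 = (∫ t, ρ t ^ 2) * ‖v‖ ^ 2 :=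
  norm_tensorOp_sq _ _ _ v

theorem norm_axialOp_sq (h : HasCylindricalEnd Γ U R) {ρ : ℝ → ℝ} (hρ : IsCutoff R ρ)
    (v : Lp ℝ 2 (volume.restrict Γ)) : ‖h.axialOp hρ v‖ ^ 2 = (∫ t, ρ t ^ 2) * ‖v‖ ^ 2 :=
  norm_tensorOp_sq _ _ _ v

theorem norm_crossOp_sq (h : HasCylindricalEnd Γ U R) {ρ : ℝ → ℝ} (hρ : IsCutoff R ρ)
    (v : Lp Plane 2 (volume.restrict Γ)) : ‖h.crossOp hρ v‖ ^ 2 = (∫ t, ρ t ^ 2) * ‖v‖ ^ 2 :=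
  norm_tensorOp_sq _ _ _ v

theorem norm_stripOp_sq {ρ : ℝ → ℝ} (hρ : IsCutoff R ρ)
    (v : Lp ℝ 2 (volume.restrict (Ioo (-l) l))) : ‖stripOp l hρ v‖ ^ 2 = (∫ t, ρ t ^ 2) * ‖v‖ ^ 2 :=
  norm_tensorOp_sq _ _ _ v

theorem inner_crossOp_axialOp (h : HasCylindricalEnd Γ U R) {ρ σ : ℝ → ℝ} (hρ : IsCutoff R ρ)
    (hσ : IsCutoff R σ) (G : Lp Plane 2 (volume.restrict Γ)) (v : Lp ℝ 2 (volume.restrict Γ)) :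
    ⟪h.crossOp hρ G, h.axialOp hσ v⟫_ℝ = 0 := by
  rw [L2.inner_def]
  refine integral_eq_zero_of_ae ?_
  filter_upwards [h.coeFn_crossOp hρ (ae_eq_refl G), h.coeFn_axialOp hσ v] with x h1 h2
  rw [h1, h2, real_inner_smul_left, real_inner_smul_right, real_inner_comm, inner_axialEmb_crossEmb]
  simp

/-- The function `ρ(x₁)` is constant in the transversal variables. Its slice will show that
constants are admissible in the cross-section, without a separate Green formula on `Γ`. -/
theorem exists_unit_element (h : HasCylindricalEnd Γ U R) (hΓ : IsCrossSection Γ l) {ρ : ℝ → ℝ}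
    (hρ : IsCutoff R ρ) : ∃ (Ψ : EnergySpace U l) (v : Lp ℝ 2 (volume.restrict Γ)), v ≠ 0 ∧
      potential Ψ = h.fnOp hρ v ∧ grad Ψ = h.axialOp hρ.deriv v := by
  have := h.isFiniteMeasure
  have m0 : MemLp (fun _ : Plane => (1 : ℝ)) 2 (volume.restrict Γ) := memLp_const 1
  have m0' : MemLp (fun _ : ℝ => (1 : ℝ)) 2 (volume.restrict (Ioo (-l) l)) := memLp_const 1
  set Z : Space → ℝ := fun x => ρ (x 0) with hZ
  have hZs : ContDiff ℝ ∞ Z := hρ.smooth.comp (by fun_prop)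
  have hgrad : ∀ x, gradient Z x = deriv ρ (x 0) • axialEmb 1 := fun x => by
    have h1 : HasFDerivAt Z
        (deriv ρ (x 0) • (EuclideanSpace.proj (𝕜 := ℝ) (0 : Fin 3) : Space →L[ℝ] ℝ)) x :=
      ((hρ.smooth.differentiable (by simp)) _).hasDerivAt.comp_hasFDerivAt x
        (EuclideanSpace.proj (𝕜 := ℝ) (0 : Fin 3)).hasFDerivAt
    refine ext_inner_right ℝ fun y => ?_
    rw [gradient, InnerProductSpace.toDual_symm_apply, h1.fderiv, real_inner_smul_left]
    simp [axialEmb_apply, PiLp.inner_apply, Fin.sum_univ_three]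
  have hUm := h.isOpen.measurableSet
  have a1 : U.indicator Z =ᵐ[volume.restrict U] h.fnOp hρ (m0.toLp _) := by
    filter_upwards [h.coeFn_fnOp hρ m0.coeFn_toLp, ae_restrict_mem hUm] with x hx hxU
    rw [hx, indicator_of_mem hxU, mul_one]
  have a2 : U.indicator (gradient Z) =ᵐ[volume.restrict U] h.axialOp hρ.deriv (m0.toLp _) := by
    filter_upwards [h.coeFn_axialOp hρ.deriv (m0.toLp _), h.isCylindrical.ae m0.coeFn_toLp,
      ae_restrict_mem hUm] with x hx hx2 hxU
    rw [hx, indicator_of_mem hxU, hgrad]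
    by_cases hR : R < x 0
    · have hx3 : m0.toLp _ (crossL x) = 1 := hx2 hR
      rw [hx3]
    · simp [hρ.deriv.eq_zero (not_lt.1 hR)]
  have a3 : ((surfaceStrip l).indicator fun y => Z (toSurface y)) =ᵐ[volume.restrict (surfaceStrip l)]
      stripOp l hρ (m0'.toLp _) := by
    filter_upwards [coeFn_stripOp hρ m0'.coeFn_toLp,
      ae_restrict_mem (isOpen_surfaceStrip l).measurableSet] with y hy hyS
    rw [hy, indicator_of_mem hyS, mul_one]
    simp [hZ, toSurface]
  have key : IsEnergyTriple U l (U.indicator Z) (U.indicator (gradient Z))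
      ((surfaceStrip l).indicator fun y => Z (toSurface y)) := by
    refine isEnergyTriple_indicator h.isOpen le_rfl h.lower le_rfl hZs
      ((Lp.memLp _).ae_eq a1.symm) ((Lp.memLp _).ae_eq a2.symm) ((Lp.memLp _).ae_eq a3.symm) ?_ ?_
    · intro φ hφ x hx hxφ _
      by_contra hcon
      exact Set.disjoint_left.1 hφ.vanishes hxφ ⟨hx, fun hf => hcon hf.2.ge⟩
    · intro φ hφ y
      have hcont : Continuous fun x => Z x * φ x := hZs.continuous.mul hφ.smooth.continuous
      by_cases hy0 : R < y 0
      · have hcr : crossL (toSurface y) = !₂[y 1, 0] := by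
          ext j; fin_cases j <;> simp [crossL_apply, toSurface]
        have hfr := h.mem_frontier_iff (x := toSurface y) (by simpa [toSurface] using hy0)
        rw [hcr] at hfr
        -- Over the open strip there is water immediately below. Its edges belong to the boundary
        -- without the free surface, so test functions vanish near them. Outside there is no water
        -- nearby.
        rcases lt_trichotomy |y 1| l with hy | hy | hy
        · refine tendsto_indicator_of_eventually_mem hcont hy ?_
          filter_upwards [hΓ.eventually_mem hy] with t ht
          rw [h.mem_iff _ (by simpa using hy0)]
          simpa using ht
        · refine tendsto_indicator_of_notMem_tsupport fun hmem => ?_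
          refine Set.disjoint_left.1 hφ.vanishes (tsupport_mul_subset_right hmem)
            ⟨hfr.2 (hΓ.mem_frontier hy.le), fun hf => ?_⟩
          have : |y 1| < l := by simpa [toSurface] using hf.1
          linarith
        · refine tendsto_indicator_of_notMem_closure (not_lt.2 hy.le) fun hcl => ?_
          rw [closure_eq_self_union_frontier] at hcl
          rcases hcl with hcl | hcl
          · have := h.lower _ hcl
            simp [toSurface] at this
          · exact hΓ.notMem_frontier hy (hfr.1 hcl)
      · refine tendsto_indicator_of_notMem_tsupport fun hmem => hy0 ?_
        have h1 : toSurface y ∈ tsupport Z := tsupport_mul_subset_left hmem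
        have h2 := tsupport_comp_subset_preimage ρ (f := fun x : Space => x 0) (by fun_prop) h1
        simpa [toSurface] using hρ.support h2
  refine ⟨key.toEnergySpace, m0.toLp _, ?_, Lp.ext (key.potential_toEnergySpace.trans a1),
    Lp.ext (key.grad_toEnergySpace.trans a2)⟩
  intro h0
  have h1 := (Lp.eq_zero_iff_ae_eq_zero.1 h0).symm.trans m0.coeFn_toLp
  have h2 : volume Γ = 0 := by
    rw [← Measure.restrict_eq_zero, ← ae_eq_bot]
    by_contra hne
    have : (ae (volume.restrict Γ)).NeBot := ⟨hne⟩
    obtain ⟨x, hx⟩ := h1.exists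
    simp at hx
  exact (h.isOpen_base.measure_pos volume hΓ.connected.nonempty).ne' h2

end HasCylindricalEnd

/-! ### Long oscillating cutoffs -/

section Cutoffs

theorem IsCutoff.integral_sq_nonneg {ρ : ℝ → ℝ} : 0 ≤ ∫ t, ρ t ^ 2 :=
  integral_nonneg fun _ => sq_nonneg _

theorem IsCutoff.integrable_sq {R : ℝ} {ρ : ℝ → ℝ} (hρ : IsCutoff R ρ) :
    Integrable fun t => ρ t ^ 2 :=
  (hρ.memLp (ν := volume)).integrable_sq

theorem exists_cutoff (R : ℝ) : ∃ ρ : ℝ → ℝ, IsCutoff R ρ ∧ tsupport ρ ⊆ Ioo R (R + 1) ∧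
    0 < ∫ t, ρ t ^ 2 := by
  let f : ContDiffBump (R + 1 / 2) := ⟨1 / 8, 1 / 4, by norm_num, by norm_num⟩
  have hs : tsupport f ⊆ Ioo R (R + 1) := by
    rw [f.tsupport_eq, Real.closedBall_eq_Icc]
    exact Icc_subset_Ioo (by change R < R + 1 / 2 - 1 / 4; linarith)
      (by change R + 1 / 2 + 1 / 4 < R + 1; linarith)
  have hf : IsCutoff R f := ⟨f.contDiff, f.hasCompactSupport, hs.trans fun t ht => ht.1⟩
  refine ⟨f, hf, hs, ?_⟩
  refine (f.continuous.pow 2).integral_pos_of_hasCompactSupport_nonneg_nonzero (x := R + 1 / 2) ?_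
    (fun t => sq_nonneg _) ?_
  · exact f.hasCompactSupport.comp_left (g := fun x : ℝ => x ^ 2) (by simp)
  · have : f (R + 1 / 2) = 1 := f.one_of_mem_closedBall (Metric.mem_closedBall_self (by norm_num))
    rw [this]; norm_num

theorem IsCutoff.comp_scale {β : ℝ → ℝ} (hβ : IsCutoff 0 β) {s : ℝ} (hs : 0 < s) (R : ℝ) :
    IsCutoff R fun t => β (s * (t - R)) := by
  have hsub : tsupport (fun t => β (s * (t - R))) ⊆ (fun t => s * (t - R)) ⁻¹' tsupport β :=
    tsupport_comp_subset_preimage β (by fun_prop)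
  refine ⟨hβ.smooth.comp (by fun_prop), ?_, fun t ht => ?_⟩
  · refine HasCompactSupport.of_support_subset_isCompact
      (hβ.compact.isCompact.image (f := fun x => x / s + R) (by fun_prop)) fun t ht => ?_
    refine ⟨s * (t - R), hsub (subset_tsupport _ ht), ?_⟩
    field_simp
    ring
  · have h1 : 0 < s * (t - R) := hβ.support (hsub ht)
    have h2 := (pos_iff_pos_of_mul_pos h1).1 hs
    exact sub_pos.1 h2

theorem integral_comp_scale (f : ℝ → ℝ) {s : ℝ} (hs : 0 < s) (R : ℝ) :
    ∫ t, f (s * (t - R)) = s⁻¹ * ∫ t, f t := by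
  rw [integral_sub_right_eq_self (fun t => f (s * t)) R, Measure.integral_comp_mul_left,
    abs_of_pos (inv_pos.2 hs), smul_eq_mul]

theorem deriv_deriv_mul_trig {β : ℝ → ℝ} (hβ : ContDiff ℝ ∞ β) (s R k a b t : ℝ) :
    deriv (deriv fun t => (a * Real.cos (k * t) + b * Real.sin (k * t)) * β (s * (t - R))) t +
        k ^ 2 * ((a * Real.cos (k * t) + b * Real.sin (k * t)) * β (s * (t - R))) =
      (a * Real.cos (k * t) + b * Real.sin (k * t)) * (s ^ 2 * deriv (deriv β) (s * (t - R))) +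
        (b * Real.cos (k * t) - a * Real.sin (k * t)) * (2 * s * k * deriv β (s * (t - R))) := by
  have hc : ∀ t, HasDerivAt (fun t => Real.cos (k * t)) (-(k * Real.sin (k * t))) t := fun t => by
    have := ((hasDerivAt_id t).const_mul k).cos
    simpa [mul_comm] using this
  have hs' : ∀ t, HasDerivAt (fun t => Real.sin (k * t)) (k * Real.cos (k * t)) t := fun t => by
    have := ((hasDerivAt_id t).const_mul k).sin
    simpa [mul_comm] using this
  have hl : ∀ t, HasDerivAt (fun t => s * (t - R)) s t := fun t => by
    simpa using ((hasDerivAt_id t).sub_const R).const_mul s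
  have hb : ∀ t, HasDerivAt (fun t => β (s * (t - R))) (s * deriv β (s * (t - R))) t := fun t => by
    have := ((hβ.differentiable (by simp)) (s * (t - R))).hasDerivAt.comp t (hl t)
    simpa [mul_comm, Function.comp_def] using this
  have hb' : ∀ t, HasDerivAt (fun t => deriv β (s * (t - R))) (s * deriv (deriv β) (s * (t - R))) t := fun t => by
    have hd : ContDiff ℝ ∞ (deriv β) := hβ.deriv'
    have := ((hd.differentiable (by simp)) (s * (t - R))).hasDerivAt.comp t (hl t)
    simpa [mul_comm, Function.comp_def] using this
  have h1 : ∀ t, HasDerivAt (fun t => (a * Real.cos (k * t) + b * Real.sin (k * t)) * β (s * (t - R)))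
      _ t := fun t => (((hc t).const_mul a).add ((hs' t).const_mul b)).mul (hb t)
  have h2 : deriv (fun t => (a * Real.cos (k * t) + b * Real.sin (k * t)) * β (s * (t - R))) =
      fun t => (a * -(k * Real.sin (k * t)) + b * (k * Real.cos (k * t))) * β (s * (t - R)) +
        (a * Real.cos (k * t) + b * Real.sin (k * t)) * (s * deriv β (s * (t - R))) :=
    funext fun t => (h1 t).deriv
  have h3 : HasDerivAt (fun t => (a * -(k * Real.sin (k * t)) + b * (k * Real.cos (k * t))) *
      β (s * (t - R)) + (a * Real.cos (k * t) + b * Real.sin (k * t)) * (s * deriv β (s * (t - R))))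
      _ t := (((((hs' t).const_mul k).neg.const_mul a).add (((hc t).const_mul k).const_mul b)).mul
        (hb t)).add ((((hc t).const_mul a).add ((hs' t).const_mul b)).mul ((hb' t).const_mul s))
  rw [h2, h3.deriv]
  simp only [Pi.add_apply, Pi.neg_apply]
  ring

/-- There are cutoff functions that nearly satisfy the equation `ρ'' + k²ρ = 0`. -/
theorem exists_oscillating_cutoff (R k : ℝ) {δ : ℝ} (hδ : 0 < δ) : ∃ ρ : ℝ → ℝ, IsCutoff R ρ ∧
    0 < ∫ t, ρ t ^ 2 ∧ ∫ t, (deriv (deriv ρ) t + k ^ 2 * ρ t) ^ 2 ≤ δ ^ 2 * ∫ t, ρ t ^ 2 := by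
  obtain ⟨β, hβ, -, hb⟩ := exists_cutoff 0
  -- Neither the cosine nor the sine modulation of a stretched cutoff is singled out: if the claim
  -- fails for every cutoff, it fails for both, and the two inequalities can be added.
  by_contra! H
  have H' : ∀ ρ, IsCutoff R ρ →
      δ ^ 2 * ∫ t, ρ t ^ 2 ≤ ∫ t, (deriv (deriv ρ) t + k ^ 2 * ρ t) ^ 2 := by
    intro ρ hρ
    rcases (IsCutoff.integral_sq_nonneg (ρ := ρ)).eq_or_lt with h0 | h0
    · rw [← h0, mul_zero]
      exact integral_nonneg fun _ => sq_nonneg _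
    · exact (H ρ hρ h0).le
  have key : ∀ s, 0 < s → δ ^ 2 * ∫ t, β t ^ 2 ≤ s ^ 4 * (∫ t, deriv (deriv β) t ^ 2) +
      4 * s ^ 2 * k ^ 2 * ∫ t, deriv β t ^ 2 := by
    intro s hs
    have tr : ∀ a b : ℝ, ContDiff ℝ ∞ fun t => a * Real.cos (k * t) + b * Real.sin (k * t) :=
      fun a b => by fun_prop
    have cs := hβ.comp_scale hs R
    have cs1 := hβ.deriv.comp_scale hs R
    have cs2 := hβ.deriv.deriv.comp_scale hs R
    have cc : ∀ a b, IsCutoff R fun t => (a * Real.cos (k * t) + b * Real.sin (k * t)) * β (s * (t - R)) :=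
      fun a b => cs.mul_left (tr a b)
    have ce : ∀ a b, IsCutoff R fun t =>
        deriv (deriv fun t => (a * Real.cos (k * t) + b * Real.sin (k * t)) * β (s * (t - R))) t +
        k ^ 2 * ((a * Real.cos (k * t) + b * Real.sin (k * t)) * β (s * (t - R))) :=
      fun a b => (cc a b).deriv.deriv.add ((cc a b).mul_left contDiff_const)
    -- In the sum the oscillations disappear by `sin² + cos² = 1`, and only scaled integrals of `β`,
    -- `β'`, `β''` remain.
    have h1 := add_le_add (H' _ (cc 1 0)) (H' _ (cc 0 1))
    rw [← mul_add, ← integral_add (cc 1 0).integrable_sq (cc 0 1).integrable_sq,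
      ← integral_add (ce 1 0).integrable_sq (ce 0 1).integrable_sq] at h1
    have e1 : ∀ t, ((1 * Real.cos (k * t) + 0 * Real.sin (k * t)) * β (s * (t - R))) ^ 2 +
        ((0 * Real.cos (k * t) + 1 * Real.sin (k * t)) * β (s * (t - R))) ^ 2 =
        β (s * (t - R)) ^ 2 := fun t => by
      linear_combination β (s * (t - R)) ^ 2 * Real.sin_sq_add_cos_sq (k * t)
    simp only [e1, deriv_deriv_mul_trig hβ.smooth] at h1
    have e2 : ∀ t, ((1 * Real.cos (k * t) + 0 * Real.sin (k * t)) * (s ^ 2 * deriv (deriv β) (s * (t - R))) +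
        (0 * Real.cos (k * t) - 1 * Real.sin (k * t)) * (2 * s * k * deriv β (s * (t - R)))) ^ 2 +
        ((0 * Real.cos (k * t) + 1 * Real.sin (k * t)) * (s ^ 2 * deriv (deriv β) (s * (t - R))) +
        (1 * Real.cos (k * t) - 0 * Real.sin (k * t)) * (2 * s * k * deriv β (s * (t - R)))) ^ 2 =
        s ^ 4 * deriv (deriv β) (s * (t - R)) ^ 2 + 4 * s ^ 2 * k ^ 2 * deriv β (s * (t - R)) ^ 2 :=
      fun t => by
        linear_combination ((s ^ 2 * deriv (deriv β) (s * (t - R))) ^ 2 +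
          (2 * s * k * deriv β (s * (t - R))) ^ 2) * Real.sin_sq_add_cos_sq (k * t)
    simp only [e2] at h1
    rw [integral_add (cs2.integrable_sq.const_mul _) (cs1.integrable_sq.const_mul _),
      integral_const_mul, integral_const_mul, integral_comp_scale (fun t => β t ^ 2) hs,
      integral_comp_scale (fun t => deriv (deriv β) t ^ 2) hs,
      integral_comp_scale (fun t => deriv β t ^ 2) hs] at h1
    have h2 := mul_le_mul_of_nonneg_left h1 hs.le
    have e3 : s * s⁻¹ = 1 := mul_inv_cancel₀ hs.ne'
    calc _ = s * (δ ^ 2 * (s⁻¹ * ∫ t, β t ^ 2)) := by linear_combination (-(δ ^ 2 * ∫ t, β t ^ 2)) * e3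
      _ ≤ _ := h2
      _ = _ := by
        linear_combination (s ^ 4 * (∫ t, deriv (deriv β) t ^ 2) +
          4 * s ^ 2 * k ^ 2 * ∫ t, deriv β t ^ 2) * e3
  -- Stretching: the derivatives of the envelope contribute powers of `s`, so `s → 0` contradicts
  -- the fixed positive left side.
  have hlim : Tendsto (fun s : ℝ => s ^ 4 * (∫ t, deriv (deriv β) t ^ 2) +
      4 * s ^ 2 * k ^ 2 * ∫ t, deriv β t ^ 2) (𝓝[>] 0) (𝓝 0) := by
    have : Continuous fun s : ℝ => s ^ 4 * (∫ t, deriv (deriv β) t ^ 2) +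
      4 * s ^ 2 * k ^ 2 * ∫ t, deriv β t ^ 2 := by fun_prop
    have h0 := (this.tendsto 0).mono_left (nhdsWithin_le_nhds (s := Ioi 0))
    simpa using h0
  have := ge_of_tendsto hlim (by filter_upwards [self_mem_nhdsWithin] with s hs using key s hs)
  have h3 : 0 < δ ^ 2 * ∫ t, β t ^ 2 := by positivity
  linarith

end Cutoffs

/-! ### Approximate eigenvalues and closedness of the range -/

section Abstract

variable {H : Type*} [NormedAddCommGroup H] [InnerProductSpace ℝ H] [CompleteSpace H]

/-- The range of a symmetric operator is not closed if all small positive numbers are approximate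
eigenvalues. -/
theorem not_isClosed_range_of_approx (T : H →L[ℝ] H) (hT : ∀ x y, ⟪T x, y⟫_ℝ = ⟪x, T y⟫_ℝ)
    (h : ∀ τ : ℝ, 0 < τ → τ < 1 → ∀ δ : ℝ, 0 < δ → ∃ x, x ≠ 0 ∧ ‖T x - τ • x‖ ≤ δ * ‖x‖) :
    ¬ IsClosed (range T) := by
  intro hcl
  have hcl' : IsClosed (LinearMap.range T.toLinearMap : Set H) := by
    rw [LinearMap.coe_range]; exact hcl
  have : CompleteSpace (LinearMap.range T.toLinearMap) := hcl'.completeSpace_coe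
  -- A closed range is complete, so the open mapping theorem provides preimages with norm at most
  -- `C` times that of the image.
  obtain ⟨C, hC, HC⟩ := T.rangeRestrict.exists_preimage_norm_le (by
    rintro ⟨_, x, rfl⟩
    exact ⟨x, rfl⟩)
  set τ := min (1 / 2) (1 / (16 * C)) with hτ
  have hτ0 : 0 < τ := lt_min (by norm_num) (by positivity)
  have hτ1 : τ < 1 := (min_le_left _ _).trans_lt (by norm_num)
  have hτC : C * τ ≤ 1 / 16 := by
    have := min_le_right (1 / 2) (1 / (16 * C))
    rw [← hτ, le_div_iff₀ (by positivity)] at this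
    linarith
  obtain ⟨x, hx0, hx⟩ := h τ hτ0 hτ1 (τ / 8) (by positivity)
  have hxn : 0 < ‖x‖ := norm_pos_iff.2 hx0
  obtain ⟨x₁, h1, h2⟩ := HC (T.rangeRestrict x)
  have h1' : T x₁ = T x := congrArg Subtype.val h1
  have hTx : ‖T x‖ ≤ (τ + τ / 8) * ‖x‖ := by
    calc ‖T x‖ = ‖(T x - τ • x) + τ • x‖ := by rw [sub_add_cancel]
      _ ≤ τ / 8 * ‖x‖ + τ * ‖x‖ := by
        refine (norm_add_le _ _).trans (add_le_add hx ?_)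
        rw [norm_smul, Real.norm_eq_abs, abs_of_pos hτ0]
      _ = _ := by ring
  have hx₁ : ‖x₁‖ ≤ 9 / 128 * ‖x‖ := by
    have h3 : ‖x₁‖ ≤ C * ‖T x‖ := h2
    calc ‖x₁‖ ≤ C * ((τ + τ / 8) * ‖x‖) := h3.trans (by gcongr)
      _ = C * τ * (9 / 8) * ‖x‖ := by ring
      _ ≤ 1 / 16 * (9 / 8) * ‖x‖ := by gcongr
      _ = _ := by ring
  -- `x₁` is a preimage of `T x` that is small since `T x ≈ τ x` and `C τ ≤ 1 / 16`. So `x` is close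
  -- to the kernel element `K`. But symmetry makes an approximate eigenvector for `τ ≠ 0` almost
  -- orthogonal to the kernel, and the two facts are incompatible.
  set K := x - x₁ with hK
  have hTK : T K = 0 := by rw [hK, map_sub, h1', sub_self]
  have h3 : τ * ⟪x, K⟫_ℝ = -⟪T x - τ • x, K⟫_ℝ := by
    rw [inner_sub_left, hT, hTK, inner_zero_right, real_inner_smul_left]; ring
  have h4 : ⟪x, K⟫_ℝ ≤ 1 / 8 * ‖x‖ * ‖K‖ := by
    have h5 : τ * ⟪x, K⟫_ℝ ≤ τ / 8 * ‖x‖ * ‖K‖ := by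
      rw [h3]
      refine (neg_le_abs _).trans ((abs_real_inner_le_norm _ _).trans ?_)
      gcongr
    have h6 : τ * ⟪x, K⟫_ℝ ≤ τ * (1 / 8 * ‖x‖ * ‖K‖) := h5.trans (le_of_eq (by ring))
    exact le_of_mul_le_mul_left h6 hτ0
  have h5 : ‖K‖ ^ 2 = ⟪x, K⟫_ℝ - ⟪x₁, K⟫_ℝ := by
    rw [← inner_sub_left, ← real_inner_self_eq_norm_sq]
  have h6 : -⟪x₁, K⟫_ℝ ≤ ‖x₁‖ * ‖K‖ := (neg_le_abs _).trans (abs_real_inner_le_norm _ _)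
  have h7 : ‖K‖ ≤ 1 / 8 * ‖x‖ + ‖x₁‖ := by
    rcases (norm_nonneg K).eq_or_lt with h0 | h0
    · rw [← h0]; positivity
    · refine le_of_mul_le_mul_right ?_ h0
      nlinarith
  have h8 : ‖x‖ ≤ ‖K‖ + ‖x₁‖ := by
    calc ‖x‖ = ‖K + x₁‖ := by rw [hK, sub_add_cancel]
      _ ≤ _ := norm_add_le _ _
  linarith

/-- The range of the operator of a symmetric bounded bilinear form is not closed if all small
positive numbers are approximate eigenvalues. -/
theorem not_isClosed_of_approx (B : H → H → ℝ) (hadd : ∀ x y z, B (x + y) z = B x z + B y z)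
    (hsmul : ∀ (a : ℝ) x y, B (a • x) y = a * B x y) (hB : ∀ x y, B x y = B y x) {C : ℝ}
    (hC : ∀ x y, |B x y| ≤ C * ‖x‖ * ‖y‖)
    (h : ∀ τ : ℝ, 0 < τ → τ < 1 → ∀ δ : ℝ, 0 < δ → ∃ x, x ≠ 0 ∧
      ∀ y, B x y - τ * ⟪x, y⟫_ℝ ≤ δ * ‖x‖ * ‖y‖) :
    ¬ IsClosed {F : StrongDual ℝ H | ∃ x, ∀ y, B x y = F y} := by
  intro hcl
  set T := InnerProductSpace.continuousLinearMapOfBilin (LinearMap.mkContinuous₂ (LinearMap.mk₂ ℝ B hadd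
    hsmul (fun x y z => by rw [hB, hadd, hB y, hB z]) (fun a x y => by rw [hB, hsmul, hB, smul_eq_mul])) C hC)
  have hT : ∀ x y, ⟪T x, y⟫_ℝ = B x y := fun x y => by
    rw [InnerProductSpace.continuousLinearMapOfBilin_apply]
    rfl
  refine not_isClosed_range_of_approx T (fun x y => ?_) (fun τ h0 h1 δ hδ => ?_) ?_
  · rw [hT, real_inner_comm, hT, hB]
  · obtain ⟨x, hx, H'⟩ := h τ h0 h1 δ hδ
    refine ⟨x, hx, ?_⟩
    -- Testing with the residual itself turns the bound for the form into a bound for its norm.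
    have h2 := H' (T x - τ • x)
    rw [← hT, ← real_inner_smul_left, ← inner_sub_left, real_inner_self_eq_norm_sq, pow_two] at h2
    rcases (norm_nonneg (T x - τ • x)).eq_or_lt with h3 | h3
    · rw [← h3]; positivity
    · exact le_of_mul_le_mul_right h2 h3
  -- By the Riesz isomorphism the range of `T` is the preimage of the set of functionals represented
  -- by the form.
  · have h2 := hcl.preimage (InnerProductSpace.toDual ℝ H).continuous
    convert h2 using 1
    ext x
    constructor
    · rintro ⟨y, rfl⟩
      exact ⟨y, fun z => by rw [InnerProductSpace.toDual_apply_apply, hT]⟩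
    · rintro ⟨y, hy⟩
      refine ⟨y, ext_inner_right ℝ fun z => ?_⟩
      rw [hT, hy, InnerProductSpace.toDual_apply_apply]

end Abstract

theorem norm_adjoint_sq_le {E F : Type*} [NormedAddCommGroup E] [InnerProductSpace ℝ E]
    [CompleteSpace E] [NormedAddCommGroup F] [InnerProductSpace ℝ F] [CompleteSpace F]
    (A : E →L[ℝ] F) {m : ℝ} (hm : 0 ≤ m) (hA : ∀ v, ‖A v‖ ^ 2 = m * ‖v‖ ^ 2) (x : F) :
    ‖A.adjoint x‖ ^ 2 ≤ m * ‖x‖ ^ 2 := by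
  have h1 : ‖A.adjoint x‖ ^ 2 ≤ ‖A (A.adjoint x)‖ * ‖x‖ := by
    rw [← real_inner_self_eq_norm_sq, ContinuousLinearMap.adjoint_inner_right]
    exact real_inner_le_norm _ _
  have h2 := hA (A.adjoint x)
  set p := ‖A.adjoint x‖
  have h3 : p ^ 2 * p ^ 2 ≤ (m * ‖x‖ ^ 2) * p ^ 2 := by
    calc p ^ 2 * p ^ 2 = (p ^ 2) ^ 2 := by ring
      _ ≤ (‖A (A.adjoint x)‖ * ‖x‖) ^ 2 := by gcongr
      _ = _ := by rw [mul_pow, h2]; ring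
  rcases (sq_nonneg p).eq_or_lt with h0 | h0
  · rw [← h0]; positivity
  · exact le_of_mul_le_mul_right h3 h0

/-! ### The bottom of the spectrum in the cross-section -/

section CrossForm

variable {Γ : Set Plane} {l : ℝ} {v v' : Lp ℝ 2 (volume.restrict Γ)}
  {G G' : Lp Plane 2 (volume.restrict Γ)} {g g' : Lp ℝ 2 (volume.restrict (Ioo (-l) l))}

/-- The Cauchy-Schwarz inequality in the cross-section. -/
theorem IsCrossElement.sq_form_le {a b E : ℝ}
    (hE : ∀ (v : Lp ℝ 2 (volume.restrict Γ)) (G : Lp Plane 2 (volume.restrict Γ))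
      (g : Lp ℝ 2 (volume.restrict (Ioo (-l) l))), IsCrossElement v G g →
      E * ‖v‖ ^ 2 ≤ a * ‖G‖ ^ 2 - b * ‖g‖ ^ 2)
    (h : IsCrossElement v G g) (h' : IsCrossElement v' G' g') :
    (a * ⟪G, G'⟫_ℝ - b * ⟪g, g'⟫_ℝ - E * ⟪v, v'⟫_ℝ) ^ 2 ≤
      (a * ‖G‖ ^ 2 - b * ‖g‖ ^ 2 - E * ‖v‖ ^ 2) * (a * ‖G'‖ ^ 2 - b * ‖g'‖ ^ 2 - E * ‖v'‖ ^ 2) := by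
  have key : ∀ t : ℝ, 0 ≤ (a * ‖G'‖ ^ 2 - b * ‖g'‖ ^ 2 - E * ‖v'‖ ^ 2) * (t * t) +
      2 * (a * ⟪G, G'⟫_ℝ - b * ⟪g, g'⟫_ℝ - E * ⟪v, v'⟫_ℝ) * t +
      (a * ‖G‖ ^ 2 - b * ‖g‖ ^ 2 - E * ‖v‖ ^ 2) := fun t => by
    have h1 := hE _ _ _ (h.add_smul h' t)
    rw [norm_add_sq_real, norm_add_sq_real, norm_add_sq_real] at h1
    simp only [real_inner_smul_right, norm_smul, mul_pow, Real.norm_eq_abs, sq_abs] at h1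
    linear_combination h1
  have h2 := discrim_le_zero key
  unfold discrim at h2
  linarith

end CrossForm

namespace HasCylindricalEnd

variable {Γ : Set Plane} {U : Set Space} {R l : ℝ}

theorem lintegral_trace_product {ρ : ℝ → ℝ} (hρ : IsCutoff R ρ)
    (hs : tsupport ρ ⊆ Ioo R (R + 1)) (g : Lp ℝ 2 (volume.restrict (Ioo (-l) l))) :
    ENNReal.ofReal (‖stripOp l hρ g‖ ^ 2) ≤
      ∫⁻ y in surfaceSlab l R univ, ‖stripOp l hρ g y‖ₑ ^ 2 := by
  have hT : MeasurableSet {y : Plane | R < y 0 ∧ y 0 < R + 1} := by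
    have hm : Measurable fun y : Plane => y 0 := by fun_prop
    exact (measurableSet_lt measurable_const hm).inter (measurableSet_lt hm measurable_const)
  rw [ofReal_norm_sq]
  calc _ = ∫⁻ y in surfaceStrip l, {y : Plane | R < y 0 ∧ y 0 < R + 1}.indicator
        (fun y => ‖stripOp l hρ g y‖ₑ ^ 2) y := by
        refine lintegral_congr_ae ?_
        filter_upwards [coeFn_stripOp hρ (ae_eq_refl g)] with y hy
        by_cases hyT : y ∈ {y : Plane | R < y 0 ∧ y 0 < R + 1}
        · rw [indicator_of_mem hyT]
        · have : ρ (y 0) = 0 := image_eq_zero_of_notMem_tsupport fun hm => hyT (hs hm)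
          rw [indicator_of_notMem hyT, hy, this]
          simp
    _ = ∫⁻ y in {y : Plane | R < y 0 ∧ y 0 < R + 1} ∩ surfaceStrip l, ‖stripOp l hρ g y‖ₑ ^ 2 := by
        rw [lintegral_indicator hT, Measure.restrict_restrict hT]
    _ ≤ _ := by
        refine lintegral_mono_set fun y hy => ?_
        exact ⟨hy.1.1, hy.1.2, hy.2, mem_univ _⟩

/-- In the cross-section the traces are bounded by the functions, up to a small multiple of the
gradients. -/
theorem exists_cross_trace_bound (h : HasCylindricalEnd Γ U R) (hΓ : IsCrossSection Γ l) {δ : ℝ}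
    (hδ : 0 < δ) : ∃ K : ℝ, ∀ (v : Lp ℝ 2 (volume.restrict Γ))
      (G : Lp Plane 2 (volume.restrict Γ)) (g : Lp ℝ 2 (volume.restrict (Ioo (-l) l))),
      IsCrossElement v G g → ‖g‖ ^ 2 ≤ K * ‖v‖ ^ 2 + δ * ‖G‖ ^ 2 := by
  obtain ⟨C, τ, hC, hτ, H⟩ := hΓ.exists_slab_traceBound
  obtain ⟨ρ, hρ, hs, hm⟩ := exists_cutoff R
  set m := ∫ t, ρ t ^ 2
  set m' := ∫ t, deriv ρ t ^ 2
  set s := min τ (δ / C) with hsd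
  have hs0 : 0 < s := lt_min hτ (by positivity)
  have hsC : C * s ≤ δ := by
    have := min_le_right τ (δ / C)
    rw [← hsd, le_div_iff₀ hC] at this
    linarith
  refine ⟨C / s + C * s * m' / m, fun v G g hv => ?_⟩
  -- The trace inequality of a slab is applied to the product with a cutoff supported in that slab.
  -- Division by `∫ ρ²` returns to the cross-section, and the axial derivative adds `C s m' / m` to
  -- the coefficient at `‖v‖²`.
  obtain ⟨Φ, e1, e2, e3⟩ := h.exists_product hρ hv
  have hD : slab R Γ ⊆ U := fun x hx => (h.mem_iff x hx.1).2 hx.2.2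
  have h1 := H R U _ _ _ (isEnergyTriple Φ) h.isOpen h.lower hD s hs0 (min_le_left _ _)
  have h2 := lintegral_trace_product hρ hs g
  rw [← e3] at h2
  have h3 : ENNReal.ofReal (‖surfaceTrace Φ‖ ^ 2) ≤
      ENNReal.ofReal (C / s * ‖potential Φ‖ ^ 2 + C * s * ‖grad Φ‖ ^ 2) := by
    rw [ENNReal.ofReal_add (by positivity) (by positivity), ENNReal.ofReal_mul (by positivity),
      ENNReal.ofReal_mul (by positivity), ofReal_norm_sq (potential Φ), ofReal_norm_sq (grad Φ)]
    refine (h2.trans h1).trans (add_le_add ?_ ?_)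
    · gcongr
    · gcongr
  rw [ENNReal.ofReal_le_ofReal_iff (by positivity), e3, norm_stripOp_sq, e1, h.norm_fnOp_sq, e2,
    norm_add_sq_real, real_inner_comm, h.inner_crossOp_axialOp, h.norm_axialOp_sq,
    h.norm_crossOp_sq] at h3
  have h4 : C * s * ‖G‖ ^ 2 ≤ δ * ‖G‖ ^ 2 := by gcongr
  refine le_trans ?_ (add_le_add_right h4 _)
  refine le_of_mul_le_mul_left ?_ hm
  refine h3.trans (le_of_eq ?_)
  field_simp
  ring

set_option maxHeartbeats 1000000 in
/-- A slice of a function of finite energy which depends on `x₁` only. -/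
theorem exists_cross_unit (h : HasCylindricalEnd Γ U R) (hΓ : IsCrossSection Γ l) :
    ∃ (v : Lp ℝ 2 (volume.restrict Γ)) (g : Lp ℝ 2 (volume.restrict (Ioo (-l) l))),
      IsCrossElement v 0 g ∧ v ≠ 0 := by
  obtain ⟨ρ, hρ, -, hm⟩ := exists_cutoff R
  obtain ⟨Ψ, w, hw, e1, e2⟩ := h.exists_unit_element hΓ hρ
  have hG : (h.crossOp hρ).adjoint (grad Ψ) = 0 := by
    refine ext_inner_left ℝ fun G => ?_
    rw [inner_zero_right]
    refine (ContinuousLinearMap.adjoint_inner_right (h.crossOp hρ) G (grad Ψ)).trans ?_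
    rw [e2]
    exact h.inner_crossOp_axialOp hρ hρ.deriv G w
  have hv0 : (h.fnOp hρ).adjoint (potential Ψ) ≠ 0 := fun h0 => by
    have h1 := ContinuousLinearMap.adjoint_inner_right (h.fnOp hρ) w (potential Ψ)
    rw [h0, inner_zero_right, e1, real_inner_self_eq_norm_sq, h.norm_fnOp_sq] at h1
    exact (mul_pos hm (pow_pos (norm_pos_iff.2 hw) 2)).ne h1
  have hv := h.isCrossElement_slice hρ Ψ
  rw [hG] at hv
  exact ⟨_, _, hv, hv0⟩

/-- The bottom of the spectrum of the cross-section, and functions that nearly attain it. -/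
theorem exists_spectral_bottom (h : HasCylindricalEnd Γ U R) (hΓ : IsCrossSection Γ l) {a b : ℝ}
    (ha : 0 < a) (hb : 0 < b) : ∃ E : ℝ, E ≤ 0 ∧
      (∀ (v : Lp ℝ 2 (volume.restrict Γ)) (G : Lp Plane 2 (volume.restrict Γ))
        (g : Lp ℝ 2 (volume.restrict (Ioo (-l) l))), IsCrossElement v G g →
        E * ‖v‖ ^ 2 ≤ a * ‖G‖ ^ 2 - b * ‖g‖ ^ 2) ∧
      ∀ δ, 0 < δ → ∃ (v : Lp ℝ 2 (volume.restrict Γ)) (G : Lp Plane 2 (volume.restrict Γ))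
        (g : Lp ℝ 2 (volume.restrict (Ioo (-l) l))), IsCrossElement v G g ∧ v ≠ 0 ∧
        a * ‖G‖ ^ 2 - b * ‖g‖ ^ 2 ≤ (E + δ) * ‖v‖ ^ 2 := by
  obtain ⟨K, hK⟩ := h.exists_cross_trace_bound hΓ (δ := a / b) (by positivity)
  have hlow : ∀ (v : Lp ℝ 2 (volume.restrict Γ)) (G : Lp Plane 2 (volume.restrict Γ))
      (g : Lp ℝ 2 (volume.restrict (Ioo (-l) l))), IsCrossElement v G g →
      -(b * K) * ‖v‖ ^ 2 ≤ a * ‖G‖ ^ 2 - b * ‖g‖ ^ 2 := fun v G g hv => by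
    have h1 := mul_le_mul_of_nonneg_left (hK v G g hv) hb.le
    have h2 : b * (a / b * ‖G‖ ^ 2) = a * ‖G‖ ^ 2 := by field_simp
    rw [mul_add, h2] at h1
    linarith
  set S : Set ℝ := {x | ∃ (v : Lp ℝ 2 (volume.restrict Γ)) (G : Lp Plane 2 (volume.restrict Γ))
    (g : Lp ℝ 2 (volume.restrict (Ioo (-l) l))), IsCrossElement v G g ∧ v ≠ 0 ∧
      x = (a * ‖G‖ ^ 2 - b * ‖g‖ ^ 2) / ‖v‖ ^ 2} with hS
  have hpos : ∀ v : Lp ℝ 2 (volume.restrict Γ), v ≠ 0 → 0 < ‖v‖ ^ 2 := fun v hv =>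
    pow_pos (norm_pos_iff.2 hv) 2
  have hbdd : BddBelow S := by
    refine ⟨-(b * K), ?_⟩
    rintro x ⟨v, G, g, hv, hv0, rfl⟩
    rw [le_div_iff₀ (hpos v hv0)]
    exact hlow v G g hv
  -- An element with zero gradient has a nonpositive quotient, so the infimum is at most `0`.
  -- Whether it is attained is irrelevant; near minimizers suffice.
  obtain ⟨x₀, hx₀, hx₀'⟩ : ∃ x ∈ S, x ≤ 0 := by
    obtain ⟨v, g, hv, hv0⟩ := h.exists_cross_unit hΓ
    refine ⟨_, ⟨v, 0, g, hv, hv0, rfl⟩, ?_⟩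
    refine div_nonpos_of_nonpos_of_nonneg ?_ (sq_nonneg _)
    have : 0 ≤ b * ‖g‖ ^ 2 := by positivity
    rw [norm_zero]
    linarith
  refine ⟨sInf S, (csInf_le hbdd hx₀).trans hx₀', fun v G g hv => ?_, fun δ hδ => ?_⟩
  · rcases eq_or_ne v 0 with hv0 | hv0
    · have := hlow v G g hv
      rw [hv0, norm_zero] at this ⊢
      simpa using this
    · rw [← le_div_iff₀ (hpos v hv0)]
      exact csInf_le hbdd ⟨v, G, g, hv, hv0, rfl⟩
  · obtain ⟨x, ⟨v, G, g, hv, hv0, rfl⟩, hx⟩ :=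
      exists_lt_of_csInf_lt ⟨x₀, hx₀⟩ (lt_add_of_pos_right (sInf S) hδ)
    refine ⟨v, G, g, hv, hv0, ?_⟩
    rw [div_lt_iff₀ (hpos v hv0)] at hx
    exact hx.le

end HasCylindricalEnd

theorem inner_eq_of_eq_add {H : Type*} [NormedAddCommGroup H] [InnerProductSpace ℝ H] {x a b : H}
    (h : x = a + b) (y : H) : ⟪x, y⟫_ℝ = ⟪a, y⟫_ℝ + ⟪b, y⟫_ℝ := by
  rw [h, inner_add_left]

/-! ### Approximate eigenfunctions and the continuous spectrum -/

section WaveOperator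

variable {U : Set Space} {l : ℝ}

theorem EnergySpace.inner_eq (Φ Ψ : EnergySpace U l) : ⟪Φ, Ψ⟫_ℝ =
    ⟪potential Φ, potential Ψ⟫_ℝ + ⟪grad Φ, grad Ψ⟫_ℝ + ⟪surfaceTrace Φ, surfaceTrace Ψ⟫_ℝ := by
  rw [Submodule.coe_inner, WithLp.prod_inner_apply, WithLp.prod_inner_apply, ← add_assoc]
  rfl

theorem waveForm_comm (lam : ℝ) (Φ Ψ : EnergySpace U l) : waveForm lam Φ Ψ = waveForm lam Ψ Φ := by
  unfold waveForm
  rw [real_inner_comm, real_inner_comm (surfaceTrace Φ)]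

theorem abs_waveForm_le {lam : ℝ} (hlam : 0 ≤ lam) (Φ Ψ : EnergySpace U l) :
    |waveForm lam Φ Ψ| ≤ (1 + lam) * ‖Φ‖ * ‖Ψ‖ := by
  have hg : ∀ Φ : EnergySpace U l, ‖grad Φ‖ ≤ ‖Φ‖ := fun Φ => (abs_le_of_sq_le_sq' (by
    rw [EnergySpace.norm_sq_eq]
    linarith [sq_nonneg ‖potential Φ‖, sq_nonneg ‖surfaceTrace Φ‖]) (norm_nonneg _)).2
  have ht : ∀ Φ : EnergySpace U l, ‖surfaceTrace Φ‖ ≤ ‖Φ‖ := fun Φ => (abs_le_of_sq_le_sq' (by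
    rw [EnergySpace.norm_sq_eq]
    linarith [sq_nonneg ‖potential Φ‖, sq_nonneg ‖grad Φ‖]) (norm_nonneg _)).2
  have h1 := (abs_real_inner_le_norm (grad Φ) (grad Ψ)).trans
    (mul_le_mul (hg Φ) (hg Ψ) (norm_nonneg _) (norm_nonneg _))
  have h2 := (abs_real_inner_le_norm (surfaceTrace Φ) (surfaceTrace Ψ)).trans
    (mul_le_mul (ht Φ) (ht Ψ) (norm_nonneg _) (norm_nonneg _))
  have h3 := abs_sub ⟪grad Φ, grad Ψ⟫_ℝ (lam * ⟪surfaceTrace Φ, surfaceTrace Ψ⟫_ℝ)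
  rw [abs_mul, abs_of_nonneg hlam] at h3
  have h4 := mul_le_mul_of_nonneg_left h2 hlam
  unfold waveForm
  linarith

theorem inContinuousSpectrum_of_approx {lam : ℝ} (hlam : 0 ≤ lam)
    (h : ∀ τ : ℝ, 0 < τ → τ < 1 → ∀ δ : ℝ, 0 < δ → ∃ Φ : EnergySpace U l, Φ ≠ 0 ∧
      ∀ Ψ : EnergySpace U l, waveForm lam Φ Ψ - τ * ⟪Φ, Ψ⟫_ℝ ≤ δ * ‖Φ‖ * ‖Ψ‖) :
    InContinuousSpectrum U l lam := by
  refine not_isClosed_of_approx (waveForm lam) (fun Φ Ψ Χ => ?_) (fun a Φ Ψ => ?_) (waveForm_comm lam)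
    (abs_waveForm_le hlam) h
  · unfold waveForm
    rw [grad_add, surfaceTrace_add, inner_add_left, inner_add_left]
    ring
  · unfold waveForm
    rw [grad_smul, surfaceTrace_smul, real_inner_smul_left, real_inner_smul_left]
    ring

end WaveOperator

namespace HasCylindricalEnd

variable {Γ : Set Plane} {U : Set Space} {R l : ℝ}

theorem fnOp_add_smul (h : HasCylindricalEnd Γ U R) {ρ σ : ℝ → ℝ} (hρ : IsCutoff R ρ)
    (hσ : IsCutoff R σ) {k : ℝ} (he : IsCutoff R fun t => σ t + k * ρ t)
    (v : Lp ℝ 2 (volume.restrict Γ)) : h.fnOp he v = h.fnOp hσ v + k • h.fnOp hρ v := by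
  refine Lp.ext ?_
  filter_upwards [h.coeFn_fnOp he (ae_eq_refl v), h.coeFn_fnOp hσ (ae_eq_refl v),
    h.coeFn_fnOp hρ (ae_eq_refl v), Lp.coeFn_add (h.fnOp hσ v) (k • h.fnOp hρ v),
    Lp.coeFn_smul k (h.fnOp hρ v)] with x h1 h2 h3 h4 h5
  rw [h1, h4, Pi.add_apply, h5, Pi.smul_apply, h2, h3, smul_eq_mul]
  ring

theorem exists_slice (h : HasCylindricalEnd Γ U R) {ρ : ℝ → ℝ} (hρ : IsCutoff R ρ)
    (Ψ : EnergySpace U l) : ∃ (v : Lp ℝ 2 (volume.restrict Γ)) (G : Lp Plane 2 (volume.restrict Γ))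
      (g : Lp ℝ 2 (volume.restrict (Ioo (-l) l))), IsCrossElement v G g ∧
      (∀ w, ⟪w, v⟫_ℝ = ⟪h.fnOp hρ w, potential Ψ⟫_ℝ) ∧
      (∀ w, ⟪w, G⟫_ℝ = ⟪h.crossOp hρ w, grad Ψ⟫_ℝ) ∧
      (∀ w, ⟪w, g⟫_ℝ = ⟪stripOp l hρ w, surfaceTrace Ψ⟫_ℝ) ∧
      ‖v‖ ^ 2 ≤ (∫ t, ρ t ^ 2) * ‖potential Ψ‖ ^ 2 ∧ ‖G‖ ^ 2 ≤ (∫ t, ρ t ^ 2) * ‖grad Ψ‖ ^ 2 :=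
  ⟨_, _, _, h.isCrossElement_slice hρ Ψ,
    fun w => ContinuousLinearMap.adjoint_inner_right (h.fnOp hρ) w (potential Ψ),
    fun w => ContinuousLinearMap.adjoint_inner_right (h.crossOp hρ) w (grad Ψ),
    fun w => ContinuousLinearMap.adjoint_inner_right (stripOp l hρ) w (surfaceTrace Ψ),
    norm_adjoint_sq_le (h.fnOp hρ) IsCutoff.integral_sq_nonneg (h.norm_fnOp_sq hρ) (potential Ψ),
    norm_adjoint_sq_le (h.crossOp hρ) IsCutoff.integral_sq_nonneg (h.norm_crossOp_sq hρ) (grad Ψ)⟩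

theorem waveForm_arithmetic {lam τ k E p q t i p' q' t' p'' e : ℝ} (hk : τ - E = (1 - τ) * k)
    (hi : i = p + q + t) (hp : p = p') (hq : q = -p'' + q') (ht : t = t') (he : e = p'' + k * p') :
    q - lam * t - τ * i = ((1 - τ) * q' - (lam + τ) * t' - E * p') - (1 - τ) * e := by
  subst hi hp hq ht he
  linear_combination (-p) * hk

/-- The form of the water-wave problem on the product of a cutoff function and a function in the
cross-section. -/
theorem waveForm_product (h : HasCylindricalEnd Γ U R) {ρ : ℝ → ℝ} (hρ : IsCutoff R ρ)
    {v : Lp ℝ 2 (volume.restrict Γ)} {G : Lp Plane 2 (volume.restrict Γ)}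
    {g : Lp ℝ 2 (volume.restrict (Ioo (-l) l))} {Φ : EnergySpace U l}
    (e1 : potential Φ = h.fnOp hρ v) (e2 : grad Φ = h.axialOp hρ.deriv v + h.crossOp hρ G)
    (e3 : surfaceTrace Φ = stripOp l hρ g) {lam τ k E : ℝ} (hk : τ - E = (1 - τ) * k)
    (he : IsCutoff R fun t => deriv (deriv ρ) t + k * ρ t) (Ψ : EnergySpace U l) :
    waveForm lam Φ Ψ - τ * ⟪Φ, Ψ⟫_ℝ =
      ((1 - τ) * ⟪h.crossOp hρ G, grad Ψ⟫_ℝ - (lam + τ) * ⟪stripOp l hρ g, surfaceTrace Ψ⟫_ℝ -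
        E * ⟪h.fnOp hρ v, potential Ψ⟫_ℝ) - (1 - τ) * ⟪h.fnOp he v, potential Ψ⟫_ℝ := by
  -- Integration by parts in `x₁` turns the axial gradient term into `-ρ''`. As `τ - E = (1 - τ) k`,
  -- what remains besides the form of the cross-section shifted by `E` is the defect `ρ'' + k ρ`.
  have a4 := h.inner_axialOp_grad hρ.deriv v Ψ
  have a5 : ⟪h.fnOp he v, potential Ψ⟫_ℝ = ⟪h.fnOp hρ.deriv.deriv v, potential Ψ⟫_ℝ +
      k * ⟪h.fnOp hρ v, potential Ψ⟫_ℝ := by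
    rw [h.fnOp_add_smul hρ hρ.deriv.deriv he v, inner_add_left, real_inner_smul_left]
  have b2 : ⟪grad Φ, grad Ψ⟫_ℝ = -⟪h.fnOp hρ.deriv.deriv v, potential Ψ⟫_ℝ +
      ⟪h.crossOp hρ G, grad Ψ⟫_ℝ := by
    rw [← a4]
    exact inner_eq_of_eq_add e2 _
  have b1 : ⟪potential Φ, potential Ψ⟫_ℝ = ⟪h.fnOp hρ v, potential Ψ⟫_ℝ :=
    congrArg (fun w => ⟪w, potential Ψ⟫_ℝ) e1
  have b3 : ⟪surfaceTrace Φ, surfaceTrace Ψ⟫_ℝ = ⟪stripOp l hρ g, surfaceTrace Ψ⟫_ℝ :=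
    congrArg (fun w => ⟪w, surfaceTrace Ψ⟫_ℝ) e3
  exact waveForm_arithmetic hk (EnergySpace.inner_eq Φ Ψ) b1 b2 b3 a5

/-- The bound for the residual of an approximate eigenfunction. -/
theorem residual_le {A P E τ b m δ nv nG ng q nP nT nt N F V : ℝ} (hE : E ≤ 0) (h0 : 0 < τ) (h1 : τ < 1)
    (hb : 0 < b) (hm : 0 < m) (hδ : 0 < δ) (hV : 0 ≤ V) (hN : 0 ≤ N)
    (hcs : A ^ 2 ≤ q * ((1 - τ) * nG - b * ng - E * nv)) (hq2 : 0 ≤ (1 - τ) * nG - b * ng - E * nv)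
    (hq : q ≤ δ ^ 2 / (4 * (1 - E)) * V ^ 2) (hng : 0 ≤ ng) (hnG0 : 0 ≤ nG) (hnv : nv ≤ m * nP ^ 2)
    (hnG : nG ≤ m * nT ^ 2) (hNN : N ^ 2 = nP ^ 2 + nT ^ 2 + nt ^ 2) (hF : m * V ^ 2 ≤ F ^ 2)
    (hF0 : 0 ≤ F) {e : ℝ} (he : e ^ 2 ≤ (δ / 2) ^ 2 * m * V ^ 2) (hnP : 0 ≤ nP)
    (hP : |P| ≤ e * nP) : A - (1 - τ) * P ≤ δ * F * N := by
  have hE1 : 0 < 1 - E := by linarith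
  have q2 : (1 - τ) * nG - b * ng - E * nv ≤ m * (1 - E) * N ^ 2 := by
    have b1 : (1 - τ) * nG ≤ 1 * (m * nT ^ 2) := mul_le_mul (by linarith) hnG hnG0 zero_le_one
    have b2 : 0 ≤ b * ng := by positivity
    have b3 := mul_le_mul_of_nonneg_left hnv (neg_nonneg.2 hE)
    have b4 : nP ^ 2 ≤ N ^ 2 := by linarith [sq_nonneg nT, sq_nonneg nt]
    have b5 : nT ^ 2 ≤ N ^ 2 := by linarith [sq_nonneg nP, sq_nonneg nt]
    have b6 := mul_le_mul_of_nonneg_left b4 (mul_nonneg (neg_nonneg.2 hE) hm.le)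
    have b7 := mul_le_mul_of_nonneg_left b5 hm.le
    linarith
  have hFV : √m * V ≤ F := (abs_le_of_sq_le_sq' (by
    rw [mul_pow, Real.sq_sqrt hm.le]; exact hF) hF0).2
  have hA2 : A ^ 2 ≤ (δ / 2 * (√m * V) * N) ^ 2 := by
    refine hcs.trans ((mul_le_mul hq q2 hq2 (by positivity)).trans (le_of_eq ?_))
    rw [mul_pow, mul_pow, mul_pow, Real.sq_sqrt hm.le]
    field_simp
    ring
  have hA : A ≤ δ / 2 * (√m * V) * N := (abs_le_of_sq_le_sq' hA2 (by positivity)).2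
  have he2 : e ≤ δ / 2 * (√m * V) := (abs_le_of_sq_le_sq' (by
    rw [mul_pow, mul_pow, Real.sq_sqrt hm.le]; linarith) (by positivity)).2
  have hPN : nP ≤ N := (abs_le_of_sq_le_sq' (by
      linarith [sq_nonneg nT, sq_nonneg nt]) hN).2
  have hB : -((1 - τ) * P) ≤ δ / 2 * (√m * V) * N := by
    have c2 : e * nP ≤ δ / 2 * (√m * V) * N := by gcongr
    have c3 : (0 : ℝ) ≤ δ / 2 * (√m * V) * N := by positivity
    have c4 := mul_le_mul_of_nonneg_left (((neg_le_abs P).trans hP).trans c2) (show 0 ≤ 1 - τ by linarith)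
    have c5 : (1 - τ) * (δ / 2 * (√m * V) * N) ≤ 1 * (δ / 2 * (√m * V) * N) :=
      mul_le_mul_of_nonneg_right (by linarith) c3
    linarith
  calc _ ≤ δ * (√m * V) * N := by linarith
    _ ≤ _ := by gcongr

/-- The residual consists of the shifted form of the cross-section, paired with a slice of `Ψ`, and
of the defect of the cutoff. The first is small by Cauchy-Schwarz for a nonnegative form that nearly
vanishes at `v`, the second by the choice of `ρ`. -/
theorem exists_approx_of_cutoff (h : HasCylindricalEnd Γ U R) {lam τ E k δ : ℝ} (hlam : 0 < lam)
    (h0 : 0 < τ) (h1 : τ < 1) (hδ : 0 < δ) (hE0 : E ≤ 0)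
    (hE : ∀ (v : Lp ℝ 2 (volume.restrict Γ)) (G : Lp Plane 2 (volume.restrict Γ))
      (g : Lp ℝ 2 (volume.restrict (Ioo (-l) l))), IsCrossElement v G g →
      E * ‖v‖ ^ 2 ≤ (1 - τ) * ‖G‖ ^ 2 - (lam + τ) * ‖g‖ ^ 2)
    {v : Lp ℝ 2 (volume.restrict Γ)} {G : Lp Plane 2 (volume.restrict Γ)}
    {g : Lp ℝ 2 (volume.restrict (Ioo (-l) l))} (hv : IsCrossElement v G g) (hv0 : v ≠ 0)
    (hq : (1 - τ) * ‖G‖ ^ 2 - (lam + τ) * ‖g‖ ^ 2 ≤ (E + δ ^ 2 / (4 * (1 - E))) * ‖v‖ ^ 2)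
    {ρ : ℝ → ℝ} (hρ : IsCutoff R ρ) (hm : 0 < ∫ t, ρ t ^ 2) (hk : τ - E = (1 - τ) * k)
    (hρe : ∫ t, (deriv (deriv ρ) t + k * ρ t) ^ 2 ≤ (δ / 2) ^ 2 * ∫ t, ρ t ^ 2) :
    ∃ Φ : EnergySpace U l, Φ ≠ 0 ∧
      ∀ Ψ : EnergySpace U l, waveForm lam Φ Ψ - τ * ⟪Φ, Ψ⟫_ℝ ≤ δ * ‖Φ‖ * ‖Ψ‖ := by
  obtain ⟨Φ, e1, e2, e3⟩ := h.exists_product hρ hv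
  have he : IsCutoff R fun t => deriv (deriv ρ) t + k * ρ t :=
    hρ.deriv.deriv.add (hρ.mul_left contDiff_const)
  have hvn : 0 < ‖v‖ := norm_pos_iff.2 hv0
  have hΦ2 : (∫ t, ρ t ^ 2) * ‖v‖ ^ 2 ≤ ‖Φ‖ ^ 2 := by
    rw [← h.norm_fnOp_sq hρ v, ← e1, EnergySpace.norm_sq_eq, add_assoc]
    exact le_add_of_nonneg_right (add_nonneg (sq_nonneg _) (sq_nonneg _))
  refine ⟨Φ, fun hΦ => ?_, fun Ψ => ?_⟩
  · rw [hΦ, norm_zero, zero_pow two_ne_zero] at hΦ2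
    exact absurd hΦ2 (not_le.2 (mul_pos hm (pow_pos hvn 2)))
  rw [h.waveForm_product hρ e1 e2 e3 hk he Ψ]
  obtain ⟨v', G', g', hs, s1, s2, s3, n1, n2⟩ := h.exists_slice hρ Ψ
  have cs := hv.sq_form_le hE hs
  rw [s1, s2, s3] at cs
  have hee : ‖h.fnOp he v‖ ^ 2 ≤ (δ / 2) ^ 2 * (∫ t, ρ t ^ 2) * ‖v‖ ^ 2 := by
    rw [h.norm_fnOp_sq]
    exact mul_le_mul_of_nonneg_right hρe (sq_nonneg _)
  have hq' : (1 - τ) * ‖G‖ ^ 2 - (lam + τ) * ‖g‖ ^ 2 - E * ‖v‖ ^ 2 ≤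
      δ ^ 2 / (4 * (1 - E)) * ‖v‖ ^ 2 :=
    sub_le_iff_le_add'.2 (hq.trans_eq (add_mul _ _ _))
  exact residual_le hE0 h0 h1 (add_pos hlam h0) hm hδ hvn.le (norm_nonneg Ψ) cs
    (sub_nonneg.2 (hE _ _ _ hs)) hq' (sq_nonneg _) (sq_nonneg _) n1 n2
    (EnergySpace.norm_sq_eq Ψ) hΦ2 (norm_nonneg _) hee (norm_nonneg _)
    (abs_real_inner_le_norm _ _)

/-- Small positive numbers are approximate eigenvalues of the water-wave problem. -/
theorem exists_approx (h : HasCylindricalEnd Γ U R) (hΓ : IsCrossSection Γ l) {lam : ℝ}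
    (hlam : 0 < lam) {τ : ℝ} (h0 : 0 < τ) (h1 : τ < 1) {δ : ℝ} (hδ : 0 < δ) :
    ∃ Φ : EnergySpace U l, Φ ≠ 0 ∧
      ∀ Ψ : EnergySpace U l, waveForm lam Φ Ψ - τ * ⟪Φ, Ψ⟫_ℝ ≤ δ * ‖Φ‖ * ‖Ψ‖ := by
  obtain ⟨E, hE0, hE, hE'⟩ := h.exists_spectral_bottom hΓ (a := 1 - τ) (b := lam + τ) (by linarith)
    (by linarith)
  -- The shifted form at a slice of `Ψ` is at most `(1 - E) ‖ρ‖² ‖Ψ‖²`. With this accuracy for `v`,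
  -- Cauchy-Schwarz leaves the factor `δ / 2`; the other half is for the cutoff.
  obtain ⟨v, G, g, hv, hv0, hq⟩ := hE' (δ ^ 2 / (4 * (1 - E))) (by
    have : 0 < 1 - E := by linarith
    positivity)
  -- Here `E ≤ 0` matters: the square of the axial wave number is nonnegative, so the wave
  -- oscillates rather than grows.
  have hk0 : 0 ≤ (τ - E) / (1 - τ) := div_nonneg (by linarith) (by linarith)
  obtain ⟨ρ, hρ, hm, hρe⟩ := exists_oscillating_cutoff R (√((τ - E) / (1 - τ))) (half_pos hδ)
  rw [Real.sq_sqrt hk0] at hρe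
  exact h.exists_approx_of_cutoff hlam h0 h1 hδ hE0 hE hv hv0 hq hρ hm
    (mul_div_cancel₀ _ (by linarith)).symm hρe

end HasCylindricalEnd

theorem IsSubmergedBody.exists_hasCylindricalEnd {Γ : Set Plane} {l : ℝ} {Θ : Set Space}
    (hΓ : IsCrossSection Γ l) (hΘ : IsSubmergedBody Γ l Θ) :
    ∃ R : ℝ, HasCylindricalEnd Γ (waterDomain Γ Θ) R := by
  obtain ⟨R, -, hR⟩ := hΘ.exists_radius
  exact ⟨R, hΘ.lipschitz.1, hΓ.lipschitz.1, hΓ.bounded, waterDomain_lower hΓ,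
    fun x hx => hR x (hx.le.trans (le_abs_self _))⟩

/-- All positive numbers belong to the continuous spectrum. -/
theorem inContinuousSpectrum {Γ : Set Plane} {l : ℝ} {Θ : Set Space} (hΓ : IsCrossSection Γ l)
    (hΘ : IsSubmergedBody Γ l Θ) {lam : ℝ} (hlam : 0 < lam) :
    InContinuousSpectrum (waterDomain Γ Θ) l lam := by
  obtain ⟨R, h⟩ := hΘ.exists_hasCylindricalEnd hΓ
  exact inContinuousSpectrum_of_approx hlam.le fun τ h0 h1 δ hδ => h.exists_approx hΓ hlam h0 h1 hδ

end WaterWave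

/-! ### The trapped modes and the continuous spectrum together -/

theorem theorem1p1
    (l : ℝ) (hl : 0 < l) (Γ : Set Plane) (hΓ : IsCrossSection Γ l)
    (a A : Fin 2 → ℝ) (ha : ∀ i, 0 < a i) (hA : ∀ i, 0 < A i)
    (h H : ℝ) (hh : 0 < h) (hH : h ≤ H)
    (C : Set Space) (hC₁ : cellBox a h ⊆ C) (hC₂ : C ⊆ cellBox a H)
    (d : ℝ) (hd : 0 < d) (N : ℕ) :
    ∃ ε₀ : ℝ, 0 < ε₀ ∧ ∀ ε : ℝ, 0 < ε → ε < ε₀ →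
      ∀ n : Fin 2 → ℕ, (∀ i, A i = ε * a i * n i) →
      ∀ Θ : Set Space, IsSubmergedBody Γ l Θ →
        (∀ x, x ∈ waterDomain Γ Θ ↔ reflect x ∈ waterDomain Γ Θ) →
        plate ε a n C ⊆ waterDomain Γ Θ →
        lowerBase A (plate ε a n C) ⊆ frontier Θ →
        ∃ (lam : Fin N → ℝ) (Φ : Fin N → EnergySpace (waterDomain Γ Θ) l),
          LinearIndependent ℝ Φ ∧
          ∀ k, 0 < lam k ∧ lam k < d ∧
            IsEigenfunction (waterDomain Γ Θ) l (lam k) (Φ k) ∧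
            DecaysExponentially (Φ k) ∧
            InContinuousSpectrum (waterDomain Γ Θ) l (lam k) := by
  obtain ⟨ε₀, hε₀, H⟩ := exists_trapped_modes hl hΓ ha hA hh hH hC₁ hC₂ hd N
  refine ⟨ε₀, hε₀, fun ε h1 h2 n h3 Θ hΘ h4 h5 h6 => ?_⟩
  obtain ⟨lam, Φ, hlin, hk⟩ := H ε h1 h2 n h3 Θ hΘ h4 h5 h6
  exact ⟨lam, Φ, hlin, fun k => ⟨(hk k).1, (hk k).2.1, (hk k).2.2.1, (hk k).2.2.2,
    inContinuousSpectrum hΓ hΘ (hk k).1⟩⟩
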